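/- Let $\mathbb{T}$ be the circle group. For a based $\mathbb{T}$-space $X$ let $\tilde H^*_{\mathbb T}(X;\Bbbk)=H^*(E\mathbb T\times_{\mathbb T}X,\,E\mathbb T\times_{\mathbb T}*;\Bbbk)$ be its reduced Borel cohomology. A $\mathbb{T}$-space $X$ is of type SWF if it is $\mathbb{T}$-homotopy equivalent to a finite $\mathbb{T}$-CW complex, $\mathbb{T}$ acts freely on $X\setminus X^{\mathbb T}$, and $X^{\mathbb T}\simeq S^\ell$ for some $\ell$. For such $X$ and a commutative ring $\Bbbk$ let $i_X\colon X^{\mathbb T}\to X$ be the inclusion, and let $h^s(X;\Bbbk)$ (resp. $h^w(X;\Bbbk)$) be the least $k\ge 0$ such that $i_X^*\colon\tilde H_{\mathbb T}^{\ell+2k}(X;\Bbbk)\to \tilde H_{\mathbb T}^{\ell+2k}(X^{\mathbb T};\Bbbk)$ is surjective (resp. non-zero). For $p$ a prime or $0$ put $h^p(X)=h^s(X;\mathbb F_p)=h^w(X;\mathbb F_p)$, where $\mathbb F_0=\mathbb Q$. Let $\ell,h\ge 0$ be integers with $n=\ell+2h\ge 2$, let $S^{\ell,h}$ be the one-point compactification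 of the $\mathbb T$-representation $\mathbb R^\ell\oplus\mathbb C^h$ (trivial action on $\mathbb R^\ell$, complex multiplication on $\mathbb C^h$), and let $A=S^{\ell,h}\vee(\mathbb T_+\wedge S^n)$. Then $\tilde H^n_{\mathbb T}(A;\mathbb Z)$ is free abelian with a basis $e_A,f_A$ such that $i_A^*f_A=0$ and $i_A^*e_A$ generates $\tilde H^n_{\mathbb T}(A^{\mathbb T};\mathbb Z)\cong\mathbb Z$, and $H^n_{\mathbb T}(\mathbb T\times S^n;\mathbb Z)\cong\mathbb Z$ has a generator $e^n$. Fix any such $e_A,f_A,e^n$. For all $a,b\in\mathbb Z$ there is a $\mathbb T$-map $\varphi\colon\mathbb T\times S^n\to A$ with $\varphi^*e_A=a\,e^n$ and $\varphi^*f_A=b\,e^n$, and for every such $\varphi$ the space $X_{a,b}=A\cup_\varphi(\mathbb T\times D^{n+1})$ is of type SWF with $X_{a,b}^{\mathbb T}\simeq S^\ell$ and, for every $p$ that is a prime or $0$, $$h^p(X_{a,b})=\begin{cases}h+1,& b\in p\mathbb Z\text{ and }a\notin p\mathbb Z,\\ h,&\text{otherwise.}\end{cases}$$ In particular, if $a,b\in\mathbb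 N$ are distinct primes, then $h^b(X_{a,b})=h+1\neq h=h^p(X_{a,b})$ for every $p\ne b$ that is a prime or $0$, and $$h^w(X_{a,b};\mathbb Z)=h^0(X_{a,b})=h<h+1=h^b(X_{a,b})=h^s(X_{a,b};\mathbb Z).$$ -/

import Mathlib

open CategoryTheory

noncomputable section

namespace SWF

/-! ### Spaces with an action of the circle group -/

section Spaces

variable (X Y : Type) [TopologicalSpace X] [MulAction Circle X]
  [TopologicalSpace Y] [MulAction Circle Y]

/-- A continuous map is equivariant if it commutes with the circle actions. -/
def IsEquivariant {X Y : Type} [TopologicalSpace X] [MulAction Circle X]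
    [TopologicalSpace Y] [MulAction Circle Y] (f : C(X, Y)) : Prop :=
  ∀ (z : Circle) (x : X), f (z • x) = z • f x

/-- Continuous equivariant maps between spaces with a circle action. -/
structure TMap where
  /-- the underlying continuous map -/
  map : C(X, Y)
  equivariant : IsEquivariant map

/-- Two spaces with circle action are equivariantly homotopy equivalent. -/
def TEquivalent : Prop :=
  ∃ (f : TMap X Y) (g : TMap Y X),
    ContinuousMap.HomotopicWith (g.map.comp f.map) (ContinuousMap.id X) IsEquivariant ∧
    ContinuousMap.HomotopicWith (f.map.comp g.map) (ContinuousMap.id Y) IsEquivariant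

/-- The circle acts (trivially) on the fixed point set. -/
instance fixedPointsAction : MulAction Circle (MulAction.fixedPoints Circle X) where
  smul z x := ⟨z • x.1, by rw [x.2 z]; exact x.2⟩
  one_smul x := Subtype.ext (one_smul Circle x.1)
  mul_smul z w x := Subtype.ext (mul_smul z w x.1)

/-- The inclusion of the fixed point set. -/
def fixedInclusion : TMap (MulAction.fixedPoints Circle X) X where
  map := ⟨Subtype.val, continuous_subtype_val⟩
  equivariant _ _ := rfl

/-- The closed unit disk of dimension `d`. -/
abbrev Disk (d : ℕ) : Type := Metric.closedBall (0 : EuclideanSpace ℝ (Fin d)) 1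

/-- The unit sphere in Euclidean `d`-space, that is, the boundary of `Disk d`. -/
abbrev DiskBoundary (d : ℕ) : Type := Metric.sphere (0 : EuclideanSpace ℝ (Fin d)) 1

/-- The standard sphere of dimension `l`. -/
abbrev StdSphere (l : ℕ) : Type := DiskBoundary (l + 1)

/-- Finite equivariant CW complexes: a Hausdorff space with finitely many cells
`𝕋/H × Disk d` (with `H ≤ 𝕋` closed), given by equivariant characteristic maps, such that the space
is the disjoint union of the open cells and the boundary of each cell lies in the union of the
cells of smaller dimension. (As there are finitely many cells, this determines the topology.) -/
def IsFiniteTComplex : Prop :=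
  T2Space X ∧
  ∃ (J : Type) (_ : Finite J) (d : J → ℕ) (H : J → Subgroup Circle)
    (Φ : ∀ j, C((Circle ⧸ H j) × Disk (d j), X)),
    (∀ j, IsClosed (H j : Set Circle)) ∧
    (∀ (j : J) (z : Circle) (q : Circle ⧸ H j) (v : Disk (d j)),
      Φ j (z • q, v) = z • Φ j (q, v)) ∧
    (∀ x : X, ∃! c : Σ j, (Circle ⧸ H j) × Disk (d j),
      ‖(c.2.2 : EuclideanSpace ℝ (Fin (d c.1)))‖ < 1 ∧ Φ c.1 c.2 = x) ∧
    (∀ (j : J) (q : Circle ⧸ H j) (v : Disk (d j)),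
      ‖(v : EuclideanSpace ℝ (Fin (d j)))‖ = 1 →
        ∃ i, d i < d j ∧ ∃ c : (Circle ⧸ H i) × Disk (d i), Φ i c = Φ j (q, v))

/-- The circle space `X` is of type SWF, and its fixed point set is homotopy equivalent to the
sphere of dimension `l`. -/
structure IsTypeSWF [ContinuousSMul Circle X] (l : ℕ) : Prop where
  finite : ∃ (K : Type) (_ : TopologicalSpace K) (_ : MulAction Circle K)
    (_ : ContinuousSMul Circle K), IsFiniteTComplex K ∧ TEquivalent X K
  free : ∀ x : X, x ∉ MulAction.fixedPoints Circle X → ∀ z : Circle, z • x = x → z = 1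
  fixed : Nonempty (ContinuousMap.HomotopyEquiv (MulAction.fixedPoints Circle X) (StdSphere l))

end Spaces

/-! ### Singular cohomology of pairs of spaces -/

section Cohomology

variable (k : Type) [CommRing k]

/-- Relative singular chains with coefficients in `k`: the quotient of the singular chains of the
space by those of the subspace. -/
def relChains : TopPair.{0} ⥤ ChainComplex (ModuleCat.{0} k) ℕ :=
  MorphismProperty.Arrow.forget _ _ _ ⋙
    ((AlgebraicTopology.singularChainComplexFunctor (ModuleCat.{0} k)).obj
      (ModuleCat.of k k)).mapArrow ⋙ Limits.coker (ChainComplex (ModuleCat.{0} k) ℕ)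

/-- Relative singular cochains: the `k`-linear dual of the relative singular chains. -/
def relCochains : TopPair.{0}ᵒᵖ ⥤ CochainComplex (ModuleCat.{0} k) ℕ :=
  (relChains k ⋙ ((linearYoneda k (ModuleCat.{0} k)).obj
    (ModuleCat.of k k)).rightOp.mapHomologicalComplex (ComplexShape.down ℕ)).op ⋙
    HomologicalComplex.unopFunctor (ModuleCat.{0} k) (ComplexShape.down ℕ)

/-- Relative singular cohomology `Hⁿ(X, A; k)`. -/
def cohomology (n : ℕ) : TopPair.{0}ᵒᵖ ⥤ ModuleCat.{0} k :=
  relCochains k ⋙ HomologicalComplex.homologyFunctor (ModuleCat.{0} k) (ComplexShape.up ℕ) n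

end Cohomology

/-! ### The Borel construction and Borel cohomology -/

section Borel

/-- The total space `E𝕋 = S(ℂ^∞)` of the universal principal circle bundle: the unit vectors in
the space of finitely supported sequences of complex numbers. -/
@[ext]
structure ET where
  /-- the underlying finitely supported sequence -/
  vec : ℕ →₀ ℂ
  unit : vec.sum (fun _ c => ‖c‖ ^ 2) = 1

/-- The stage `S(ℂ^N)` of `E𝕋`: unit vectors supported in the first `N` coordinates. -/
abbrev ETStage (N : ℕ) : Type := {v : ET // ∀ i, N ≤ i → v.vec i = 0}

/-- `S(ℂ^N)` has the usual topology, the coarsest one for which the coordinates are continuous. -/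
abbrev stageTopology (N : ℕ) : TopologicalSpace (ETStage N) :=
  TopologicalSpace.induced (fun v => (fun i => v.1.vec i : ℕ → ℂ)) inferInstance

/-- `E𝕋` carries the colimit topology: a set is open if and only if its intersection with each
`S(ℂ^N)` is open. -/
instance : TopologicalSpace ET :=
  ⨆ N, TopologicalSpace.coinduced Subtype.val (stageTopology N)

/-- The circle acts on `E𝕋` by scalar multiplication. -/
instance : MulAction Circle ET where
  smul z v := ⟨z • v.vec, by
    have h := v.unit
    have hs : (z • v.vec).support = v.vec.support := by
      ext i
      simp [Circle.smul_def]
    unfold Finsupp.sum at h ⊢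
    rw [hs, ← h]
    refine Finset.sum_congr rfl fun i _ => ?_
    exact congrArg (· ^ 2) (Circle.norm_smul z (v.vec i))⟩
  one_smul v := ET.ext (one_smul Circle v.vec)
  mul_smul z w v := ET.ext (mul_smul z w v.vec)

variable (X : Type) [TopologicalSpace X] [MulAction Circle X]

/-- The Borel construction `E𝕋 ×_𝕋 X`: the orbit space of the diagonal action on `E𝕋 × X`. -/
def Bor : Type := Quotient (MulAction.orbitRel Circle (ET × X))

instance : TopologicalSpace (Bor X) := inferInstanceAs (TopologicalSpace (Quotient _))

variable {X} in
/-- The class `[e, x]` in the Borel construction. -/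
def Bor.mk (p : ET × X) : Bor X := Quotient.mk (MulAction.orbitRel Circle (ET × X)) p

/-- The map of Borel constructions induced by an equivariant map. -/
def Bor.map {X Y : Type} [TopologicalSpace X] [MulAction Circle X]
    [TopologicalSpace Y] [MulAction Circle Y] (f : TMap X Y) : C(Bor X, Bor Y) where
  toFun := Quotient.map (fun p : ET × X => (p.1, f.map p.2)) (by
    rintro _ q ⟨z, rfl⟩
    exact ⟨z, Prod.ext rfl (f.equivariant z q.2).symm⟩)
  continuous_toFun :=
    (continuous_quot_mk.comp (continuous_fst.prodMk (f.map.continuous.comp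
      continuous_snd))).quotient_lift _

/-- The part of the Borel construction lying over a subset `S` of `X`. -/
def borSubset (S : Set X) : Set (Bor X) := {q | ∃ e : ET, ∃ x ∈ S, Bor.mk (e, x) = q}

/-- The pair `(E𝕋 ×_𝕋 X, E𝕋 ×_𝕋 S)`. -/
def borPair (S : Set X) : TopPair.{0} :=
  TopPair.ofSubset (X := TopCat.of (Bor X)) (borSubset X S)

/-- The map of pairs of Borel constructions induced by an equivariant map. -/
def borPairMap {X Y : Type} [TopologicalSpace X] [MulAction Circle X]
    [TopologicalSpace Y] [MulAction Circle Y] (f : TMap X Y) (S : Set X) (S' : Set Y)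
    (h : Set.MapsTo f.map S S') : borPair X S ⟶ borPair Y S' :=
  TopPair.ofHom (X := borPair X S) (Y := borPair Y S')
    (TopCat.ofHom (Bor.map f))
    (TopCat.ofHom ⟨fun q => ⟨Bor.map f q.1, by
      obtain ⟨e, x, hx, hq⟩ := q.2
      exact ⟨e, f.map x, h hx, by rw [← hq]; rfl⟩⟩,
      ((Bor.map f).continuous.comp continuous_subtype_val).subtype_mk _⟩)
    rfl

/-- Relative Borel cohomology `H_𝕋ⁿ(X, S; k)`. For `S = ∅` this is the unreduced, and for `S` a
fixed base point the reduced Borel cohomology. -/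
def borelCohomology (k : Type) [CommRing k] (n : ℕ) (S : Set X) : ModuleCat.{0} k :=
  (cohomology k n).obj (Opposite.op (borPair X S))

/-- The map on relative Borel cohomology induced by an equivariant map. -/
def borelPullback (k : Type) [CommRing k] (n : ℕ) {X Y : Type}
    [TopologicalSpace X] [MulAction Circle X] [TopologicalSpace Y] [MulAction Circle Y]
    (f : TMap X Y) (S : Set X) (S' : Set Y) (h : Set.MapsTo f.map S S') :
    borelCohomology Y k n S' →ₗ[k] borelCohomology X k n S :=
  ((cohomology k n).map (borPairMap f S S' h).op).hom

end Borel

/-! ### The h-invariants -/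

section Invariants

variable (k : Type) [CommRing k] (X : Type) [TopologicalSpace X] [MulAction Circle X]
  (x₀ : MulAction.fixedPoints Circle X)

/-- Restriction to the fixed point set in reduced Borel cohomology. The base point is `x₀`. -/
def restrictFixed (n : ℕ) :
    borelCohomology X k n {x₀.1} →ₗ[k]
      borelCohomology (MulAction.fixedPoints Circle X) k n {x₀} :=
  borelPullback k n (fixedInclusion X) {x₀} {x₀.1} (by rintro _ rfl; rfl)

/-- The strong h-invariant of a space of type SWF whose fixed point set is a homotopy `l`-sphere:
the smallest `j ≥ 0` such that restriction to the fixed point set is surjective in degree `l + 2j`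
(and `⊤` if there is none). -/
def hStrong (l : ℕ) : ℕ∞ :=
  sInf {m | ∃ j : ℕ, Function.Surjective (restrictFixed k X x₀ (l + 2 * j)) ∧ m = j}

/-- The weak h-invariant: as the strong one, with non-zero in place of surjective. -/
def hWeak (l : ℕ) : ℕ∞ :=
  sInf {m | ∃ j : ℕ, restrictFixed k X x₀ (l + 2 * j) ≠ 0 ∧ m = j}

/-- The prime field of characteristic `p`, for `p` a prime or zero. -/
def PrimeField : ℕ → Type
  | 0 => ℚ
  | n + 1 => ZMod (n + 1)

instance : (p : ℕ) → CommRing (PrimeField p)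
  | 0 => inferInstanceAs (CommRing ℚ)
  | n + 1 => inferInstanceAs (CommRing (ZMod (n + 1)))

end Invariants

/-! ### Representation spheres and free cells -/

section Examples

/-- The one-point compactification `S^{l,h}` of the representation `ℝ^l ⊕ ℂ^h`, based at `∞`. -/
def RepSphere (l h : ℕ) : Type := OnePoint (EuclideanSpace ℝ (Fin l) × EuclideanSpace ℂ (Fin h))

instance (l h : ℕ) : TopologicalSpace (RepSphere l h) :=
  inferInstanceAs (TopologicalSpace (OnePoint _))

/-- The circle acts on `ℝ^l ⊕ ℂ^h` by complex multiplication on the second summand. -/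
def repSMul {l h : ℕ} (z : Circle) (v : EuclideanSpace ℝ (Fin l) × EuclideanSpace ℂ (Fin h)) :
    EuclideanSpace ℝ (Fin l) × EuclideanSpace ℂ (Fin h) := (v.1, z • v.2)

instance (l h : ℕ) : MulAction Circle (RepSphere l h) where
  smul z v := OnePoint.map (repSMul z) v
  one_smul v := by
    induction v using OnePoint.rec with
    | infty => rfl
    | coe v => exact congrArg OnePoint.some (Prod.ext rfl (one_smul Circle v.2))
  mul_smul z w v := by
    induction v using OnePoint.rec with
    | infty => rfl
    | coe v => exact congrArg OnePoint.some (Prod.ext rfl (mul_smul z w v.2))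

instance (l h : ℕ) : ContinuousSMul Circle (RepSphere l h) where
  continuous_smul := by
    have hc : Continuous fun p : Circle × (EuclideanSpace ℝ (Fin l) × EuclideanSpace ℂ (Fin h)) =>
        repSMul p.1 p.2 := by
      unfold repSMul
      fun_prop
    have hn : ∀ (z : Circle) (v : EuclideanSpace ℝ (Fin l) × EuclideanSpace ℂ (Fin h)),
        ‖repSMul z v‖ = ‖v‖ := fun z v => by
      simp only [repSMul, Prod.norm_def, Circle.norm_smul]
    rw [continuous_iff_continuousAt]
    rintro ⟨z, v⟩
    induction v using OnePoint.rec with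
    | infty =>
      refine OnePoint.hasBasis_nhds_infty.tendsto_right_iff.2 ?_
      rintro K ⟨-, hK⟩
      obtain ⟨R, hR⟩ := hK.isBounded.exists_norm_le
      have hU := (OnePoint.hasBasis_nhds_infty
        (X := EuclideanSpace ℝ (Fin l) × EuclideanSpace ℂ (Fin h))).mem_of_mem
          ⟨Metric.isClosed_closedBall, isCompact_closedBall 0 R⟩
      have hV : Prod.snd ⁻¹' _ ∈ nhds (z, (OnePoint.infty : OnePoint
        (EuclideanSpace ℝ (Fin l) × EuclideanSpace ℂ (Fin h)))) :=
          continuous_snd.continuousAt.preimage_mem_nhds hU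
      refine Filter.mem_of_superset hV ?_
      rintro ⟨w, v⟩ hv
      induction v using OnePoint.rec with
      | infty => exact Or.inr rfl
      | coe v =>
        refine Or.inl ⟨repSMul w v, fun hmem => ?_, rfl⟩
        have h1 := hR _ hmem
        rw [hn] at h1
        rcases hv with ⟨u, hu, huv⟩ | huv
        · rw [OnePoint.coe_injective huv] at hu
          exact hu (mem_closedBall_zero_iff.2 h1)
        · exact OnePoint.coe_ne_infty v huv
    | coe v =>
      have he : Topology.IsOpenEmbedding (Prod.map id OnePoint.some :
          Circle × (EuclideanSpace ℝ (Fin l) × EuclideanSpace ℂ (Fin h)) →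
            Circle × OnePoint (EuclideanSpace ℝ (Fin l) × EuclideanSpace ℂ (Fin h))) :=
        Topology.IsOpenEmbedding.id.prodMap OnePoint.isOpenEmbedding_coe
      exact (he.continuousAt_iff (x := (z, v))).1
        (OnePoint.continuous_coe.comp hc).continuousAt

/-- The base point `∞` of `S^{l,h}`. -/
def RepSphere.base (l h : ℕ) : MulAction.fixedPoints Circle (RepSphere l h) :=
  ⟨(OnePoint.infty : OnePoint _), fun _ => rfl⟩

/-- The free cell `𝕋 × Disk d`. -/
def FreeCell (d : ℕ) : Type := Circle × Disk d

instance (d : ℕ) : TopologicalSpace (FreeCell d) :=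
  inferInstanceAs (TopologicalSpace (Circle × Disk d))

/-- The circle acts on a free cell by multiplication on the factor `𝕋`. -/
instance (d : ℕ) : MulAction Circle (FreeCell d) where
  smul z c := (z * c.1, c.2)
  one_smul c := Prod.ext (one_mul c.1) rfl
  mul_smul z w c := Prod.ext (mul_assoc z w c.1) rfl

/-- The boundary `𝕋 × S^{d-1}` of the free cell `𝕋 × Disk d`. -/
def FreeCellBoundary (d : ℕ) : Type := Circle × DiskBoundary d

instance (d : ℕ) : TopologicalSpace (FreeCellBoundary d) :=
  inferInstanceAs (TopologicalSpace (Circle × DiskBoundary d))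

/-- The circle acts on the boundary of a free cell by multiplication on the factor `𝕋`. -/
instance (d : ℕ) : MulAction Circle (FreeCellBoundary d) where
  smul z c := (z * c.1, c.2)
  one_smul c := Prod.ext (one_mul c.1) rfl
  mul_smul z w c := Prod.ext (mul_assoc z w c.1) rfl

/-- The inclusion of the boundary of a free cell. -/
def FreeCellBoundary.incl {d : ℕ} (c : FreeCellBoundary d) : FreeCell d :=
  (c.1, ⟨c.2.1, Metric.sphere_subset_closedBall c.2.2⟩)

variable {Y : Type} [TopologicalSpace Y] [MulAction Circle Y] {d : ℕ}

/-- The gluing relation that identifies `φ c` with `c` for `c` in the boundary of the cell. -/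
inductive AttachRel (φ : TMap (FreeCellBoundary d) Y) : Y ⊕ FreeCell d → Y ⊕ FreeCell d → Prop
  | glue (c : FreeCellBoundary d) : AttachRel φ (Sum.inl (φ.map c)) (Sum.inr c.incl)

/-- The space `Y ∪_φ (𝕋 × Disk d)` obtained from `Y` by attaching a free cell along `φ`. -/
def Attach (φ : TMap (FreeCellBoundary d) Y) : Type := Quot (AttachRel φ)

instance (φ : TMap (FreeCellBoundary d) Y) : TopologicalSpace (Attach φ) :=
  inferInstanceAs (TopologicalSpace (Quot _))

instance (φ : TMap (FreeCellBoundary d) Y) : MulAction Circle (Attach φ) where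
  smul z := Quot.map (Sum.map (z • ·) (z • ·)) (by
    rintro _ _ ⟨c⟩
    have h := AttachRel.glue (φ := φ) (z • c)
    rw [φ.equivariant] at h
    exact h)
  one_smul x := by
    induction x using Quot.ind with
    | mk s =>
      cases s with
      | inl y => exact congrArg (fun t => Quot.mk _ (Sum.inl t)) (one_smul Circle y)
      | inr c => exact congrArg (fun t => Quot.mk _ (Sum.inr t)) (one_smul Circle c)
  mul_smul z w x := by
    induction x using Quot.ind with
    | mk s =>
      cases s with
      | inl y => exact congrArg (fun t => Quot.mk _ (Sum.inl t)) (mul_smul z w y)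
      | inr c => exact congrArg (fun t => Quot.mk _ (Sum.inr t)) (mul_smul z w c)

instance [ContinuousSMul Circle Y] (φ : TMap (FreeCellBoundary d) Y) :
    ContinuousSMul Circle (Attach φ) where
  continuous_smul := by
    have hq : Topology.IsQuotientMap (Quot.mk (AttachRel φ)) := isQuotientMap_quot_mk
    refine hq.continuous_lift_prod_right (Y := Circle)
      (g := fun p : Circle × Attach φ => p.1 • p.2) ?_
    have h1 : Continuous fun p : Circle × Y =>
        (Quot.mk (AttachRel φ) (Sum.inl (p.1 • p.2)) : Attach φ) :=
      continuous_quot_mk.comp (continuous_inl.comp continuous_smul)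
    have h2 : Continuous fun p : Circle × FreeCell d =>
        (Quot.mk (AttachRel φ) (Sum.inr (p.1 • p.2)) : Attach φ) :=
      continuous_quot_mk.comp (continuous_inr.comp
        ((continuous_fst.mul (continuous_fst.comp continuous_snd)).prodMk
          (continuous_snd.comp continuous_snd)))
    have h3 := (h1.sumElim h2).comp
      (Homeomorph.prodSumDistrib (X := Circle) (Y := Y) (Z := FreeCell d)).continuous
    refine h3.congr ?_
    rintro ⟨z, s⟩
    cases s <;> rfl

/-- A fixed point of `Y`, regarded as a fixed point of `Y ∪_φ (𝕋 × Disk d)`. -/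
def Attach.base (φ : TMap (FreeCellBoundary d) Y) (y₀ : MulAction.fixedPoints Circle Y) :
    MulAction.fixedPoints Circle (Attach φ) :=
  ⟨Quot.mk _ (Sum.inl y₀.1), fun z =>
    congrArg (fun t => Quot.mk (AttachRel φ) (Sum.inl t)) (y₀.2 z)⟩

variable (l h : ℕ)

/-- The constant equivariant map to the base point of `S^{l,h}`. -/
def constBase (d : ℕ) : TMap (FreeCellBoundary d) (RepSphere l h) where
  map := ContinuousMap.const _ (RepSphere.base l h).1
  equivariant z _ := ((RepSphere.base l h).2 z).symm

/-- The space `A = S^{l,h} ∨ (𝕋₊ ∧ S^n)` with `n = l + 2h`, obtained from `S^{l,h}` by attaching the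
free cell `𝕋 × Disk n` along the constant map to the base point. -/
abbrev SpaceA : Type := Attach (constBase l h (l + 2 * h))

/-- The base point of `A`. -/
def SpaceA.base : MulAction.fixedPoints Circle (SpaceA l h) :=
  Attach.base _ (RepSphere.base l h)

/-- Equivariant maps `𝕋 × S^n → A`, where `n = l + 2h`. -/
abbrev AttachingMap : Type := TMap (FreeCellBoundary (l + 2 * h + 1)) (SpaceA l h)

/-- Generators `eA`, `fA` of the reduced Borel cohomology group of `A` in degree `n = l + 2h` with
integer coefficients, such that restriction to the fixed point set annihilates `fA` and maps `eA` to
a generator of an infinite cyclic group, and a generator `g` of the infinite cyclic group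
`H_𝕋ⁿ(𝕋 × S^n; ℤ)`. -/
structure IsGenerators
    (eA fA : borelCohomology (SpaceA l h) ℤ (l + 2 * h) {(SpaceA.base l h).1})
    (g : borelCohomology (FreeCellBoundary (l + 2 * h + 1)) ℤ (l + 2 * h) ∅) : Prop where
  basis : ∀ y, ∃! c : ℤ × ℤ, y = c.1 • eA + c.2 • fA
  restrict_fA : restrictFixed ℤ (SpaceA l h) (SpaceA.base l h) (l + 2 * h) fA = 0
  restrict_eA : ∀ y, ∃! c : ℤ,
    y = c • restrictFixed ℤ (SpaceA l h) (SpaceA.base l h) (l + 2 * h) eA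
  generator : ∀ y, ∃! c : ℤ, y = c • g

/-- The map from reduced Borel cohomology of `A` to Borel cohomology of `𝕋 × S^n` that is induced
by an equivariant map `φ`. -/
def AttachingMap.pullback {l h : ℕ} (φ : AttachingMap l h) :
    borelCohomology (SpaceA l h) ℤ (l + 2 * h) {(SpaceA.base l h).1} →ₗ[ℤ]
      borelCohomology (FreeCellBoundary (l + 2 * h + 1)) ℤ (l + 2 * h) ∅ :=
  borelPullback ℤ (l + 2 * h) φ ∅ _ (Set.mapsTo_empty _ _)

/-- The equivariant map `φ` has degrees `(a, b)`: it pulls back `eA` to `a • g` and `fA` to `b • g`.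
The space `X_{a,b}` is obtained from `A` by attaching a free cell along such a map. -/
def HasDegrees {l h : ℕ} (φ : AttachingMap l h)
    (eA fA : borelCohomology (SpaceA l h) ℤ (l + 2 * h) {(SpaceA.base l h).1})
    (g : borelCohomology (FreeCellBoundary (l + 2 * h + 1)) ℤ (l + 2 * h) ∅) (a b : ℤ) : Prop :=
  φ.pullback eA = a • g ∧ φ.pullback fA = b • g

/-- The base point of the space obtained from `A` by attaching a free cell along `φ`. -/
def AttachingMap.base {l h : ℕ} (φ : AttachingMap l h) :
    MulAction.fixedPoints Circle (Attach φ) :=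
  Attach.base φ (SpaceA.base l h)

end Examples

end SWF

end

open SWF

noncomputable section

namespace SWF

/-! ### Singular cochains on arbitrary functions from simplices -/

/-! Put `n = l + 2h`. In degree `n` the reduced cohomology of `A` has a basis `e, f`; the class `e`
restricts to a generator on the fixed sphere, and `f` restricts to zero. Attaching a free cell of
dimension `n + 1` along `φ` obstructs the extension of classes only in degree `n`. There `c e + d f`
extends if and only if `φ` pulls it back to zero, that is, if and only if `c a + d b = 0` in the
coefficient ring `k`, and its restriction to the fixed points is then `c` times a generator
(`Attach.exists_incl_iff`, `AttachingMap.exists_restrict_iff`). Below degree `n` the restriction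
factors through the cohomology of `S^{l,h}`, which vanishes there. Above degree `n` it is onto,
because restriction from `S^{l,h}` to its fixed sphere is an isomorphism from degree `n` on and the
cell does not interfere. Hence `h^s = h` if and only if `a + d b = 0` has a solution `d`, and `h^w =
h` if and only if `c a + d b = 0` has a solution with `c ≠ 0`; otherwise the value is `h + 1`
(`AttachingMap.hStrong_eq`, `AttachingMap.hWeak_eq`). Over a field both conditions fail exactly when
`b = 0 ≠ a`. Over `ℤ` the first says that `b` divides `a`, while the second always holds if `b ≠ 0`.

The input about `S^{l,h}` comes from two geometric arguments, without products or spectral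
sequences. Filtering `E𝕋 × V` by the first nonvanishing coordinate in `E𝕋` gives layers with the
cohomology of `(ℂ^j × V, complement of 0)` (`stage_iso`). This shows vanishing below `dim V` and
that restriction to the fibre is an isomorphism up to `dim V` (`van_thom`, `thom_iso`). Adding a
complex line to `V` changes nothing from degree `dim V + 2` on, since the difference is carried by a
set on which the circle acts freely (`addLine_iso`); induction on `h` compares `S^{l,h}` with its
fixed points (`sphere_incl_iso`).

Cohomology itself is developed for pairs of subsets of an ambient space: `Coh` uses functions on all
set maps from a simplex, but imposes conditions only on singular simplices of the subsets. Exactness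
for triples, homotopy invariance (`pull_eq_of_homotopy`) and excision (`excision`) are proved for
it, and `cohEquiv` identifies it with the singular cohomology in the statement. In place of
universal coefficients, `IsGen` records that an integral class generates for every coefficient ring
at once.

For the existence of `φ`, equivariant maps from `𝕋 × S^n` are the same as maps from `S^n`. The pairs
of degrees realized by based maps form a subgroup of `ℤ × ℤ` (`degreeGroup`), and the two spheres in
`A` show that it contains `(±1, 0)` and `(0, ±1)` (`exists_degrees`). That `X` is of type SWF
follows from explicit cells (`hasFiniteCells_repSphere`, `isTypeSWF`). -/

/-- The standard topological simplex. -/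
abbrev Simplex (n : ℕ) : Type := stdSimplex ℝ (Fin (n + 1))

/-- The inclusion of the `i`-th face of the standard simplex. -/
def face {n : ℕ} (i : Fin (n + 2)) : Simplex n → Simplex (n + 1) :=
  stdSimplex.map i.succAbove

lemma continuous_face {n : ℕ} (i : Fin (n + 2)) : Continuous (face i) :=
  stdSimplex.continuous_map _

lemma succAbove_comm {n : ℕ} {i j : Fin (n + 2)} (h : i ≤ j) (x : Fin (n + 1)) :
    i.castSucc.succAbove (j.succAbove x) = j.succ.succAbove (i.succAbove x) := by
  ext
  simp only [Fin.succAbove, Fin.lt_def, Fin.le_def, Fin.val_castSucc, Fin.val_succ] at h ⊢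
  split_ifs <;> simp only [Fin.val_castSucc, Fin.val_succ] at * <;> omega

lemma face_comm {n : ℕ} {i j : Fin (n + 2)} (h : i ≤ j) :
    (face i.castSucc ∘ face j : Simplex n → Simplex (n + 2)) = face j.succ ∘ face i := by
  funext x
  simp only [face, Function.comp_apply, stdSimplex.map_comp_apply]
  congr 1
  funext y
  exact succAbove_comm h y

/-- The term at `(i, j)` with `i ≤ j` cancels the one at `(j + 1, i)`, which has the opposite sign.
The abstract form serves both for cochains (`cobd_cobd`) and for affine chains (`bd_bd`). -/
lemma alternating_sum_zero {M : Type*} [AddCommGroup M] {n : ℕ}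
    (a : Fin (n + 3) → Fin (n + 2) → M)
    (h : ∀ i j : Fin (n + 2), i ≤ j → a i.castSucc j = a j.succ i) :
    ∑ i : Fin (n + 3), (-1 : ℤ) ^ (i : ℕ) • ∑ j : Fin (n + 2), (-1 : ℤ) ^ (j : ℕ) • a i j = 0 := by
  simp only [Finset.smul_sum, smul_smul, ← pow_add]
  rw [← Finset.sum_product']
  let S : Finset (Fin (n + 3) × Fin (n + 2)) := {p | (p.1 : ℕ) ≤ p.2}
  have hS : (Finset.univ ×ˢ Finset.univ : Finset (Fin (n + 3) × Fin (n + 2))) =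
    S ∪ Sᶜ := by simp
  rw [hS, Finset.sum_union disjoint_compl_right, ← eq_neg_iff_add_eq_zero,
    ← Finset.sum_neg_distrib]
  refine Finset.sum_bij (fun p hp => (p.2.succ, ⟨p.1, by
    have := p.2.2
    simp only [S, Finset.mem_filter] at hp
    omega⟩)) ?_ ?_ ?_ ?_
  · rintro ⟨i, j⟩ hp
    simp only [S, Finset.mem_filter, Finset.mem_compl] at hp ⊢
    simp only [Fin.val_succ]
    omega
  · rintro ⟨i, j⟩ hp ⟨i', j'⟩ hp' he
    simp only [Prod.mk.injEq, Fin.succ_inj, Fin.mk.injEq] at he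
    exact Prod.ext (Fin.ext he.2) he.1
  · rintro ⟨i, j⟩ hp
    simp only [S, Finset.mem_filter, Finset.mem_compl, Finset.mem_univ, true_and] at hp
    refine ⟨(j.castSucc, ⟨i - 1, by omega⟩), ?_, ?_⟩
    · simp only [S, Finset.mem_filter, Finset.mem_univ, true_and, Fin.val_castSucc]
      omega
    · refine Prod.ext (Fin.ext ?_) (Fin.ext ?_)
      · simp only [Fin.val_succ]
        omega
      · rfl
  · rintro ⟨i, j⟩ hp
    simp only [S, Finset.mem_filter, Finset.mem_univ, true_and] at hp
    have hi : (i : ℕ) < n + 2 := lt_of_le_of_lt hp j.2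
    have := h ⟨i, hi⟩ j hp
    have h2 : (⟨(i : ℕ), hi⟩ : Fin (n + 2)).castSucc = i := rfl
    rw [h2] at this
    dsimp only
    rw [this, ← neg_smul]
    congr 1
    rw [Fin.val_succ, show (j : ℕ) + 1 + (i : ℕ) = (i : ℕ) + j + 1 by ring, pow_succ]
    ring

variable {k : Type} [CommRing k] {X Y W : Type}

/-- The alternating sum of the values of a cochain on the faces. -/
def cobd (k : Type) [CommRing k] {X : Type} (n : ℕ) :
    ((Simplex n → X) → k) →ₗ[k] ((Simplex (n + 1) → X) → k) where
  toFun f σ := ∑ i : Fin (n + 2), (-1 : ℤ) ^ (i : ℕ) • f (σ ∘ face i)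
  map_add' f g := by
    funext σ
    simp [Finset.sum_add_distrib]
  map_smul' c f := by
    funext σ
    simp only [Pi.smul_apply, RingHom.id_apply, Finset.smul_sum]
    exact Finset.sum_congr rfl fun i _ => smul_comm _ _ _

lemma cobd_apply {n : ℕ} (f : (Simplex n → X) → k) (σ : Simplex (n + 1) → X) :
    cobd k n f σ = ∑ i : Fin (n + 2), (-1 : ℤ) ^ (i : ℕ) • f (σ ∘ face i) := rfl

lemma cobd_cobd {n : ℕ} (f : (Simplex n → X) → k) : cobd k (n + 1) (cobd k n f) = 0 := by
  funext σ
  simp only [cobd_apply]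
  refine alternating_sum_zero (fun i j => f ((σ ∘ face i) ∘ face j)) fun i j h => ?_
  rw [Function.comp_assoc, face_comm h, Function.comp_assoc]

/-- Precomposition with `φ` on cochains. -/
def cpull (k : Type) [CommRing k] {X Y : Type} (n : ℕ) (φ : X → Y) :
    ((Simplex n → Y) → k) →ₗ[k] ((Simplex n → X) → k) where
  toFun f σ := f (φ ∘ σ)
  map_add' _ _ := rfl
  map_smul' _ _ := rfl

lemma cpull_apply {n : ℕ} (φ : X → Y) (f : (Simplex n → Y) → k) (σ : Simplex n → X) :
    cpull k n φ f σ = f (φ ∘ σ) := rfl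

variable [TopologicalSpace X] [TopologicalSpace Y] [TopologicalSpace W]

/-- `σ` is a singular simplex of the subset `U`. -/
def In {n : ℕ} (U : Set X) (σ : Simplex n → X) : Prop := Continuous σ ∧ ∀ t, σ t ∈ U

lemma In.mono {n : ℕ} {U V : Set X} {σ : Simplex n → X} (h : In U σ) (hUV : U ⊆ V) : In V σ :=
  ⟨h.1, fun t => hUV (h.2 t)⟩

lemma In.face {n : ℕ} {U : Set X} {σ : Simplex (n + 1) → X} (h : In U σ) (i : Fin (n + 2)) :
    In U (σ ∘ face i) :=
  ⟨h.1.comp (continuous_face i), fun _ => h.2 _⟩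

lemma In.inter {n : ℕ} {U V : Set X} {σ : Simplex n → X} (h : In U σ) (h' : In V σ) :
    In (U ∩ V) σ := ⟨h.1, fun t => ⟨h.2 t, h'.2 t⟩⟩

/-- Faces of singular simplices of `U` are again singular simplices of `U`. This locality is what
allows cochains to be defined on all maps of sets, continuous or not. -/
lemma cobd_congr {n : ℕ} {U : Set X} {f g : (Simplex n → X) → k}
    (h : ∀ σ, In U σ → f σ = g σ) {σ : Simplex (n + 1) → X} (hσ : In U σ) :
    cobd k n f σ = cobd k n g σ := by
  simp only [cobd_apply]
  exact Finset.sum_congr rfl fun i _ => by rw [h _ (hσ.face i)]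

lemma cobd_eq_zero {n : ℕ} {U : Set X} {f : (Simplex n → X) → k}
    (h : ∀ σ, In U σ → f σ = 0) {σ : Simplex (n + 1) → X} (hσ : In U σ) :
    cobd k n f σ = 0 := by
  rw [cobd_congr (g := 0) h hσ, map_zero]
  rfl

/-- Relative cocycles of `(U, A)`: cochains that vanish on simplices of `A` and whose coboundary
vanishes on simplices of `U`. -/
def cocyc (k : Type) [CommRing k] (n : ℕ) (U A : Set X) : Submodule k ((Simplex n → X) → k) where
  carrier := {f | (∀ σ, In A σ → f σ = 0) ∧ ∀ σ, In U σ → cobd k n f σ = 0}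
  add_mem' {f g} hf hg := ⟨fun σ h => by simp [hf.1 σ h, hg.1 σ h],
    fun σ h => by simp [hf.2 σ h, hg.2 σ h]⟩
  zero_mem' := ⟨fun _ _ => rfl, fun σ _ => by simp⟩
  smul_mem' c f hf := ⟨fun σ h => by simp [hf.1 σ h], fun σ h => by simp [hf.2 σ h]⟩

/-- `f` agrees on `U` with the coboundary of a cochain that vanishes on `A`. -/
def IsCob {k : Type} [CommRing k] (U A : Set X) : {n : ℕ} → ((Simplex n → X) → k) → Prop
  | 0, f => ∀ σ, In U σ → f σ = 0
  | n + 1, f => ∃ g : (Simplex n → X) → k, (∀ σ, In A σ → g σ = 0) ∧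
      ∀ σ, In U σ → f σ = cobd k n g σ

/-- In degree 0 this is the convention, and in positive degrees `0` is a primitive. As a consequence
the values of a cochain off the singular simplices of `U` disappear in `Coh`. -/
lemma IsCob.zero {n : ℕ} {U A : Set X} {f : (Simplex n → X) → k} (h : ∀ σ, In U σ → f σ = 0) :
    IsCob U A f := by
  cases n with
  | zero => exact h
  | succ n => exact ⟨0, fun _ _ => rfl, fun σ hσ => by rw [h σ hσ, map_zero]; rfl⟩

lemma IsCob.add {n : ℕ} {U A : Set X} {f g : (Simplex n → X) → k} (hf : IsCob U A f)
    (hg : IsCob U A g) : IsCob U A (f + g) := by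
  cases n with
  | zero => exact fun σ h => by simp [hf σ h, hg σ h]
  | succ n =>
    obtain ⟨a, ha, ha'⟩ := hf
    obtain ⟨b, hb, hb'⟩ := hg
    exact ⟨a + b, fun σ h => by simp [ha σ h, hb σ h], fun σ h => by simp [ha' σ h, hb' σ h]⟩

lemma IsCob.smul {n : ℕ} {U A : Set X} {f : (Simplex n → X) → k} (c : k) (hf : IsCob U A f) :
    IsCob U A (c • f) := by
  cases n with
  | zero => exact fun σ h => by simp [hf σ h]
  | succ n =>
    obtain ⟨a, ha, ha'⟩ := hf
    exact ⟨c • a, fun σ h => by simp [ha σ h], fun σ h => by simp [ha' σ h]⟩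

lemma IsCob.congr {n : ℕ} {U A : Set X} {f g : (Simplex n → X) → k} (hf : IsCob U A f)
    (h : ∀ σ, In U σ → g σ = f σ) : IsCob U A g := by
  cases n with
  | zero => exact fun σ hσ => by rw [h σ hσ, hf σ hσ]
  | succ n =>
    obtain ⟨a, ha, ha'⟩ := hf
    exact ⟨a, ha, fun σ hσ => by rw [h σ hσ, ha' σ hσ]⟩

lemma IsCob.neg {n : ℕ} {U A : Set X} {f : (Simplex n → X) → k} (hf : IsCob U A f) :
    IsCob U A (-f) := by
  simpa using hf.smul (-1)

/-- Relative cocycles that are coboundaries. -/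
def cobs (k : Type) [CommRing k] (n : ℕ) (U A : Set X) : Submodule k (cocyc k n U A) where
  carrier := {f | IsCob U A f.1}
  add_mem' hf hg := IsCob.add hf hg
  zero_mem' := IsCob.zero fun _ _ => rfl
  smul_mem' c _ hf := IsCob.smul c hf

/-- Singular cohomology of the pair `(U, A)` of subsets of `X`. -/
abbrev Coh (k : Type) [CommRing k] (n : ℕ) (U A : Set X) : Type := cocyc k n U A ⧸ cobs k n U A

/-- The cohomology class of a relative cocycle. -/
def Coh.mk {n : ℕ} {U A : Set X} (f : cocyc k n U A) : Coh k n U A := Submodule.Quotient.mk f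

lemma Coh.mk_surjective {n : ℕ} {U A : Set X} (y : Coh k n U A) : ∃ f, Coh.mk f = y :=
  Submodule.Quotient.mk_surjective _ y

lemma Coh.mk_eq_zero {n : ℕ} {U A : Set X} {f : cocyc k n U A} :
    Coh.mk f = 0 ↔ IsCob U A f.1 := Submodule.Quotient.mk_eq_zero _

lemma Coh.mk_eq_mk {n : ℕ} {U A : Set X} {f g : cocyc k n U A} :
    Coh.mk f = Coh.mk g ↔ IsCob U A (f.1 - g.1) := Submodule.Quotient.eq _

/-- `φ` is a map of pairs from `(U, A)` to `(V, B)`. It need not be continuous outside of `U`. -/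
structure PairMap (φ : X → Y) (U A : Set X) (V B : Set Y) : Prop where
  cont : ContinuousOn φ U
  sub : A ⊆ U
  maps : Set.MapsTo φ U V
  maps' : Set.MapsTo φ A B

lemma In.map {n : ℕ} {φ : X → Y} {U : Set X} {V : Set Y} {σ : Simplex n → X} (hσ : In U σ)
    (hφ : ContinuousOn φ U) (h : Set.MapsTo φ U V) : In V (φ ∘ σ) :=
  ⟨hφ.comp_continuous hσ.1 hσ.2, fun t => h (hσ.2 t)⟩

namespace PairMap

variable {φ : X → Y} {ψ : Y → W} {U A : Set X} {V B : Set Y} {V' B' : Set W}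

lemma comp (hψ : PairMap ψ V B V' B') (hφ : PairMap φ U A V B) :
    PairMap (ψ ∘ φ) U A V' B' where
  cont := hψ.cont.comp hφ.cont hφ.maps
  sub := hφ.sub
  maps := hψ.maps.comp hφ.maps
  maps' := hψ.maps'.comp hφ.maps'

lemma id {U A U' A' : Set X} (hA : A ⊆ U) (hU : U ⊆ U') (hA' : A ⊆ A') :
    PairMap id U A U' A' := ⟨continuousOn_id, hA, hU, hA'⟩

lemma in_left (h : PairMap φ U A V B) {n : ℕ} {σ : Simplex n → X} (hσ : In U σ) :
    In V (φ ∘ σ) := hσ.map h.cont h.maps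

lemma in_right (h : PairMap φ U A V B) {n : ℕ} {σ : Simplex n → X} (hσ : In A σ) :
    In B (φ ∘ σ) := hσ.map (h.cont.mono h.sub) h.maps'

lemma isCob (h : PairMap φ U A V B) {n : ℕ} {f : (Simplex n → Y) → k} (hf : IsCob V B f) :
    IsCob U A (cpull k n φ f) := by
  cases n with
  | zero => exact fun σ hσ => hf _ (h.in_left hσ)
  | succ n =>
    obtain ⟨a, ha, ha'⟩ := hf
    exact ⟨cpull k n φ a, fun σ hσ => ha _ (h.in_right hσ), fun σ hσ => ha' _ (h.in_left hσ)⟩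

/-- Pullback of cocycles. -/
def zpull (k : Type) [CommRing k] (n : ℕ) (h : PairMap φ U A V B) :
    cocyc k n V B →ₗ[k] cocyc k n U A :=
  (cpull k n φ).restrict fun _ hf =>
    ⟨fun _ hσ => hf.1 _ (h.in_right hσ), fun _ hσ => hf.2 _ (h.in_left hσ)⟩

/-- The map induced in cohomology by a map of pairs. -/
def pull (k : Type) [CommRing k] (n : ℕ) (h : PairMap φ U A V B) :
    Coh k n V B →ₗ[k] Coh k n U A :=
  Submodule.mapQ _ _ (h.zpull k n) fun _ hf => h.isCob hf

lemma pull_mk (h : PairMap φ U A V B) {n : ℕ} (f : cocyc k n V B) :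
    h.pull k n (Coh.mk f) = Coh.mk (h.zpull k n f) := rfl

lemma pull_comp (hψ : PairMap ψ V B V' B') (hφ : PairMap φ U A V B) (n : ℕ)
    (y : Coh k n V' B') : (hψ.comp hφ).pull k n y = hφ.pull k n (hψ.pull k n y) := by
  obtain ⟨f, rfl⟩ := Coh.mk_surjective y
  rfl

lemma pull_id (h : PairMap _root_.id U A U A) (n : ℕ) (y : Coh k n U A) : h.pull k n y = y := by
  obtain ⟨f, rfl⟩ := Coh.mk_surjective y
  rfl

lemma pull_eq_of_eqOn {φ' : X → Y} (h : PairMap φ U A V B) (h' : PairMap φ' U A V B)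
    (he : Set.EqOn φ φ' U) (n : ℕ) (y : Coh k n V B) : h.pull k n y = h'.pull k n y := by
  obtain ⟨f, rfl⟩ := Coh.mk_surjective y
  rw [pull_mk, pull_mk, Coh.mk_eq_mk]
  refine IsCob.zero fun σ hσ => sub_eq_zero.2 ?_
  change f.1 (φ ∘ σ) = f.1 (φ' ∘ σ)
  exact congrArg f.1 (funext fun t => he (hσ.2 t))

end PairMap

/-- A map of pairs that induces isomorphisms in degree `n` for all coefficients. -/
def PairMap.Iso {φ : X → Y} {U A : Set X} {V B : Set Y} (h : PairMap φ U A V B) (n : ℕ) : Prop :=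
  ∀ (k : Type) [CommRing k], Function.Bijective (h.pull k n)

/-- The cohomology of `(U, A)` vanishes in degree `n` for all coefficients. -/
def Van (n : ℕ) (U A : Set X) : Prop :=
  ∀ (k : Type) [CommRing k] (f : (Simplex n → X) → k), f ∈ cocyc k n U A → IsCob U A f

lemma Van.eq_zero {n : ℕ} {U A : Set X} (h : Van n U A) (y : Coh k n U A) : y = 0 := by
  obtain ⟨f, rfl⟩ := Coh.mk_surjective y
  exact Coh.mk_eq_zero.2 (h k f.1 f.2)

lemma Van.of_eq_zero {n : ℕ} {U A : Set X}
    (h : ∀ (k : Type) [CommRing k] (y : Coh k n U A), y = 0) : Van n U A :=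
  fun k _ f hf => Coh.mk_eq_zero.1 (h k (Coh.mk ⟨f, hf⟩))

namespace PairMap

variable {φ : X → Y} {ψ : Y → W} {U A : Set X} {V B : Set Y} {V' B' : Set W} {n : ℕ}

lemma Iso.comp {hψ : PairMap ψ V B V' B'} {hφ : PairMap φ U A V B} (h1 : hψ.Iso n)
    (h2 : hφ.Iso n) : (hψ.comp hφ).Iso n := fun k _ => by
  have : ⇑((hψ.comp hφ).pull k n) = hφ.pull k n ∘ hψ.pull k n :=
    funext (pull_comp hψ hφ n)
  rw [this]
  exact (h2 k).comp (h1 k)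

lemma Iso.of_comp_left {hψ : PairMap ψ V B V' B'} {hφ : PairMap φ U A V B} (h1 : hψ.Iso n)
    (h : (hψ.comp hφ).Iso n) : hφ.Iso n := fun k _ => by
  have : ⇑((hψ.comp hφ).pull k n) = hφ.pull k n ∘ hψ.pull k n :=
    funext (pull_comp hψ hφ n)
  have h3 := h k
  rw [this] at h3
  exact (Function.Bijective.of_comp_iff _ (h1 k)).1 h3

lemma Iso.of_comp_right {hψ : PairMap ψ V B V' B'} {hφ : PairMap φ U A V B} (h2 : hφ.Iso n)
    (h : (hψ.comp hφ).Iso n) : hψ.Iso n := fun k _ => by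
  have : ⇑((hψ.comp hφ).pull k n) = hφ.pull k n ∘ hψ.pull k n :=
    funext (pull_comp hψ hφ n)
  have h3 := h k
  rw [this] at h3
  exact (Function.Bijective.of_comp_iff' (h2 k) _).1 h3

lemma Iso.congr {φ' : X → Y} {h : PairMap φ U A V B} {h' : PairMap φ' U A V B}
    (he : Set.EqOn φ φ' U) (hi : h.Iso n) : h'.Iso n := fun k _ => by
  have : ⇑(h'.pull k n) = h.pull k n := funext fun y => (pull_eq_of_eqOn h h' he n y).symm
  rw [this]
  exact hi k

lemma Iso.van {h : PairMap φ U A V B} (hi : h.Iso n) (hv : Van n U A) : Van n V B :=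
  Van.of_eq_zero fun k _ y => (hi k).1 (by rw [hv.eq_zero (h.pull k n y), map_zero])

lemma Iso.van' {h : PairMap φ U A V B} (hi : h.Iso n) (hv : Van n V B) : Van n U A :=
  Van.of_eq_zero fun k _ y => by
    obtain ⟨z, rfl⟩ := (hi k).2 y
    rw [hv.eq_zero z, map_zero]

end PairMap

/-! ### Change of coefficients -/

/-- The change of coefficients from `ℤ` to `k`. -/
def coeff (k : Type) [CommRing k] (n : ℕ) (U A : Set X) : Coh ℤ n U A →+ Coh k n U A :=
  QuotientAddGroup.map (cobs ℤ n U A).toAddSubgroup (cobs k n U A).toAddSubgroup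
    (AddMonoidHom.mk' (fun f => (⟨fun σ => (f.1 σ : k), fun σ h => by simp [f.2.1 σ h], fun σ h => by
      have := congrArg (Int.cast : ℤ → k) (f.2.2 σ h)
      simpa [cobd_apply] using this⟩ : cocyc k n U A)) fun f g => by
        ext σ
        simp) (by
    intro f hf
    change IsCob U A _
    replace hf : IsCob U A f.1 := hf
    cases n with
    | zero => exact fun σ h => by simp [hf σ h]
    | succ n =>
      obtain ⟨g, hg, hg'⟩ := hf
      exact ⟨fun σ => (g σ : k), fun σ h => by simp [hg σ h], fun σ h => by
        simp [hg' σ h, cobd_apply]⟩)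

lemma coeff_mk {n : ℕ} {U A : Set X} (f : cocyc ℤ n U A) :
    ∃ h, coeff k n U A (Coh.mk f) = Coh.mk ⟨fun σ => (f.1 σ : k), h⟩ := ⟨_, rfl⟩

lemma coeff_pull {φ : X → Y} {U A : Set X} {V B : Set Y} (h : PairMap φ U A V B) (n : ℕ)
    (y : Coh ℤ n V B) : coeff k n U A (h.pull ℤ n y) = h.pull k n (coeff k n V B y) := by
  obtain ⟨f, rfl⟩ := Coh.mk_surjective y
  rfl

lemma coeff_int {n : ℕ} {U A : Set X} (y : Coh ℤ n U A) : coeff ℤ n U A y = y := by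
  obtain ⟨f, rfl⟩ := Coh.mk_surjective y
  rfl

lemma coeff_smul {n : ℕ} {U A : Set X} (c : ℤ) (y : Coh ℤ n U A) :
    coeff k n U A (c • y) = (c : k) • coeff k n U A y := by
  rw [map_zsmul, Int.cast_smul_eq_zsmul]

/-- `u` freely generates the cohomology of `(U, A)` in degree `n`, for all coefficients. -/
def IsGen {n : ℕ} {U A : Set X} (u : Coh ℤ n U A) : Prop :=
  ∀ (k : Type) [CommRing k] (y : Coh k n U A), ∃! c : k, y = c • coeff k n U A u

lemma IsGen.int {n : ℕ} {U A : Set X} {u : Coh ℤ n U A} (h : IsGen u) (y : Coh ℤ n U A) :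
    ∃! c : ℤ, y = c • u := by
  simpa only [coeff_int] using h ℤ y

lemma IsGen.pull {φ : X → Y} {U A : Set X} {V B : Set Y} {h : PairMap φ U A V B} {n : ℕ}
    (hi : h.Iso n) {u : Coh ℤ n V B} (hu : IsGen u) : IsGen (h.pull ℤ n u) := fun k _ y => by
  obtain ⟨z, rfl⟩ := (hi k).2 y
  obtain ⟨c, hc, hc'⟩ := hu k z
  refine ⟨c, by simp only [hc, map_smul, coeff_pull], fun c' h' => hc' c' ((hi k).1 ?_)⟩
  simp only [h', map_smul, coeff_pull]

lemma IsGen.of_pull {φ : X → Y} {U A : Set X} {V B : Set Y} {h : PairMap φ U A V B} {n : ℕ}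
    (hi : h.Iso n) {u : Coh ℤ n V B} (hu : IsGen (h.pull ℤ n u)) : IsGen u := fun k _ y => by
  obtain ⟨c, hc, hc'⟩ := hu k (h.pull k n y)
  refine ⟨c, (hi k).1 (by simpa only [map_smul, ← coeff_pull] using hc), fun c' h' => hc' c' ?_⟩
  simp only [h', map_smul, coeff_pull]

/-! ### The exact sequence of a triple -/

open Classical in
/-- Extension of a cochain by zero outside of the simplices of `G`. -/
def extz (k : Type) [CommRing k] (n : ℕ) (G : Set X) :
    ((Simplex n → X) → k) →ₗ[k] ((Simplex n → X) → k) where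
  toFun f σ := if In G σ then f σ else 0
  map_add' f g := by
    funext σ
    by_cases h : In G σ <;> simp [h]
  map_smul' c f := by
    funext σ
    by_cases h : In G σ <;> simp [h]

lemma extz_of_in {n : ℕ} {G : Set X} (f : (Simplex n → X) → k) {σ : Simplex n → X}
    (h : In G σ) : extz k n G f σ = f σ := if_pos h

lemma extz_of_not_in {n : ℕ} {G : Set X} (f : (Simplex n → X) → k) {σ : Simplex n → X}
    (h : ¬ In G σ) : extz k n G f σ = 0 := if_neg h

lemma cobd_extz {n : ℕ} {G : Set X} (f : (Simplex n → X) → k) {σ : Simplex (n + 1) → X}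
    (h : In G σ) : cobd k n (extz k n G f) σ = cobd k n f σ :=
  cobd_congr (fun _ hσ => extz_of_in f hσ) h

section Triple

variable {U G K : Set X} {n : ℕ}

/-- The connecting homomorphism of the triple `(U, G, K)`. -/
def conn (k : Type) [CommRing k] (n : ℕ) (hG : G ⊆ U) (hK : K ⊆ G) :
    Coh k n G K →ₗ[k] Coh k (n + 1) U G :=
  Submodule.mapQ _ _
    (((cobd k n).comp (extz k n G)).restrict (p := cocyc k n G K) (q := cocyc k (n + 1) U G)
      fun f hf => ⟨fun σ hσ => by
        rw [LinearMap.comp_apply, cobd_extz f hσ, hf.2 σ hσ], fun σ _ => by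
          rw [LinearMap.comp_apply, cobd_cobd]
          rfl⟩)
    (by
      intro f hf
      change IsCob U G (cobd k n (extz k n G f.1))
      replace hf : IsCob G K f.1 := hf
      cases n with
      | zero =>
        refine ⟨extz k 0 G f.1, fun σ hσ => ?_, fun σ _ => rfl⟩
        rw [extz_of_in _ hσ, hf σ hσ]
      | succ n =>
        obtain ⟨g, hg, hg'⟩ := hf
        -- If `f = δg` on `G`, then subtracting `δ` of the extended `g` makes the extension of `f`
        -- vanish on `G` and leaves its coboundary unchanged.
        refine ⟨extz k _ G f.1 - cobd k n (extz k n G g), fun σ hσ => ?_, fun σ _ => ?_⟩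
        · rw [Pi.sub_apply, extz_of_in _ hσ, cobd_extz _ hσ, hg' σ hσ, sub_self]
        · rw [map_sub, cobd_cobd, sub_zero])

lemma conn_mk (hG : G ⊆ U) (hK : K ⊆ G) (f : cocyc k n G K) :
    ∃ h, conn k n hG hK (Coh.mk f) = Coh.mk ⟨cobd k n (extz k n G f.1), h⟩ := ⟨_, rfl⟩

lemma coeff_conn (hG : G ⊆ U) (hK : K ⊆ G) (y : Coh ℤ n G K) :
    coeff k (n + 1) U G (conn ℤ n hG hK y) = conn k n hG hK (coeff k n G K y) := by
  obtain ⟨f, rfl⟩ := Coh.mk_surjective y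
  obtain ⟨h1, e1⟩ := conn_mk hG hK f
  obtain ⟨h2, e2⟩ := coeff_mk (k := k) f
  rw [e1, e2]
  obtain ⟨h3, e3⟩ := coeff_mk (k := k) ⟨_, h1⟩
  obtain ⟨h4, e4⟩ := conn_mk (k := k) hG hK ⟨_, h2⟩
  rw [e3, e4]
  congr 2
  funext σ
  simp only [cobd_apply, Int.cast_sum]
  refine Finset.sum_congr rfl fun i _ => ?_
  by_cases hi : In G (σ ∘ face i)
  · simp [extz_of_in _ hi]
  · simp [extz_of_not_in _ hi]

/-- Restriction from `(U, K)` to `(G, K)`. -/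
lemma resMap (hG : G ⊆ U) (hK : K ⊆ G) : PairMap id G K U K := PairMap.id hK hG subset_rfl

/-- The map from `(U, K)` to `(U, G)`. -/
lemma relMap (hG : G ⊆ U) (hK : K ⊆ G) : PairMap id U K U G :=
  PairMap.id (hK.trans hG) subset_rfl hK

/-- If `f = δg` on `G`, extend `g` by zero: subtracting its coboundary makes `f` vanish on `G`, and
the class relative to `K` is unchanged because `g` vanishes on `K`. -/
lemma exact_rel_res (hG : G ⊆ U) (hK : K ⊆ G) (y : Coh k n U K)
    (hy : (resMap hG hK).pull k n y = 0) : ∃ z, (relMap hG hK).pull k n z = y := by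
  obtain ⟨f, rfl⟩ := Coh.mk_surjective y
  rw [PairMap.pull_mk, Coh.mk_eq_zero] at hy
  change IsCob G K f.1 at hy
  cases n with
  | zero =>
    exact ⟨Coh.mk ⟨f.1, hy, f.2.2⟩, rfl⟩
  | succ n =>
    obtain ⟨g, hg, hg'⟩ := hy
    refine ⟨Coh.mk ⟨f.1 - cobd k n (extz k n G g), fun σ hσ => ?_, fun σ hσ => ?_⟩, ?_⟩
    · rw [Pi.sub_apply, cobd_extz _ hσ, hg' σ hσ, sub_self]
    · rw [map_sub, cobd_cobd, sub_zero]
      exact f.2.2 σ hσ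
    · rw [PairMap.pull_mk, Coh.mk_eq_mk]
      refine IsCob.neg (f := cobd k n (extz k n G g)) ⟨extz k n G g, fun σ hσ => ?_, fun σ _ => rfl⟩ |>.congr
        fun σ _ => ?_
      · rw [extz_of_in _ (hσ.mono hK), hg σ hσ]
      · change (f.1 σ - cobd k n (extz k n G g) σ) - f.1 σ = - cobd k n (extz k n G g) σ
        ring

lemma res_rel (hG : G ⊆ U) (hK : K ⊆ G) (z : Coh k n U G) :
    (resMap hG hK).pull k n ((relMap hG hK).pull k n z) = 0 := by
  obtain ⟨f, rfl⟩ := Coh.mk_surjective z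
  rw [PairMap.pull_mk, PairMap.pull_mk, Coh.mk_eq_zero]
  exact IsCob.zero fun σ hσ => f.2.1 σ hσ

lemma exact_res_conn (hG : G ⊆ U) (hK : K ⊆ G) (y : Coh k n G K)
    (hy : conn k n hG hK y = 0) : ∃ z, (resMap hG hK).pull k n z = y := by
  obtain ⟨f, rfl⟩ := Coh.mk_surjective y
  obtain ⟨_, h⟩ := conn_mk hG hK f
  rw [h, Coh.mk_eq_zero] at hy
  obtain ⟨g, hg, hg'⟩ := hy
  refine ⟨Coh.mk ⟨extz k n G f.1 - g, fun σ hσ => ?_, fun σ hσ => ?_⟩, ?_⟩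
  · rw [Pi.sub_apply, extz_of_in _ (hσ.mono hK), hg σ (hσ.mono hK), f.2.1 σ hσ, sub_self]
  · rw [map_sub, Pi.sub_apply, ← hg' σ hσ, sub_self]
  · rw [PairMap.pull_mk, Coh.mk_eq_mk]
    refine IsCob.zero fun σ hσ => ?_
    change (extz k n G f.1 σ - g σ) - f.1 σ = 0
    rw [extz_of_in _ hσ, hg σ hσ]
    ring

lemma conn_res (hG : G ⊆ U) (hK : K ⊆ G) (z : Coh k n U K) :
    conn k n hG hK ((resMap hG hK).pull k n z) = 0 := by
  obtain ⟨f, rfl⟩ := Coh.mk_surjective z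
  obtain ⟨_, h⟩ := conn_mk hG hK ((resMap hG hK).zpull k n f)
  rw [PairMap.pull_mk, h, Coh.mk_eq_zero]
  refine ⟨extz k n G f.1 - f.1, fun σ hσ => ?_, fun σ hσ => ?_⟩
  · rw [Pi.sub_apply, extz_of_in _ hσ, sub_self]
  · rw [map_sub, Pi.sub_apply, f.2.2 σ hσ, sub_zero]
    rfl

lemma exact_conn_rel (hG : G ⊆ U) (hK : K ⊆ G) (y : Coh k (n + 1) U G)
    (hy : (relMap hG hK).pull k (n + 1) y = 0) : ∃ z, conn k n hG hK z = y := by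
  obtain ⟨f, rfl⟩ := Coh.mk_surjective y
  rw [PairMap.pull_mk, Coh.mk_eq_zero] at hy
  obtain ⟨g, hg, hg'⟩ := hy
  refine ⟨Coh.mk ⟨g, hg, fun σ hσ => ?_⟩, ?_⟩
  · rw [← hg' σ (hσ.mono hG)]
    exact f.2.1 σ hσ
  · obtain ⟨_, h⟩ := conn_mk hG hK (⟨g, hg, fun σ hσ => by
      rw [← hg' σ (hσ.mono hG)]
      exact f.2.1 σ hσ⟩ : cocyc k n G K)
    rw [h, Coh.mk_eq_mk]
    refine ⟨extz k n G g - g, fun σ hσ => ?_, fun σ hσ => ?_⟩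
    · rw [Pi.sub_apply, extz_of_in _ hσ, sub_self]
    · rw [map_sub, Pi.sub_apply, Pi.sub_apply, ← hg' σ hσ]
      rfl

lemma res_injective (hG : G ⊆ U) (hK : K ⊆ G) (h : Van n U G) :
    Function.Injective ((resMap hG hK).pull k n) := by
  refine (injective_iff_map_eq_zero _).2 fun y hy => ?_
  obtain ⟨z, rfl⟩ := exact_rel_res hG hK y hy
  rw [h.eq_zero z, map_zero]

lemma res_surjective (hG : G ⊆ U) (hK : K ⊆ G) (h : Van (n + 1) U G) :
    Function.Surjective ((resMap hG hK).pull k n) :=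
  fun y => exact_res_conn hG hK y (h.eq_zero _)

lemma res_iso (hG : G ⊆ U) (hK : K ⊆ G) (h : Van n U G) (h' : Van (n + 1) U G) :
    (resMap hG hK).Iso n := fun _ _ => ⟨res_injective hG hK h, res_surjective hG hK h'⟩

lemma rel_surjective (hG : G ⊆ U) (hK : K ⊆ G) (h : Van n G K) :
    Function.Surjective ((relMap hG hK).pull k n) :=
  fun y => exact_rel_res hG hK y (h.eq_zero _)

/-- Surjectivity uses the vanishing in degree `n`, injectivity that in degree `n - 1`. In degree 0
the notion of coboundary does not involve the subset, so injectivity is automatic. -/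
lemma rel_iso (hG : G ⊆ U) (hK : K ⊆ G) (h : ∀ m, Van m G K) : (relMap hG hK).Iso n :=
  fun k _ => ⟨(injective_iff_map_eq_zero _).2 fun y hy => by
    cases n with
    | zero =>
      obtain ⟨f, rfl⟩ := Coh.mk_surjective y
      rw [PairMap.pull_mk, Coh.mk_eq_zero] at hy
      exact Coh.mk_eq_zero.2 hy
    | succ n =>
      obtain ⟨z, rfl⟩ := exact_conn_rel hG hK y hy
      rw [(h n).eq_zero z, map_zero], rel_surjective hG hK (h n)⟩

lemma conn_bijective (hG : G ⊆ U) (hK : K ⊆ G) (h : ∀ m, Van m U K) :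
    Function.Bijective (conn k n hG hK) :=
  ⟨(injective_iff_map_eq_zero _).2 fun y hy => by
    obtain ⟨z, rfl⟩ := exact_res_conn hG hK y hy
    rw [(h n).eq_zero z, map_zero],
    fun y => exact_conn_rel hG hK y ((h (n + 1)).eq_zero _)⟩

lemma Van.trans (hG : G ⊆ U) (hK : K ⊆ G) (h : Van n U G) (h' : Van n G K) : Van n U K :=
  Van.of_eq_zero fun k _ y => by
    obtain ⟨z, rfl⟩ := exact_rel_res hG hK y (h'.eq_zero _)
    rw [h.eq_zero z, map_zero]

lemma Van.of_conn (hG : G ⊆ U) (hK : K ⊆ G) (h : ∀ m, Van m U K) (h' : Van n G K) :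
    Van (n + 1) U G :=
  Van.of_eq_zero fun k _ y => by
    obtain ⟨z, rfl⟩ := (conn_bijective hG hK h).2 y
    rw [h'.eq_zero z, map_zero]

lemma IsGen.conn (hG : G ⊆ U) (hK : K ⊆ G) (h : ∀ m, Van m U K) {u : Coh ℤ n G K} (hu : IsGen u) :
    IsGen (conn ℤ n hG hK u) := fun k _ y => by
  obtain ⟨z, rfl⟩ := (conn_bijective hG hK h).2 y
  obtain ⟨c, hc, hc'⟩ := hu k z
  refine ⟨c, by simp only [hc, map_smul, coeff_conn], fun c' h' =>
    hc' c' ((conn_bijective hG hK h).1 ?_)⟩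
  simp only [h', map_smul, coeff_conn]

end Triple


/-! ### Affine chains and barycentric subdivision -/

/-- Spaces with affine combinations of finitely many points. -/
class AffSpace (K : Type) where
  /-- the affine combination with barycentric coordinates `t` -/
  aff : ∀ {n : ℕ}, (Fin (n + 1) → K) → Simplex n → K
  aff_face : ∀ {n : ℕ} (v : Fin (n + 2) → K) (i : Fin (n + 2)) (t : Simplex n),
    aff v (face i t) = aff (v ∘ i.succAbove) t

open AffSpace

/-- The points of a standard simplex can be combined affinely. -/
def simplexAff {m n : ℕ} (v : Fin (n + 1) → Simplex m) (t : Simplex n) : Simplex m :=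
  ⟨∑ i, t i • (v i : Fin (m + 1) → ℝ), (convex_stdSimplex ℝ _).sum_mem (fun i _ => t.2.1 i) t.2.2
    fun i _ => (v i).2⟩

lemma simplexAff_apply {m n : ℕ} (v : Fin (n + 1) → Simplex m) (t : Simplex n) (x : Fin (m + 1)) :
    simplexAff v t x = ∑ i, t i * v i x := by
  change (∑ i, t i • (v i : Fin (m + 1) → ℝ)) x = _
  simp [Finset.sum_apply]

lemma face_apply_succAbove {n : ℕ} (i : Fin (n + 2)) (t : Simplex n) (j : Fin (n + 1)) :
    face i t (i.succAbove j) = t j := by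
  change (face i t : Fin (n + 2) → ℝ) _ = _
  simp only [face, stdSimplex.map_coe, FunOnFinite.linearMap_apply_apply]
  rw [Finset.sum_eq_single j]
  · intro b hb hbj
    simp only [Finset.mem_filter, Finset.mem_univ, true_and] at hb
    exact absurd (Fin.succAbove_right_injective hb) hbj
  · simp

lemma face_apply_self {n : ℕ} (i : Fin (n + 2)) (t : Simplex n) : face i t i = 0 := by
  change (face i t : Fin (n + 2) → ℝ) _ = _
  simp only [face, stdSimplex.map_coe, FunOnFinite.linearMap_apply_apply]
  refine Finset.sum_eq_zero fun j hj => ?_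
  simp only [Finset.mem_filter, Finset.mem_univ, true_and] at hj
  exact absurd hj (Fin.succAbove_ne i j)

lemma sum_face_mul {n : ℕ} (i : Fin (n + 2)) (t : Simplex n) (a : Fin (n + 2) → ℝ) :
    ∑ j, face i t j * a j = ∑ j, t j * a (i.succAbove j) := by
  rw [Fin.sum_univ_succAbove _ i, face_apply_self, zero_mul, zero_add]
  simp only [face_apply_succAbove]

instance (m : ℕ) : AffSpace (Simplex m) where
  aff := simplexAff
  aff_face v i t := by
    refine stdSimplex.ext (funext fun x => ?_)
    rw [simplexAff_apply, simplexAff_apply]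
    exact sum_face_mul i t fun j => v j x

instance : AffSpace unitInterval where
  aff v t := ⟨∑ i, t i • (v i : ℝ), (convex_Icc (0 : ℝ) 1).sum_mem (fun i _ => t.2.1 i) t.2.2
    fun i _ => (v i).2⟩
  aff_face v i t := Subtype.ext (sum_face_mul i t fun j => (v j : ℝ))

instance (K L : Type) [AffSpace K] [AffSpace L] : AffSpace (K × L) where
  aff v t := (aff (Prod.fst ∘ v) t, aff (Prod.snd ∘ v) t)
  aff_face v i t := Prod.ext (aff_face _ i t) (aff_face _ i t)

/-- Maps that preserve affine combinations. -/
def IsAff {K L : Type} [AffSpace K] [AffSpace L] (f : K → L) : Prop :=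
  ∀ ⦃n : ℕ⦄ (v : Fin (n + 1) → K) (t : Simplex n), f (aff v t) = aff (f ∘ v) t

lemma IsAff.prodMap {K L : Type} [AffSpace K] [AffSpace L] {f : K → L} (hf : IsAff f) :
    IsAff (Prod.map f (id : unitInterval → unitInterval)) := fun _ v t =>
  Prod.ext (hf _ t) rfl

/-- The end `x ↦ (x, s)` of the cylinder. -/
def cyl {K : Type} (s : unitInterval) (x : K) : K × unitInterval := (x, s)

lemma isAff_cyl {K : Type} [AffSpace K] (s : unitInterval) : IsAff (cyl (K := K) s) := fun _ v t => by
  refine Prod.ext rfl (Subtype.ext ?_)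
  change (s : ℝ) = ∑ i, t i • (s : ℝ)
  rw [← Finset.sum_smul, stdSimplex.sum_eq_one, one_smul]

lemma isAff_aff {m n : ℕ} (v : Fin (n + 1) → Simplex m) : IsAff (aff v) := fun _ w t => by
  refine stdSimplex.ext (funext fun x => ?_)
  change simplexAff v (simplexAff w t) x = simplexAff (simplexAff v ∘ w) t x
  simp only [simplexAff_apply, Function.comp_apply, Finset.sum_mul, Finset.mul_sum, mul_assoc]
  exact Finset.sum_comm

lemma aff_vertex {m n : ℕ} (v : Fin (n + 1) → Simplex m) (i : Fin (n + 1)) :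
    aff v (stdSimplex.vertex i) = v i := by
  refine stdSimplex.ext (funext fun x => ?_)
  change simplexAff v _ x = _
  rw [simplexAff_apply, Finset.sum_eq_single i]
  · change (Pi.single i (1 : ℝ) : Fin (n + 1) → ℝ) i * _ = _
    simp
  · intro j _ hj
    change (Pi.single i (1 : ℝ) : Fin (n + 1) → ℝ) j * _ = _
    simp [hj]
  · simp

lemma aff_vertices {n : ℕ} (t : Simplex n) : aff (stdSimplex.vertex : Fin (n + 1) → _) t = t := by
  refine stdSimplex.ext (funext fun x => ?_)
  change simplexAff _ _ x = _
  rw [simplexAff_apply, Finset.sum_eq_single x]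
  · change _ * (Pi.single x (1 : ℝ) : Fin (n + 1) → ℝ) x = _
    simp
  · intro j _ hj
    change _ * (Pi.single j (1 : ℝ) : Fin (n + 1) → ℝ) x = _
    simp [hj.symm]
  · simp

lemma isAff_face {n : ℕ} (i : Fin (n + 2)) : IsAff (face i : Simplex n → Simplex (n + 1)) := by
  have : (face i : Simplex n → Simplex (n + 1)) =
      aff (fun j => stdSimplex.vertex (i.succAbove j)) := by
    funext t
    rw [← aff_vertices (face i t), aff_face]
    rfl
  rw [this]
  exact isAff_aff _

lemma continuous_simplexAff {m n : ℕ} (v : Fin (n + 1) → Simplex m) :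
    Continuous (simplexAff v) := by
  refine Continuous.subtype_mk (continuous_finsetSum _ fun i _ => ?_) _
  exact ((continuous_apply i).comp continuous_subtype_val).smul continuous_const

lemma continuous_aff_prod {m n : ℕ} (v : Fin (n + 1) → Simplex m × unitInterval) :
    Continuous (aff v : Simplex n → _) := by
  refine (continuous_simplexAff (Prod.fst ∘ v)).prodMk (Continuous.subtype_mk ?_ _)
  refine continuous_finsetSum _ fun i _ => ?_
  exact ((continuous_apply i).comp continuous_subtype_val).smul continuous_const

/-- Chains of affine simplices in `K`. -/
abbrev Ch (n : ℕ) (K : Type) : Type := (Fin (n + 1) → K) →₀ ℤ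

section Ch

variable {K L : Type}

/-- The boundary of affine chains. -/
def bd (n : ℕ) (K : Type) : Ch (n + 1) K →ₗ[ℤ] Ch n K :=
  Finsupp.linearCombination ℤ fun v =>
    ∑ i : Fin (n + 2), (-1 : ℤ) ^ (i : ℕ) • Finsupp.single (v ∘ i.succAbove) 1

lemma bd_single {n : ℕ} (v : Fin (n + 2) → K) : bd n K (Finsupp.single v 1) =
    ∑ i : Fin (n + 2), (-1 : ℤ) ^ (i : ℕ) • Finsupp.single (v ∘ i.succAbove) 1 := by
  rw [bd, Finsupp.linearCombination_single, one_smul]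

lemma bd_bd {n : ℕ} (c : Ch (n + 2) K) : bd n K (bd (n + 1) K c) = 0 := by
  have : (bd n K).comp (bd (n + 1) K) = 0 := by
    refine Finsupp.lhom_ext' fun v => LinearMap.ext_ring ?_
    simp only [LinearMap.comp_apply, Finsupp.lsingle_apply, bd_single, map_sum, map_smul,
      LinearMap.zero_apply]
    refine alternating_sum_zero (fun i j => Finsupp.single ((v ∘ i.succAbove) ∘ j.succAbove) 1)
      fun i j h => ?_
    congr 1
    funext x
    exact congrArg v (succAbove_comm h x)
  exact LinearMap.congr_fun this c

/-- The cone on an affine chain. -/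
def cone (n : ℕ) (b : K) : Ch n K →ₗ[ℤ] Ch (n + 1) K :=
  Finsupp.lmapDomain ℤ ℤ (fun v => (Fin.cons b v : Fin (n + 2) → K))

lemma cone_single {n : ℕ} (b : K) (v : Fin (n + 1) → K) (c : ℤ) :
    cone n b (Finsupp.single v c) = Finsupp.single (Fin.cons b v) c := Finsupp.mapDomain_single

/-- The augmentation of affine chains. -/
def aug (K : Type) : Ch 0 K →ₗ[ℤ] ℤ := Finsupp.linearCombination ℤ fun _ => 1

lemma aug_bd (c : Ch 1 K) : aug K (bd 0 K c) = 0 := by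
  have : (aug K).comp (bd 0 K) = 0 := by
    refine Finsupp.lhom_ext' fun v => LinearMap.ext_ring ?_
    simp [bd_single, aug, Fin.sum_univ_succ]
  exact LinearMap.congr_fun this c

/-- The complex is not augmented, so the cone formula has a correction term at the apex in lowest
degree, weighted by the augmentation. -/
lemma bd_cone_zero (b : K) (c : Ch 0 K) :
    bd 0 K (cone 0 b c) = c - aug K c • Finsupp.single (fun _ => b) 1 := by
  have : (bd 0 K).comp (cone 0 b) = LinearMap.id -
      (aug K).smulRight (Finsupp.single (fun _ => b) 1) := by
    refine Finsupp.lhom_ext' fun v => LinearMap.ext_ring ?_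
    simp only [LinearMap.comp_apply, Finsupp.lsingle_apply, cone_single, bd_single,
      Fin.sum_univ_succ, LinearMap.sub_apply, LinearMap.id_apply, LinearMap.smulRight_apply]
    simp only [aug, Finsupp.linearCombination_single, Fin.val_zero, pow_zero, one_smul,
      sub_eq_add_neg]
    have h0 : (Fin.cons b v : Fin 2 → K) ∘ (0 : Fin 2).succAbove = v := by
      funext i
      simp [Fin.succAbove_zero]
    have h1 : (Fin.cons b v : Fin 2 → K) ∘ (Fin.succ (0 : Fin 1)).succAbove = fun _ => b := by
      funext i
      have : i = 0 := Subsingleton.elim _ _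
      subst this
      rfl
    rw [h0, h1]
    simp
  exact LinearMap.congr_fun this c

lemma bd_cone {n : ℕ} (b : K) (c : Ch (n + 1) K) :
    bd (n + 1) K (cone (n + 1) b c) = c - cone n b (bd n K c) := by
  have : (bd (n + 1) K).comp (cone (n + 1) b) = LinearMap.id - (cone n b).comp (bd n K) := by
    refine Finsupp.lhom_ext' fun v => LinearMap.ext_ring ?_
    simp only [LinearMap.comp_apply, Finsupp.lsingle_apply, cone_single, bd_single,
      LinearMap.sub_apply, LinearMap.id_apply, map_sum, map_smul]
    rw [Fin.sum_univ_succ, sub_eq_add_neg, ← Finset.sum_neg_distrib]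
    congr 1
    · simp only [Fin.val_zero, pow_zero, one_smul]
      congr 1
    · refine Finset.sum_congr rfl fun i _ => ?_
      rw [← neg_smul]
      congr 1
      · rw [Fin.val_succ, pow_succ]
        ring
      · congr 1
        funext x
        refine Fin.cases ?_ (fun x => ?_) x
        · rfl
        · simp
  exact LinearMap.congr_fun this c

/-- The image of an affine chain under a map. -/
def push (n : ℕ) (f : K → L) : Ch n K →ₗ[ℤ] Ch n L :=
  Finsupp.lmapDomain ℤ ℤ (fun v => f ∘ v)

lemma push_single {n : ℕ} (f : K → L) (v : Fin (n + 1) → K) (c : ℤ) :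
    push n f (Finsupp.single v c) = Finsupp.single (f ∘ v) c := Finsupp.mapDomain_single

lemma push_bd {n : ℕ} (f : K → L) (c : Ch (n + 1) K) :
    push n f (bd n K c) = bd n L (push (n + 1) f c) := by
  have : (push n f).comp (bd n K) = (bd n L).comp (push (n + 1) f) := by
    refine Finsupp.lhom_ext' fun v => LinearMap.ext_ring ?_
    simp only [LinearMap.comp_apply, Finsupp.lsingle_apply, bd_single, map_sum, map_smul,
      push_single]
    rfl
  exact LinearMap.congr_fun this c

lemma push_cone {n : ℕ} (f : K → L) (b : K) (c : Ch n K) :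
    push (n + 1) f (cone n b c) = cone n (f b) (push n f c) := by
  have : (push (n + 1) f).comp (cone n b) = (cone n (f b)).comp (push n f) := by
    refine Finsupp.lhom_ext' fun v => LinearMap.ext_ring ?_
    simp only [LinearMap.comp_apply, Finsupp.lsingle_apply, push_single, cone_single]
    congr 1
    funext x
    refine Fin.cases ?_ (fun x => ?_) x <;> simp
  exact LinearMap.congr_fun this c

lemma aug_push (f : K → L) (c : Ch 0 K) : aug L (push 0 f c) = aug K c := by
  have : (aug L).comp (push 0 f) = aug K := by
    refine Finsupp.lhom_ext' fun v => LinearMap.ext_ring ?_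
    simp [push_single, aug]
  exact LinearMap.congr_fun this c

variable [AffSpace K] [AffSpace L]

/-- The barycenter of an affine simplex. -/
def bary {n : ℕ} (v : Fin (n + 1) → K) : K := aff v stdSimplex.barycenter

lemma IsAff.bary {f : K → L} (hf : IsAff f) {n : ℕ} (v : Fin (n + 1) → K) :
    f (bary v) = SWF.bary (f ∘ v) := hf _ _

/-- Barycentric subdivision of affine chains. -/
def sd (K : Type) [AffSpace K] : (n : ℕ) → Ch n K →ₗ[ℤ] Ch n K
  | 0 => LinearMap.id
  | n + 1 => Finsupp.linearCombination ℤ fun v =>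
      cone n (bary v) (sd K n (bd n K (Finsupp.single v 1)))

lemma sd_single {n : ℕ} (v : Fin (n + 2) → K) : sd K (n + 1) (Finsupp.single v 1) =
    cone n (bary v) (sd K n (bd n K (Finsupp.single v 1))) := by
  rw [sd, Finsupp.linearCombination_single, one_smul]

lemma push_sd {f : K → L} (hf : IsAff f) : ∀ {n : ℕ} (c : Ch n K),
    push n f (sd K n c) = sd L n (push n f c)
  | 0, _ => rfl
  | n + 1, c => by
    have : (push (n + 1) f).comp (sd K (n + 1)) = (sd L (n + 1)).comp (push (n + 1) f) := by
      refine Finsupp.lhom_ext' fun v => LinearMap.ext_ring ?_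
      simp only [LinearMap.comp_apply, Finsupp.lsingle_apply, push_single, sd_single, push_cone,
        push_sd hf, push_bd, hf.bary]
    exact LinearMap.congr_fun this c

lemma aug_sd (c : Ch 0 K) : aug K (sd K 0 c) = aug K c := rfl

/-- The cone formula gives `sd ∂v` minus the cone on `∂ sd ∂v`, which is `sd ∂∂v = 0` by induction.
In lowest degree the correction term is the augmentation of a boundary, hence zero. -/
lemma bd_sd : ∀ {n : ℕ} (c : Ch (n + 1) K), bd n K (sd K (n + 1) c) = sd K n (bd n K c)
  | 0, c => by
    have : (bd 0 K).comp (sd K 1) = (sd K 0).comp (bd 0 K) := by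
      refine Finsupp.lhom_ext' fun v => LinearMap.ext_ring ?_
      simp only [LinearMap.comp_apply, Finsupp.lsingle_apply, sd_single, bd_cone_zero]
      rw [aug_sd, aug_bd, zero_smul, sub_zero]
    exact LinearMap.congr_fun this c
  | n + 1, c => by
    have : (bd (n + 1) K).comp (sd K (n + 2)) = (sd K (n + 1)).comp (bd (n + 1) K) := by
      refine Finsupp.lhom_ext' fun v => LinearMap.ext_ring ?_
      simp only [LinearMap.comp_apply, Finsupp.lsingle_apply, sd_single, bd_cone]
      rw [bd_sd, bd_bd, map_zero, map_zero, sub_zero]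
    exact LinearMap.congr_fun this c

/-- The natural chain homotopy between one end of the cylinder and the subdivision of the other. -/
def prism (K : Type) [AffSpace K] : (n : ℕ) → Ch n K →ₗ[ℤ] Ch (n + 1) (K × unitInterval)
  | 0 => Finsupp.linearCombination ℤ fun v => cone 0 (bary v, 1)
      (push 0 (cyl 1) (Finsupp.single v 1) - push 0 (cyl 0) (Finsupp.single v 1))
  | n + 1 => Finsupp.linearCombination ℤ fun v => cone (n + 1) (bary v, 1)
      -- The chain that is coned off is the one that the boundary of the prism has to be; it is a
      -- cycle, so its cone has it as boundary. Subdividing the end at `1` makes a single recursion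
      -- serve for homotopy invariance and for subdivision.
      (push (n + 1) (cyl 1) (sd K (n + 1) (Finsupp.single v 1)) -
        push (n + 1) (cyl 0) (Finsupp.single v 1) - prism K n (bd n K (Finsupp.single v 1)))

lemma bd_prism_zero (c : Ch 0 K) :
    bd 0 _ (prism K 0 c) = push 0 (cyl 1) (sd K 0 c) - push 0 (cyl 0) c := by
  have : (bd 0 _).comp (prism K 0) =
      (push 0 (cyl (K := K) 1)).comp (sd K 0) - push 0 (cyl 0) := by
    refine Finsupp.lhom_ext' fun v => LinearMap.ext_ring ?_
    simp only [LinearMap.comp_apply, Finsupp.lsingle_apply, prism, LinearMap.sub_apply,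
      Finsupp.linearCombination_single, one_smul, bd_cone_zero]
    rw [map_sub (aug _), aug_push, aug_push, sub_self, zero_smul, sub_zero]
    rfl
  exact LinearMap.congr_fun this c

lemma bd_prism : ∀ {n : ℕ} (c : Ch (n + 1) K), bd (n + 1) _ (prism K (n + 1) c) =
    push (n + 1) (cyl 1) (sd K (n + 1) c) - push (n + 1) (cyl 0) c - prism K n (bd n K c)
  | n, c => by
    have : (bd (n + 1) _).comp (prism K (n + 1)) =
        (push (n + 1) (cyl (K := K) 1)).comp (sd K (n + 1)) - push (n + 1) (cyl 0) -
          (prism K n).comp (bd n K) := by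
      refine Finsupp.lhom_ext' fun v => LinearMap.ext_ring ?_
      -- The chain under the cone is a cycle by the same formula one degree lower.
      have h0 : bd n _ (push (n + 1) (cyl 1) (sd K (n + 1) (Finsupp.single v 1)) -
          push (n + 1) (cyl 0) (Finsupp.single v 1) -
            prism K n (bd n K (Finsupp.single v 1))) = 0 := by
        simp only [map_sub, ← push_bd, bd_sd]
        cases n with
        | zero => rw [bd_prism_zero, sub_self]
        | succ n => rw [bd_prism, bd_bd, map_zero, sub_zero, sub_self]
      simp only [LinearMap.comp_apply, Finsupp.lsingle_apply, prism, LinearMap.sub_apply,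
        Finsupp.linearCombination_single, one_smul, bd_cone]
      rw [h0, map_zero, sub_zero]
    exact LinearMap.congr_fun this c

lemma push_prism {f : K → L} (hf : IsAff f) : ∀ {n : ℕ} (c : Ch n K),
    push (n + 1) (Prod.map f id) (prism K n c) = prism L n (push n f c)
  | 0, c => by
    have : (push 1 (Prod.map f id)).comp (prism K 0) = (prism L 0).comp (push 0 f) := by
      refine Finsupp.lhom_ext' fun v => LinearMap.ext_ring ?_
      simp only [LinearMap.comp_apply, Finsupp.lsingle_apply, prism,
        Finsupp.linearCombination_single, one_smul, push_cone, map_sub, push_single, Prod.map,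
        hf.bary, id]
      rfl
    exact LinearMap.congr_fun this c
  | n + 1, c => by
    have hc : ∀ (s : unitInterval) (c : Ch (n + 1) K), push (n + 1) (Prod.map f id)
        (push (n + 1) (cyl s) c) = push (n + 1) (cyl s) (push (n + 1) f c) := fun s c => by
      simp only [push, Finsupp.lmapDomain_apply, ← Finsupp.mapDomain_comp]
      rfl
    have : (push (n + 2) (Prod.map f id)).comp (prism K (n + 1)) =
        (prism L (n + 1)).comp (push (n + 1) f) := by
      refine Finsupp.lhom_ext' fun v => LinearMap.ext_ring ?_
      simp only [LinearMap.comp_apply, Finsupp.lsingle_apply, prism, push_single (n := n + 1) f v,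
        Finsupp.linearCombination_single, one_smul]
      rw [push_cone, map_sub (push (n + 1) (Prod.map f id)), map_sub (push (n + 1) (Prod.map f id)),
        hc, hc, push_prism hf, push_bd, push_sd hf, push_single]
      simp only [Prod.map, hf.bary, id]
    exact LinearMap.congr_fun this c

end Ch

/-! ### Evaluation of cochains on affine chains -/

section Eval

variable {k : Type} [CommRing k] {X Y K L : Type} [AffSpace K] [AffSpace L]

/-- The value of a cochain on the image under `τ` of an affine chain. -/
def ev {n : ℕ} (f : (Simplex n → X) → k) (τ : K → X) : Ch n K →ₗ[ℤ] k :=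
  Finsupp.linearCombination ℤ fun v => f (τ ∘ aff v)

lemma ev_single {n : ℕ} (f : (Simplex n → X) → k) (τ : K → X) (v : Fin (n + 1) → K) :
    ev f τ (Finsupp.single v 1) = f (τ ∘ aff v) := by
  rw [ev, Finsupp.linearCombination_single, one_smul]

lemma ev_cobd {n : ℕ} (f : (Simplex n → X) → k) (τ : K → X) (c : Ch (n + 1) K) :
    ev (cobd k n f) τ c = ev f τ (bd n K c) := by
  have : ev (cobd k n f) τ = (ev f τ).comp (bd n K) := by
    refine Finsupp.lhom_ext' fun v => LinearMap.ext_ring ?_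
    simp only [LinearMap.comp_apply, Finsupp.lsingle_apply, ev_single, bd_single, map_sum,
      map_smul, cobd_apply]
    refine Finset.sum_congr rfl fun i _ => ?_
    congr 2
    funext t
    exact congrArg τ (aff_face v i t)
  exact LinearMap.congr_fun this c

lemma ev_push {n : ℕ} (f : (Simplex n → X) → k) (τ : L → X) {g : K → L} (hg : IsAff g)
    (c : Ch n K) : ev f (τ ∘ g) c = ev f τ (push n g c) := by
  have : ev f (τ ∘ g) = (ev f τ).comp (push n g) := by
    refine Finsupp.lhom_ext' fun v => LinearMap.ext_ring ?_
    simp only [LinearMap.comp_apply, Finsupp.lsingle_apply, ev_single, push_single]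
    congr 1
    funext t
    exact congrArg τ (hg v t)
  exact LinearMap.congr_fun this c

lemma ev_eq_zero {n : ℕ} {f : (Simplex n → X) → k} {τ : K → X} {s : Set (Fin (n + 1) → K)}
    (h : ∀ v ∈ s, f (τ ∘ aff v) = 0) {c : Ch n K} (hc : c ∈ Finsupp.supported ℤ ℤ s) :
    ev f τ c = 0 := by
  rw [ev, Finsupp.linearCombination_apply]
  refine Finset.sum_eq_zero fun v hv => ?_
  dsimp only
  rw [h v (hc hv), smul_zero]

lemma ev_eq_zero' {n : ℕ} {f : (Simplex n → X) → k} {τ : K → X}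
    (h : ∀ v, f (τ ∘ aff v) = 0) (c : Ch n K) : ev f τ c = 0 :=
  ev_eq_zero (s := Set.univ) (fun v _ => h v) (by simp)

/-- The fundamental chain of the standard simplex. -/
def fund (n : ℕ) : Ch n (Simplex n) := Finsupp.single stdSimplex.vertex 1

lemma ev_fund {n : ℕ} (f : (Simplex n → X) → k) (σ : Simplex n → X) : ev f σ (fund n) = f σ := by
  rw [fund, ev_single]
  congr 1
  funext t
  exact congrArg σ (aff_vertices t)

lemma bd_fund (n : ℕ) : bd n _ (fund (n + 1)) =
    ∑ i : Fin (n + 2), (-1 : ℤ) ^ (i : ℕ) • push n (face i) (fund n) := by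
  rw [fund, bd_single]
  refine Finset.sum_congr rfl fun i _ => ?_
  rw [fund, push_single]
  congr 2
  funext j
  exact (stdSimplex.map_vertex i.succAbove j).symm

lemma push_aff_fund {n m : ℕ} (v : Fin (n + 1) → Simplex m) :
    push n (aff v) (fund n) = Finsupp.single v 1 := by
  rw [fund, push_single]
  congr 1
  funext i
  exact aff_vertex v i

/-- The action of barycentric subdivision on cochains. -/
def csd {n : ℕ} (f : (Simplex n → X) → k) : (Simplex n → X) → k :=
  fun σ => ev f σ (sd _ n (fund n))

/-- By naturality all `j` subdivisions can be carried out on the fundamental chain of the standard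
simplex, where diameters can be controlled. -/
lemma csd_iterate {n : ℕ} (f : (Simplex n → X) → k) (j : ℕ) (σ : Simplex n → X) :
    csd^[j] f σ = ev f σ ((sd _ n)^[j] (fund n)) := by
  induction j generalizing σ with
  | zero => exact (ev_fund f σ).symm
  | succ j ih =>
    rw [Function.iterate_succ_apply', csd, Function.iterate_succ_apply]
    have : ev (csd^[j] f) σ = (ev f σ).comp ((sd (Simplex n) n) ^ j) := by
      refine Finsupp.lhom_ext' fun v => LinearMap.ext_ring ?_
      simp only [LinearMap.comp_apply, Finsupp.lsingle_apply, ev_single, Module.End.pow_apply]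
      rw [ih, ev_push _ _ (isAff_aff v), ← push_aff_fund v]
      congr 1
      generalize fund n = c
      clear ih
      induction j generalizing c with
      | zero => rfl
      | succ j ih =>
        rw [Function.iterate_succ_apply, ih, push_sd (isAff_aff v), Function.iterate_succ_apply]
    rw [this, LinearMap.comp_apply, Module.End.pow_apply]

lemma cobd_csd {n : ℕ} (f : (Simplex n → X) → k) : cobd k n (csd f) = csd (cobd k n f) := by
  funext σ
  rw [csd, ev_cobd, bd_sd, bd_fund, cobd_apply]
  simp only [map_sum, map_smul, csd]
  refine Finset.sum_congr rfl fun i _ => ?_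
  rw [ev_push _ _ (isAff_face i), push_sd (isAff_face i)]

/-- The cochain homotopy associated with a homotopy `h`. -/
def cprism {n : ℕ} (h : X × unitInterval → Y) (f : (Simplex (n + 1) → Y) → k) :
    (Simplex n → X) → k :=
  fun σ => ev f (h ∘ Prod.map σ id) (prism _ n (fund n))

lemma cprism_cobd_zero (h : X × unitInterval → Y) (f : (Simplex 0 → Y) → k) (σ : Simplex 0 → X) :
    cprism h (cobd k 0 f) σ = f (fun t => h (σ t, 1)) - f (fun t => h (σ t, 0)) := by
  rw [cprism, ev_cobd, bd_prism_zero, map_sub, ← ev_push _ _ (isAff_cyl 1),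
    ← ev_push _ _ (isAff_cyl 0)]
  change ev f _ (fund 0) - _ = _
  rw [ev_fund, ev_fund]
  rfl

lemma cobd_cprism {n : ℕ} (h : X × unitInterval → Y) (f : (Simplex (n + 1) → Y) → k)
    (σ : Simplex (n + 1) → X) :
    cobd k n (cprism h f) σ = ev f (h ∘ Prod.map σ id) (prism _ n (bd n _ (fund (n + 1)))) := by
  rw [cobd_apply, bd_fund]
  simp only [map_sum, map_smul, cprism]
  refine Finset.sum_congr rfl fun i _ => ?_
  rw [← push_prism (isAff_face i), ← ev_push _ _ (IsAff.prodMap (isAff_face i))]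
  rfl

/-- This is the transpose of `bd_prism` on the fundamental chain. The end at `1` appears subdivided.
-/
lemma cprism_cobd {n : ℕ} (h : X × unitInterval → Y) (f : (Simplex (n + 1) → Y) → k)
    (σ : Simplex (n + 1) → X) :
    cprism h (cobd k (n + 1) f) σ + cobd k n (cprism h f) σ =
      csd f (fun t => h (σ t, 1)) - f (fun t => h (σ t, 0)) := by
  rw [cobd_cprism, cprism, ev_cobd, bd_prism, map_sub, map_sub, sub_add_cancel,
    ← ev_push _ _ (isAff_cyl 1), ← ev_push _ _ (isAff_cyl 0), ev_fund]
  rfl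

end Eval

/-! ### Homotopy invariance -/

section Homotopy

variable {k : Type} [CommRing k] {X Y : Type} [TopologicalSpace X] [TopologicalSpace Y]

/-- Every affine simplex of the prism over a simplex of `U` is carried by `h` to a singular simplex
of `V`. Used once for the spaces and once for the subspaces, this makes the prism operator a
relative one. -/
lemma cprism_eq_zero {n : ℕ} {h : X × unitInterval → Y} {U : Set X} {V : Set Y}
    (hc : ContinuousOn h (U ×ˢ Set.univ)) (hm : Set.MapsTo h (U ×ˢ Set.univ) V)
    {f : (Simplex (n + 1) → Y) → k} (hf : ∀ σ, In V σ → f σ = 0) {σ : Simplex n → X}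
    (hσ : In U σ) : cprism h f σ = 0 := by
  refine ev_eq_zero' (fun v => hf _ ⟨?_, fun t => ?_⟩) _
  · exact (hc.comp_continuous (hσ.1.prodMap continuous_id) fun p => ⟨hσ.2 _, trivial⟩).comp
      (continuous_aff_prod v)
  · exact hm ⟨hσ.2 _, trivial⟩

/-- Homotopic maps of pairs induce the same map in cohomology. -/
theorem pull_eq_of_homotopy {φ ψ : X → Y} {U A : Set X} {V B : Set Y} (hφ : PairMap φ U A V B)
    (hψ : PairMap ψ U A V B) (h : X × unitInterval → Y) (hc : ContinuousOn h (U ×ˢ Set.univ))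
    (hU : Set.MapsTo h (U ×ˢ Set.univ) V) (hA : Set.MapsTo h (A ×ˢ Set.univ) B)
    (h0 : ∀ x ∈ U, h (x, 0) = φ x) (h1 : ∀ x ∈ U, h (x, 1) = ψ x) (n : ℕ) (y : Coh k n V B) :
    hφ.pull k n y = hψ.pull k n y := by
  obtain ⟨f, rfl⟩ := Coh.mk_surjective y
  have hcA : ContinuousOn h (A ×ˢ Set.univ) := hc.mono (Set.prod_mono hφ.sub subset_rfl)
  rw [PairMap.pull_mk, PairMap.pull_mk, Coh.mk_eq_mk]
  have e0 : ∀ {n} (σ : Simplex n → X), In U σ → (fun t => h (σ t, 0)) = φ ∘ σ :=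
    fun σ hσ => funext fun t => h0 _ (hσ.2 t)
  have e1 : ∀ {n} (σ : Simplex n → X), In U σ → (fun t => h (σ t, 1)) = ψ ∘ σ :=
    fun σ hσ => funext fun t => h1 _ (hσ.2 t)
  cases n with
  | zero =>
    intro σ hσ
    have h2 := cprism_cobd_zero h f.1 σ
    rw [cprism_eq_zero hc hU (fun τ hτ => f.2.2 τ hτ) hσ, e0 σ hσ, e1 σ hσ] at h2
    change f.1 (φ ∘ σ) - f.1 (ψ ∘ σ) = 0
    rw [← neg_sub, ← h2, neg_zero]
  | succ n =>
    have hfst : Continuous (Prod.fst : Y × unitInterval → Y) := continuous_fst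
    -- The prism of `h` compares `φ` with the subdivision of `ψ`; the prism of the constant homotopy
    -- at `ψ` takes the subdivision away again.
    refine ⟨fun σ => cprism Prod.fst f.1 (ψ ∘ σ) - cprism h f.1 σ, fun σ hσ => ?_, fun σ hσ => ?_⟩
    · have hB : ∀ τ, In B τ → f.1 τ = 0 := f.2.1
      dsimp only
      rw [cprism_eq_zero hcA hA hB hσ, cprism_eq_zero (U := B) (V := B) hfst.continuousOn
        (fun p hp => hp.1) hB (hψ.in_right hσ), sub_self]
    · have hV : ∀ τ, In V τ → cobd k (n + 1) f.1 τ = 0 := f.2.2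
      have h2 := cprism_cobd h f.1 σ
      have h3 := cprism_cobd (Prod.fst : Y × unitInterval → Y) f.1 (ψ ∘ σ)
      rw [cprism_eq_zero hc hU hV hσ, e0 σ hσ, e1 σ hσ, zero_add] at h2
      rw [cprism_eq_zero (U := V) (V := V) hfst.continuousOn
        (fun p hp => hp.1) hV (hψ.in_left hσ), zero_add] at h3
      have h4 : cobd k n (fun σ => cprism Prod.fst f.1 (ψ ∘ σ) - cprism h f.1 σ) σ =
          cobd k n (cprism Prod.fst f.1) (ψ ∘ σ) - cobd k n (cprism h f.1) σ := by
        simp only [cobd_apply, smul_sub, Finset.sum_sub_distrib]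
        rfl
      rw [h4, h2, h3]
      change f.1 (φ ∘ σ) - f.1 (ψ ∘ σ) = csd f.1 (ψ ∘ σ) - f.1 (ψ ∘ σ) - _
      ring

end Homotopy

/-! ### Small simplices -/

section Small

variable {k : Type} [CommRing k] {X : Type}

lemma dist_aff_le {m n : ℕ} (v : Fin (n + 1) → Simplex m) (t : Simplex n) (p : Simplex m) {r : ℝ}
    (hr : 0 ≤ r) (h : ∀ i, dist (v i) p ≤ r) : dist (aff v t) p ≤ r := by
  rw [Subtype.dist_eq]
  refine (dist_pi_le_iff hr).2 fun x => ?_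
  change dist (simplexAff v t x) (p x) ≤ r
  rw [simplexAff_apply, Real.dist_eq]
  have h1 : p x = ∑ i, t i * p x := by
    rw [← Finset.sum_mul, stdSimplex.sum_eq_one, one_mul]
  rw [h1, ← Finset.sum_sub_distrib]
  refine (Finset.abs_sum_le_sum_abs _ _).trans ?_
  have h2 : ∑ i, t i * r = r := by rw [← Finset.sum_mul, stdSimplex.sum_eq_one, one_mul]
  rw [← h2]
  refine Finset.sum_le_sum fun i _ => ?_
  rw [← mul_sub, abs_mul, abs_of_nonneg (stdSimplex.zero_le t i)]
  refine mul_le_mul_of_nonneg_left ?_ (stdSimplex.zero_le t i)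
  have h3 := h i
  rw [Subtype.dist_eq] at h3
  exact (dist_le_pi_dist (v i : Fin (m + 1) → ℝ) p x).trans h3

/-- The difference of a vertex and the barycenter is the mean of `n + 1` differences of vertices,
one of which is zero; this is the source of the factor `n / (n + 1)`. -/
lemma dist_bary_le {m n : ℕ} (v : Fin (n + 1) → Simplex m) {r : ℝ} (hr : 0 ≤ r)
    (h : ∀ i j, dist (v i) (v j) ≤ r) (j : Fin (n + 1)) :
    dist (v j) (bary v) ≤ n / (n + 1) * r := by
  rw [dist_comm, Subtype.dist_eq]
  refine (dist_pi_le_iff (by positivity)).2 fun x => ?_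
  change dist (simplexAff v _ x) (v j x) ≤ _
  rw [simplexAff_apply, Real.dist_eq]
  have h0 : ∀ i, (stdSimplex.barycenter : Simplex n) i = ((n + 1 : ℕ) : ℝ)⁻¹ := fun i =>
    (stdSimplex.barycenter_apply i).trans (by rw [Fintype.card_fin])
  simp only [h0]
  have h1 : ∑ i, ((n + 1 : ℕ) : ℝ)⁻¹ * v i x - v j x =
      ∑ i, ((n + 1 : ℕ) : ℝ)⁻¹ * (v i x - v j x) := by
    simp only [mul_sub, Finset.sum_sub_distrib, Finset.sum_const, Finset.card_univ,
      Fintype.card_fin, nsmul_eq_mul]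
    rw [← mul_assoc, mul_inv_cancel₀ (by positivity), one_mul]
  rw [h1, ← Finset.mul_sum, abs_mul, abs_of_nonneg (by positivity)]
  have h2 : |∑ i, (v i x - v j x)| ≤ n * r := by
    rw [Fin.sum_univ_succAbove _ j, sub_self, zero_add]
    refine (Finset.abs_sum_le_sum_abs _ _).trans ?_
    refine (Finset.sum_le_card_nsmul _ _ r fun i _ => ?_).trans (by simp)
    have h3 := h (j.succAbove i) j
    rw [Subtype.dist_eq] at h3
    exact (dist_le_pi_dist (v _ : Fin (m + 1) → ℝ) (v j) x).trans h3
  calc ((n + 1 : ℕ) : ℝ)⁻¹ * |∑ i, (v i x - v j x)| ≤ ((n + 1 : ℕ) : ℝ)⁻¹ * (n * r) :=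
        mul_le_mul_of_nonneg_left h2 (by positivity)
    _ = n / (n + 1) * r := by push_cast; ring

/-- The affine simplices in the convex hull of `v` and of diameter at most `r`. -/
def smallIn {m n : ℕ} {l : ℕ} (v : Fin (l + 1) → Simplex m) (r : ℝ) :
    Set (Fin (n + 1) → Simplex m) :=
  {w | (∀ i p s, 0 ≤ s → (∀ j, dist (v j) p ≤ s) → dist (w i) p ≤ s) ∧ ∀ i j, dist (w i) (w j) ≤ r}

/-- A simplex of the subdivision is the barycenter followed by a simplex of the subdivision of a
face. Edges within the face are bounded by induction, as `n / (n + 1)` increases with `n`. An edge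
at the barycenter is bounded by `dist_bary_le`, because its other end lies in every closed ball that
contains the vertices of `v`; this is how `smallIn` expresses membership in the convex hull. -/
lemma sd_supported {m : ℕ} : ∀ {n : ℕ} (v : Fin (n + 1) → Simplex m) {r : ℝ}, 0 ≤ r →
    (∀ i j, dist (v i) (v j) ≤ r) →
      sd _ n (Finsupp.single v 1) ∈ Finsupp.supported ℤ ℤ (smallIn v (n / (n + 1) * r))
  | 0, v, r, hr, h => by
    refine Finsupp.single_mem_supported _ _ ⟨fun i p s _ hs => hs i, fun i j => ?_⟩
    rw [show i = j from Subsingleton.elim (α := Fin 1) i j, dist_self]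
    simp
  | n + 1, v, r, hr, h => by
    rw [sd_single, bd_single, map_sum, map_sum]
    refine Submodule.sum_mem _ fun i _ => ?_
    rw [map_smul, map_smul]
    refine Submodule.smul_mem _ _ ?_
    have h1 := sd_supported (v ∘ i.succAbove) hr fun a b => h _ _
    have h2 := Finsupp.lmapDomain_supported (M := ℤ) (R := ℤ)
      (fun w => (Fin.cons (bary v) w : Fin (n + 2) → Simplex m))
      (smallIn (n := n) (v ∘ i.succAbove) (n / (n + 1) * r))
    refine Finsupp.supported_mono ?_ (h2.le ⟨_, h1, rfl⟩)
    rintro _ ⟨w, hw, rfl⟩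
    have hb := dist_bary_le v hr h
    have hw' : ∀ i p s, 0 ≤ s → (∀ j, dist (v j) p ≤ s) → dist (w i) p ≤ s :=
      fun a p s h0 hs => hw.1 a p s h0 fun j => hs _
    have hle : (n : ℝ) / (n + 1) * r ≤ ((n + 1 : ℕ) : ℝ) / ((n + 1 : ℕ) + 1) * r := by
      refine mul_le_mul_of_nonneg_right ?_ hr
      rw [div_le_div_iff₀ (by positivity) (by positivity)]
      push_cast
      nlinarith
    refine ⟨fun a p s h0 hs => ?_, fun a b => ?_⟩
    · refine Fin.cases ?_ (fun a => ?_) a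
      · exact dist_aff_le v _ p h0 hs
      · exact hw' a p s h0 hs
    · refine Fin.cases ?_ (fun a => ?_) a <;> refine Fin.cases ?_ (fun b => ?_) b
      · simp only [Fin.cons_zero, dist_self]
        positivity
      · simp only [Fin.cons_zero, Fin.cons_succ]
        rw [dist_comm]
        exact hw' b _ _ (by positivity) hb
      · simp only [Fin.cons_zero, Fin.cons_succ]
        exact hw' a _ _ (by positivity) hb
      · simp only [Fin.cons_succ]
        exact (hw.2 a b).trans hle

lemma sd_iterate_supported {m n : ℕ} {r : ℝ} (hr : 0 ≤ r) (j : ℕ) {c : Ch n (Simplex m)}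
    (hc : c ∈ Finsupp.supported ℤ ℤ {w | ∀ i j, dist (w i) (w j) ≤ r}) :
    (sd _ n)^[j] c ∈ Finsupp.supported ℤ ℤ
      {w : Fin (n + 1) → Simplex m | ∀ a b, dist (w a) (w b) ≤ (n / (n + 1)) ^ j * r} := by
  induction j with
  | zero => simpa using hc
  | succ j ih =>
    rw [Function.iterate_succ_apply']
    generalize (sd (Simplex m) n)^[j] c = d at ih
    rw [← Finsupp.sum_single d, Finsupp.sum, map_sum]
    refine Submodule.sum_mem _ fun v hv => ?_
    rw [show Finsupp.single v (d v) = d v • Finsupp.single v (1 : ℤ) by simp, map_smul]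
    refine Submodule.smul_mem _ _ (Finsupp.supported_mono ?_
      (sd_supported v (r := (n / (n + 1)) ^ j * r) (by positivity) (ih hv)))
    intro w hw a b
    rw [pow_succ', mul_assoc]
    exact hw.2 a b

variable [TopologicalSpace X]

/-- The preimages of `U` and `A` cover the compact standard simplex, so they have a Lebesgue number,
and the diameters in the `j`-th subdivision are at most `(n / (n + 1)) ^ j`. The bound `N` depends
on the simplex. -/
lemma csd_iterate_eq_zero {n : ℕ} {U A : Set X} (hU : IsOpen U) (hA : IsOpen A)
    {f : (Simplex n → X) → k} (hfU : ∀ σ, In U σ → f σ = 0) (hfA : ∀ σ, In A σ → f σ = 0)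
    {σ : Simplex n → X} (hσ : In (U ∪ A) σ) : ∃ N, ∀ j, N ≤ j → csd^[j] f σ = 0 := by
  obtain ⟨δ, hδ, h⟩ := lebesgue_number_lemma_of_metric (s := (Set.univ : Set (Simplex n)))
    isCompact_univ (c := fun b : Bool => σ ⁻¹' (if b then U else A))
    (fun b => by cases b <;> exact IsOpen.preimage hσ.1 (by assumption)) (by
      intro t _
      rcases hσ.2 t with ht | ht
      · exact Set.mem_iUnion.2 ⟨true, ht⟩
      · exact Set.mem_iUnion.2 ⟨false, ht⟩)
  have hlt : (n : ℝ) / (n + 1) < 1 := by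
    rw [div_lt_one (by positivity)]
    linarith
  obtain ⟨N, hN⟩ := exists_pow_lt_of_lt_one hδ hlt
  refine ⟨N, fun j hj => ?_⟩
  rw [csd_iterate]
  refine ev_eq_zero (s := {w | ∀ a b, dist (w a) (w b) ≤ ((n : ℝ) / (n + 1)) ^ j * 1})
    (fun v hv => ?_) (sd_iterate_supported zero_le_one j
      (Finsupp.single_mem_supported _ _ fun a b => ?_))
  · have hj' : ((n : ℝ) / (n + 1)) ^ j * 1 < δ := by
      rw [mul_one]
      exact (pow_le_pow_of_le_one (by positivity) hlt.le hj).trans_lt hN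
    have hball : ∀ t, aff v t ∈ Metric.ball (v 0) δ := fun t =>
      (dist_aff_le v t (v 0) (by positivity) fun i => hv i 0).trans_lt hj'
    have hcont : Continuous (σ ∘ aff v) := hσ.1.comp (continuous_simplexAff v)
    obtain ⟨b, hb⟩ := h (v 0) trivial
    cases b with
    | true => exact hfU _ ⟨hcont, fun t => by simpa using hb (hball t)⟩
    | false => exact hfA _ ⟨hcont, fun t => by simpa using hb (hball t)⟩
  · rw [Subtype.dist_eq]
    refine (dist_pi_le_iff zero_le_one).2 fun x => ?_
    exact Real.dist_le_of_mem_Icc_01 ⟨(stdSimplex.vertex a).2.1 x, stdSimplex.le_one _ x⟩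
      ⟨(stdSimplex.vertex b).2.1 x, stdSimplex.le_one _ x⟩

lemma csd_eq_zero {n : ℕ} {U : Set X} {f : (Simplex n → X) → k} (hf : ∀ σ, In U σ → f σ = 0)
    {σ : Simplex n → X} (hσ : In U σ) : csd f σ = 0 :=
  ev_eq_zero' (fun v => hf _ ⟨hσ.1.comp (continuous_simplexAff v), fun _ => hσ.2 _⟩) _

lemma csd_iterate_eq_zero' {n : ℕ} {U : Set X} {f : (Simplex n → X) → k}
    (hf : ∀ σ, In U σ → f σ = 0) (j : ℕ) {σ : Simplex n → X} (hσ : In U σ) :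
    csd^[j] f σ = 0 := by
  induction j generalizing σ with
  | zero => exact hf σ hσ
  | succ j ih =>
    rw [Function.iterate_succ_apply']
    exact csd_eq_zero (fun τ hτ => ih hτ) hσ

lemma cobd_csd_iterate {n : ℕ} (f : (Simplex n → X) → k) (j : ℕ) :
    cobd k n (csd^[j] f) = csd^[j] (cobd k n f) := by
  induction j generalizing f with
  | zero => rfl
  | succ j ih => rw [Function.iterate_succ_apply, ih, cobd_csd, Function.iterate_succ_apply]

lemma exists_cprism_iterate_eq_zero {n : ℕ} {U A : Set X} (hU : IsOpen U) (hA : IsOpen A)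
    {f : (Simplex (n + 1) → X) → k} (hfU : ∀ σ, In U σ → f σ = 0) (hfA : ∀ σ, In A σ → f σ = 0)
    {σ : Simplex n → X} (hσ : In (U ∪ A) σ) :
    ∃ N, ∀ j, N ≤ j → cprism Prod.fst (csd^[j] f) σ = 0 := by
  have h1 : ∀ v : Fin (n + 2) → Simplex n × unitInterval,
      ∃ N, ∀ j, N ≤ j → csd^[j] f ((Prod.fst ∘ Prod.map σ id) ∘ aff v) = 0 := fun v =>
    csd_iterate_eq_zero hU hA hfU hfA ⟨(hσ.1.comp continuous_fst).comp (continuous_aff_prod v),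
      fun t => hσ.2 _⟩
  choose N hN using h1
  refine ⟨(prism _ n (fund n)).support.sup N, fun j hj => ?_⟩
  exact ev_eq_zero (s := ((prism _ n (fund n)).support : Set _)) (fun v hv => hN v j
    ((Finset.le_sup (f := N) hv).trans hj)) fun v hv => hv

/-- A cocycle on the union of two open sets that vanishes on small simplices is the coboundary of
a cochain that vanishes on small simplices. -/
theorem exists_cobd_eq_of_small {n : ℕ} {U A : Set X} (hU : IsOpen U) (hA : IsOpen A)
    {f : (Simplex (n + 1) → X) → k} (hfU : ∀ σ, In U σ → f σ = 0) (hfA : ∀ σ, In A σ → f σ = 0)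
    (hf : ∀ σ, In (U ∪ A) σ → cobd k (n + 1) f σ = 0) :
    ∃ g : (Simplex n → X) → k, (∀ σ, In U σ → g σ = 0) ∧ (∀ σ, In A σ → g σ = 0) ∧
      ∀ σ, In (U ∪ A) σ → f σ = cobd k n g σ := by
  classical
  set a : ℕ → (Simplex n → X) → k := fun j => cprism Prod.fst (csd^[j] f) with ha
  have hN := fun (σ : Simplex n → X) (hσ : In (U ∪ A) σ) =>
    exists_cprism_iterate_eq_zero hU hA hfU hfA hσ
  choose N hN using hN
  have hsum : ∀ (σ : Simplex n → X) (hσ : In (U ∪ A) σ) (M : ℕ), N σ hσ ≤ M →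
      ∑ j ∈ Finset.range (N σ hσ), a j σ = ∑ j ∈ Finset.range M, a j σ := fun σ hσ M hM =>
    Finset.sum_subset (Finset.range_mono hM) fun j _ hj => hN σ hσ j (by simpa using hj)
  have hfst : Continuous (Prod.fst : X × unitInterval → X) := continuous_fst
  have hav : ∀ (V : Set X), (∀ σ, In V σ → f σ = 0) → ∀ σ, In V σ → ∀ j, a j σ = 0 :=
    fun V hV σ hσ j => cprism_eq_zero (U := V) (V := V) hfst.continuousOn (fun p hp => hp.1)
      (fun τ hτ => csd_iterate_eq_zero' hV j hτ) hσ
  -- A telescoping series: the coboundary of the `j`-th term is the difference of the `(j + 1)`-st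
  -- and the `j`-th subdivision of `f`. On each simplex only finitely many terms are nonzero, but
  -- their number depends on the simplex.
  refine ⟨fun σ => if hσ : In (U ∪ A) σ then -∑ j ∈ Finset.range (N σ hσ), a j σ else 0,
    fun σ hσ => ?_, fun σ hσ => ?_, fun σ hσ => ?_⟩
  · dsimp only
    rw [dif_pos (hσ.mono Set.subset_union_left), Finset.sum_eq_zero fun j _ => hav U hfU σ hσ j,
      neg_zero]
  · dsimp only
    rw [dif_pos (hσ.mono Set.subset_union_right), Finset.sum_eq_zero fun j _ => hav A hfA σ hσ j,
      neg_zero]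
  · obtain ⟨M₀, hM₀⟩ := csd_iterate_eq_zero hU hA hfU hfA hσ
    -- One range of summation that suffices for all faces of `σ`, and after which the subdivided `f`
    -- vanishes on `σ` itself.
    set M := max M₀ (Finset.univ.sup fun i => N _ (hσ.face i)) with hM
    have h1 : ∀ i, N _ (hσ.face i) ≤ M := fun i =>
      (Finset.le_sup (f := fun i => N _ (hσ.face i)) (Finset.mem_univ i)).trans (le_max_right _ _)
    have h2 : ∀ j, cobd k n (a j) σ = csd^[j + 1] f σ - csd^[j] f σ := fun j => by
      have h3 := cprism_cobd (Prod.fst : X × unitInterval → X) (csd^[j] f) σ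
      rw [cprism_eq_zero (U := U ∪ A) (V := U ∪ A) hfst.continuousOn (fun p hp => hp.1)
        (fun τ hτ => by
          rw [cobd_csd_iterate]
          exact csd_iterate_eq_zero' hf j hτ) hσ, zero_add] at h3
      rw [ha, h3, Function.iterate_succ_apply']
    have h4 : ∑ j ∈ Finset.range M, cobd k n (a j) σ = - f σ := by
      simp only [h2]
      rw [Finset.sum_range_sub (fun j => csd^[j] f σ), hM₀ M (le_max_left _ _), zero_sub]
      rfl
    rw [← neg_neg (f σ), ← h4]
    simp only [cobd_apply]
    rw [Finset.sum_comm, ← Finset.sum_neg_distrib]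
    refine Finset.sum_congr rfl fun i _ => ?_
    rw [dif_pos (hσ.face i), hsum _ (hσ.face i) M (h1 i), smul_neg, Finset.smul_sum]

/-- Excision for open sets. -/
theorem excision {U A : Set X} (hU : IsOpen U) (hA : IsOpen A) (n : ℕ) :
    (PairMap.id (Set.inter_subset_left) Set.subset_union_left Set.inter_subset_right :
      PairMap id U (U ∩ A) (U ∪ A) A).Iso n := by
  intro k _
  refine ⟨(injective_iff_map_eq_zero _).2 fun y hy => ?_, fun y => ?_⟩
  · obtain ⟨f, rfl⟩ := Coh.mk_surjective y
    rw [PairMap.pull_mk, Coh.mk_eq_zero] at hy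
    rw [Coh.mk_eq_zero]
    cases n with
    | zero =>
      refine fun σ hσ => ?_
      obtain ⟨N, hN⟩ := csd_iterate_eq_zero hU hA (f := f.1) hy f.2.1 hσ
      have h1 : ∀ t, t = (default : Simplex 0) := fun t => Subsingleton.elim _ _
      rcases hσ.2 default with h | h
      · exact hy σ ⟨hσ.1, fun t => h1 t ▸ h⟩
      · exact f.2.1 σ ⟨hσ.1, fun t => h1 t ▸ h⟩
    | succ n =>
      obtain ⟨g, hg, hg'⟩ := hy
      have hg2 : ∀ σ, In A σ → extz k n U g σ = 0 := fun σ hσ => by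
        by_cases hσU : In U σ
        · rw [extz_of_in _ hσU, hg σ (hσU.inter hσ)]
        · exact extz_of_not_in _ hσU
      -- After subtraction of the coboundary of the extended primitive, the cocycle vanishes on
      -- simplices of `U` and on simplices of `A`, but perhaps not on simplices that meet both
      -- complements. The result on small cochains deals with the latter.
      obtain ⟨g', hgU, hgA, hg''⟩ := exists_cobd_eq_of_small hU hA
        (f := f.1 - cobd k n (extz k n U g)) (fun σ hσ => by
          rw [Pi.sub_apply, cobd_extz _ hσ, ← hg' σ hσ]
          exact sub_self _) (fun σ hσ => by
          rw [Pi.sub_apply, f.2.1 σ hσ, cobd_eq_zero hg2 hσ, sub_zero]) (fun σ hσ => by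
          rw [map_sub, cobd_cobd, sub_zero]
          exact f.2.2 σ hσ)
      refine ⟨g' + extz k n U g, fun σ hσ => by simp [hgA σ hσ, hg2 σ hσ], fun σ hσ => ?_⟩
      rw [map_add, Pi.add_apply, ← hg'' σ hσ]
      simp
  · obtain ⟨f, rfl⟩ := Coh.mk_surjective y
    have hf2 : ∀ σ, In A σ → extz k n U f.1 σ = 0 := fun σ hσ => by
      by_cases hσU : In U σ
      · rw [extz_of_in _ hσU, f.2.1 σ (hσU.inter hσ)]
      · exact extz_of_not_in _ hσU
    -- The extension of `f` by zero fails to be a cocycle only on simplices that are not small; its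
    -- coboundary is the coboundary of a cochain vanishing on small simplices, and subtracting that
    -- cochain does not affect `f` on `U`.
    obtain ⟨g, hgU, hgA, hg⟩ := exists_cobd_eq_of_small hU hA (f := cobd k n (extz k n U f.1))
      (fun σ hσ => by rw [cobd_extz _ hσ, f.2.2 σ hσ]) (fun σ hσ => cobd_eq_zero hf2 hσ)
      (fun σ _ => by rw [cobd_cobd]; rfl)
    refine ⟨Coh.mk ⟨extz k n U f.1 - g, fun σ hσ => by simp [hf2 σ hσ, hgA σ hσ], fun σ hσ => ?_⟩, ?_⟩
    · rw [map_sub, Pi.sub_apply, hg σ hσ, sub_self]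
    · rw [PairMap.pull_mk, Coh.mk_eq_mk]
      refine IsCob.zero fun σ hσ => ?_
      change (extz k n U f.1 σ - g σ) - f.1 σ = 0
      rw [extz_of_in _ hσ, hgU σ hσ]
      ring

end Small


/-! ### Comparison with the singular cohomology of pairs -/

section Bridge

/-- Two surjections with the same kernel have isomorphic targets. -/
def equivOfKer {R M N N' : Type*} [CommRing R] [AddCommGroup M] [AddCommGroup N] [AddCommGroup N']
    [Module R M] [Module R N] [Module R N'] {p : M →ₗ[R] N} {q : M →ₗ[R] N'}
    (hp : Function.Surjective p) (hq : Function.Surjective q)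
    (h : LinearMap.ker p = LinearMap.ker q) : N ≃ₗ[R] N' :=
  (p.quotKerEquivOfSurjective hp).symm.trans
    ((Submodule.quotEquivOfEq _ _ h).trans (q.quotKerEquivOfSurjective hq))

lemma equivOfKer_apply {R M N N' : Type*} [CommRing R] [AddCommGroup M] [AddCommGroup N]
    [AddCommGroup N'] [Module R M] [Module R N] [Module R N'] {p : M →ₗ[R] N} {q : M →ₗ[R] N'}
    (hp : Function.Surjective p) (hq : Function.Surjective q)
    (h : LinearMap.ker p = LinearMap.ker q) (m : M) : equivOfKer hp hq h (p m) = q m := by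
  have h1 : (p.quotKerEquivOfSurjective hp).symm (p m) = Submodule.Quotient.mk m := by
    rw [LinearEquiv.symm_apply_eq]
    rfl
  simp only [equivOfKer, LinearEquiv.trans_apply]
  rw [h1]
  rfl

open Limits Opposite Simplicial

variable (k : Type) [CommRing k]

/-- The function underlying a singular simplex. -/
def simplexFun {X : TopCat.{0}} {n : ℕ} (s : (TopCat.toSSet.obj X) _⦋n⦌) : Simplex n → X :=
  X.toSSetObjEquiv _ s

lemma continuous_simplexFun {X : TopCat.{0}} {n : ℕ} (s : (TopCat.toSSet.obj X) _⦋n⦌) :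
    Continuous (simplexFun s) := (X.toSSetObjEquiv _ s).continuous

lemma simplexFun_delta {X : TopCat.{0}} {n : ℕ} (s : (TopCat.toSSet.obj X) _⦋n + 1⦌) (i : Fin (n + 2)) :
    simplexFun ((TopCat.toSSet.obj X).δ i s) = simplexFun s ∘ face i := rfl

lemma simplexFun_map {X Y : TopCat.{0}} (f : X ⟶ Y) {n : ℕ} (s : (TopCat.toSSet.obj X) _⦋n⦌) :
    simplexFun ((TopCat.toSSet.map f).app _ s) = f ∘ simplexFun s := rfl

lemma exists_simplexFun {X : TopCat.{0}} {n : ℕ} {σ : Simplex n → X} (h : Continuous σ) :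
    ∃ s : (TopCat.toSSet.obj X) _⦋n⦌, simplexFun s = σ :=
  ⟨(X.toSSetObjEquiv _).symm ⟨σ, h⟩, by simp [simplexFun]⟩

lemma simplexFun_injective {X : TopCat.{0}} {n : ℕ} :
    Function.Injective (simplexFun : (TopCat.toSSet.obj X) _⦋n⦌ → _) := fun s t h =>
  (X.toSSetObjEquiv _).injective (DFunLike.coe_injective h)

/-- The projection from the singular chains to the relative chains. -/
def toRel (P : TopPair.{0}) :
    (TopCat.toSSet.obj P.fst).chainComplex (ModuleCat.of k k) ⟶ (relChains k).obj P :=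
  cokernel.π _

/-- The map of singular chains of the subspace. -/
def subMap (P : TopPair.{0}) : (TopCat.toSSet.obj P.snd).chainComplex (ModuleCat.of k k) ⟶
    (TopCat.toSSet.obj P.fst).chainComplex (ModuleCat.of k k) :=
  SSet.chainComplexMap (TopCat.toSSet.map P.map) _

lemma subMap_toRel (P : TopPair.{0}) : subMap k P ≫ toRel k P = 0 := cokernel.condition _

lemma toRel_naturality {P Q : TopPair.{0}} (f : P ⟶ Q) :
    toRel k P ≫ (relChains k).map f =
      SSet.chainComplexMap (TopCat.toSSet.map (TopPair.Hom.fst f)) _ ≫ toRel k Q := by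
  exact cokernel.π_desc _ _ _

/-- The relative chains are the cokernel in each degree. -/
def toRelIsColimit (P : TopPair.{0}) (n : ℕ) :
    IsColimit (CokernelCofork.ofπ ((toRel k P).f n) (by
      rw [← HomologicalComplex.comp_f, subMap_toRel]; rfl : (subMap k P).f n ≫ _ = 0)) :=
  CokernelCofork.mapIsColimit _ (cokernelIsCokernel (subMap k P)) (HomologicalComplex.eval _ _ n)

instance (P : TopPair.{0}) (n : ℕ) : Epi ((toRel k P).f n) :=
  Cofork.IsColimit.epi (toRelIsColimit k P n)

/-- Relative cochains as morphisms. -/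
def toHom {P : TopPair.{0}} {n : ℕ} (c : ((relCochains k).obj (op P)).X n) :
    ((relChains k).obj P).X n ⟶ ModuleCat.of k k := c

def ofHom' {P : TopPair.{0}} {n : ℕ} (c : ((relChains k).obj P).X n ⟶ ModuleCat.of k k) :
    ((relCochains k).obj (op P)).X n := c

lemma toHom_d {P : TopPair.{0}} {n : ℕ} (c : ((relCochains k).obj (op P)).X n) :
    toHom k ((((relCochains k).obj (op P)).d n (n + 1)).hom c) =
      ((relChains k).obj P).d (n + 1) n ≫ toHom k c := rfl

lemma toHom_map {P Q : TopPair.{0}} (f : P ⟶ Q) {n : ℕ} (c : ((relCochains k).obj (op Q)).X n) :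
    toHom k ((((relCochains k).map f.op).f n).hom c) = ((relChains k).map f).f n ≫ toHom k c := rfl

lemma toHom_ext {P : TopPair.{0}} {n : ℕ} {c d : ((relCochains k).obj (op P)).X n}
    (h : ∀ s : (TopCat.toSSet.obj P.fst) _⦋n⦌,
      SSet.ιChainComplex _ s ≫ (toRel k P).f n ≫ toHom k c =
        SSet.ιChainComplex _ s ≫ (toRel k P).f n ≫ toHom k d) : c = d := by
  have h1 : toHom k c = toHom k d := by
    rw [← cancel_epi ((toRel k P).f n)]
    exact SSet.chainComplex_hom_ext h
  exact h1

open Classical in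
/-- The function on simplices that corresponds to a relative cochain. -/
def cochainFun (P : TopPair.{0}) (n : ℕ) :
    ((relCochains k).obj (op P)).X n →ₗ[k] ((Simplex n → P.fst) → k) where
  toFun c σ := if h : Continuous σ then
    (SSet.ιChainComplex _ (exists_simplexFun h).choose ≫ (toRel k P).f n ≫ toHom k c).hom 1 else 0
  map_add' c d := by
    funext σ
    by_cases h : Continuous σ
    · simp only [dif_pos h, Pi.add_apply]
      rfl
    · simp [dif_neg h]
  map_smul' a c := by
    funext σ
    by_cases h : Continuous σ
    · simp only [dif_pos h, Pi.smul_apply]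
      rfl
    · simp [dif_neg h]

variable {k}

lemma cochainFun_simplexFun {P : TopPair.{0}} {n : ℕ} (c : ((relCochains k).obj (op P)).X n)
    (s : (TopCat.toSSet.obj P.fst) _⦋n⦌) : cochainFun k P n c (simplexFun s) =
      (SSet.ιChainComplex _ s ≫ (toRel k P).f n ≫ toHom k c).hom 1 := by
  have h := continuous_simplexFun s
  refine (dif_pos h).trans ?_
  rw [simplexFun_injective (exists_simplexFun h).choose_spec]

lemma cochainFun_of_not {P : TopPair.{0}} {n : ℕ} (c : ((relCochains k).obj (op P)).X n)
    {σ : Simplex n → P.fst} (h : ¬ Continuous σ) : cochainFun k P n c σ = 0 := by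
  classical
  exact dif_neg h

lemma cochainFun_injective {P : TopPair.{0}} {n : ℕ} :
    Function.Injective (cochainFun k P n) := fun c d h => by
  refine toHom_ext k fun s => ?_
  ext
  have h1 := congrFun h (simplexFun s)
  rwa [cochainFun_simplexFun, cochainFun_simplexFun] at h1

lemma cochainFun_d {P : TopPair.{0}} {n : ℕ} (c : ((relCochains k).obj (op P)).X n)
    {σ : Simplex (n + 1) → P.fst} (h : Continuous σ) :
    cochainFun k P (n + 1) ((((relCochains k).obj (op P)).d n (n + 1)).hom c) σ =
      cobd k n (cochainFun k P n c) σ := by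
  obtain ⟨s, rfl⟩ := exists_simplexFun h
  rw [cochainFun_simplexFun, toHom_d, (toRel k P).comm_assoc, SSet.ιChainComplex_d_assoc,
    Preadditive.sum_comp, cobd_apply]
  rw [ModuleCat.hom_sum, LinearMap.sum_apply]
  refine Finset.sum_congr rfl fun i _ => ?_
  rw [← simplexFun_delta, cochainFun_simplexFun]
  rcases neg_one_pow_eq_or ℤ (i : ℕ) with h | h <;> rw [h] <;> simp

lemma cochainFun_map {P Q : TopPair.{0}} (f : P ⟶ Q) {n : ℕ}
    (c : ((relCochains k).obj (op Q)).X n) {σ : Simplex n → P.fst} (h : Continuous σ) :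
    cochainFun k P n ((((relCochains k).map f.op).f n).hom c) σ =
      cochainFun k Q n c (TopPair.Hom.fst f ∘ σ) := by
  obtain ⟨s, rfl⟩ := exists_simplexFun h
  rw [cochainFun_simplexFun, toHom_map, ← HomologicalComplex.comp_f_assoc, toRel_naturality,
    HomologicalComplex.comp_f_assoc, SSet.ι_chainComplexMap_f_assoc, ← simplexFun_map,
    cochainFun_simplexFun]

lemma cochainFun_sub {P : TopPair.{0}} {n : ℕ} (c : ((relCochains k).obj (op P)).X n)
    {σ : Simplex n → P.snd} (h : Continuous σ) : cochainFun k P n c (P.map ∘ σ) = 0 := by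
  obtain ⟨s, rfl⟩ := exists_simplexFun h
  rw [← simplexFun_map, cochainFun_simplexFun, ← SSet.ι_chainComplexMap_f_assoc]
  have : (SSet.chainComplexMap (TopCat.toSSet.map P.map) (ModuleCat.of k k)).f n ≫
      (toRel k P).f n = 0 := by
    rw [← HomologicalComplex.comp_f]
    exact congrArg (fun g => HomologicalComplex.Hom.f g n) (subMap_toRel k P)
  rw [reassoc_of% this, zero_comp, comp_zero]
  rfl

/-- The singular chains are a coproduct over the simplices, so values on simplices define a
morphism. It descends to relative chains because these are a cokernel in each degree. -/
lemma exists_cochainFun {P : TopPair.{0}} {n : ℕ} (f : (Simplex n → P.fst) → k)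
    (hf : ∀ σ : Simplex n → P.snd, Continuous σ → f (P.map ∘ σ) = 0) :
    ∃ c, ∀ σ, Continuous σ → cochainFun k P n c σ = f σ := by
  let g : ((TopCat.toSSet.obj P.fst).chainComplex (ModuleCat.of k k)).X n ⟶ ModuleCat.of k k :=
    Sigma.desc fun s => ModuleCat.ofHom (LinearMap.toSpanSingleton k k (f (simplexFun s)))
  have hg : ∀ s, SSet.ιChainComplex _ s ≫ g =
      ModuleCat.ofHom (LinearMap.toSpanSingleton k k (f (simplexFun s))) := fun s =>
    Sigma.ι_desc _ _
  have h0 : (subMap k P).f n ≫ g = 0 := by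
    refine SSet.chainComplex_hom_ext fun s => ?_
    rw [subMap, SSet.ι_chainComplexMap_f_assoc, hg, simplexFun_map, hf _ (continuous_simplexFun s)]
    ext
    simp
  obtain ⟨c, hc⟩ := CokernelCofork.IsColimit.desc' (toRelIsColimit k P n) g h0
  refine ⟨ofHom' k c, fun σ hσ => ?_⟩
  obtain ⟨s, rfl⟩ := exists_simplexFun hσ
  rw [cochainFun_simplexFun]
  change (SSet.ιChainComplex _ s ≫ (toRel k P).f n ≫ c).hom 1 = _
  have hc' : (toRel k P).f n ≫ c = g := hc
  rw [hc', hg]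
  simp

section Subset

variable {X : Type} [TopologicalSpace X] (A : Set X)

/-- The pair `(X, A)`. -/
abbrev subPair : TopPair.{0} := TopPair.ofSubset (X := TopCat.of X) A

variable {A}

lemma cochainFun_in {n : ℕ} (c : ((relCochains k).obj (op (subPair A))).X n)
    {σ : Simplex n → X} (h : In A σ) : cochainFun k (subPair A) n c σ = 0 :=
  cochainFun_sub (P := subPair A) c (σ := fun t => (⟨σ t, h.2 t⟩ : A)) (h.1.subtype_mk _)

lemma exists_cochainFun_subset {n : ℕ} (f : (Simplex n → X) → k)
    (hf : ∀ σ, In A σ → f σ = 0) :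
    ∃ c, ∀ σ, Continuous σ → cochainFun k (subPair A) n c σ = f σ :=
  exists_cochainFun (P := subPair A) f fun σ hσ =>
    hf _ ⟨continuous_subtype_val.comp hσ, fun t => (σ t).2⟩

variable (A) in
lemma cochainFun_cobd {n : ℕ} (c : ((relCochains k).obj (op (subPair A))).X n)
    {σ : Simplex (n + 1) → X} (h : Continuous σ) :
    cochainFun k (subPair A) (n + 1) ((((relCochains k).obj (op (subPair A))).d n (n + 1)).hom c) σ =
      cobd k n (X := X) (cochainFun k (subPair A) n c) σ := cochainFun_d c h

lemma iCycles_d_apply {K : CochainComplex (ModuleCat.{0} k) ℕ} {n : ℕ} (z : K.cycles n) (m : ℕ) :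
    (K.d n m).hom ((K.iCycles n).hom z) = 0 :=
  congrArg (fun g => g.hom z) (K.iCycles_d n m)

lemma iCycles_injective {K : CochainComplex (ModuleCat.{0} k) ℕ} {n : ℕ} :
    Function.Injective (K.iCycles n).hom := (ModuleCat.mono_iff_injective _).1 inferInstance

lemma exists_iCycles {K : CochainComplex (ModuleCat.{0} k) ℕ} {n : ℕ} {x : K.X n}
    (hx : (K.d n (n + 1)).hom x = 0) : ∃ z, (K.iCycles n).hom z = x := by
  refine ⟨(K.liftCycles (ModuleCat.ofHom (LinearMap.toSpanSingleton k _ x)) (n + 1) (by simp) (by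
    ext
    simpa using hx)).hom 1, ?_⟩
  change ((_ ≫ K.iCycles n).hom) 1 = x
  rw [HomologicalComplex.liftCycles_i]
  simp

lemma homologyπ_surjective (K : CochainComplex (ModuleCat.{0} k) ℕ) (n : ℕ) :
    Function.Surjective (K.homologyπ n).hom := (ModuleCat.epi_iff_surjective _).1 inferInstance

lemma homologyπ_zero_eq_zero {K : CochainComplex (ModuleCat.{0} k) ℕ} {z : K.cycles 0} :
    (K.homologyπ 0).hom z = 0 ↔ (K.iCycles 0).hom z = 0 := by
  have := K.isIso_homologyπ 0 0 (by simp) (by simp)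
  have h : Function.Injective (K.homologyπ 0).hom :=
    (ModuleCat.mono_iff_injective _).1 inferInstance
  rw [map_eq_zero_iff _ h, map_eq_zero_iff _ iCycles_injective]

lemma homologyπ_succ_eq_zero {K : CochainComplex (ModuleCat.{0} k) ℕ} {n : ℕ}
    {z : K.cycles (n + 1)} :
    (K.homologyπ (n + 1)).hom z = 0 ↔ ∃ w, (K.d n (n + 1)).hom w = (K.iCycles (n + 1)).hom z := by
  have h1 := (ShortComplex.exact_of_g_is_cokernel (ShortComplex.mk _ _
    (K.toCycles_comp_homologyπ n (n + 1))) (K.homologyIsCokernel n (n + 1) (by simp)))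
  have h2 := (ShortComplex.moduleCat_exact_iff _).1 h1 z
  constructor
  · intro h
    obtain ⟨w, hw⟩ := h2 h
    refine ⟨w, ?_⟩
    rw [← hw]
    exact (congrArg (fun g => g.hom w) (K.toCycles_i n (n + 1))).symm
  · rintro ⟨w, hw⟩
    have h3 : (K.toCycles n (n + 1)).hom w = z := by
      refine iCycles_injective ?_
      rw [← hw]
      exact congrArg (fun g => g.hom w) (K.toCycles_i n (n + 1))
    rw [← h3]
    exact congrArg (fun g => g.hom w) (K.toCycles_comp_homologyπ n (n + 1))

variable (k A)

/-- The class in `Coh` defined by a cycle. -/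
def cyclesToCoh (n : ℕ) : ((relCochains k).obj (op (subPair A))).cycles n →ₗ[k]
    Coh k n (Set.univ : Set X) A where
  toFun z := Coh.mk ⟨cochainFun k (subPair A) n
    ((((relCochains k).obj (op (subPair A))).iCycles n).hom z), fun σ hσ => cochainFun_in _ hσ,
    fun σ hσ => by
      rw [← cochainFun_cobd A _ hσ.1, iCycles_d_apply, map_zero]
      rfl⟩
  map_add' z w := by
    refine Eq.trans (congrArg Coh.mk (Subtype.ext ?_)) (Submodule.Quotient.mk_add _).symm
    simp only [map_add]
    rfl
  map_smul' a z := by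
    refine Eq.trans (congrArg Coh.mk (Subtype.ext ?_)) (Submodule.Quotient.mk_smul _ _ _).symm
    simp only [map_smul]
    rfl

lemma cyclesToCoh_surjective (n : ℕ) : Function.Surjective (cyclesToCoh k A n) := by
  intro y
  obtain ⟨f, rfl⟩ := Coh.mk_surjective y
  obtain ⟨c, hc⟩ := exists_cochainFun_subset f.1 f.2.1
  have hd : (((relCochains k).obj (op (subPair A))).d n (n + 1)).hom c = 0 := by
    refine cochainFun_injective ?_
    funext σ
    rw [map_zero]
    by_cases hσ : Continuous σ
    · have h1 := cochainFun_cobd A c hσ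
      rw [h1, cobd_congr (U := Set.univ) (g := f.1) (fun τ hτ => hc τ hτ.1) ⟨hσ, fun _ => trivial⟩,
        f.2.2 σ ⟨hσ, fun _ => trivial⟩]
      rfl
    · exact cochainFun_of_not _ hσ
  obtain ⟨z, hz⟩ := exists_iCycles hd
  refine ⟨z, Coh.mk_eq_mk.2 (IsCob.zero fun σ hσ => sub_eq_zero.2 ?_)⟩
  dsimp only
  rw [hz, hc σ hσ.1]

/-- Cycles map onto homology and onto `Coh`, and both kernels consist of the coboundaries. The
comparison isomorphism rests on this equality. -/
lemma ker_cyclesToCoh (n : ℕ) : LinearMap.ker (cyclesToCoh k A n) =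
    LinearMap.ker (((relCochains k).obj (op (subPair A))).homologyπ n).hom := by
  ext z
  rw [LinearMap.mem_ker, LinearMap.mem_ker]
  refine Coh.mk_eq_zero.trans ?_
  cases n with
  | zero =>
    rw [homologyπ_zero_eq_zero]
    refine ⟨fun h => cochainFun_injective (funext fun σ => ?_), fun h σ _ => ?_⟩
    · rw [map_zero]
      by_cases hσ : Continuous σ
      · exact h σ ⟨hσ, fun _ => trivial⟩
      · exact cochainFun_of_not _ hσ
    · dsimp only
      rw [h, map_zero]
      rfl
  | succ n =>
    rw [homologyπ_succ_eq_zero]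
    constructor
    · rintro ⟨g, hg, hg'⟩
      obtain ⟨c, hc⟩ := exists_cochainFun_subset g hg
      refine ⟨c, cochainFun_injective (funext fun σ => ?_)⟩
      by_cases hσ : Continuous σ
      · have h1 := cochainFun_cobd A c hσ
        rw [h1, cobd_congr (U := Set.univ) (g := g) (fun τ hτ => hc τ hτ.1)
          ⟨hσ, fun _ => trivial⟩]
        exact (hg' σ ⟨hσ, fun _ => trivial⟩).symm
      · rw [cochainFun_of_not _ hσ, cochainFun_of_not _ hσ]
    · rintro ⟨w, hw⟩
      refine ⟨cochainFun k (subPair A) n w, fun σ hσ => cochainFun_in _ hσ, fun σ hσ => ?_⟩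
      dsimp only
      rw [← hw]
      exact cochainFun_cobd A w hσ.1

/-- The comparison isomorphism. -/
def cohEquiv (n : ℕ) : (cohomology k n).obj (op (subPair A)) ≃ₗ[k]
    Coh k n (Set.univ : Set X) A :=
  equivOfKer (homologyπ_surjective _ n) (cyclesToCoh_surjective k A n) (ker_cyclesToCoh k A n).symm

lemma cohEquiv_homologyπ (n : ℕ) (z : ((relCochains k).obj (op (subPair A))).cycles n) :
    cohEquiv k A n ((((relCochains k).obj (op (subPair A))).homologyπ n).hom z) =
      cyclesToCoh k A n z := equivOfKer_apply _ _ _ z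

variable {A}

lemma cohEquiv_map {Y : Type} [TopologicalSpace Y] {B : Set Y} (f : subPair A ⟶ subPair B)
    (h : PairMap (X := X) (Y := Y) (TopPair.Hom.fst f) Set.univ A Set.univ B) (n : ℕ)
    (y : (cohomology k n).obj (op (subPair B))) :
    cohEquiv k A n (((cohomology k n).map f.op).hom y) = h.pull k n (cohEquiv k B n y) := by
  obtain ⟨z, rfl⟩ := homologyπ_surjective _ n y
  have h1 : ((cohomology k n).map f.op).hom
      ((((relCochains k).obj (op (subPair B))).homologyπ n).hom z) =
      (((relCochains k).obj (op (subPair A))).homologyπ n).hom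
        ((HomologicalComplex.cyclesMap ((relCochains k).map f.op) n).hom z) :=
    congrArg (fun g => g.hom z) (HomologicalComplex.homologyπ_naturality
      ((relCochains k).map f.op) n)
  erw [h1]
  rw [cohEquiv_homologyπ, cohEquiv_homologyπ]
  refine Coh.mk_eq_mk.2 (IsCob.zero fun σ hσ => sub_eq_zero.2 ?_)
  have h2 : (((relCochains k).obj (op (subPair A))).iCycles n).hom
      ((HomologicalComplex.cyclesMap ((relCochains k).map f.op) n).hom z) =
      (((relCochains k).map f.op).f n).hom
        ((((relCochains k).obj (op (subPair B))).iCycles n).hom z) :=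
    congrArg (fun g => g.hom z) (HomologicalComplex.cyclesMap_i ((relCochains k).map f.op) n)
  dsimp only
  rw [h2]
  exact cochainFun_map f _ hσ.1

end Subset

end Bridge


/-! ### Consequences of homotopy invariance and excision -/

section Tools

variable {X Y : Type} [TopologicalSpace X] [TopologicalSpace Y] {k : Type} [CommRing k]

/-- `φ` and `ψ` are homotopic as maps of pairs. -/
def PairHomotopic (φ ψ : X → Y) (U A : Set X) (V B : Set Y) : Prop :=
  ∃ h : X × unitInterval → Y, ContinuousOn h (U ×ˢ Set.univ) ∧
    Set.MapsTo h (U ×ˢ Set.univ) V ∧ Set.MapsTo h (A ×ˢ Set.univ) B ∧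
    (∀ x ∈ U, h (x, 0) = φ x) ∧ ∀ x ∈ U, h (x, 1) = ψ x

lemma PairHomotopic.of_eqOn {φ ψ : X → Y} {U A : Set X} {V B : Set Y} (hφ : PairMap φ U A V B)
    (h : Set.EqOn φ ψ U) : PairHomotopic φ ψ U A V B :=
  ⟨fun p => φ p.1, hφ.cont.comp continuousOn_fst fun _ hp => hp.1, fun _ hp => hφ.maps hp.1,
    fun _ hp => hφ.maps' hp.1, fun _ _ => rfl, fun _ hx => h hx⟩

lemma PairHomotopic.pull_eq {φ ψ : X → Y} {U A : Set X} {V B : Set Y}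
    (h : PairHomotopic φ ψ U A V B) (hφ : PairMap φ U A V B) (hψ : PairMap ψ U A V B) (n : ℕ)
    (y : Coh k n V B) : hφ.pull k n y = hψ.pull k n y := by
  obtain ⟨h, h1, h2, h3, h4, h5⟩ := h
  exact pull_eq_of_homotopy hφ hψ h h1 h2 h3 h4 h5 n y

lemma PairMap.Iso.of_homotopy_inverse {φ : X → Y} {ψ : Y → X} {U A : Set X} {V B : Set Y}
    (hφ : PairMap φ U A V B) (hψ : PairMap ψ V B U A)
    (h1 : PairHomotopic (ψ ∘ φ) _root_.id U A U A)
    (h2 : PairHomotopic (φ ∘ ψ) _root_.id V B V B) (n : ℕ) :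
    hφ.Iso n := by
  intro k _
  have e1 : ∀ y : Coh k n U A, hφ.pull k n (hψ.pull k n y) = y := fun y => by
    rw [← PairMap.pull_comp, h1.pull_eq _ (PairMap.id hφ.sub subset_rfl subset_rfl),
      PairMap.pull_id]
  have e2 : ∀ y : Coh k n V B, hψ.pull k n (hφ.pull k n y) = y := fun y => by
    rw [← PairMap.pull_comp, h2.pull_eq _ (PairMap.id hψ.sub subset_rfl subset_rfl),
      PairMap.pull_id]
  exact ⟨Function.LeftInverse.injective e2, Function.RightInverse.surjective e1⟩

lemma PairMap.Iso.of_inverse {φ : X → Y} {ψ : Y → X} {U A : Set X} {V B : Set Y}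
    (hφ : PairMap φ U A V B) (hψ : PairMap ψ V B U A) (h1 : ∀ x ∈ U, ψ (φ x) = x)
    (h2 : ∀ y ∈ V, φ (ψ y) = y) (n : ℕ) : hφ.Iso n :=
  PairMap.Iso.of_homotopy_inverse hφ hψ (PairHomotopic.of_eqOn (hψ.comp hφ) h1)
    (PairHomotopic.of_eqOn (hφ.comp hψ) h2) n

lemma van_self (n : ℕ) (U : Set X) : Van n U U := fun _ _ _ hf => IsCob.zero hf.1

lemma Van.zero {U G K : Set X} (hK : K ⊆ G) (h : Van 0 U K) : Van 0 U G :=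
  fun k _ f hf => h k f ⟨fun σ hσ => hf.1 σ (hσ.mono hK), hf.2⟩

/-- A pair `(W, A)` has no cohomology if `W` can be deformed into `A` within the pair. -/
lemma van_of_deformation {W A : Set X} (hA : A ⊆ W) (h : X × unitInterval → X)
    (hc : ContinuousOn h (W ×ˢ Set.univ)) (h0 : ∀ x ∈ W, h (x, 0) = x)
    (hW : ∀ x ∈ W, ∀ s, h (x, s) ∈ W) (hA' : ∀ x ∈ A, ∀ s, h (x, s) ∈ A)
    (h1 : ∀ x ∈ W, h (x, 1) ∈ A) (n : ℕ) : Van n W A := by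
  refine Van.of_eq_zero fun k _ y => ?_
  have p1 : PairMap (fun x => h (x, 1)) W A W A :=
    ⟨hc.comp (continuousOn_id.prodMk continuousOn_const) fun x hx => ⟨hx, trivial⟩, hA,
      fun x hx => hW x hx 1, fun x hx => hA' x hx 1⟩
  have p2 : PairMap (fun x => h (x, 1)) W A A A :=
    ⟨p1.cont, hA, fun x hx => h1 x hx, fun x hx => hA' x hx 1⟩
  have p0 := PairMap.id hA (subset_refl W) (subset_refl A)
  have e : p0.pull k n y = p1.pull k n y :=
    pull_eq_of_homotopy p0 p1 h hc (fun p hp => hW _ hp.1 _) (fun p hp => hA' _ hp.1 _) h0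
      (fun _ _ => rfl) n y
  rw [PairMap.pull_id] at e
  -- The end of the deformation factors through the pair `(A, A)`, which has no cohomology.
  have p3 := PairMap.id (subset_refl A) hA (subset_refl A)
  have e2 := PairMap.pull_comp p3 p2 n y
  rw [e]
  refine e2.trans ?_
  rw [(van_self n A).eq_zero (p3.pull k n y), map_zero]

lemma excision_iso {U A V B : Set X} (hU : IsOpen U) (hB : IsOpen B) (hV : U ∪ B = V)
    (hA : U ∩ B = A) (n : ℕ) (h : PairMap id U A V B) : h.Iso n := by
  subst hV hA
  exact excision hU hB n

/-- The pair `(U, A)` has the cohomology of the pair `(ℝ^d, ℝ^d ∖ 0)`. -/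
def SphereLike (d : ℕ) (U A : Set X) : Prop :=
  (∀ m, m ≠ d → Van m U A) ∧ ∃ u : Coh ℤ d U A, IsGen u

lemma SphereLike.of_iso {φ : X → Y} {U A : Set X} {V B : Set Y} {d : ℕ} {h : PairMap φ U A V B}
    (hi : ∀ n, h.Iso n) (hs : SphereLike d U A) : SphereLike d V B := by
  refine ⟨fun m hm => (hi m).van (hs.1 m hm), ?_⟩
  obtain ⟨u, hu⟩ := hs.2
  obtain ⟨w, rfl⟩ := (hi d ℤ).2 u
  exact ⟨w, IsGen.of_pull (hi d) hu⟩

lemma SphereLike.of_iso' {φ : X → Y} {U A : Set X} {V B : Set Y} {d : ℕ} {h : PairMap φ U A V B}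
    (hi : ∀ n, h.Iso n) (hs : SphereLike d V B) : SphereLike d U A := by
  refine ⟨fun m hm => (hi m).van' (hs.1 m hm), ?_⟩
  obtain ⟨u, hu⟩ := hs.2
  exact ⟨_, IsGen.pull (hi d) hu⟩

/-- Extension by zero does not commute with pullback, as a simplex outside of `G` may be mapped into
`H`. The two extensions agree on `G`, so their difference is an admissible primitive relative to
`G`. -/
lemma conn_pull {φ : X → Y} {U G K : Set X} {V H L : Set Y} (hG : G ⊆ U) (hK : K ⊆ G)
    (hH : H ⊆ V) (hL : L ⊆ H) (h1 : PairMap φ U G V H) (h2 : PairMap φ G K H L) (n : ℕ)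
    (y : Coh k n H L) :
    conn k n hG hK (h2.pull k n y) = h1.pull k (n + 1) (conn k n hH hL y) := by
  obtain ⟨f, rfl⟩ := Coh.mk_surjective y
  obtain ⟨_, e1⟩ := conn_mk hG hK (h2.zpull k n f)
  obtain ⟨_, e2⟩ := conn_mk hH hL f
  rw [PairMap.pull_mk, e1, e2, PairMap.pull_mk, Coh.mk_eq_mk]
  refine ⟨extz k n G (cpull k n φ f.1) - cpull k n φ (extz k n H f.1), fun σ hσ => ?_,
    fun σ _ => ?_⟩
  · rw [Pi.sub_apply, extz_of_in _ hσ, cpull_apply, cpull_apply, extz_of_in _ (h2.in_left hσ),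
      sub_self]
  · rw [map_sub]
    rfl

/-- Vanishing of cohomology is inherited by increasing unions of open sets. -/
lemma van_iUnion {U : ℕ → Set X} {A : Set X} (hU : ∀ j, IsOpen (U j)) (hmono : Monotone U)
    (hA : A ⊆ U 0) {m : ℕ} (h : ∀ j, Van m (U j) A) (h' : ∀ j l, l + 1 = m → Van l (U j) A) :
    Van m (⋃ j, U j) A := by
  intro k _ f hf
  -- A simplex has compact image, so it lies in a single member of the increasing open cover.
  have hex : ∀ {n : ℕ} (σ : Simplex n → X), In (⋃ j, U j) σ → ∃ j, In (U j) σ := fun σ hσ => by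
    obtain ⟨j, hj⟩ := (isCompact_range hσ.1).elim_directed_cover U hU
      (Set.range_subset_iff.2 hσ.2) (hmono.directed_le)
    exact ⟨j, hσ.1, fun t => hj (Set.mem_range_self t)⟩
  have hfj : ∀ j, f ∈ cocyc k m (U j) A := fun j =>
    ⟨hf.1, fun σ hσ => hf.2 σ (hσ.mono (Set.subset_iUnion U j))⟩
  cases m with
  | zero =>
    intro σ hσ
    obtain ⟨j, hj⟩ := hex σ hσ
    exact h j k f (hfj j) σ hj
  | succ m =>
    let P : ℕ → ((Simplex m → X) → k) → Prop := fun j g =>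
      (∀ σ, In A σ → g σ = 0) ∧ ∀ σ, In (U j) σ → f σ = cobd k m g σ
    -- Any primitive on the next set differs on the present one by a cocycle of one degree less. By
    -- `h'` this is a coboundary, and correcting by an extension of its primitive gives a primitive
    -- that really extends the given one. The vanishing one degree lower thus plays the part of the
    -- vanishing of `lim¹`.
    have step : ∀ j (g : {g // P j g}), ∃ g' : {g' // P (j + 1) g'},
        ∀ σ, In (U j) σ → g'.1 σ = g.1 σ := by
      rintro j ⟨g, hg, hg'⟩
      obtain ⟨b, hb, hb'⟩ := h (j + 1) k f (hfj _)
      have hUj : U j ⊆ U (j + 1) := hmono (Nat.le_succ j)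
      have hAj : ∀ i, A ⊆ U i := fun i => hA.trans (hmono (Nat.zero_le i))
      have hc := h' j m rfl k (g - b) ⟨fun σ hσ => by simp [hg σ hσ, hb σ hσ], fun σ hσ => by
        rw [map_sub, Pi.sub_apply, ← hg' σ hσ, ← hb' σ (hσ.mono hUj), sub_self]⟩
      cases m with
      | zero =>
        exact ⟨⟨b, hb, hb'⟩, fun σ hσ => (sub_eq_zero.1 (hc σ hσ)).symm⟩
      | succ m =>
        obtain ⟨a, ha, ha'⟩ := hc
        have ha2 : ∀ σ, In A σ → extz k m (U j) a σ = 0 := fun σ hσ => by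
          rw [extz_of_in _ (hσ.mono (hAj j)), ha σ hσ]
        refine ⟨⟨b + cobd k m (extz k m (U j) a), fun σ hσ => ?_, fun σ hσ => ?_⟩,
          fun σ hσ => ?_⟩
        · rw [Pi.add_apply, hb σ hσ, cobd_eq_zero ha2 hσ, add_zero]
        · rw [map_add, cobd_cobd, add_zero, ← hb' σ hσ]
        · change (b + cobd k m (extz k m (U j) a)) σ = g σ
          rw [Pi.add_apply, cobd_extz _ hσ, ← ha' σ hσ]
          simp
    choose F hF using step
    let g : (j : ℕ) → {g // P j g} := fun j => Nat.rec
      ⟨_, (h 0 k f (hfj 0)).choose_spec⟩ (fun j g => F j g) j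
    have hg : ∀ i j, i ≤ j → ∀ σ, In (U i) σ → (g j).1 σ = (g i).1 σ := by
      intro i j hij
      induction j, hij using Nat.le_induction with
      | base => exact fun _ _ => rfl
      | succ j hij ih => exact fun σ hσ => (hF j (g j) σ (hσ.mono (hmono hij))).trans (ih σ hσ)
    have hg' : ∀ i j σ, In (U i) σ → In (U j) σ → (g i).1 σ = (g j).1 σ := fun i j σ hi hj => by
      rcases le_total i j with hij | hij
      · exact (hg i j hij σ hi).symm
      · exact hg j i hij σ hj
    classical
    let G : (Simplex m → X) → k := fun σ =>
      if hσ : In (⋃ j, U j) σ then (g (hex σ hσ).choose).1 σ else 0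
    have hG : ∀ j σ, In (U j) σ → G σ = (g j).1 σ := fun j σ hσ => by
      have h2 := hσ.mono (Set.subset_iUnion U j)
      exact (dif_pos h2).trans (hg' _ _ _ (hex σ h2).choose_spec hσ)
    refine ⟨G, fun σ hσ => ?_, fun σ hσ => ?_⟩
    · rw [hG 0 σ (hσ.mono hA)]
      exact (g 0).2.1 σ hσ
    · obtain ⟨j, hj⟩ := hex σ hσ
      rw [cobd_congr (hG j) hj]
      exact (g j).2.2 σ hj

/-- A map that is concentrated on two disjoint pieces is the sum of the pieces. -/
lemma pull_eq_add {y₀ : Y} {φ φ₁ φ₂ : X → Y} {O₁ O₂ : Set X} (h1 : IsOpen O₁) (h2 : IsOpen O₂)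
    (hO : O₁ ∪ O₂ = Set.univ) (e1 : ∀ x ∈ O₁, φ x = φ₁ x) (c1 : ∀ x ∈ O₁, φ₂ x = y₀)
    (e2 : ∀ x ∈ O₂, φ x = φ₂ x) (c2 : ∀ x ∈ O₂, φ₁ x = y₀)
    (hφ : PairMap φ Set.univ ∅ Set.univ {y₀}) (hφ₁ : PairMap φ₁ Set.univ ∅ Set.univ {y₀})
    (hφ₂ : PairMap φ₂ Set.univ ∅ Set.univ {y₀}) (n : ℕ) (y : Coh k n Set.univ {y₀}) :
    hφ.pull k n y = hφ₁.pull k n y + hφ₂.pull k n y := by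
  obtain ⟨f, rfl⟩ := Coh.mk_surjective y
  simp only [PairMap.pull_mk]
  refine Eq.trans (Coh.mk_eq_mk.2 ?_) (Submodule.Quotient.mk_add _)
  have hin : ∀ {n : ℕ} {σ : Simplex n → X}, In Set.univ σ → In (O₁ ∪ O₂) σ := fun h => hO ▸ h
  have hc : ∀ {n : ℕ} (c : (Simplex n → Y) → k), (∀ σ, In {y₀} σ → c σ = 0) →
      ∀ {O : Set X} {a b d : X → Y}, (∀ x ∈ O, a x = b x) → (∀ x ∈ O, d x = y₀) →
      ∀ σ, In O σ → c (a ∘ σ) = c (b ∘ σ) ∧ c (d ∘ σ) = 0 := by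
    intro n c hc O a b d hab hd σ hσ
    refine ⟨congrArg c (funext fun t => hab _ (hσ.2 t)), hc _ ?_⟩
    have : d ∘ σ = fun _ => y₀ := funext fun t => hd _ (hσ.2 t)
    rw [this]
    exact ⟨continuous_const, fun _ => rfl⟩
  -- On each of the two open sets one of the summands is evaluated on constant simplices at `y₀`,
  -- where `f` vanishes, and the other one equals the total. The defect therefore vanishes on small
  -- simplices and is a coboundary.
  set F : (Simplex n → X) → k := fun σ => f.1 (φ ∘ σ) - (f.1 (φ₁ ∘ σ) + f.1 (φ₂ ∘ σ)) with hF
  change IsCob Set.univ ∅ F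
  have hF1 : ∀ σ, In O₁ σ → F σ = 0 := fun σ hσ => by
    obtain ⟨a1, a2⟩ := hc f.1 f.2.1 e1 c1 σ hσ
    simp only [hF, a1, a2, add_zero, sub_self]
  have hF2 : ∀ σ, In O₂ σ → F σ = 0 := fun σ hσ => by
    obtain ⟨a1, a2⟩ := hc f.1 f.2.1 e2 c2 σ hσ
    simp only [hF, a1, a2, zero_add, sub_self]
  cases n with
  | zero =>
    intro σ hσ
    have h1 : ∀ t, stdSimplex.vertex (S := ℝ) (0 : Fin 1) = t := fun t => Subsingleton.elim _ _
    rcases (hin hσ).2 (stdSimplex.vertex 0) with h | h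
    · exact hF1 σ ⟨hσ.1, fun t => h1 t ▸ h⟩
    · exact hF2 σ ⟨hσ.1, fun t => h1 t ▸ h⟩
  | succ n =>
    obtain ⟨g, -, -, hg⟩ := exists_cobd_eq_of_small h1 h2 hF1 hF2 (fun σ hσ => by
      have hz : ∀ {a : X → Y}, PairMap a Set.univ ∅ Set.univ {y₀} →
          cobd k (n + 1) (cpull k (n + 1) a f.1) σ = 0 := fun ha =>
        f.2.2 _ (ha.in_left (hσ.mono (Set.subset_univ _)))
      have : F = cpull k (n + 1) φ f.1 - (cpull k (n + 1) φ₁ f.1 + cpull k (n + 1) φ₂ f.1) := rfl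
      rw [this, map_sub, map_add, Pi.sub_apply, Pi.add_apply, hz hφ, hz hφ₁, hz hφ₂]
      simp)
    exact ⟨g, fun σ hσ => absurd (hσ.2 (stdSimplex.vertex 0)) (Set.notMem_empty _), fun σ hσ => hg σ (hin hσ)⟩

end Tools

/-! ### Euclidean spaces -/

section Euclidean

lemma sum_neg_one_pow (n : ℕ) : ∑ i : Fin n, (-1 : ℤ) ^ (i : ℕ) = if Even n then 0 else 1 := by
  rw [Fin.sum_univ_eq_sum_range (fun i => (-1 : ℤ) ^ i), neg_one_geom_sum]

lemma cobd_subsingleton {X : Type} [Subsingleton X] {k : Type} [CommRing k] {n : ℕ}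
    (f : (Simplex n → X) → k) (σ : Simplex (n + 1) → X) (τ : Simplex n → X) :
    cobd k n f σ = (if Even n then 0 else 1 : ℤ) • f τ := by
  have h : ∀ i, f (σ ∘ face i) = f τ := fun i => congrArg f (Subsingleton.elim _ _)
  simp only [cobd_apply, h]
  rw [← Finset.sum_smul, sum_neg_one_pow]
  simp [Nat.even_add_one]

/-- There is one simplex in each degree, and the coboundary is alternately zero and the identity,
starting with zero. -/
lemma sphereLike_point {X : Type} [TopologicalSpace X] [Subsingleton X] [Nonempty X] :
    SphereLike 0 (Set.univ : Set X) ∅ := by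
  obtain ⟨x⟩ := ‹Nonempty X›
  have hin : ∀ {n : ℕ} (σ : Simplex n → X), In Set.univ σ := fun σ =>
    ⟨continuous_of_const fun _ _ => Subsingleton.elim _ _, fun _ => trivial⟩
  have hno : ∀ {n : ℕ} (σ : Simplex n → X), ¬ In ∅ σ := fun σ h => h.2 (stdSimplex.vertex 0)
  refine ⟨fun m hm k _ f hf => ?_, ?_⟩
  · obtain ⟨m, rfl⟩ := Nat.exists_eq_add_one_of_ne_zero hm
    refine ⟨fun _ => f fun _ => x, fun σ hσ => absurd hσ (hno σ), fun σ _ => ?_⟩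
    have h1 := hf.2 _ (hin fun _ => x)
    rw [cobd_subsingleton f _ fun _ => x] at h1
    rw [cobd_subsingleton _ _ fun _ => x, show f σ = f fun _ => x from
      congrArg f (Subsingleton.elim _ _)]
    by_cases hm : Even m
    · simpa [Nat.even_add_one, hm] using h1
    · simp [hm]
  · refine ⟨Coh.mk ⟨fun _ => 1, fun σ hσ => absurd hσ (hno σ), fun σ _ => ?_⟩, fun k _ y => ?_⟩
    · rw [cobd_subsingleton _ _ fun _ => x]
      simp
    · obtain ⟨f, rfl⟩ := Coh.mk_surjective y
      obtain ⟨h, e⟩ := coeff_mk (k := k) (⟨fun _ => 1, fun σ hσ => absurd hσ (hno σ), fun σ _ => by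
        rw [cobd_subsingleton _ _ fun _ => x]; simp⟩ : cocyc ℤ 0 (Set.univ : Set X) ∅)
      rw [e]
      have h2 : ∀ c : k, Coh.mk f = c • (Coh.mk ⟨fun _ => ((1 : ℤ) : k), h⟩ :
          Coh k 0 (Set.univ : Set X) ∅) ↔ f.1 (fun _ => x) = c := fun c => by
        rw [show c • (Coh.mk ⟨fun _ => ((1 : ℤ) : k), h⟩ : Coh k 0 (Set.univ : Set X) ∅) =
          Coh.mk (c • ⟨fun _ => ((1 : ℤ) : k), h⟩) from rfl, Coh.mk_eq_mk]
        constructor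
        · intro h3
          have := h3 (fun _ => x) (hin _)
          simpa [sub_eq_zero] using this
        · intro h3 σ _
          rw [show σ = fun _ => x from Subsingleton.elim _ _]
          simp [h3]
      simp only [h2]
      exact ⟨_, rfl, fun _ h => h.symm⟩

variable {E : Type} [NormedAddCommGroup E] [NormedSpace ℝ E]

/-- Star-shaped sets have the cohomology of a point. -/
lemma van_of_starConvex {W : Set E} {p : E} (hp : p ∈ W) (hW : StarConvex ℝ p W) (n : ℕ) :
    Van n W {p} := by
  refine van_of_deformation (Set.singleton_subset_iff.2 hp)
    (fun q => (q.2 : ℝ) • p + (1 - (q.2 : ℝ)) • q.1) ?_ ?_ ?_ ?_ ?_ n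
  · fun_prop
  · intro x _
    simp
  · intro x hx s
    exact hW hx s.2.1 (sub_nonneg.2 s.2.2) (by ring)
  · rintro x rfl s
    rw [← add_smul]
    simp
  · intro x _
    simp

lemma van_of_starConvex₂ {W U : Set E} {p : E} (hp : p ∈ U) (hUW : U ⊆ W) (hW : StarConvex ℝ p W)
    (hU : StarConvex ℝ p U) (n : ℕ) : Van n W U := by
  have h1 : ∀ m, Van m W {p} := van_of_starConvex (hUW hp) hW
  have hpU : {p} ⊆ U := Set.singleton_subset_iff.2 hp
  refine Van.of_eq_zero fun k _ y => (rel_iso hUW hpU (van_of_starConvex hp hU) k).1 ?_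
  rw [map_zero]
  exact (h1 n).eq_zero _

/-- The half of the punctured product `E × ℝ` that is star-shaped about `(0, s)`. -/
def half (E : Type) [NormedAddCommGroup E] (s : ℝ) : Set (E × ℝ) := {q | q.1 ≠ 0 ∨ 0 < s * q.2}

lemma isOpen_half (s : ℝ) : IsOpen (half E s) :=
  (isOpen_ne_fun continuous_fst continuous_const).union
    (isOpen_lt continuous_const (continuous_const.mul continuous_snd))

lemma starConvex_half {s : ℝ} (hs : s ≠ 0) : StarConvex ℝ ((0, s) : E × ℝ) (half E s) := by
  rintro ⟨e, t⟩ h a b ha hb hab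
  rcases hb.eq_or_lt with rfl | hb
  · right
    obtain rfl : a = 1 := by linarith
    simpa using mul_self_pos.2 hs
  · rcases h with h | h
    · left
      simpa [hb.ne'] using h
    · right
      simp only [smul_eq_mul, Prod.smul_mk, Prod.mk_add_mk] at h ⊢
      have : 0 < s * s := mul_self_pos.2 hs
      have h2 : 0 < b * (s * t) := mul_pos hb h
      nlinarith [mul_nonneg ha this.le]

lemma starConvex_univ' (p : E) : StarConvex ℝ p Set.univ := fun _ _ _ _ _ _ _ => trivial

/-- The punctured space is the union of two open star-shaped halves that meet in `Z = (E ∖ 0) × ℝ`.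
The groups of `(E, E ∖ 0)`, `(E × ℝ, Z)`, `(upper half, Z)` and `(punctured space, lower half)`
agree by projection, contractibility and excision, and the connecting homomorphism to `(E × ℝ,
punctured space)` raises the degree by one. -/
lemma sphereLike_prod {d : ℕ} (h : SphereLike d (Set.univ : Set E) {0}ᶜ) :
    SphereLike (d + 1) (Set.univ : Set (E × ℝ)) {0}ᶜ := by
  have hm : ((0, -1) : E × ℝ) ∈ half E (-1) := Or.inr (by norm_num)
  have hp : ((0, 1) : E × ℝ) ∈ half E 1 := Or.inr (by norm_num)
  have hsub : half E (-1) ⊆ ({0}ᶜ : Set (E × ℝ)) := by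
    rintro q hq rfl
    rcases hq with hq | hq <;> simp at hq
  have hV : ∀ m, Van m (Set.univ : Set (E × ℝ)) (half E (-1)) := fun m =>
    van_of_starConvex₂ hm (Set.subset_univ _) (starConvex_univ' _) (starConvex_half (by norm_num)) m
  have hV' : ∀ m, Van m (Set.univ : Set (E × ℝ)) (half E 1) := fun m =>
    van_of_starConvex₂ hp (Set.subset_univ _) (starConvex_univ' _) (starConvex_half (by norm_num)) m
  set Z : Set (E × ℝ) := {q | q.1 ≠ 0} with hZ
  have hZh : Z ⊆ half E 1 := fun q hq => Or.inl hq
  have hun : half E 1 ∪ half E (-1) = ({0}ᶜ : Set (E × ℝ)) := by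
    ext ⟨e, t⟩
    simp only [half, Set.mem_union, Set.mem_setOf_eq, Set.mem_compl_iff, Set.mem_singleton_iff,
      Prod.mk_eq_zero, not_and_or, ne_eq]
    constructor
    · rintro ((h | h) | (h | h))
      · exact Or.inl h
      · right
        rintro rfl
        simp at h
      · exact Or.inl h
      · right
        rintro rfl
        simp at h
    · rintro (h | h)
      · exact Or.inl (Or.inl h)
      · rcases lt_or_gt_of_ne h with h | h
        · exact Or.inr (Or.inr (by linarith))
        · exact Or.inl (Or.inr (by linarith))
  have hint : half E 1 ∩ half E (-1) = Z := by
    ext ⟨e, t⟩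
    simp only [half, hZ, Set.mem_inter_iff, Set.mem_setOf_eq, ne_eq]
    constructor
    · rintro ⟨h | h, h' | h'⟩
      · exact h
      · exact h
      · exact h'
      · linarith
    · exact fun h => ⟨Or.inl h, Or.inl h⟩
  have pproj : PairMap (Prod.fst : E × ℝ → E) Set.univ Z Set.univ {0}ᶜ :=
    ⟨continuous_fst.continuousOn, Set.subset_univ _, fun _ _ => trivial, fun q hq => hq⟩
  have pinc : PairMap (fun e : E => (e, (0 : ℝ))) Set.univ {0}ᶜ Set.univ Z :=
    ⟨by fun_prop, Set.subset_univ _, fun _ _ => trivial, fun q hq => hq⟩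
  have i1 : SphereLike d (Set.univ : Set (E × ℝ)) Z := by
    refine SphereLike.of_iso' (h := pproj) (fun n => ?_) h
    refine PairMap.Iso.of_homotopy_inverse pproj pinc ⟨fun p => (p.1.1, (p.2 : ℝ) * p.1.2), ?_,
      fun _ _ => trivial, fun q hq => hq.1, ?_, ?_⟩ (PairHomotopic.of_eqOn (pproj.comp pinc)
        fun _ _ => rfl) n
    · fun_prop
    · intro x _
      simp
    · intro x _
      simp
  have i2 : SphereLike d (half E 1) Z := SphereLike.of_iso' (h := resMap (Set.subset_univ _) hZh)
    (fun n => res_iso (Set.subset_univ _) hZh (hV' n) (hV' (n + 1))) i1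
  have i3 : SphereLike d ({0}ᶜ : Set (E × ℝ)) (half E (-1)) :=
    SphereLike.of_iso (h := PairMap.id hZh (fun q hq => hun ▸ Or.inl hq) fun q hq => Or.inl hq)
      (fun n => excision_iso (isOpen_half _) (isOpen_half _) hun hint n _) i2
  refine ⟨fun m hm => ?_, ?_⟩
  · cases m with
    | zero => exact Van.zero hsub (hV 0)
    | succ m => exact Van.of_conn (Set.subset_univ _) hsub hV (i3.1 m fun h => hm (by rw [h]))
  · obtain ⟨u, hu⟩ := i3.2
    exact ⟨_, IsGen.conn (Set.subset_univ _) hsub hV hu⟩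

/-- The cohomology of a finite dimensional space relative to the complement of the origin. -/
theorem sphereLike_finrank (d : ℕ) : ∀ (V : Type) [NormedAddCommGroup V] [NormedSpace ℝ V]
    [FiniteDimensional ℝ V], Module.finrank ℝ V = d → SphereLike d (Set.univ : Set V) {0}ᶜ := by
  induction d with
  | zero =>
    intro V _ _ _ hV
    have := Module.finrank_zero_iff.1 hV
    have h : ({0}ᶜ : Set V) = ∅ := by
      ext v
      simp [Subsingleton.elim v 0]
    rw [h]
    exact sphereLike_point
  | succ d ih =>
    intro V _ _ _ hV
    have h1 := sphereLike_prod (ih (EuclideanSpace ℝ (Fin d)) (by simp))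
    let e : V ≃L[ℝ] EuclideanSpace ℝ (Fin d) × ℝ := ContinuousLinearEquiv.ofFinrankEq (by
      rw [hV, Module.finrank_prod]
      simp)
    have p1 : PairMap e Set.univ {0}ᶜ Set.univ {0}ᶜ :=
      ⟨e.continuous.continuousOn, Set.subset_univ _, fun _ _ => trivial, fun x hx => by
        simpa using hx⟩
    have p2 : PairMap e.symm Set.univ {0}ᶜ Set.univ {0}ᶜ :=
      ⟨e.symm.continuous.continuousOn, Set.subset_univ _, fun _ _ => trivial, fun x hx => by
        simpa using hx⟩
    exact SphereLike.of_iso' (h := p1) (fun n => PairMap.Iso.of_inverse p1 p2 (by simp) (by simp) n) h1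

end Euclidean


/-! ### The topology of `E𝕋` -/

section TotalSpace

open Topology

lemma isQuotientMap_prodMap_id {A B Z : Type} [TopologicalSpace A] [TopologicalSpace B]
    [TopologicalSpace Z] [LocallyCompactSpace Z] {f : A → B} (hf : IsQuotientMap f) :
    IsQuotientMap (Prod.map f id : A × Z → B × Z) := by
  refine ⟨⟨le_antisymm ?_ ?_⟩, hf.surjective.prodMap Function.surjective_id⟩
  · let τ : TopologicalSpace (B × Z) := TopologicalSpace.coinduced (Prod.map f id) inferInstance
    have h : @Continuous _ _ instTopologicalSpaceProd τ (id : B × Z → B × Z) :=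
      @IsQuotientMap.continuous_lift_prod_left A B Z (B × Z) _ _ _ τ _ f hf id
        (continuous_iff_coinduced_le.2 le_rfl)
    exact continuous_id_iff_le.1 h
  · exact continuous_iff_coinduced_le.1 (hf.continuous.prodMap continuous_id)

/-- The stage `S(ℂ^N)` with its usual topology. -/
def Stage (N : ℕ) : Type := ETStage N

instance (N : ℕ) : TopologicalSpace (Stage N) := stageTopology N

/-- A point of a stage, as a point of `E𝕋`. -/
def Stage.pt {N : ℕ} (v : Stage N) : ET := Subtype.val v

lemma Stage.vec_eq_zero {N : ℕ} (v : Stage N) : ∀ i, N ≤ i → v.pt.vec i = 0 := Subtype.property v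

lemma continuous_stage (N : ℕ) : Continuous (Stage.pt : Stage N → ET) :=
  continuous_iff_coinduced_le.2 (le_iSup (fun N =>
    TopologicalSpace.coinduced Subtype.val (stageTopology N)) N)

lemma continuous_stage_vec (N i : ℕ) : Continuous fun v : Stage N => v.pt.vec i :=
  (continuous_apply i).comp continuous_induced_dom

lemma ET.exists_stage (e : ET) : ∃ N, ∀ i, N ≤ i → e.vec i = 0 :=
  ⟨e.vec.support.sup id + 1, fun i hi => by
    by_contra h
    exact absurd (Finset.le_sup (f := id) (Finsupp.mem_support_iff.2 h)) (by simp; omega)⟩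

lemma isQuotientMap_stage : IsQuotientMap fun v : Σ N, Stage N => v.2.pt := by
  refine ⟨⟨le_antisymm ?_ ?_⟩, fun e => ?_⟩
  · refine iSup_le fun N => ?_
    have h : @Continuous (Σ N, Stage N) ET _ (TopologicalSpace.coinduced
        (fun v : Σ N, Stage N => v.2.pt) inferInstance) (fun v => v.2.pt) :=
      continuous_iff_coinduced_le.2 le_rfl
    have h2 := continuous_sigmaMk (σ := Stage) (i := N)
    have : @Continuous (Stage N) ET _ (TopologicalSpace.coinduced
        (fun v : Σ N, Stage N => v.2.pt) inferInstance) Stage.pt :=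
      @Continuous.comp (Stage N) (Σ N, Stage N) ET _ _ (_) (Sigma.mk N) (fun v => v.2.pt) h h2
    exact continuous_iff_coinduced_le.1 this
  · exact continuous_iff_coinduced_le.1 (continuous_sigma fun N => continuous_stage N)
  · obtain ⟨N, hN⟩ := e.exists_stage
    exact ⟨⟨N, e, hN⟩, rfl⟩

variable {Z W : Type} [TopologicalSpace Z] [TopologicalSpace W]

/-- Products with a locally compact space preserve quotient maps, so continuity on `E𝕋 × Z` can be
tested on the stages. The factor `Z` will be the circle or the interval; a general space `X` enters
only as a further coordinate that the homotopies of `E𝕋` leave alone. -/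
lemma ET.continuousOn_of_stages [LocallyCompactSpace Z] {f : ET × Z → W} {O : Set (ET × Z)}
    (hO : IsOpen O)
    (h : ∀ N, ContinuousOn (fun p : Stage N × Z => f (p.1.pt, p.2)) {p | (p.1.pt, p.2) ∈ O}) :
    ContinuousOn f O := by
  have hq := isQuotientMap_prodMap_id (Z := Z) isQuotientMap_stage
  refine (hq.continuousOn_isOpen_iff hO).2 ?_
  rintro ⟨⟨N, v⟩, z⟩ hp
  refine ContinuousAt.continuousWithinAt ?_
  have hN := (h N).continuousAt (x := (v, z)) (IsOpen.mem_nhds (hO.preimage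
    (((continuous_stage N).comp continuous_fst).prodMk continuous_snd)) hp)
  exact ((IsOpenEmbedding.sigmaMk (σ := Stage) (i := N)).prodMap
    (IsOpenEmbedding.id (X := Z))).continuousAt_iff (x := (v, z)) |>.1 hN

lemma continuous_vec (i : ℕ) : Continuous fun e : ET => e.vec i :=
  isQuotientMap_stage.continuous_iff.2 (continuous_sigma fun N => continuous_stage_vec N i)

/-- Coordinatewise continuity suffices for maps to a fixed stage, which has the topology induced by
the coordinates; without the uniform bound `N` on the support this would not give the colimit
topology. -/
lemma ET.continuousOn_of_vec {f : W → ET} {S : Set W} (N : ℕ)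
    (hN : ∀ a ∈ S, ∀ i, N ≤ i → (f a).vec i = 0)
    (h : ∀ i, ContinuousOn (fun a => (f a).vec i) S) : ContinuousOn f S := by
  rw [continuousOn_iff_continuous_restrict]
  let g : S → Stage N := fun a => ⟨f a.1, hN a.1 a.2⟩
  have hg : Continuous g := continuous_induced_rng.2 (continuous_pi fun i =>
    continuousOn_iff_continuous_restrict.1 (h i))
  exact (continuous_stage N).comp hg

instance : ContinuousSMul Circle ET where
  continuous_smul := by
    have h : ContinuousOn (fun p : ET × Circle => p.2 • p.1) Set.univ :=
      ET.continuousOn_of_stages isOpen_univ fun N => ET.continuousOn_of_vec N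
        (fun p _ i hi => by
          change p.2 • p.1.pt.vec i = 0
          rw [p.1.vec_eq_zero i hi, smul_zero]) fun i =>
            (Continuous.smul continuous_snd
              ((continuous_stage_vec N i).comp continuous_fst)).continuousOn
    exact (continuousOn_univ.1 h).comp continuous_swap

lemma ET.vec_ne_zero (e : ET) : e.vec ≠ 0 := fun h => by
  have := e.unit
  simp [h] at this

/-- The sum of squares of a finitely supported sequence. -/
def normSum (v : ℕ →₀ ℂ) : ℝ := v.sum fun _ c => ‖c‖ ^ 2

lemma normSum_eq {v : ℕ →₀ ℂ} {N : ℕ} (h : ∀ i, N ≤ i → v i = 0) :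
    normSum v = ∑ i ∈ Finset.range N, ‖v i‖ ^ 2 :=
  Finsupp.sum_of_support_subset _ (fun i hi => by
    by_contra h'
    exact Finsupp.mem_support_iff.1 hi (h i (by simpa using h'))) _ (by simp)

lemma normSum_pos {v : ℕ →₀ ℂ} (h : v ≠ 0) : 0 < normSum v :=
  Finset.sum_pos (fun i hi => by
    have := Finsupp.mem_support_iff.1 hi
    positivity) (Finsupp.support_nonempty_iff.2 h)

lemma normSum_smul (c : ℂ) (v : ℕ →₀ ℂ) : normSum (c • v) = ‖c‖ ^ 2 * normSum v := by
  rcases eq_or_ne c 0 with rfl | hc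
  · simp [normSum]
  · simp only [normSum, Finsupp.sum]
    rw [Finsupp.support_smul_eq hc, Finset.mul_sum]
    exact Finset.sum_congr rfl fun i _ => by
      rw [Finsupp.smul_apply, smul_eq_mul, norm_mul, mul_pow]

/-- The first basis vector. -/
def ET.basis (j : ℕ) : ET := ⟨Finsupp.single j 1, by simp⟩

/-- The unit vector in the direction of a vector. -/
def ET.normalize (v : ℕ →₀ ℂ) : ET :=
  if h : v = 0 then ET.basis 0 else
    ⟨(((Real.sqrt (normSum v))⁻¹ : ℝ) : ℂ) • v, by
      have h1 := normSum_pos h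
      change normSum _ = 1
      rw [normSum_smul, Complex.norm_real, Real.norm_of_nonneg (by positivity), inv_pow,
        Real.sq_sqrt h1.le, inv_mul_cancel₀ h1.ne']⟩

lemma ET.vec_normalize {v : ℕ →₀ ℂ} (h : v ≠ 0) (i : ℕ) :
    (ET.normalize v).vec i = (((Real.sqrt (normSum v))⁻¹ : ℝ) : ℂ) * v i := by
  rw [ET.normalize, dif_neg h]
  rfl

lemma ET.normalize_eq {e : ET} {v : ℕ →₀ ℂ} {r : ℝ} (hr : 0 < r) (h : v = (r : ℂ) • e.vec) :
    ET.normalize v = e := by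
  have h1 : normSum v = r ^ 2 := by
    rw [h, normSum_smul, show normSum e.vec = 1 from e.unit]
    simp
  have h2 : v ≠ 0 := by
    rw [h]
    exact smul_ne_zero (by exact_mod_cast hr.ne') e.vec_ne_zero
  refine ET.ext (Finsupp.ext fun i => ?_)
  rw [ET.vec_normalize h2, h1, Real.sqrt_sq hr.le, h, Finsupp.smul_apply, smul_eq_mul, ← mul_assoc,
    ← Complex.ofReal_mul, inv_mul_cancel₀ hr.ne']
  simp

lemma ET.continuousOn_normalize₀ {F : W → ℕ →₀ ℂ} {S : Set W} (hF : ∀ a ∈ S, F a ≠ 0) (N : ℕ)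
    (hN : ∀ a ∈ S, ∀ i, N ≤ i → F a i = 0) (hc : ∀ i, ContinuousOn (fun a => F a i) S) :
    ContinuousOn (fun a => ET.normalize (F a)) S := by
  have hs : ContinuousOn (fun a => normSum (F a)) S :=
    (continuousOn_finsetSum (Finset.range N) fun i _ => (hc i).norm.pow 2).congr
      fun a ha => normSum_eq (hN a ha)
  refine ET.continuousOn_of_vec N (fun a ha i hi => ?_) fun i => ?_
  · rw [ET.vec_normalize (hF a ha), hN a ha i hi, mul_zero]
  · refine ContinuousOn.congr ?_ fun a ha => ET.vec_normalize (hF a ha) i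
    exact (Complex.continuous_ofReal.comp_continuousOn (hs.sqrt.inv₀ fun a ha =>
      (Real.sqrt_pos.2 (normSum_pos (hF a ha))).ne')).mul (hc i)

lemma ET.continuousOn_normalize [LocallyCompactSpace Z] {F : ET × Z → ℕ →₀ ℂ} {O : Set (ET × Z)}
    (hO : IsOpen O) (hF : ∀ p ∈ O, F p ≠ 0)
    (hs : ∀ N, ∃ M, ∀ p : ET × Z, (∀ i, N ≤ i → p.1.vec i = 0) → ∀ i, M ≤ i → F p i = 0)
    (hc : ∀ i, Continuous fun p => F p i) : ContinuousOn (fun p => ET.normalize (F p)) O := by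
  refine ET.continuousOn_of_stages hO fun N => ?_
  obtain ⟨M, hM⟩ := hs N
  exact ET.continuousOn_normalize₀ (fun p hp => hF _ hp) M (fun p _ => hM _ p.1.vec_eq_zero) fun i =>
    ((hc i).comp (((continuous_stage N).comp continuous_fst).prodMk continuous_snd)).continuousOn

/-- The shift of a finitely supported sequence. -/
def shift (v : ℕ →₀ ℂ) : ℕ →₀ ℂ := v.embDomain ⟨Nat.succ, Nat.succ_injective⟩

lemma shift_zero (v : ℕ →₀ ℂ) : shift v 0 = 0 :=
  Finsupp.embDomain_notin_range _ _ _ (by simp)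

lemma shift_succ (v : ℕ →₀ ℂ) (i : ℕ) : shift v (i + 1) = v i :=
  Finsupp.embDomain_apply_self ⟨Nat.succ, Nat.succ_injective⟩ v i

/-- `E𝕋` is contractible. -/
lemma exists_contraction : ∃ H : ET × unitInterval → ET, Continuous H ∧ (∀ e, H (e, 0) = e) ∧
    ∀ e, H (e, 1) = ET.basis 0 := by
  -- In the first half of the time a vector moves to its shift, in the second half the shift moves
  -- to the first basis vector. At time `1/2` only the coefficient `b` is nonzero.
  let a : unitInterval → ℝ := fun s => max 0 (1 - 2 * s)
  let b : unitInterval → ℝ := fun s => min (2 * s) (2 - 2 * s)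
  let c : unitInterval → ℝ := fun s => max 0 (2 * s - 1)
  let F : ET × unitInterval → ℕ →₀ ℂ := fun p =>
    (a p.2 : ℂ) • p.1.vec + (b p.2 : ℂ) • shift p.1.vec + (c p.2 : ℂ) • Finsupp.single 0 1
  have hF : ∀ p, F p ≠ 0 := by
    rintro ⟨e, s⟩ h
    have h0 : ∀ i, F (e, s) i = 0 := fun i => by rw [h]; rfl
    have hz := h0 0
    have hs : ∀ i, (a s : ℂ) * e.vec (i + 1) + (b s : ℂ) * e.vec i = 0 := fun i => by
      have := h0 (i + 1)
      simpa [F, shift_succ] using this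
    simp only [F, Finsupp.add_apply, Finsupp.smul_apply, shift_zero, smul_eq_mul, mul_zero,
      add_zero, Finsupp.single_eq_same, mul_one] at hz
    have hs0 := s.2.1
    have hs1 := s.2.2
    refine e.vec_ne_zero ?_
    -- In the second half, coordinate `0` and the shifted coordinates cannot interfere. In the first
    -- half `c = 0`, so coordinate `0` of the combination shows `e₀ = 0`, and each further
    -- coordinate then vanishes by induction.
    by_cases h1 : a s = 0
    · have h2 : (1 : ℝ) ≤ 2 * s := by
        have : 1 - 2 * (s : ℝ) ≤ 0 := by rw [← h1]; exact le_max_right _ _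
        linarith
      by_cases h3 : b s = 0
      · exfalso
        have h4 : (s : ℝ) = 1 := by
          rcases min_choice (2 * (s : ℝ)) (2 - 2 * s) with h5 | h5
          · have : 2 * (s : ℝ) = 0 := by rw [← h5]; exact h3
            linarith
          · have : 2 - 2 * (s : ℝ) = 0 := by rw [← h5]; exact h3
            linarith
        have h5 : c s = 1 := by simp only [c, h4]; norm_num
        rw [h1, h5] at hz
        simp at hz
      · refine Finsupp.ext fun i => ?_
        have := hs i
        rw [h1] at this
        simpa [h3] using this
    · have h2 : c s = 0 := by
        have : 0 < 1 - 2 * (s : ℝ) := by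
          by_contra h2
          exact h1 (max_eq_left (not_lt.1 h2))
        exact max_eq_left (by linarith)
      refine Finsupp.ext fun i => ?_
      have h3 : (a s : ℂ) ≠ 0 := by exact_mod_cast h1
      induction i with
      | zero => simpa [h2, h1] using hz
      | succ i ih =>
        have := hs i
        rw [ih] at this
        simpa [h1] using this
  refine ⟨fun p => ET.normalize (F p), ?_, fun e => ?_, fun e => ?_⟩
  · refine continuousOn_univ.1 (ET.continuousOn_normalize isOpen_univ (fun p _ => hF p)
      (fun N => ⟨N + 1, fun p hp i hi => ?_⟩) fun i => ?_)
    · obtain ⟨j, rfl⟩ : ∃ j, i = j + 1 := ⟨i - 1, by omega⟩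
      simp [F, shift_succ, hp j (by omega), hp (j + 1) (by omega)]
    · have hv := continuous_vec
      have ha : Continuous a := by fun_prop
      have hb : Continuous b := by fun_prop
      have hc : Continuous c := by fun_prop
      have h1 : Continuous fun e : ET => shift e.vec i := by
        cases i with
        | zero => simpa only [shift_zero] using continuous_const
        | succ i => simpa only [shift_succ] using hv i
      simp only [F, Finsupp.add_apply, Finsupp.smul_apply, smul_eq_mul]
      exact (((Complex.continuous_ofReal.comp (ha.comp continuous_snd)).mul
        ((hv i).comp continuous_fst)).add ((Complex.continuous_ofReal.comp
        (hb.comp continuous_snd)).mul (h1.comp continuous_fst))).add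
        ((Complex.continuous_ofReal.comp (hc.comp continuous_snd)).mul continuous_const)
  · exact ET.normalize_eq one_pos (by simp [F, a, b, c])
  · refine ET.normalize_eq one_pos ?_
    simp only [F, a, b, c, ET.basis]
    norm_num

end TotalSpace

/-! ### Maps and homotopies on the Borel construction -/

section BorelMaps

open Topology

variable {X : Type} [TopologicalSpace X] [MulAction Circle X] {Z : Type} [TopologicalSpace Z]

/-- A subset is invariant under the action of the circle. -/
def Inv {P : Type} [MulAction Circle P] (W : Set P) : Prop := ∀ (z : Circle), ∀ p ∈ W, z • p ∈ W

lemma Inv.iff {P : Type} [MulAction Circle P] {W : Set P} (h : Inv W) (z : Circle) (p : P) :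
    z • p ∈ W ↔ p ∈ W :=
  ⟨fun hp => by simpa using h z⁻¹ _ hp, h z p⟩

lemma Inv.snd {S : Set X} (h : Inv S) : Inv (Prod.snd ⁻¹' S : Set (ET × X)) := fun z _ hp => h z _ hp

lemma Inv.compl {P : Type} [MulAction Circle P] {W : Set P} (h : Inv W) : Inv Wᶜ :=
  fun z p hp h' => hp ((h.iff z p).1 h')

lemma Inv.inter {P : Type} [MulAction Circle P] {W W' : Set P} (h : Inv W) (h' : Inv W') :
    Inv (W ∩ W') := fun z p hp => ⟨h z p hp.1, h' z p hp.2⟩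

lemma inv_univ {P : Type} [MulAction Circle P] : Inv (Set.univ : Set P) := fun _ _ _ => trivial

lemma inv_empty {P : Type} [MulAction Circle P] : Inv (∅ : Set P) := fun _ _ h => h.elim

lemma inv_fixed (x : MulAction.fixedPoints Circle X) : Inv ({x.1} : Set X) := by
  rintro z _ rfl
  exact x.2 z

lemma Bor.mk_smul (z : Circle) (p : ET × X) : Bor.mk (z • p) = Bor.mk p :=
  Quotient.sound ⟨z, rfl⟩

lemma Bor.mk_eq {p q : ET × X} (h : Bor.mk p = Bor.mk q) : ∃ z : Circle, z • q = p := by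
  obtain ⟨z, hz⟩ := Quotient.exact h
  exact ⟨z, hz⟩

lemma Bor.mk_surjective (x : Bor X) : ∃ p, Bor.mk p = x := Quotient.exists_rep x

lemma Bor.continuous_mk : Continuous (Bor.mk : ET × X → Bor X) := continuous_quot_mk

/-- The subset of the Borel construction that is covered by a set of pairs. -/
def img (W : Set (ET × X)) : Set (Bor X) := Bor.mk '' W

lemma mem_img {W : Set (ET × X)} (h : Inv W) {p : ET × X} : Bor.mk p ∈ img W ↔ p ∈ W := by
  refine ⟨?_, fun hp => ⟨p, hp, rfl⟩⟩
  rintro ⟨q, hq, hqp⟩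
  obtain ⟨z, rfl⟩ := Bor.mk_eq hqp
  exact (h.iff z p).1 hq

lemma img_mono {W W' : Set (ET × X)} (h : W ⊆ W') : img W ⊆ img W' := Set.image_mono h

lemma img_union (W W' : Set (ET × X)) : img W ∪ img W' = img (W ∪ W') :=
  (Set.image_union _ _ _).symm

lemma img_inter {W W' : Set (ET × X)} (h : Inv W) (h' : Inv W') :
    img W ∩ img W' = img (W ∩ W') := by
  ext x
  obtain ⟨p, rfl⟩ := Bor.mk_surjective x
  rw [Set.mem_inter_iff, mem_img h, mem_img h', mem_img (h.inter h'), Set.mem_inter_iff]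

lemma img_univ : img (Set.univ : Set (ET × X)) = Set.univ :=
  Set.image_univ_of_surjective Bor.mk_surjective

lemma borSubset_eq (S : Set X) : borSubset X S = img (Prod.snd ⁻¹' S) := by
  ext x
  constructor
  · rintro ⟨e, y, hy, rfl⟩
    exact ⟨(e, y), hy, rfl⟩
  · rintro ⟨⟨e, y⟩, hy, rfl⟩
    exact ⟨e, y, hy, rfl⟩

/-- The function on the Borel construction defined by an invariant function. -/
def desc (F : ET × X → Z) : Bor X → Z := fun x => F (Quotient.out x)

lemma desc_mk {F : ET × X → Z} {W : Set (ET × X)} (hF : ∀ z : Circle, ∀ p ∈ W, F (z • p) = F p)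
    {p : ET × X} (hp : p ∈ W) : desc F (Bor.mk p) = F p := by
  obtain ⟨z, hz⟩ := Bor.mk_eq (Quotient.out_eq (Bor.mk p) : Bor.mk _ = Bor.mk p)
  change F (Quotient.out (Bor.mk p)) = F p
  rw [← hz, hF z p hp]

/-- An open quotient map carries neighborhood filters to neighborhood filters, so continuity can be
tested upstairs even on subsets that are neither open nor closed. -/
lemma continuousOn_of_comp {A B : Type} [TopologicalSpace A] [TopologicalSpace B] {q : A → B}
    (hq : IsOpenQuotientMap q) {f : B → Z} {S : Set B} (h : ContinuousOn (f ∘ q) (q ⁻¹' S)) :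
    ContinuousOn f S := by
  intro b hb
  obtain ⟨a, rfl⟩ := hq.surjective b
  have h1 := h a hb
  unfold ContinuousWithinAt at h1 ⊢
  rw [nhdsWithin, ← hq.map_nhds_eq, ← Filter.push_pull, Filter.comap_principal]
  exact h1

variable [ContinuousSMul Circle X]

lemma Bor.isOpenQuotientMap_mk : IsOpenQuotientMap (Bor.mk : ET × X → Bor X) :=
  MulAction.isOpenQuotientMap_quotientMk

lemma isOpen_img {W : Set (ET × X)} (h : IsOpen W) : IsOpen (img W) :=
  Bor.isOpenQuotientMap_mk.isOpenMap W h

lemma preimage_img {W : Set (ET × X)} (h : Inv W) : Bor.mk ⁻¹' img W = W :=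
  Set.ext fun _ => mem_img h

lemma pairMap_of_mk {φ : Bor X → Z} {F : ET × X → Z} {W A : Set (ET × X)} {V B : Set Z}
    (hW : Inv W) (hφ : ∀ p ∈ W, φ (Bor.mk p) = F p) (hc : ContinuousOn F W) (hA : A ⊆ W)
    (h : Set.MapsTo F W V) (h' : Set.MapsTo F A B) : PairMap φ (img W) (img A) V B where
  cont := continuousOn_of_comp Bor.isOpenQuotientMap_mk (by
    rw [preimage_img hW]
    exact hc.congr hφ)
  sub := img_mono hA
  maps := by
    rintro _ ⟨p, hp, rfl⟩
    rw [hφ p hp]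
    exact h hp
  maps' := by
    rintro _ ⟨p, hp, rfl⟩
    rw [hφ p (hA hp)]
    exact h' hp

lemma pairHomotopic_of_mk {φ ψ : Bor X → Z} {H : (ET × X) × unitInterval → Z}
    {W A : Set (ET × X)} {V B : Set Z} (hW : Inv W)
    (hH : ∀ (z : Circle), ∀ p ∈ W, ∀ s, H (z • p, s) = H (p, s))
    (hc : ContinuousOn H (W ×ˢ Set.univ)) (hA : A ⊆ W) (h : ∀ p ∈ W, ∀ s, H (p, s) ∈ V)
    (h' : ∀ p ∈ A, ∀ s, H (p, s) ∈ B) (h0 : ∀ p ∈ W, H (p, 0) = φ (Bor.mk p))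
    (h1 : ∀ p ∈ W, H (p, 1) = ψ (Bor.mk p)) : PairHomotopic φ ψ (img W) (img A) V B := by
  have hd : ∀ p ∈ W, ∀ s, desc (fun p => H (p, s)) (Bor.mk p) = H (p, s) := fun p hp s =>
    desc_mk (fun z p hp => hH z p hp s) hp
  refine ⟨fun q => desc (fun p => H (p, q.2)) q.1, ?_, ?_, ?_, ?_, ?_⟩
  · refine continuousOn_of_comp (Bor.isOpenQuotientMap_mk.prodMap IsOpenQuotientMap.id) ?_
    have : Prod.map Bor.mk id ⁻¹' (img W ×ˢ (Set.univ : Set unitInterval)) = W ×ˢ Set.univ := by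
      ext q
      simp only [Set.mem_preimage, Set.mem_prod, Prod.map_fst, mem_img hW, Set.mem_univ]
    rw [this]
    exact hc.congr fun q hq => hd _ hq.1 _
  · rintro ⟨_, s⟩ ⟨⟨p, hp, rfl⟩, -⟩
    exact Set.mem_of_eq_of_mem (hd p hp s) (h p hp s)
  · rintro ⟨_, s⟩ ⟨⟨p, hp, rfl⟩, -⟩
    exact Set.mem_of_eq_of_mem (hd p (hA hp) s) (h' p hp s)
  · rintro _ ⟨p, hp, rfl⟩
    exact (hd p hp 0).trans (h0 p hp)
  · rintro _ ⟨p, hp, rfl⟩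
    exact (hd p hp 1).trans (h1 p hp)

/-- A pair `(W, A)` of invariant sets has no equivariant cohomology if `W` can be equivariantly
deformed into `A`. -/
lemma van_img_of_deformation {W A : Set (ET × X)} (hW : Inv W) (hAi : Inv A) (hA : A ⊆ W)
    (H : (ET × X) × unitInterval → ET × X)
    (hH : ∀ (z : Circle), ∀ p ∈ W, ∀ s, H (z • p, s) = z • H (p, s))
    (hc : ContinuousOn H (W ×ˢ Set.univ)) (h0 : ∀ p ∈ W, H (p, 0) = p)
    (h : ∀ p ∈ W, ∀ s, H (p, s) ∈ W) (h' : ∀ p ∈ A, ∀ s, H (p, s) ∈ A)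
    (h1 : ∀ p ∈ W, H (p, 1) ∈ A) (n : ℕ) : Van n (img W) (img A) := by
  obtain ⟨g, g1, g2, g3, g4, g5⟩ := pairHomotopic_of_mk (φ := id)
    (ψ := desc fun p => Bor.mk (H (p, 1))) (H := fun q => Bor.mk (H q)) hW
    (fun z p hp s => by rw [hH z p hp s, Bor.mk_smul])
    (Bor.continuous_mk.comp_continuousOn hc) hA (fun p hp s => (mem_img hW).2 (h p hp s))
    (fun p hp s => (mem_img hAi).2 (h' p hp s)) (fun p hp => by rw [h0 p hp]; rfl)
    (fun p hp => by
      rw [desc_mk (W := W) (fun z p hp => by rw [hH z p hp, Bor.mk_smul]) hp])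
  refine van_of_deformation (img_mono hA) g g1 g4 (fun x hx s => g2 ⟨hx, trivial⟩)
    (fun x hx s => g3 ⟨hx, trivial⟩) ?_ n
  rintro _ ⟨p, hp, rfl⟩
  rw [g5 _ ⟨p, hp, rfl⟩, desc_mk (W := W) (fun z p hp => by rw [hH z p hp, Bor.mk_smul]) hp]
  exact (mem_img hAi).2 (h1 p hp)

/-- A set on which the circle acts freely, with a slice, has the equivariant cohomology of the
slice. -/
lemma slice_iso {θ : ET × X → Circle} {W A : Set (ET × X)} (hW : Inv W) (hAi : Inv A) (hA : A ⊆ W)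
    (hθ : ContinuousOn θ W) (he : ∀ z : Circle, ∀ p ∈ W, θ (z • p) = z * θ p)
    (h : PairMap Bor.mk {p ∈ W | θ p = 1} {p ∈ A | θ p = 1} (img W) (img A)) (n : ℕ) : h.Iso n := by
  -- Turning `p` back by its angle is invariant and lands in the slice `θ = 1`; on orbits it is the
  -- inverse of the projection from the slice.
  have hF : ∀ z : Circle, ∀ p ∈ W, (θ (z • p))⁻¹ • (z • p) = (θ p)⁻¹ • p := fun z p hp => by
    rw [he z p hp, smul_smul, mul_inv, mul_comm z⁻¹, mul_assoc, inv_mul_cancel, mul_one]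
  have h1 : ∀ p ∈ W, θ ((θ p)⁻¹ • p) = 1 := fun p hp => by
    rw [he _ p hp, inv_mul_cancel]
  have hψ : PairMap (desc fun p => (θ p)⁻¹ • p) (img W) (img A) {p ∈ W | θ p = 1}
      {p ∈ A | θ p = 1} :=
    pairMap_of_mk hW (fun p hp => desc_mk hF hp) (hθ.inv.smul continuousOn_id) hA
      (fun p hp => ⟨hW _ p hp, h1 p hp⟩) (fun p hp => ⟨hAi _ p hp, h1 p (hA hp)⟩)
  refine PairMap.Iso.of_inverse h hψ (fun p hp => ?_) ?_ n
  · rw [desc_mk hF hp.1, hp.2, inv_one, one_smul]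
  · rintro _ ⟨p, hp, rfl⟩
    rw [desc_mk hF hp, Bor.mk_smul]

/-- As `E𝕋` is contractible, the projection to `X` is a homotopy inverse. The contraction moves the
coordinate in `E𝕋` only and hence respects all subsets pulled back from `X`. -/
lemma contraction_iso {S S' : Set X}
    (h : PairMap (fun x => (ET.basis 0, x)) S S' (Prod.snd ⁻¹' S) (Prod.snd ⁻¹' S')) (n : ℕ) :
    h.Iso n := by
  have h2 : PairMap (Prod.snd : ET × X → X) (Prod.snd ⁻¹' S) (Prod.snd ⁻¹' S') S S' :=
    ⟨continuous_snd.continuousOn, Set.preimage_mono h.sub, fun _ hp => hp, fun _ hp => hp⟩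
  obtain ⟨H, hH, h0, h1⟩ := exists_contraction
  have h3 : (h2.comp h).Iso n := PairMap.Iso.of_inverse (h2.comp h) (h2.comp h) (fun _ _ => rfl)
    (fun _ _ => rfl) n
  have h4 : (h.comp h2).Iso n := by
    intro k _
    have : ∀ y, (h.comp h2).pull k n y = y := fun y => by
      rw [← pull_eq_of_homotopy (PairMap.id h2.sub subset_rfl subset_rfl) (h.comp h2)
        (fun q => (H (q.1.1, q.2), q.1.2)) ?_ (fun q hq => hq.1) (fun q hq => hq.1) ?_ ?_ n y,
        PairMap.pull_id]
      · exact Continuous.continuousOn (by fun_prop)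
      · intro p _
        simp [h0]
      · intro p _
        simp [h1]
    rw [show ⇑((h.comp h2).pull k n) = id from funext this]
    exact Function.bijective_id
  have h5 : h2.Iso n := fun k _ => by
    constructor
    · exact Function.Injective.of_comp (f := h.pull k n) (by
        rw [← show ⇑((h2.comp h).pull k n) = h.pull k n ∘ h2.pull k n from
          funext (PairMap.pull_comp h2 h n)]
        exact (h3 k).1)
    · exact Function.Surjective.of_comp (g := h.pull k n) (by
        rw [← show ⇑((h.comp h2).pull k n) = h2.pull k n ∘ h.pull k n from
          funext (PairMap.pull_comp h h2 n)]
        exact (h4 k).2)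
  exact PairMap.Iso.of_comp_left h5 h3

/-- The equivariant cohomology of a pair with a map to the circle is the cohomology of a fibre. -/
lemma free_iso {θ : X → Circle} {S S' : Set X} (hS : Inv S) (hS' : Inv S') (hSS : S' ⊆ S)
    (hθ : ContinuousOn θ S) (he : ∀ z : Circle, ∀ x ∈ S, θ (z • x) = z * θ x)
    (h : PairMap (fun x => Bor.mk (ET.basis 0, x)) {x ∈ S | θ x = 1} {x ∈ S' | θ x = 1}
      (borSubset X S) (borSubset X S')) (n : ℕ) : h.Iso n := by
  have h1 : PairMap (fun x => (ET.basis 0, x)) {x ∈ S | θ x = 1} {x ∈ S' | θ x = 1}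
      (Prod.snd ⁻¹' {x ∈ S | θ x = 1}) (Prod.snd ⁻¹' {x ∈ S' | θ x = 1}) :=
    ⟨by fun_prop, fun x hx => ⟨hSS hx.1, hx.2⟩, fun _ hx => hx, fun _ hx => hx⟩
  have h2 : PairMap (Bor.mk : ET × X → Bor X) (Prod.snd ⁻¹' {x ∈ S | θ x = 1})
      (Prod.snd ⁻¹' {x ∈ S' | θ x = 1}) (borSubset X S) (borSubset X S') :=
    ⟨Bor.continuous_mk.continuousOn, fun p hp => ⟨hSS hp.1, hp.2⟩,
      fun p hp => ⟨p.1, p.2, hp.1, rfl⟩, fun p hp => ⟨p.1, p.2, hp.1, rfl⟩⟩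
  have i2 : h2.Iso n := by
    have := borSubset_eq S
    have := borSubset_eq S'
    revert h2
    rw [borSubset_eq, borSubset_eq]
    intro h2
    exact slice_iso (θ := θ ∘ Prod.snd) hS.snd hS'.snd (fun p hp => hSS hp)
      (hθ.comp continuousOn_snd fun _ hp => hp) (fun z p hp => he z p.2 hp) h2 n
  exact PairMap.Iso.comp (hψ := h2) (hφ := h1) i2 (contraction_iso h1 n)

end BorelMaps


/-! ### The direction of a complex number -/

section Direction

/-- A complex number of norm one, as a point of the circle. -/
def circleMk (w : ℂ) (h : ‖w‖ = 1) : Circle where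
  val := w
  property := mem_sphere_zero_iff_norm.2 h

lemma norm_div_norm {w : ℂ} (h : w ≠ 0) : ‖w / ‖w‖‖ = 1 := by
  rw [norm_div, Complex.norm_real, norm_norm, div_self (norm_ne_zero_iff.2 h)]

/-- The direction of a non-zero complex number. -/
def direction (w : ℂ) : Circle :=
  if h : w = 0 then 1 else circleMk (w / ‖w‖) (norm_div_norm h)

lemma direction_eq {w : ℂ} (h : w ≠ 0) : direction w = circleMk (w / ‖w‖) (norm_div_norm h) := by
  rw [direction, dif_neg h]

lemma coe_direction {w : ℂ} (h : w ≠ 0) : (direction w : ℂ) = w / ‖w‖ := by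
  rw [direction_eq h]
  rfl

lemma direction_mul (z : Circle) {w : ℂ} (h : w ≠ 0) : direction (z * w) = z * direction w := by
  ext
  rw [Circle.coe_mul, coe_direction h, coe_direction (mul_ne_zero (Circle.coe_ne_zero z) h),
    norm_mul, Circle.norm_coe, one_mul, mul_div_assoc]

lemma direction_eq_one {w : ℂ} (h : w ≠ 0) : direction w = 1 ↔ w = ‖w‖ := by
  rw [← Circle.coe_inj, coe_direction h, Circle.coe_one, div_eq_one_iff_eq]
  exact_mod_cast norm_ne_zero_iff.2 h

lemma direction_ofReal {r : ℝ} (h : 0 < r) : direction (r : ℂ) = 1 := by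
  rw [direction_eq_one (by exact_mod_cast h.ne'), Complex.norm_real, Real.norm_of_nonneg h.le]

lemma continuousOn_direction : ContinuousOn direction {0}ᶜ := by
  rw [continuousOn_iff_continuous_restrict]
  have h : Continuous fun w : ({0}ᶜ : Set ℂ) => (w : ℂ) / (‖(w : ℂ)‖ : ℂ) :=
    continuous_subtype_val.div (Complex.continuous_ofReal.comp continuous_subtype_val.norm)
      fun w => by exact_mod_cast norm_ne_zero_iff.2 w.2
  have h2 : Continuous fun w : ({0}ᶜ : Set ℂ) => circleMk (w / ‖(w : ℂ)‖) (norm_div_norm w.2) :=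
    Continuous.subtype_mk h _
  exact h2.congr fun w => (direction_eq w.2).symm

end Direction

/-! ### Exactness with vanishing in two degrees only -/

section MoreExact

variable {X : Type} [TopologicalSpace X] {U G K : Set X}

lemma rel_iso_succ {n : ℕ} (hG : G ⊆ U) (hK : K ⊆ G) (h : Van n G K) (h' : Van (n + 1) G K) :
    (relMap hG hK).Iso (n + 1) := fun k _ =>
  ⟨(injective_iff_map_eq_zero _).2 fun y hy => by
    obtain ⟨z, rfl⟩ := exact_conn_rel hG hK y hy
    rw [h.eq_zero z, map_zero], rel_surjective hG hK h'⟩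

end MoreExact

/-! ### Functoriality and excision for the Borel construction -/

section BorelMap

variable {X Y : Type} [TopologicalSpace X] [MulAction Circle X] [ContinuousSMul Circle X]
  [TopologicalSpace Y] [MulAction Circle Y] [ContinuousSMul Circle Y]

lemma pairMap_bor (f : TMap X Y) {S : Set X} {S' : Set Y} (h : Set.MapsTo f.map S S') :
    PairMap (Bor.map f) Set.univ (borSubset X S) Set.univ (borSubset Y S') where
  cont := (Bor.map f).continuous.continuousOn
  sub := Set.subset_univ _
  maps _ _ := trivial
  maps' := by
    rintro _ ⟨e, x, hx, rfl⟩
    exact ⟨e, f.map x, h hx, rfl⟩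

lemma borMap_iso (f : TMap X Y) (g : TMap Y X) {S : Set X} {S' : Set Y} (h : Set.MapsTo f.map S S')
    (h' : Set.MapsTo g.map S' S) (h1 : ∀ x, g.map (f.map x) = x) (h2 : ∀ y, f.map (g.map y) = y)
    (n : ℕ) : (pairMap_bor f h).Iso n := by
  refine PairMap.Iso.of_inverse (pairMap_bor f h) (pairMap_bor g h') (fun x _ => ?_) (fun y _ => ?_) n
  · obtain ⟨p, rfl⟩ := Bor.mk_surjective x
    exact congrArg (fun x => Bor.mk (p.1, x)) (h1 p.2)
  · obtain ⟨p, rfl⟩ := Bor.mk_surjective y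
    exact congrArg (fun x => Bor.mk (p.1, x)) (h2 p.2)

lemma borSubset_mono {S S' : Set X} (h : S ⊆ S') : borSubset X S ⊆ borSubset X S' := by
  rintro _ ⟨e, x, hx, rfl⟩
  exact ⟨e, x, h hx, rfl⟩

lemma bor_excision_iso {L K U A : Set X} (hLo : IsOpen L) (hKo : IsOpen K) (hL : Inv L)
    (hK : Inv K) (hU : L ∪ K = U) (hA : L ∩ K = A) (n : ℕ)
    (h : PairMap id (borSubset X L) (borSubset X A) (borSubset X U) (borSubset X K)) : h.Iso n := by
  subst hU hA
  refine excision_iso ?_ ?_ ?_ ?_ n h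
  · rw [borSubset_eq]
    exact isOpen_img (hLo.preimage continuous_snd)
  · rw [borSubset_eq]
    exact isOpen_img (hKo.preimage continuous_snd)
  · rw [borSubset_eq, borSubset_eq, borSubset_eq, img_union, ← Set.preimage_union]
  · rw [borSubset_eq, borSubset_eq, borSubset_eq, img_inter hL.snd hK.snd, Set.preimage_inter]

end BorelMap

/-! ### The Thom isomorphism for a representation -/

section Thom

open Module

variable (V : Type) [NormedAddCommGroup V] [NormedSpace ℝ V]
  [DistribMulAction Circle V] [ContinuousSMul Circle V]

lemma inv_nonzero : Inv ({0}ᶜ : Set V) := fun z p hp => by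
  simpa [smul_eq_zero_iff_eq] using hp

/-- The pairs `(e, v)` with `v ≠ 0` or `e_i ≠ 0` for some `i < j`. -/
def stageSet (j : ℕ) : Set (ET × V) := {p | (∃ i < j, p.1.vec i ≠ 0) ∨ p.2 ≠ 0}

lemma isOpen_coord (i : ℕ) : IsOpen {p : ET × V | p.1.vec i ≠ 0} :=
  isOpen_ne_fun ((continuous_vec i).comp continuous_fst) continuous_const

lemma inv_coord (i : ℕ) : Inv {p : ET × V | p.1.vec i ≠ 0} := fun z p hp =>
  mul_ne_zero (Circle.coe_ne_zero z) hp

lemma isOpen_stageSet (j : ℕ) : IsOpen (stageSet V j) := by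
  have : stageSet V j = (⋃ i, ⋃ (_ : i < j), {p : ET × V | p.1.vec i ≠ 0}) ∪ {p | p.2 ≠ 0} := by
    ext p
    simp [stageSet]
  rw [this]
  exact (isOpen_iUnion fun i => isOpen_iUnion fun _ => isOpen_coord V i).union
    (isOpen_ne_fun continuous_snd continuous_const)

lemma inv_stageSet (j : ℕ) : Inv (stageSet V j) := fun z p hp => by
  rcases hp with ⟨i, hi, h⟩ | h
  · exact Or.inl ⟨i, hi, inv_coord V i z p h⟩
  · exact Or.inr (inv_nonzero V z p.2 h)

lemma monotone_stageSet : Monotone (stageSet V) := fun i j hij p hp => by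
  rcases hp with ⟨a, ha, h⟩ | h
  · exact Or.inl ⟨a, ha.trans_le hij, h⟩
  · exact Or.inr h

lemma img_stageSet_zero : img (stageSet V 0) = borSubset V {0}ᶜ := by
  rw [borSubset_eq]
  congr 1
  ext p
  simp [stageSet]

lemma iUnion_stageSet : ⋃ j, img (stageSet V (j + 1)) = Set.univ := by
  refine Set.eq_univ_of_forall fun x => ?_
  obtain ⟨p, rfl⟩ := Bor.mk_surjective x
  obtain ⟨i, hi⟩ : ∃ i, p.1.vec i ≠ 0 := by
    by_contra! h
    exact p.1.vec_ne_zero (Finsupp.ext h)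
  exact Set.mem_iUnion.2 ⟨i, p, Or.inl ⟨i, Nat.lt_succ_self i, hi⟩, rfl⟩

/-- The sequence `(w, 1, 0, 0, …)`. -/
def tailVec {j : ℕ} (w : Fin j → ℂ) : ℕ →₀ ℂ :=
  Finsupp.onFinset (Finset.range (j + 1))
    (fun i => if h : i < j then w ⟨i, h⟩ else if i = j then 1 else 0) fun i hi => by
      by_contra h
      rw [Finset.mem_range] at h
      rw [dif_neg (by omega), if_neg (by omega)] at hi
      exact hi rfl

lemma tailVec_lt {j : ℕ} (w : Fin j → ℂ) (i : Fin j) : tailVec w i = w i := by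
  simp [tailVec]

lemma tailVec_self {j : ℕ} (w : Fin j → ℂ) : tailVec w j = 1 := by
  simp [tailVec]

lemma tailVec_gt {j : ℕ} (w : Fin j → ℂ) {i : ℕ} (hi : j < i) : tailVec w i = 0 := by
  simp [tailVec, hi.not_gt, hi.ne']

lemma tailVec_ne_zero {j : ℕ} (w : Fin j → ℂ) : tailVec w ≠ 0 := fun h => by
  have := tailVec_self w
  rw [h] at this
  simp at this

lemma continuous_tailVec {j : ℕ} (i : ℕ) : Continuous fun w : Fin j → ℂ => tailVec w i := by
  rcases lt_trichotomy i j with h | rfl | h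
  · exact (continuous_apply (⟨i, h⟩ : Fin j)).congr fun w => (tailVec_lt w ⟨i, h⟩).symm
  · simpa only [tailVec_self] using continuous_const
  · simpa only [tailVec_gt _ h] using continuous_const

lemma continuous_normalize_tailVec (j : ℕ) :
    Continuous fun w : Fin j → ℂ => ET.normalize (tailVec w) :=
  continuousOn_univ.1 (ET.continuousOn_normalize₀ (fun w _ => tailVec_ne_zero w) (j + 1)
    (fun w _ i hi => tailVec_gt w hi) fun i => (continuous_tailVec i).continuousOn)

/-- The slice in the part of `E𝕋 × V` where the coordinate `e_j` does not vanish. -/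
def coordSlice (j : ℕ) : Set (ET × V) := {p | p.1.vec j ≠ 0 ∧ direction (p.1.vec j) = 1}

lemma mem_coordSlice {j : ℕ} {p : ET × V} :
    p ∈ coordSlice V j ↔ ∃ r : ℝ, 0 < r ∧ p.1.vec j = r := by
  constructor
  · rintro ⟨h, h'⟩
    exact ⟨_, norm_pos_iff.2 h, (direction_eq_one h).1 h'⟩
  · rintro ⟨r, hr, h⟩
    refine ⟨by rw [h]; exact_mod_cast hr.ne', ?_⟩
    rw [h, direction_ofReal hr]

lemma sqrt_inv_pos {v : ℕ →₀ ℂ} (h : v ≠ 0) : 0 < (Real.sqrt (normSum v))⁻¹ :=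
  inv_pos.2 (Real.sqrt_pos.2 (normSum_pos h))

lemma vec_normalize_ne_zero {v : ℕ →₀ ℂ} (h : v ≠ 0) {i : ℕ} :
    (ET.normalize v).vec i ≠ 0 ↔ v i ≠ 0 := by
  rw [ET.vec_normalize h, mul_ne_zero_iff]
  exact and_iff_right (by exact_mod_cast (sqrt_inv_pos h).ne')

lemma normalize_mem_slice {v : ℕ →₀ ℂ} {j : ℕ} {r : ℝ} (hr : 0 < r) (h : v j = r) (x : V) :
    (ET.normalize v, x) ∈ coordSlice V j := by
  have hv : v ≠ 0 := fun h' => by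
    rw [h', Finsupp.zero_apply] at h
    exact hr.ne (by exact_mod_cast h)
  rw [mem_coordSlice]
  refine ⟨_, mul_pos (sqrt_inv_pos hv) hr, ?_⟩
  rw [ET.vec_normalize hv, h, Complex.ofReal_mul]

lemma pairMap_coordSlice (j : ℕ) :
    PairMap (fun p : (Fin j → ℂ) × V => (ET.normalize (tailVec p.1), p.2)) Set.univ {0}ᶜ
      (coordSlice V j) (coordSlice V j ∩ stageSet V j) where
  cont := (((continuous_normalize_tailVec j).comp continuous_fst).prodMk continuous_snd).continuousOn
  sub := Set.subset_univ _
  maps p _ := normalize_mem_slice V one_pos (by rw [tailVec_self]; simp) p.2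
  maps' p hp := by
    refine ⟨normalize_mem_slice V one_pos (by rw [tailVec_self]; simp) p.2, ?_⟩
    by_cases h : p.2 = 0
    · left
      have h1 : p.1 ≠ 0 := fun h1 => hp (Prod.ext h1 h)
      obtain ⟨i, hi⟩ := Function.ne_iff.1 h1
      refine ⟨i, i.2, (vec_normalize_ne_zero (tailVec_ne_zero _)).2 ?_⟩
      rwa [tailVec_lt]
    · exact Or.inr h

/-- Where `e_j` is positive, one may move linearly to the vector with the same coordinates below
`j`, coordinate `1` at `j` and zeros beyond, and normalize. Coordinate `j` stays positive and the
coordinates below `j` change only by a positive factor, so the homotopy respects the subset defined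
by these coordinates and by `v ≠ 0`. -/
lemma coordSlice_iso (j n : ℕ) : (pairMap_coordSlice V j).Iso n := by
  have hc : Continuous fun p : ET × V => ((fun i : Fin j => p.1.vec i), p.2) :=
    (continuous_pi fun i : Fin j => (continuous_vec i).comp continuous_fst).prodMk continuous_snd
  have hψ : PairMap (fun p : ET × V => ((fun i : Fin j => p.1.vec i), p.2)) (coordSlice V j)
      (coordSlice V j ∩ stageSet V j) Set.univ {0}ᶜ := by
    refine ⟨hc.continuousOn, Set.inter_subset_left, fun _ _ => trivial, ?_⟩
    rintro p ⟨-, ⟨i, hi, h⟩ | h⟩ h0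
    · exact h (congrFun (congrArg Prod.fst h0) ⟨i, hi⟩)
    · exact h (congrArg Prod.snd h0)
  let F : ET × unitInterval → ℕ →₀ ℂ := fun p =>
    ((p.2 : ℝ) : ℂ) • p.1.vec + ((1 - (p.2 : ℝ) : ℝ) : ℂ) • tailVec fun i : Fin j => p.1.vec i
  have hFlt : ∀ p (i : Fin j), F p i = p.1.vec i := fun p i => by
    simp only [F, Finsupp.add_apply, Finsupp.smul_apply, tailVec_lt, smul_eq_mul]
    push_cast
    ring
  have hFj : ∀ p, F p j = ((p.2 : ℝ) : ℂ) * p.1.vec j + ((1 - (p.2 : ℝ) : ℝ) : ℂ) := fun p => by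
    simp only [F, Finsupp.add_apply, Finsupp.smul_apply, tailVec_self, smul_eq_mul, mul_one]
  have hFslice : ∀ (p : ET × V) (s : unitInterval), p ∈ coordSlice V j →
      ∃ r : ℝ, 0 < r ∧ F (p.1, s) j = r := fun p s hp => by
    obtain ⟨r, hr, h⟩ := (mem_coordSlice V).1 hp
    refine ⟨s * r + (1 - s), ?_, ?_⟩
    · have h0 := s.2.1
      have h1 := s.2.2
      rcases h0.eq_or_lt with h2 | h2
      · rw [← h2]
        norm_num
      · nlinarith [mul_pos h2 hr]
    · rw [hFj, h]
      push_cast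
      ring
  let O : Set (ET × unitInterval) := {p | F p j ≠ 0}
  have hcF : ∀ i, Continuous fun p => F p i := fun i => by
    simp only [F, Finsupp.add_apply, Finsupp.smul_apply, smul_eq_mul]
    have h1 := (continuous_vec i).comp (continuous_fst (X := ET) (Y := unitInterval))
    have h2 : Continuous fun p : ET × unitInterval => ((p.2 : ℝ) : ℂ) :=
      Complex.continuous_ofReal.comp (continuous_subtype_val.comp continuous_snd)
    have h3 : Continuous fun p : ET × unitInterval => ((1 - (p.2 : ℝ) : ℝ) : ℂ) :=
      Complex.continuous_ofReal.comp (continuous_const.sub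
        (continuous_subtype_val.comp continuous_snd))
    exact (h2.mul h1).add (h3.mul ((continuous_tailVec i).comp (continuous_pi fun i =>
      (continuous_vec i).comp continuous_fst)))
  have hO : IsOpen O := isOpen_ne_fun (hcF j) continuous_const
  have hN : ContinuousOn (fun p => ET.normalize (F p)) O := by
    refine ET.continuousOn_normalize hO (fun p hp h => hp (by rw [h]; rfl)) (fun N =>
      ⟨max N (j + 1), fun p hp i hi => ?_⟩) hcF
    simp only [F, Finsupp.add_apply, Finsupp.smul_apply, hp i ((le_max_left _ _).trans hi),
      tailVec_gt _ ((le_max_right _ _).trans hi : j < i), smul_zero, add_zero]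
  refine PairMap.Iso.of_homotopy_inverse (pairMap_coordSlice V j) hψ ?_ ?_ n
  -- The composite multiplies the vector in `ℂ^j` by this normalizing factor; linear interpolation
  -- between it and `1` stays positive.
  · let c : (Fin j → ℂ) × V → ℝ := fun p => (Real.sqrt (normSum (tailVec p.1)))⁻¹
    have hcc : Continuous c := by
      refine Continuous.inv₀ (Continuous.sqrt ?_) fun p =>
        (Real.sqrt_pos.2 (normSum_pos (tailVec_ne_zero _))).ne'
      have : ∀ p : (Fin j → ℂ) × V, normSum (tailVec p.1) =
          ∑ i ∈ Finset.range (j + 1), ‖tailVec p.1 i‖ ^ 2 := fun p =>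
        normSum_eq fun i hi => tailVec_gt _ hi
      simp only [this]
      exact continuous_finset_sum _ fun i _ => ((continuous_tailVec i).comp continuous_fst).norm.pow 2
    refine ⟨fun q => (((1 - (q.2 : ℝ)) * c q.1 + q.2 : ℝ) • q.1.1, q.1.2), ?_, fun _ _ => trivial,
      ?_, fun p _ => ?_, fun p _ => ?_⟩
    · exact Continuous.continuousOn (by fun_prop)
    · rintro ⟨p, s⟩ ⟨hp, -⟩ (h0 : (_, _) = (0 : (Fin j → ℂ) × V))
      have h5 : p.2 = 0 := congrArg Prod.snd h0
      refine hp (Prod.ext ?_ h5)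
      have h1 := congrArg Prod.fst h0
      refine (smul_eq_zero.1 h1).resolve_left (ne_of_gt ?_)
      have hc0 : 0 < c p := sqrt_inv_pos (tailVec_ne_zero _)
      have h2 := s.2.1
      have h3 := s.2.2
      change 0 < (1 - (s : ℝ)) * c p + s
      rcases h2.eq_or_lt with h4 | h4
      · rw [← h4]
        linarith
      · nlinarith [mul_nonneg (sub_nonneg.2 h3) hc0.le]
    · refine Prod.ext (funext fun i => ?_) rfl
      simp only [Set.Icc.coe_zero, sub_zero, one_mul, add_zero, Function.comp_apply, Pi.smul_apply]
      rw [ET.vec_normalize (tailVec_ne_zero _), tailVec_lt]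
      simp [c]
    · simp
  · refine ⟨fun q => (ET.normalize (F (q.1.1, q.2)), q.1.2), ?_, ?_, ?_, fun p hp => ?_,
      fun p hp => ?_⟩
    · refine ContinuousOn.prodMk (hN.comp (by fun_prop) ?_) (by fun_prop)
      rintro ⟨p, s⟩ ⟨hp, -⟩
      obtain ⟨r, hr, h⟩ := hFslice p s hp
      change F (p.1, s) j ≠ 0
      rw [h]
      exact_mod_cast hr.ne'
    · rintro ⟨p, s⟩ ⟨hp, -⟩
      obtain ⟨r, hr, h⟩ := hFslice p s hp
      exact normalize_mem_slice V hr h _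
    · rintro ⟨p, s⟩ ⟨⟨hp, h'⟩, -⟩
      obtain ⟨r, hr, h⟩ := hFslice p s hp
      refine ⟨normalize_mem_slice V hr h _, ?_⟩
      rcases h' with ⟨i, hi, h'⟩ | h'
      · refine Or.inl ⟨i, hi, (vec_normalize_ne_zero fun h0 => ?_).2 ?_⟩
        · rw [h0, Finsupp.zero_apply] at h
          exact hr.ne (by exact_mod_cast h)
        · rw [hFlt _ ⟨i, hi⟩]
          exact h'
      · exact Or.inr h'
    · simp [F]
    · refine Prod.ext (ET.normalize_eq one_pos ?_) rfl
      simp [F]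

lemma pairMap_stage (j : ℕ) :
    PairMap (fun p : (Fin j → ℂ) × V => Bor.mk (ET.normalize (tailVec p.1), p.2)) Set.univ {0}ᶜ
      (img (stageSet V (j + 1))) (img (stageSet V j)) := by
  have h := pairMap_coordSlice V j
  refine ⟨Bor.continuous_mk.comp_continuousOn h.cont, h.sub, fun p hp => ⟨_, ?_, rfl⟩,
    fun p hp => ⟨_, (h.maps' hp).2, rfl⟩⟩
  exact Or.inl ⟨j, Nat.lt_succ_self j, (h.maps hp).1⟩

/-- The layers of the filtration by stages. -/
lemma stage_iso (j n : ℕ) : (pairMap_stage V j).Iso n := by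
  -- All points added at this stage have `e_j ≠ 0`, so the layer can be excised to this open set.
  -- There the action is free, with the direction of `e_j` as angle and `coordSlice` as slice.
  set O : Set (ET × V) := {p | p.1.vec j ≠ 0} with hO
  have hOi : Inv O := inv_coord V j
  have hun : O ∪ stageSet V j = stageSet V (j + 1) := by
    ext p
    constructor
    · rintro (h | ⟨i, hi, h⟩ | h)
      · exact Or.inl ⟨j, Nat.lt_succ_self j, h⟩
      · exact Or.inl ⟨i, hi.trans (Nat.lt_succ_self j), h⟩
      · exact Or.inr h
    · rintro (⟨i, hi, h⟩ | h)
      · rcases Nat.lt_succ_iff_lt_or_eq.1 hi with hi | rfl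
        · exact Or.inr (Or.inl ⟨i, hi, h⟩)
        · exact Or.inl h
      · exact Or.inr (Or.inr h)
  have h1 : PairMap Bor.mk {p ∈ O | direction (p.1.vec j) = 1}
      {p ∈ O ∩ stageSet V j | direction (p.1.vec j) = 1} (img O) (img (O ∩ stageSet V j)) :=
    ⟨Bor.continuous_mk.continuousOn, fun p hp => ⟨hp.1.1, hp.2⟩, fun p hp => ⟨p, hp.1, rfl⟩,
      fun p hp => ⟨p, hp.1, rfl⟩⟩
  have i1 : h1.Iso n := by
    refine slice_iso (θ := fun p => direction (p.1.vec j)) hOi (hOi.inter (inv_stageSet V j))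
      Set.inter_subset_left ?_ (fun z p hp => direction_mul z hp) h1 n
    exact continuousOn_direction.comp ((continuous_vec j).comp continuous_fst).continuousOn
      fun p hp => hp
  have e : {p ∈ O ∩ stageSet V j | direction (p.1.vec j) = 1} = coordSlice V j ∩ stageSet V j := by
    ext p
    exact ⟨fun h => ⟨⟨h.1.1, h.2⟩, h.1.2⟩, fun h => ⟨⟨h.1.1, h.2⟩, h.1.2⟩⟩
  have h2 : PairMap Bor.mk (coordSlice V j) (coordSlice V j ∩ stageSet V j) (img O)
      (img (O ∩ stageSet V j)) := e ▸ h1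
  have i2 : h2.Iso n := by
    revert h2
    rw [← e]
    exact fun _ => i1
  have h3 : PairMap id (img O) (img (O ∩ stageSet V j)) (img (stageSet V (j + 1)))
      (img (stageSet V j)) :=
    PairMap.id (img_mono Set.inter_subset_left) (img_mono (hun ▸ Set.subset_union_left))
      (img_mono Set.inter_subset_right)
  have i3 : h3.Iso n := excision_iso (isOpen_img (isOpen_coord V j))
    (isOpen_img (isOpen_stageSet V j)) (by rw [img_union, hun])
    (img_inter hOi (inv_stageSet V j)) n h3
  exact PairMap.Iso.comp (hψ := h3) (hφ := h2.comp (pairMap_coordSlice V j)) i3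
    (PairMap.Iso.comp (hψ := h2) (hφ := pairMap_coordSlice V j) i2 (coordSlice_iso V j n))

variable [FiniteDimensional ℝ V]

lemma sphereLike_stage (j : ℕ) :
    SphereLike (2 * j + finrank ℝ V) (img (stageSet V (j + 1))) (img (stageSet V j)) := by
  refine SphereLike.of_iso (h := pairMap_stage V j) (stage_iso V j)
    (sphereLike_finrank _ ((Fin j → ℂ) × V) ?_)
  rw [finrank_prod, finrank_pi_fintype]
  simp
  ring

lemma img_stageSet_mono {i j : ℕ} (h : i ≤ j) : img (stageSet V i) ⊆ img (stageSet V j) :=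
  img_mono (monotone_stageSet V h)

/-- The layers after the first have cohomology only in degrees `2j + dim V` with `j ≥ 1`, hence at
least `dim V + 2`. The bound on `m` also covers the degree below that is needed for the infinite
union. -/
lemma van_stageSet_one {m : ℕ} (hm : m ≤ finrank ℝ V + 1) :
    Van m Set.univ (img (stageSet V 1)) := by
  have h : ∀ j l, l ≤ finrank ℝ V + 1 → Van l (img (stageSet V (j + 1))) (img (stageSet V 1)) := by
    intro j l hl
    induction j with
    | zero => exact van_self l _
    | succ j ih =>
      exact Van.trans (img_stageSet_mono V (by omega)) (img_stageSet_mono V (by omega))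
        ((sphereLike_stage V (j + 1)).1 l (by omega)) ih
  rw [← iUnion_stageSet V]
  exact van_iUnion (fun j => isOpen_img (isOpen_stageSet V _))
    (fun i j hij => img_stageSet_mono V (by omega)) (subset_refl _) (fun j => h j m hm)
    fun j l hl => h j l (by omega)

/-- Vanishing below the dimension of the representation. -/
lemma van_thom {m : ℕ} (hm : m < finrank ℝ V) : Van m Set.univ (borSubset V {0}ᶜ) := by
  rw [← img_stageSet_zero]
  exact Van.trans (Set.subset_univ _) (img_stageSet_mono V (Nat.zero_le 1))
    (van_stageSet_one V (by omega)) ((sphereLike_stage V 0).1 m (by omega))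

lemma pairMap_fibre {X : Type} [TopologicalSpace X] [MulAction Circle X] (S : Set X) :
    PairMap (fun x => Bor.mk (ET.basis 0, x)) Set.univ S Set.univ (borSubset X S) :=
  ⟨(Bor.continuous_mk.comp (by fun_prop)).continuousOn, Set.subset_univ _, fun _ _ => trivial,
    fun x hx => ⟨_, x, hx, rfl⟩⟩

/-- Restriction to the fibre is an isomorphism up to the dimension of the representation. -/
lemma thom_iso {m : ℕ} (hm : m ≤ finrank ℝ V) : (pairMap_fibre ({0}ᶜ : Set V)).Iso m := by
  have h1 : PairMap (fun v : V => ((Fin.elim0 : Fin 0 → ℂ), v)) Set.univ {0}ᶜ Set.univ {0}ᶜ :=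
    ⟨by fun_prop, Set.subset_univ _, fun _ _ => trivial, fun v hv h => hv (congrArg Prod.snd h)⟩
  have h1' : PairMap (Prod.snd : (Fin 0 → ℂ) × V → V) Set.univ {0}ᶜ Set.univ {0}ᶜ :=
    ⟨by fun_prop, Set.subset_univ _, fun _ _ => trivial, fun v hv h =>
      hv (Prod.ext (Subsingleton.elim _ _) h)⟩
  have i1 : h1.Iso m := PairMap.Iso.of_inverse h1 h1' (fun _ _ => rfl)
    (fun _ _ => Prod.ext (Subsingleton.elim _ _) rfl) m
  -- For `j = 0` the model `ℂ^j × V` of the layer is `V` itself, embedded as the fibre over the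
  -- first basis vector.
  have i2 := PairMap.Iso.comp (hψ := pairMap_stage V 0) (stage_iso V 0 m) i1
  have h3 : PairMap id (img (stageSet V 1)) (img (stageSet V 0)) Set.univ (img (stageSet V 0)) :=
    resMap (Set.subset_univ _) (img_stageSet_mono V (Nat.zero_le 1))
  have i3 : h3.Iso m := res_iso (Set.subset_univ _) (img_stageSet_mono V (Nat.zero_le 1)) (van_stageSet_one V (by omega)) (van_stageSet_one V (by omega))
  have i4 := PairMap.Iso.comp (hψ := h3) i3 i2
  have h5 : PairMap (fun v : V => Bor.mk (ET.basis 0, v)) Set.univ {0}ᶜ Set.univ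
      (img (stageSet V 0)) := by
    rw [img_stageSet_zero]
    exact pairMap_fibre _
  have i5 : h5.Iso m := PairMap.Iso.congr (fun v _ => ?_) i4
  · revert h5
    rw [img_stageSet_zero]
    exact fun _ i => i
  · refine congrArg (fun e => Bor.mk (e, v)) (ET.normalize_eq one_pos ?_)
    ext i
    rcases Nat.eq_zero_or_pos i with rfl | hi
    · simp [tailVec_self, ET.basis]
    · simp [tailVec_gt _ hi, ET.basis, hi.ne]

/-- The inclusion of `V` into `V × ℂ`. -/
def addLine : TMap V (V × ℂ) where
  map := ⟨fun v => (v, 0), by fun_prop⟩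
  equivariant z v := Prod.ext rfl (smul_zero z).symm

lemma pairMap_addLine : PairMap (Bor.map (addLine V)) Set.univ (borSubset V {0}ᶜ) Set.univ
    (borSubset (V × ℂ) {0}ᶜ) :=
  pairMap_bor _ fun _ hv h => hv (congrArg Prod.fst h)

/-- Adding a complex line does not change the equivariant cohomology in high degrees. -/
lemma addLine_iso {m : ℕ} (hm : finrank ℝ V + 2 ≤ m) : (pairMap_addLine V).Iso m := by
  set K : Set (V × ℂ) := {p | p.1 ≠ 0} with hK
  set L : Set (V × ℂ) := {p | p.2 ≠ 0} with hL
  have hKi : Inv K := fun z p hp => inv_nonzero V z p.1 hp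
  have hLi : Inv L := fun z p hp => mul_ne_zero (Circle.coe_ne_zero z) hp
  have hKo : IsOpen K := isOpen_ne_fun continuous_fst continuous_const
  have hLo : IsOpen L := isOpen_ne_fun continuous_snd continuous_const
  have hLK : L ∪ K = {0}ᶜ := by
    ext p
    simp only [hK, hL, Set.mem_union, Set.mem_setOf_eq, Set.mem_compl_iff, Set.mem_singleton_iff,
      Prod.ext_iff, Prod.fst_zero, Prod.snd_zero, ne_eq]
    tauto
  have hsub : borSubset (V × ℂ) K ⊆ borSubset (V × ℂ) {0}ᶜ := by
    rw [borSubset_eq, borSubset_eq, ← hLK]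
    exact img_mono fun p hp => Or.inr hp
  -- The circle acts freely on `L`, with slice the vectors whose coordinate in `ℂ` is positive, that
  -- is, `V × (0, ∞)`. So `(L, L ∩ K)` has equivariant cohomology in degree `dim V` only.
  have hs1 : SphereLike (finrank ℝ V) {p ∈ L | direction p.2 = 1} {p ∈ L ∩ K | direction p.2 = 1} := by
    have h1 : PairMap (fun v : V => (v, (1 : ℂ))) Set.univ {0}ᶜ {p ∈ L | direction p.2 = 1}
        {p ∈ L ∩ K | direction p.2 = 1} := by
      have : direction 1 = 1 := by simpa using direction_ofReal one_pos
      exact ⟨by fun_prop, Set.subset_univ _, fun v _ => ⟨one_ne_zero, this⟩,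
        fun v hv => ⟨⟨one_ne_zero, hv⟩, this⟩⟩
    have h2 : PairMap (Prod.fst : V × ℂ → V) {p ∈ L | direction p.2 = 1}
        {p ∈ L ∩ K | direction p.2 = 1} Set.univ {0}ᶜ :=
      ⟨by fun_prop, fun p hp => ⟨hp.1.1, hp.2⟩, fun _ _ => trivial, fun p hp => hp.1.2⟩
    refine SphereLike.of_iso (h := h1) (fun n => ?_) (sphereLike_finrank _ V rfl)
    refine PairMap.Iso.of_homotopy_inverse h1 h2 (PairHomotopic.of_eqOn (h2.comp h1) fun _ _ => rfl)
      ⟨fun q => (q.1.1, ((q.2 : ℝ) : ℂ) * q.1.2 + ((1 - (q.2 : ℝ) : ℝ) : ℂ)), ?_, ?_, ?_, ?_, ?_⟩ n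
    · exact Continuous.continuousOn (by fun_prop)
    all_goals
      have key : ∀ (w : ℂ) (s : unitInterval), w ≠ 0 → direction w = 1 →
          ((s : ℝ) : ℂ) * w + ((1 - (s : ℝ) : ℝ) : ℂ) ≠ 0 ∧
          direction (((s : ℝ) : ℂ) * w + ((1 - (s : ℝ) : ℝ) : ℂ)) = 1 := by
        intro w s hw hd
        have h3 : 0 < (s : ℝ) * ‖w‖ + (1 - s) := by
          have h4 := s.2.1
          have h5 := s.2.2
          have h6 := norm_pos_iff.2 hw
          rcases h4.eq_or_lt with h7 | h7
          · rw [← h7]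
            norm_num
          · nlinarith [mul_pos h7 h6]
        have h4 : ((s : ℝ) : ℂ) * w + ((1 - (s : ℝ) : ℝ) : ℂ) = (((s : ℝ) * ‖w‖ + (1 - s) : ℝ) : ℂ) := by
          rw [(direction_eq_one hw).1 hd]
          simp
        rw [h4]
        exact ⟨by exact_mod_cast h3.ne', direction_ofReal h3⟩
    · rintro ⟨p, s⟩ ⟨⟨h3, h4⟩, -⟩
      exact key p.2 s h3 h4
    · rintro ⟨p, s⟩ ⟨⟨⟨h3, h5⟩, h4⟩, -⟩
      exact ⟨⟨(key p.2 s h3 h4).1, h5⟩, (key p.2 s h3 h4).2⟩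
    · intro p _
      simp
    · intro p _
      simp
  have hs2 : SphereLike (finrank ℝ V) (borSubset (V × ℂ) L) (borSubset (V × ℂ) (L ∩ K)) := by
    have h1 : PairMap (fun x : V × ℂ => Bor.mk (ET.basis 0, x)) {p ∈ L | direction p.2 = 1}
        {p ∈ L ∩ K | direction p.2 = 1} (borSubset _ L) (borSubset _ (L ∩ K)) :=
      ⟨(pairMap_fibre L).cont.mono (Set.subset_univ _), fun p hp => ⟨hp.1.1, hp.2⟩,
        fun p hp => ⟨_, p, hp.1, rfl⟩, fun p hp => ⟨_, p, hp.1, rfl⟩⟩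
    refine SphereLike.of_iso (h := h1) (fun n => ?_) hs1
    have hθ : ContinuousOn (fun p : V × ℂ => direction p.2) L :=
      continuousOn_direction.comp continuous_snd.continuousOn fun p hp => hp
    have he : ∀ z : Circle, ∀ p ∈ L, direction (z • p).2 = z * direction p.2 := fun z p hp =>
      direction_mul z hp
    exact free_iso hLi (hLi.inter hKi) Set.inter_subset_left hθ he h1 n
  have hs3 : SphereLike (finrank ℝ V) (borSubset (V × ℂ) {0}ᶜ) (borSubset (V × ℂ) K) := by
    have h1 : PairMap id (borSubset (V × ℂ) L) (borSubset (V × ℂ) (L ∩ K))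
        (borSubset (V × ℂ) {0}ᶜ) (borSubset (V × ℂ) K) := by
      simp only [borSubset_eq]
      exact PairMap.id (img_mono fun p hp => hp.1) (img_mono fun p hp => hLK ▸ Or.inl hp)
        (img_mono fun p hp => hp.2)
    refine SphereLike.of_iso (h := h1) (fun n => ?_) hs2
    exact bor_excision_iso hLo hKo hLi hKi hLK rfl n h1
  obtain ⟨m, rfl⟩ : ∃ i, m = i + 1 := ⟨m - 1, by omega⟩
  -- The degrees `m` and `m + 1` both exceed `dim V`, so the complement of `0` may be replaced by
  -- `K`. Contracting the factor `ℂ` then identifies the pair with `(V, V ∖ 0)`.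
  have i1 : (relMap (Set.subset_univ _) hsub).Iso (m + 1) :=
    rel_iso_succ (Set.subset_univ _) hsub (hs3.1 m (by omega)) (hs3.1 (m + 1) (by omega))
  have h2 : PairMap (Bor.map (addLine V)) Set.univ (borSubset V {0}ᶜ) Set.univ
    (borSubset (V × ℂ) K) := pairMap_bor _ fun _ hv => hv
  let pr : TMap (V × ℂ) V := ⟨⟨Prod.fst, continuous_fst⟩, fun _ _ => rfl⟩
  have h3 : PairMap (Bor.map pr) Set.univ (borSubset (V × ℂ) K) Set.univ (borSubset V {0}ᶜ) :=
    pairMap_bor _ fun _ hv => hv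
  have i2 : h2.Iso (m + 1) := by
    refine PairMap.Iso.of_homotopy_inverse h2 h3 (PairHomotopic.of_eqOn (h3.comp h2) fun x _ => ?_)
      ?_ _
    · obtain ⟨p, rfl⟩ := Bor.mk_surjective x
      rfl
    · rw [← img_univ, borSubset_eq]
      refine pairHomotopic_of_mk (H := fun q => Bor.mk (q.1.1, (q.1.2.1, ((q.2 : ℝ) : ℂ) * q.1.2.2)))
        inv_univ (fun z p _ s => ?_) (Continuous.continuousOn (Bor.continuous_mk.comp (by fun_prop)))
        (Set.subset_univ _) (fun p _ s => ⟨_, trivial, rfl⟩)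
        (fun p hp s => ⟨(p.1, (p.2.1, ((s : ℝ) : ℂ) * p.2.2)), hp, rfl⟩)
        (fun p _ => ?_) (fun p _ => ?_)
      · refine Eq.trans (congrArg Bor.mk ?_) (Bor.mk_smul z _)
        refine Prod.ext rfl (Prod.ext rfl ?_)
        change ((s : ℝ) : ℂ) * (z * p.2.2) = z * (((s : ℝ) : ℂ) * p.2.2)
        ring
      · simp
        rfl
      · simp
  exact PairMap.Iso.comp (hψ := relMap (Set.subset_univ _) hsub) (hφ := h2) i1 i2

end Thom


/-! ### The representations `ℝ^l ⊕ ℂ^h` -/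

section Representations

open Module

variable (l h : ℕ)

/-- The representation `ℝ^l ⊕ ℂ^h` of the circle. -/
def Rep : Type := EuclideanSpace ℝ (Fin l) × EuclideanSpace ℂ (Fin h)

instance : NormedAddCommGroup (Rep l h) :=
  inferInstanceAs (NormedAddCommGroup (EuclideanSpace ℝ (Fin l) × EuclideanSpace ℂ (Fin h)))

instance : NormedSpace ℝ (Rep l h) :=
  inferInstanceAs (NormedSpace ℝ (EuclideanSpace ℝ (Fin l) × EuclideanSpace ℂ (Fin h)))

instance : FiniteDimensional ℝ (Rep l h) :=
  inferInstanceAs (FiniteDimensional ℝ (EuclideanSpace ℝ (Fin l) × EuclideanSpace ℂ (Fin h)))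

instance : DistribMulAction Circle (Rep l h) where
  smul := repSMul
  one_smul v := Prod.ext rfl (one_smul Circle v.2)
  mul_smul z w v := Prod.ext rfl (mul_smul z w v.2)
  smul_zero z := Prod.ext rfl (smul_zero z)
  smul_add z v w := Prod.ext rfl (smul_add z v.2 w.2)

instance : ContinuousSMul Circle (Rep l h) where
  continuous_smul := by
    have h : Continuous fun p : Circle × (EuclideanSpace ℝ (Fin l) × EuclideanSpace ℂ (Fin h)) =>
        (p.2.1, p.1 • p.2.2) := by fun_prop
    exact h

lemma Rep.finrank : finrank ℝ (Rep l h) = l + 2 * h := by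
  change Module.finrank ℝ (EuclideanSpace ℝ (Fin l) × EuclideanSpace ℂ (Fin h)) = _
  rw [finrank_prod, finrank_euclideanSpace_fin, ← finrank_mul_finrank ℝ ℂ (EuclideanSpace ℂ (Fin h)),
    finrank_euclideanSpace_fin, Complex.finrank_real_complex]

/-- The inclusion of the fixed points of the representation. -/
def Rep.incl : TMap (Rep l 0) (Rep l h) where
  map := ⟨fun v => (v.1, 0), by
    have h : Continuous fun v : EuclideanSpace ℝ (Fin l) × EuclideanSpace ℂ (Fin 0) =>
      (v.1, (0 : EuclideanSpace ℂ (Fin h))) := by fun_prop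
    exact h⟩
  equivariant z v := Prod.ext rfl (smul_zero z).symm

/-- The decomposition `ℝ^l ⊕ ℂ^(h+1) → (ℝ^l ⊕ ℂ^h) × ℂ`. -/
def Rep.split : TMap (Rep l (h + 1)) (Rep l h × ℂ) where
  map := ⟨fun v => ((v.1, WithLp.toLp 2 fun i => v.2 i.castSucc), v.2 (Fin.last h)), by
    have h : Continuous fun v : EuclideanSpace ℝ (Fin l) × EuclideanSpace ℂ (Fin (h + 1)) =>
      ((v.1, (WithLp.toLp 2 fun i => v.2 i.castSucc : EuclideanSpace ℂ (Fin h))),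
        v.2 (Fin.last h)) := by fun_prop
    exact h⟩
  equivariant z v := rfl

/-- The inverse of `Rep.split`. -/
def Rep.join : TMap (Rep l h × ℂ) (Rep l (h + 1)) where
  map := ⟨fun v => (v.1.1, WithLp.toLp 2 (Fin.snoc v.1.2 v.2)), by
    have h : Continuous fun v : (EuclideanSpace ℝ (Fin l) × EuclideanSpace ℂ (Fin h)) × ℂ =>
        (v.1.1, (WithLp.toLp 2 (Fin.snoc v.1.2 v.2) : EuclideanSpace ℂ (Fin (h + 1)))) := by
      refine (continuous_fst.comp continuous_fst).prodMk ((PiLp.continuous_toLp 2 _).comp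
        (continuous_pi fun i => ?_))
      refine Fin.lastCases ?_ (fun i => ?_) i
      · simp only [Fin.snoc_last]
        fun_prop
      · simp only [Fin.snoc_castSucc]
        fun_prop
    exact h⟩
  equivariant z v := Prod.ext rfl (PiLp.ext fun i => by
    refine Fin.lastCases ?_ (fun i => ?_) i
    · change Fin.snoc (α := fun _ => ℂ) _ (z • v.2) (Fin.last h) =
        z • Fin.snoc (α := fun _ => ℂ) _ v.2 (Fin.last h)
      rw [Fin.snoc_last, Fin.snoc_last]
    · change Fin.snoc (α := fun _ => ℂ) (fun i => (z • v.1.2) i) (z • v.2) i.castSucc =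
        z • Fin.snoc (α := fun _ => ℂ) (fun i => v.1.2 i) v.2 i.castSucc
      rw [Fin.snoc_castSucc, Fin.snoc_castSucc]
      rfl)

lemma pairMap_incl : PairMap (Bor.map (Rep.incl l h)) Set.univ (borSubset (Rep l 0) {0}ᶜ) Set.univ
    (borSubset (Rep l h) {0}ᶜ) :=
  pairMap_bor _ fun v hv h0 => by
    have h1 : v.1 = 0 := congrArg Prod.fst (Set.mem_singleton_iff.1 h0)
    exact hv (Prod.ext h1 (Subsingleton.elim _ _))

lemma Rep.split_join (v : Rep l h × ℂ) : (Rep.split l h).map ((Rep.join l h).map v) = v := by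
  refine Prod.ext (Prod.ext rfl (PiLp.ext fun i => ?_)) ?_
  · exact Fin.snoc_castSucc (α := fun _ => ℂ) _ _ _
  · exact Fin.snoc_last (α := fun _ => ℂ) _ _

lemma Rep.join_split (v : Rep l (h + 1)) : (Rep.join l h).map ((Rep.split l h).map v) = v := by
  refine Prod.ext rfl (PiLp.ext fun i => ?_)
  refine Fin.lastCases ?_ (fun i => ?_) i
  · exact Fin.snoc_last (α := fun _ => ℂ) _ _
  · exact Fin.snoc_castSucc (α := fun _ => ℂ) _ _ _

lemma Rep.join_zero : (Rep.join l h).map 0 = 0 := Rep.join_split l h 0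

/-- In degrees at least `l + 2 h`, restriction to the fixed points is an isomorphism. -/
lemma incl_rep_iso {m : ℕ} (hm : l + 2 * h ≤ m) : (pairMap_incl l h).Iso m := by
  induction h with
  | zero =>
    refine PairMap.Iso.congr (fun x _ => ?_) (borMap_iso
      (⟨ContinuousMap.id _, fun _ _ => rfl⟩ : TMap (Rep l 0) (Rep l 0))
      ⟨ContinuousMap.id _, fun _ _ => rfl⟩ (Set.mapsTo_id _)
      (Set.mapsTo_id _) (fun _ => rfl) (fun _ => rfl) m)
    obtain ⟨p, rfl⟩ := Bor.mk_surjective x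
    exact congrArg (fun v => Bor.mk (p.1, v)) (Prod.ext rfl (Subsingleton.elim _ _))
  | succ h ih =>
    have m1 : Set.MapsTo (Rep.join l h).map {0}ᶜ {0}ᶜ := fun v hv h0 => hv (by
      rw [Set.mem_singleton_iff] at h0 ⊢
      rw [← Rep.split_join l h v, h0]
      rfl)
    have m2 : Set.MapsTo (Rep.split l h).map {0}ᶜ {0}ᶜ := fun v hv h0 => hv (by
      rw [Set.mem_singleton_iff] at h0 ⊢
      rw [← Rep.join_split l h v, h0, Rep.join_zero])
    have i1 : (pairMap_bor (Rep.join l h) m1).Iso m := borMap_iso (Rep.join l h) (Rep.split l h) m1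
      m2 (Rep.split_join l h) (Rep.join_split l h) m
    -- One more complex line: the bound `l + 2(h + 1)` is exactly the dimension of the previous
    -- representation plus `2`.
    refine PairMap.Iso.congr (fun x _ => ?_) (PairMap.Iso.comp i1 (PairMap.Iso.comp
      (addLine_iso (Rep l h) (by rw [Rep.finrank]; omega)) (ih (by omega))))
    obtain ⟨p, rfl⟩ := Bor.mk_surjective x
    refine congrArg (fun v => Bor.mk (p.1, v)) (Prod.ext rfl (PiLp.ext fun i => ?_))
    refine Fin.lastCases ?_ (fun i => ?_) i
    · exact Fin.snoc_last (α := fun _ => ℂ) _ _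
    · exact Fin.snoc_castSucc (α := fun _ => ℂ) _ _ _

/-- The Thom class: in the degree of the dimension, restriction to the fibre is an isomorphism for
all coefficients, so the generator of the fibre lifts. -/
lemma exists_gen_rep : ∃ u : Coh ℤ (l + 2 * h) Set.univ (borSubset (Rep l h) {0}ᶜ), IsGen u := by
  obtain ⟨u, hu⟩ := (sphereLike_finrank _ (Rep l h) (Rep.finrank l h)).2
  have i := thom_iso (Rep l h) (m := l + 2 * h) (Rep.finrank l h).ge
  obtain ⟨w, rfl⟩ := (i ℤ).2 u
  exact ⟨w, IsGen.of_pull i hu⟩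

end Representations


/-! ### One-point compactifications of normed spaces -/

section OnePoint

open Filter Topology

variable {W : Type} [NormedAddCommGroup W]

/-- The function `1 / (1 + ‖v‖)` on the one-point compactification. -/
def invNorm (x : OnePoint W) : ℝ := x.elim 0 fun v => (1 + ‖v‖)⁻¹

lemma invNorm_coe (v : W) : invNorm (v : OnePoint W) = (1 + ‖v‖)⁻¹ := rfl

lemma invNorm_infty : invNorm (OnePoint.infty : OnePoint W) = 0 := rfl

lemma one_add_norm_pos (v : W) : 0 < 1 + ‖v‖ := by positivity

lemma invNorm_lt_one {x : OnePoint W} (h : x ≠ ((0 : W) : OnePoint W)) : invNorm x < 1 := by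
  induction x using OnePoint.rec with
  | infty => exact one_pos
  | coe v =>
    have hv : v ≠ 0 := fun hv => h (by rw [hv])
    exact inv_lt_one_of_one_lt₀ (lt_add_of_pos_right _ (norm_pos_iff.2 hv))

variable [ProperSpace W]

/-- Closed balls are compact, so `1 / (1 + ‖v‖)` measures the distance to infinity. Continuity at
infinity becomes a limit of real functions. -/
lemma tendsto_infty_of_invNorm {α : Type} {F : Filter α} {f : α → OnePoint W}
    (h : Tendsto (fun a => invNorm (f a)) F (𝓝 0)) : Tendsto f F (𝓝 OnePoint.infty) := by
  refine OnePoint.hasBasis_nhds_infty.tendsto_right_iff.2 ?_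
  rintro K ⟨-, hK⟩
  obtain ⟨R, hR⟩ := hK.isBounded.exists_norm_le
  have hR' : 0 < (1 + max R 0)⁻¹ := inv_pos.2 (by positivity)
  filter_upwards [h.eventually (gt_mem_nhds hR')] with a ha
  generalize f a = x at ha
  induction x using OnePoint.rec with
  | infty => exact Or.inr rfl
  | coe v =>
    refine Or.inl ⟨v, fun hv => ?_, rfl⟩
    have h1 := (inv_lt_inv₀ (one_add_norm_pos v) (by positivity)).1 ha
    have h2 := (hR v hv).trans (le_max_left R 0)
    linarith

lemma continuous_invNorm : Continuous (invNorm : OnePoint W → ℝ) := by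
  refine (OnePoint.continuous_iff _).2 ⟨?_, ?_⟩
  · rw [coclosedCompact_eq_cocompact]
    exact (tendsto_inv_atTop_zero.comp (tendsto_atTop_add_const_left _ 1
      (tendsto_norm_cocompact_atTop (E := W))))
  · exact Continuous.inv₀ (by fun_prop) fun v => (one_add_norm_pos v).ne'

variable [NormedSpace ℝ W]

open Classical in
/-- The deformation `v ↦ v / (1 - s)` of the complement of the origin to the point at infinity. -/
def expand (q : OnePoint W × unitInterval) : OnePoint W :=
  q.1.elim OnePoint.infty fun v =>
    if (q.2 : ℝ) = 1 then OnePoint.infty else (((1 - (q.2 : ℝ))⁻¹ • v : W) : OnePoint W)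

lemma expand_infty (s : unitInterval) : expand ((OnePoint.infty : OnePoint W), s) = OnePoint.infty :=
  rfl

lemma expand_one (x : OnePoint W) : expand (x, 1) = OnePoint.infty := by
  induction x using OnePoint.rec with
  | infty => rfl
  | coe v => exact if_pos rfl

lemma expand_coe (v : W) {s : unitInterval} (hs : (s : ℝ) ≠ 1) :
    expand ((v : OnePoint W), s) = (((1 - (s : ℝ))⁻¹ • v : W) : OnePoint W) := if_neg hs

lemma expand_zero (x : OnePoint W) : expand (x, 0) = x := by
  induction x using OnePoint.rec with
  | infty => rfl
  | coe v =>
    rw [expand_coe v (by simp)]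
    simp

lemma expand_ne_zero {x : OnePoint W} (hx : x ≠ ((0 : W) : OnePoint W)) (s : unitInterval) :
    expand (x, s) ≠ ((0 : W) : OnePoint W) := by
  induction x using OnePoint.rec with
  | infty => exact OnePoint.infty_ne_coe _
  | coe v =>
    by_cases hs : (s : ℝ) = 1
    · obtain rfl : s = 1 := Subtype.ext hs
      rw [expand_one]
      exact OnePoint.infty_ne_coe _
    · rw [expand_coe v hs]
      intro h
      have hv : v ≠ 0 := fun hv => hx (by rw [hv])
      rw [OnePoint.coe_eq_coe] at h
      exact smul_ne_zero (inv_ne_zero (sub_ne_zero.2 (Ne.symm hs))) hv h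

/-- A formula that is rational in `invNorm x` and `s` and has no pole away from the origin, where
`invNorm` is `1`. It settles continuity of the deformation wherever its value is infinity. -/
lemma invNorm_expand {x : OnePoint W} (hx : x ≠ ((0 : W) : OnePoint W)) (s : unitInterval) :
    invNorm (expand (x, s)) =
      invNorm x * (1 - s) / (invNorm x * (1 - s) + (1 - invNorm x)) := by
  induction x using OnePoint.rec with
  | infty => simp [expand_infty, invNorm_infty]
  | coe v =>
    by_cases hs : (s : ℝ) = 1
    · obtain rfl : s = 1 := Subtype.ext hs
      simp [expand_one, invNorm_infty]
    · have h1 : 0 < 1 - (s : ℝ) := sub_pos.2 (lt_of_le_of_ne s.2.2 hs)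
      have h2 := one_add_norm_pos v
      rw [expand_coe v hs, invNorm_coe, invNorm_coe, norm_smul, norm_inv,
        Real.norm_of_nonneg h1.le]
      have h3 : 0 < 1 - (s : ℝ) + ‖v‖ := by positivity
      have h4 : (1 + ‖v‖)⁻¹ * (1 - (s : ℝ)) + (1 - (1 + ‖v‖)⁻¹) =
          (1 - (s : ℝ) + ‖v‖) / (1 + ‖v‖) := by
        field_simp
        ring
      have h5 : 1 + (1 - (s : ℝ))⁻¹ * ‖v‖ = (1 - (s : ℝ) + ‖v‖) / (1 - s) := by
        field_simp
      rw [h4, h5]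
      field_simp

lemma continuousOn_expand :
    ContinuousOn (expand : OnePoint W × unitInterval → OnePoint W)
      ({((0 : W) : OnePoint W)}ᶜ ×ˢ Set.univ) := by
  rintro ⟨x, s⟩ ⟨hx, -⟩
  by_cases h : expand (x, s) = OnePoint.infty
  · unfold ContinuousWithinAt
    rw [h]
    refine tendsto_infty_of_invNorm ?_
    have h1 : invNorm (expand (x, s)) = 0 := by
      rw [h]
      rfl
    rw [← h1, invNorm_expand hx]
    have hc : ContinuousAt (fun q : OnePoint W × unitInterval => invNorm q.1 * (1 - (q.2 : ℝ)) /
        (invNorm q.1 * (1 - (q.2 : ℝ)) + (1 - invNorm q.1))) (x, s) := by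
      have hi := continuous_invNorm (W := W)
      refine ContinuousAt.div (by fun_prop) (by fun_prop) (ne_of_gt ?_)
      have h2 : 0 ≤ invNorm x := by
        induction x using OnePoint.rec with
        | infty => exact le_rfl
        | coe v => exact inv_nonneg.2 (one_add_norm_pos v).le
      have h3 := mul_nonneg h2 (sub_nonneg.2 s.2.2)
      have h4 := invNorm_lt_one hx
      change 0 < invNorm x * (1 - (s : ℝ)) + (1 - invNorm x)
      linarith
    refine (hc.continuousWithinAt (s := {((0 : W) : OnePoint W)}ᶜ ×ˢ Set.univ)).congr' ?_
    filter_upwards [self_mem_nhdsWithin] with q hq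
    exact (invNorm_expand hq.1 q.2).symm
  · refine ContinuousAt.continuousWithinAt ?_
    induction x using OnePoint.rec with
    | infty => exact absurd rfl h
    | coe v =>
      have hs : (s : ℝ) ≠ 1 := fun hs => h (by
        obtain rfl : s = 1 := Subtype.ext hs
        exact expand_one _)
      have he : IsOpenEmbedding (Prod.map OnePoint.some id :
          W × unitInterval → OnePoint W × unitInterval) :=
        OnePoint.isOpenEmbedding_coe.prodMap IsOpenEmbedding.id
      refine (he.continuousAt_iff (x := (v, s))).1 ?_
      have hc : ContinuousAt (fun q : W × unitInterval =>
          (((1 - (q.2 : ℝ))⁻¹ • q.1 : W) : OnePoint W)) (v, s) := by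
        refine OnePoint.continuous_coe.continuousAt.comp (ContinuousAt.smul
          (ContinuousAt.inv₀ (by fun_prop) (sub_ne_zero.2 (Ne.symm hs))) (by fun_prop))
      refine hc.congr ?_
      have ho : IsOpen {q : W × unitInterval | (q.2 : ℝ) ≠ 1} :=
        isOpen_ne_fun (by fun_prop) continuous_const
      filter_upwards [ho.mem_nhds hs] with q hq
      exact (expand_coe q.1 hq).symm

/-- The inverse of the inclusion of a space in its one-point compactification. -/
def finitePart (x : OnePoint W) : W := x.elim 0 id

lemma continuousOn_finitePart :
    ContinuousOn (finitePart : OnePoint W → W) (Set.range OnePoint.some) := by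
  rintro _ ⟨v, rfl⟩
  refine ContinuousAt.continuousWithinAt ?_
  exact (OnePoint.isOpenEmbedding_coe.continuousAt_iff (x := v)).1 continuousAt_id

/-- The pair `(W⁺, ∞)` compared with `(W⁺, W⁺ ∖ 0)`. -/
lemma onePoint_rel_iso (n : ℕ) : (relMap (Set.subset_univ _) (Set.singleton_subset_iff.2
    (OnePoint.infty_ne_coe (0 : W)) : {OnePoint.infty} ⊆ ({((0 : W) : OnePoint W)}ᶜ : Set _))).Iso
      n := by
  refine rel_iso (Set.subset_univ _) (Set.singleton_subset_iff.2 (OnePoint.infty_ne_coe (0 : W)))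
    fun m => van_of_deformation ?_ expand continuousOn_expand
    (fun x _ => expand_zero x) (fun x hx s => expand_ne_zero hx s) ?_ (fun x _ => expand_one x) m
  · exact Set.singleton_subset_iff.2 (OnePoint.infty_ne_coe (0 : W))
  · rintro _ rfl s
    rfl

lemma pairMap_onePoint : PairMap (OnePoint.some : W → OnePoint W) Set.univ {0}ᶜ Set.univ
    {((0 : W) : OnePoint W)}ᶜ :=
  ⟨OnePoint.continuous_coe.continuousOn, Set.subset_univ _, fun _ _ => trivial,
    fun _ hv h => hv (OnePoint.coe_injective h)⟩

lemma onePoint_coe_iso (n : ℕ) : (pairMap_onePoint (W := W)).Iso n := by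
  set A : Set (OnePoint W) := Set.range OnePoint.some ∩ {((0 : W) : OnePoint W)}ᶜ with hA
  have h1 : PairMap (OnePoint.some : W → OnePoint W) Set.univ {0}ᶜ (Set.range OnePoint.some) A :=
    ⟨OnePoint.continuous_coe.continuousOn, Set.subset_univ _, fun _ _ => ⟨_, rfl⟩,
      fun _ hv => ⟨⟨_, rfl⟩, fun h => hv (OnePoint.coe_injective h)⟩⟩
  have h2 : PairMap (finitePart : OnePoint W → W) (Set.range OnePoint.some) A Set.univ {0}ᶜ := by
    refine ⟨continuousOn_finitePart, Set.inter_subset_left, fun _ _ => trivial, ?_⟩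
    rintro _ ⟨⟨v, rfl⟩, hv⟩ h
    exact hv (congrArg OnePoint.some h)
  have h3 : PairMap id (Set.range OnePoint.some) A Set.univ {((0 : W) : OnePoint W)}ᶜ :=
    PairMap.id Set.inter_subset_left (Set.subset_univ _) Set.inter_subset_right
  refine PairMap.Iso.comp (hψ := h3) (hφ := h1) (excision_iso OnePoint.isOpen_range_coe
    isOpen_compl_singleton ?_ rfl n h3) (PairMap.Iso.of_inverse h1 h2 (fun _ _ => rfl) ?_ n)
  · refine Set.eq_univ_of_forall fun x => ?_
    induction x using OnePoint.rec with
    | infty => exact Or.inr (OnePoint.infty_ne_coe _)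
    | coe v => exact Or.inl ⟨v, rfl⟩
  · rintro _ ⟨v, rfl⟩
    rfl

end OnePoint

/-! ### Representation spheres -/

section RepSphere

open Module

variable (l h : ℕ)

/-- The inclusion of the representation in its one-point compactification. -/
def RepSphere.coe : TMap (Rep l h) (RepSphere l h) where
  map := ⟨(OnePoint.some : Rep l h → OnePoint (Rep l h)), OnePoint.continuous_coe⟩
  equivariant _ _ := rfl

/-- The base point `∞`. -/
abbrev RepSphere.pt : RepSphere l h := (RepSphere.base l h).1

lemma RepSphere.ind {l h : ℕ} {P : RepSphere l h → Prop} (infty : P (RepSphere.pt l h))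
    (coe : ∀ v, P ((RepSphere.coe l h).map v)) (x : RepSphere l h) : P x :=
  OnePoint.rec infty coe x

/-- The origin of the representation, as a point of the representation sphere. -/
abbrev RepSphere.origin : RepSphere l h := (RepSphere.coe l h).map 0

lemma RepSphere.pt_ne (v : Rep l h) : RepSphere.pt l h ≠ (RepSphere.coe l h).map v :=
  OnePoint.infty_ne_coe v

lemma pt_subset : {RepSphere.pt l h} ⊆ ({RepSphere.origin l h}ᶜ : Set (RepSphere l h)) :=
  Set.singleton_subset_iff.2 (RepSphere.pt_ne l h 0)

lemma inv_origin : Inv ({RepSphere.origin l h}ᶜ : Set (RepSphere l h)) :=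
  Inv.compl fun z _ hx => by
    rw [Set.mem_singleton_iff] at hx ⊢
    rw [hx, RepSphere.origin, ← (RepSphere.coe l h).equivariant, smul_zero]

/-- The deformation of the complement of the origin to the base point. -/
def RepSphere.expand (x : RepSphere l h) (s : unitInterval) : RepSphere l h :=
  SWF.expand (W := Rep l h) (x, s)

lemma RepSphere.expand_smul (z : Circle) (x : RepSphere l h) (s : unitInterval) :
    RepSphere.expand l h (z • x) s = z • RepSphere.expand l h x s := by
  induction x using RepSphere.ind with
  | infty => rfl
  | coe v =>
    by_cases hs : (s : ℝ) = 1
    · obtain rfl : s = 1 := Subtype.ext hs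
      exact (expand_one _).trans (congrArg (fun x : RepSphere l h => z • x)
        (expand_one ((v : Rep l h) : OnePoint (Rep l h)))).symm
    · refine (expand_coe (z • v : Rep l h) hs).trans (Eq.trans ?_ (congrArg
        (fun x : RepSphere l h => z • x) (expand_coe (v : Rep l h) hs)).symm)
      exact congrArg OnePoint.some (Prod.ext rfl (smul_comm (1 - (s : ℝ))⁻¹ z
        (v.2 : EuclideanSpace ℂ (Fin h))))

lemma RepSphere.continuousOn_expand :
    ContinuousOn (fun q : RepSphere l h × unitInterval => RepSphere.expand l h q.1 q.2)
      ({RepSphere.origin l h}ᶜ ×ˢ Set.univ) :=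
  SWF.continuousOn_expand (W := Rep l h)

lemma van_repSphere (n : ℕ) : Van n (borSubset (RepSphere l h) {RepSphere.origin l h}ᶜ)
    (borSubset (RepSphere l h) {RepSphere.pt l h}) := by
  rw [borSubset_eq, borSubset_eq]
  refine van_img_of_deformation (inv_origin l h).snd (inv_fixed _).snd
    (fun p hp => pt_subset l h hp)
    (fun q => (q.1.1, RepSphere.expand l h q.1.2 q.2))
    (fun z p _ s => Prod.ext rfl (RepSphere.expand_smul l h z p.2 s)) ?_
    (fun p _ => Prod.ext rfl (expand_zero (W := Rep l h) p.2))
    (fun p hp s => expand_ne_zero (W := Rep l h) hp s) ?_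
    (fun p _ => expand_one (W := Rep l h) p.2) n
  · refine ContinuousOn.prodMk (by fun_prop) ?_
    exact (RepSphere.continuousOn_expand l h).comp (f := fun q : (ET × RepSphere l h) × unitInterval =>
      (q.1.2, q.2)) (by fun_prop) fun q hq => ⟨hq.1, trivial⟩
  · rintro ⟨e, _⟩ rfl s
    rfl

lemma borPt_subset : borSubset (RepSphere l h) {RepSphere.pt l h} ⊆
    borSubset (RepSphere l h) {RepSphere.origin l h}ᶜ := borSubset_mono (pt_subset l h)

lemma repSphere_rel_iso (n : ℕ) :
    (relMap (Set.subset_univ _) (borPt_subset l h)).Iso n :=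
  rel_iso (Set.subset_univ _) (borPt_subset l h) (van_repSphere l h)

lemma pairMap_coe : PairMap (Bor.map (RepSphere.coe l h)) Set.univ (borSubset _ {0}ᶜ) Set.univ
    (borSubset _ {RepSphere.origin l h}ᶜ) :=
  pairMap_bor _ fun _ hv h => hv (OnePoint.coe_injective h)

end RepSphere

/-! ### Equivariant homeomorphisms between invariant subsets -/

section OpenEmbedding

variable {X Y : Type} [TopologicalSpace X] [MulAction Circle X] [ContinuousSMul Circle X]
  [TopologicalSpace Y] [MulAction Circle Y] [ContinuousSMul Circle Y]

/-- An equivariant map that restricts to a homeomorphism between two pairs of invariant subsets. -/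
lemma bor_homeo_iso (f : TMap X Y) (g : Y → X) {D S : Set X} {E T : Set Y} (hE : Inv E)
    (hg : ContinuousOn g E) (h1 : ∀ x ∈ D, g (f.map x) = x) (h2 : ∀ y ∈ E, f.map (g y) = y)
    (hD : Inv D) (hgE : Set.MapsTo g E D) (hgT : Set.MapsTo g T S) (hTE : T ⊆ E)
    (h : PairMap (Bor.map f) (borSubset X D) (borSubset X S) (borSubset Y E) (borSubset Y T))
    (n : ℕ) : h.Iso n := by
  have hz : ∀ z : Circle, ∀ y ∈ E, g (z • y) = z • g y := fun z y hy => by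
    conv_lhs => rw [← h2 y hy, ← f.equivariant]
    exact h1 _ (hD z _ (hgE hy))
  let F : ET × Y → Bor X := fun p => Bor.mk (p.1, g p.2)
  have he : ∀ z : Circle, ∀ p ∈ (Prod.snd ⁻¹' E : Set (ET × Y)), F (z • p) = F p :=
    fun z p hp => by
      have h3 : ((z • p).1, g (z • p).2) = z • (p.1, g p.2) := Prod.ext rfl (hz z p.2 hp)
      exact (congrArg Bor.mk h3).trans (Bor.mk_smul z (p.1, g p.2))
  have hψ : PairMap (desc F) (borSubset Y E) (borSubset Y T) (borSubset X D) (borSubset X S) := by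
    rw [borSubset_eq E, borSubset_eq T]
    refine pairMap_of_mk hE.snd (fun p hp => desc_mk he hp) ?_ (fun p hp => hTE hp)
      (fun p hp => ⟨p.1, g p.2, hgE hp, rfl⟩) fun p hp => ⟨p.1, g p.2, hgT hp, rfl⟩
    exact Bor.continuous_mk.comp_continuousOn (continuousOn_fst.prodMk
      (hg.comp continuousOn_snd fun _ hp => hp))
  refine PairMap.Iso.of_inverse h hψ ?_ ?_ n
  · rintro _ ⟨e, x, hx, rfl⟩
    have hx' := h.maps ⟨e, x, hx, rfl⟩
    rw [borSubset_eq] at hx'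
    have hx2 : (e, f.map x) ∈ (Prod.snd ⁻¹' E : Set (ET × Y)) := (mem_img hE.snd).1 hx'
    refine (desc_mk he hx2).trans ?_
    exact congrArg (fun x => Bor.mk (e, x)) (h1 x hx)
  · rintro _ ⟨e, y, hy, rfl⟩
    have hy2 : (e, y) ∈ (Prod.snd ⁻¹' E : Set (ET × Y)) := hy
    refine (congrArg (Bor.map f) (desc_mk he hy2)).trans ?_
    exact congrArg (fun y => Bor.mk (e, y)) (h2 y hy)

end OpenEmbedding

/-! ### Cohomology of representation spheres and their fixed points -/

section RepSphere

variable (l h : ℕ)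

/-- Excision of the point at infinity: the sphere is covered by the representation and by the
complement of the origin, both open and invariant. -/
lemma coe_iso (n : ℕ) : (pairMap_coe l h).Iso n := by
  set E : Set (RepSphere l h) := Set.range (RepSphere.coe l h).map with hE
  have hEi : Inv E := by
    rintro z _ ⟨v, rfl⟩
    exact ⟨z • v, rfl⟩
  have h1 : PairMap (Bor.map (RepSphere.coe l h)) (borSubset _ Set.univ) (borSubset _ {0}ᶜ)
      (borSubset _ E) (borSubset _ (E ∩ {RepSphere.origin l h}ᶜ)) := by
    refine ⟨(Bor.map _).continuous.continuousOn, borSubset_mono (Set.subset_univ _), ?_, ?_⟩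
    · rintro _ ⟨e, v, -, rfl⟩
      exact ⟨e, _, ⟨v, rfl⟩, rfl⟩
    · rintro _ ⟨e, v, hv, rfl⟩
      exact ⟨e, _, ⟨⟨v, rfl⟩, fun h => hv (OnePoint.coe_injective h)⟩, rfl⟩
  have i1 : h1.Iso n := by
    refine bor_homeo_iso (RepSphere.coe l h) (fun x : RepSphere l h => finitePart (W := Rep l h) x) hEi
      (continuousOn_finitePart (W := Rep l h)) (fun _ _ => rfl) ?_ inv_univ (fun _ _ => trivial) ?_
      Set.inter_subset_left h1 n
    · rintro _ ⟨v, rfl⟩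
      rfl
    · rintro _ ⟨⟨v, rfl⟩, hv⟩ h
      exact hv (congrArg OnePoint.some h)
  have h2 : PairMap id (borSubset _ E) (borSubset _ (E ∩ {RepSphere.origin l h}ᶜ))
      (borSubset _ Set.univ) (borSubset _ {RepSphere.origin l h}ᶜ) :=
    PairMap.id (borSubset_mono Set.inter_subset_left) (borSubset_mono (Set.subset_univ _))
      (borSubset_mono Set.inter_subset_right)
  have i2 : h2.Iso n := by
    have hEo : IsOpen E := OnePoint.isOpen_range_coe (X := Rep l h)
    have hOo : IsOpen ({RepSphere.origin l h}ᶜ : Set (RepSphere l h)) :=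
      isOpen_compl_singleton (X := OnePoint (Rep l h))
    refine bor_excision_iso hEo hOo hEi (inv_origin l h) ?_ rfl n h2
    · refine Set.eq_univ_of_forall fun x => ?_
      induction x using RepSphere.ind with
      | infty => exact Or.inr (RepSphere.pt_ne l h 0)
      | coe v => exact Or.inl ⟨v, rfl⟩
  have i3 := PairMap.Iso.comp i2 i1
  have e1 : borSubset (RepSphere l h) Set.univ = Set.univ := by
    rw [borSubset_eq, Set.preimage_univ, img_univ]
  have e2 : borSubset (Rep l h) Set.univ = Set.univ := by
    rw [borSubset_eq, Set.preimage_univ, img_univ]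
  have h3 : PairMap (Bor.map (RepSphere.coe l h)) (borSubset _ Set.univ) (borSubset _ {0}ᶜ)
      (borSubset _ Set.univ) (borSubset _ {RepSphere.origin l h}ᶜ) := h2.comp h1
  have i3' : h3.Iso n := i3
  -- The sets `borSubset _ Set.univ` and `Set.univ` are only propositionally equal, so the map of
  -- pairs is generalized before rewriting; afterwards proof irrelevance identifies the two
  -- statements.
  revert h3
  rw [e1, e2]
  exact fun _ i => i

lemma van_repSphere_pt {m : ℕ} (hm : m < l + 2 * h) :
    Van m Set.univ (borSubset (RepSphere l h) {RepSphere.pt l h}) :=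
  (repSphere_rel_iso l h m).van' ((coe_iso l h m).van
    (van_thom (Rep l h) (by rwa [Rep.finrank])))

lemma exists_gen_repSphere : ∃ u : Coh ℤ (l + 2 * h) Set.univ
    (borSubset (RepSphere l h) {RepSphere.origin l h}ᶜ), IsGen u := by
  obtain ⟨u, hu⟩ := exists_gen_rep l h
  obtain ⟨w, rfl⟩ := (coe_iso l h _ ℤ).2 u
  exact ⟨w, IsGen.of_pull (coe_iso l h _) hu⟩

lemma isometry_incl : Isometry (Rep.incl l h).map := Isometry.of_dist_eq fun v w => by
  change max (dist v.1 w.1) (dist (0 : EuclideanSpace ℂ (Fin h)) 0) = max (dist v.1 w.1) (dist v.2 w.2)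
  have : dist v.2 w.2 = 0 := by
    rw [Subsingleton.elim v.2 w.2, dist_self]
  rw [dist_self, this]

/-- The inclusion of the fixed points of the representation sphere. -/
def RepSphere.incl : TMap (RepSphere l 0) (RepSphere l h) where
  map := ⟨OnePoint.map (Rep.incl l h).map, by
    refine OnePoint.continuous_map (Rep.incl l h).map.continuous ?_
    rw [Filter.coclosedCompact_eq_cocompact, Filter.coclosedCompact_eq_cocompact]
    exact (isometry_incl l h).isClosedEmbedding.tendsto_cocompact⟩
  equivariant z x := by
    induction x using RepSphere.ind with
    | infty => rfl
    | coe v => exact congrArg OnePoint.some ((Rep.incl l h).equivariant z v)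

lemma pairMap_sphere_incl : PairMap (Bor.map (RepSphere.incl l h)) Set.univ
    (borSubset _ {RepSphere.pt l 0}) Set.univ (borSubset _ {RepSphere.pt l h}) :=
  pairMap_bor _ fun _ hx => congrArg (RepSphere.incl l h).map hx

/-- In degrees at least `l + 2 h`, restriction to the fixed points is an isomorphism. -/
lemma sphere_incl_iso {m : ℕ} (hm : l + 2 * h ≤ m) : (pairMap_sphere_incl l h).Iso m := by
  have h1 : PairMap (Bor.map (RepSphere.incl l h)) Set.univ (borSubset _ {RepSphere.origin l 0}ᶜ)
      Set.univ (borSubset _ {RepSphere.origin l h}ᶜ) := by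
    refine pairMap_bor _ fun x hx => ?_
    induction x using RepSphere.ind with
    | infty => exact OnePoint.infty_ne_coe _
    | coe v =>
      intro h0
      have h2 : (Rep.incl l h).map v = 0 := OnePoint.coe_injective h0
      have h3 : v.1 = 0 := congrArg (fun w : Rep l h => w.1) h2
      have h4 : v = 0 := Prod.ext h3 (Subsingleton.elim _ _)
      exact hx (congrArg OnePoint.some h4)
  have i1 : h1.Iso m := by
    refine PairMap.Iso.of_comp_right (hφ := pairMap_coe l 0) (coe_iso l 0 m) ?_
    refine PairMap.Iso.congr (fun x _ => ?_) (PairMap.Iso.comp (coe_iso l h m)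
      (incl_rep_iso l h hm))
    obtain ⟨p, rfl⟩ := Bor.mk_surjective x
    rfl
  have i2 := PairMap.Iso.comp i1 (repSphere_rel_iso l 0 m)
  exact PairMap.Iso.of_comp_left (repSphere_rel_iso l h m) i2

/-- The Thom class of `S^{l,j}` restricts to a generator on the fixed sphere, because restriction is
an isomorphism from degree `l + 2j` on. Varying `j` gives generators in all these degrees without
computing the cohomology of the classifying space. -/
lemma exists_gen_sphere_fixed (j : ℕ) : ∃ u : Coh ℤ (l + 2 * j) Set.univ
    (borSubset (RepSphere l 0) {RepSphere.pt l 0}), IsGen u := by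
  obtain ⟨u, hu⟩ := exists_gen_repSphere l j
  exact ⟨_, IsGen.pull (sphere_incl_iso l j le_rfl) (IsGen.pull (repSphere_rel_iso l j _) hu)⟩

end RepSphere


/-! ### Transport of generators along the connecting homomorphism -/

section MoreExact

variable {X : Type} [TopologicalSpace X] {U G K : Set X} {n : ℕ}

lemma conn_bijective_of_van {k : Type} [CommRing k] (hG : G ⊆ U) (hK : K ⊆ G) (h : Van n U K)
    (h' : Van (n + 1) U K) : Function.Bijective (conn k n hG hK) :=
  ⟨(injective_iff_map_eq_zero _).2 fun y hy => by
    obtain ⟨z, rfl⟩ := exact_res_conn hG hK y hy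
    rw [h.eq_zero z, map_zero], fun y => exact_conn_rel hG hK y (h'.eq_zero _)⟩

lemma exists_gen_of_conn (hG : G ⊆ U) (hK : K ⊆ G) (h : Van n U K) (h' : Van (n + 1) U K)
    {w : Coh ℤ (n + 1) U G} (hw : IsGen w) : ∃ u : Coh ℤ n G K, IsGen u := by
  obtain ⟨u, rfl⟩ := (conn_bijective_of_van hG hK h h').2 w
  refine ⟨u, fun k _ y => ?_⟩
  have hb := conn_bijective_of_van (k := k) hG hK h h'
  obtain ⟨c, hc, hc'⟩ := hw k (conn k n hG hK y)
  refine ⟨c, hb.1 (by simpa only [map_smul, ← coeff_conn] using hc), fun c' h' => hc' c' ?_⟩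
  simp only [h', map_smul, coeff_conn]

end MoreExact

/-! ### Collars and cells -/

section Collar

/-- An invariant function on a space with circle action, together with a deformation that pushes
the points where the function is large to where it is at least one. -/
structure Collar (X : Type) [TopologicalSpace X] [MulAction Circle X] where
  /-- the function -/
  rho : X → ℝ
  /-- the deformation -/
  push : X × unitInterval → X
  continuous_rho : Continuous rho
  continuous_push : Continuous push
  rho_smul : ∀ (z : Circle) x, rho (z • x) = rho x
  push_smul : ∀ (z : Circle) x s, push (z • x, s) = z • push (x, s)
  push_zero : ∀ x, push (x, 0) = x
  rho_push : ∀ x s, rho x ≤ rho (push (x, s)) ∨ 1 ≤ rho (push (x, s))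
  rho_push_one : ∀ x, 1 / 2 < rho x → 1 ≤ rho (push (x, 1))

variable {X Y : Type} [TopologicalSpace X] [MulAction Circle X] [ContinuousSMul Circle X]
  [TopologicalSpace Y] [MulAction Circle Y] [ContinuousSMul Circle Y]

namespace Collar

/-- The boundary of a space with collar. -/
def bd (C : Collar X) : Set X := {x | 1 ≤ C.rho x}

/-- The collar. -/
def nb (C : Collar X) : Set X := {x | 1 / 2 < C.rho x}

/-- The complement of the boundary. -/
def inner (C : Collar X) : Set X := {x | C.rho x < 1}

variable (C : Collar X)

lemma inv_bd : Inv C.bd := fun z x hx => by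
  rw [bd, Set.mem_setOf_eq, C.rho_smul]
  exact hx

lemma inv_nb : Inv C.nb := fun z x hx => by
  rw [nb, Set.mem_setOf_eq, C.rho_smul]
  exact hx

lemma inv_inner : Inv C.inner := fun z x hx => by
  rw [inner, Set.mem_setOf_eq, C.rho_smul]
  exact hx

lemma bd_subset_nb : C.bd ⊆ C.nb := fun x hx =>
  lt_of_lt_of_le (show (1 / 2 : ℝ) < 1 by norm_num) hx

lemma van (n : ℕ) : Van n (borSubset X C.nb) (borSubset X C.bd) := by
  rw [borSubset_eq, borSubset_eq]
  refine van_img_of_deformation C.inv_nb.snd C.inv_bd.snd (fun p hp => C.bd_subset_nb hp)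
    (fun q => (q.1.1, C.push (q.1.2, q.2))) (fun z p _ s => Prod.ext rfl (C.push_smul z p.2 s)) ?_
    (fun p _ => Prod.ext rfl (C.push_zero p.2)) (fun p hp s => ?_) (fun p hp s => ?_)
    (fun p hp => C.rho_push_one p.2 hp) n
  · have := C.continuous_push
    exact Continuous.continuousOn (by fun_prop)
  · rcases C.rho_push p.2 s with h | h
    · exact lt_of_lt_of_le hp h
    · exact C.bd_subset_nb h
  · rcases C.rho_push p.2 s with h | h
    · exact le_trans hp h
    · exact h

lemma bor_bd_subset : borSubset X C.bd ⊆ borSubset X C.nb := borSubset_mono C.bd_subset_nb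

lemma rel_iso (n : ℕ) : (relMap (Set.subset_univ _) C.bor_bd_subset).Iso n :=
  SWF.rel_iso (Set.subset_univ _) C.bor_bd_subset C.van

lemma pairMap_inner : PairMap id (borSubset X C.inner) (borSubset X (C.inner ∩ C.nb)) Set.univ
    (borSubset X C.nb) :=
  PairMap.id (borSubset_mono Set.inter_subset_left) (Set.subset_univ _)
    (borSubset_mono Set.inter_subset_right)

lemma borSubset_univ : borSubset X Set.univ = Set.univ := by
  rw [borSubset_eq, Set.preimage_univ, img_univ]

lemma inner_iso (n : ℕ) : C.pairMap_inner.Iso n := by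
  have h : PairMap id (borSubset X C.inner) (borSubset X (C.inner ∩ C.nb)) (borSubset X Set.univ)
      (borSubset X C.nb) := by
    rw [borSubset_univ]
    exact C.pairMap_inner
  have i : h.Iso n := by
    refine bor_excision_iso (isOpen_lt C.continuous_rho continuous_const)
      (isOpen_lt continuous_const C.continuous_rho) C.inv_inner C.inv_nb ?_ rfl n h
    refine Set.eq_univ_of_forall fun x => ?_
    rcases lt_or_ge (C.rho x) 1 with hx | hx
    · exact Or.inl hx
    · exact Or.inr (C.bd_subset_nb hx)
  revert h
  rw [borSubset_univ]
  exact fun _ i => i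

/-- A relative homeomorphism induces an isomorphism in equivariant cohomology. -/
lemma relative_homeo_iso (C : Collar X) (D : Collar Y) (f : TMap X Y) (g : Y → X)
    (hf : ∀ x, D.rho (f.map x) = C.rho x) (hg : ContinuousOn g D.inner)
    (h1 : ∀ x ∈ C.inner, g (f.map x) = x) (h2 : ∀ y ∈ D.inner, f.map (g y) = y)
    (h : PairMap (Bor.map f) Set.univ (borSubset X C.bd) Set.univ (borSubset Y D.bd)) (n : ℕ) :
    h.Iso n := by
  have hgr : ∀ y ∈ D.inner, C.rho (g y) = D.rho y := fun y hy => by rw [← hf, h2 y hy]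
  have p1 : PairMap (Bor.map f) (borSubset X C.inner) (borSubset X (C.inner ∩ C.nb))
      (borSubset Y D.inner) (borSubset Y (D.inner ∩ D.nb)) := by
    refine ⟨(Bor.map f).continuous.continuousOn, borSubset_mono Set.inter_subset_left, ?_, ?_⟩
    · rintro _ ⟨e, x, hx, rfl⟩
      have h3 : f.map x ∈ D.inner := (hf x).trans_lt hx
      exact ⟨e, f.map x, h3, rfl⟩
    · rintro _ ⟨e, x, hx, rfl⟩
      have h3 : f.map x ∈ D.inner ∩ D.nb :=
        ⟨(hf x).trans_lt hx.1, lt_of_lt_of_eq hx.2 (hf x).symm⟩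
      exact ⟨e, f.map x, h3, rfl⟩
  have m1 : Set.MapsTo g D.inner C.inner := fun y hy => by
    change C.rho (g y) < 1
    rw [hgr y hy]
    exact hy
  have m2 : Set.MapsTo g (D.inner ∩ D.nb) (C.inner ∩ C.nb) := fun y hy => by
    refine ⟨m1 hy.1, ?_⟩
    change 1 / 2 < C.rho (g y)
    rw [hgr y hy.1]
    exact hy.2
  -- The boundary is enlarged to its collar and then excised, which leaves the open parts, where `f`
  -- is a homeomorphism.
  have i1 : p1.Iso n := bor_homeo_iso f g D.inv_inner hg h1 h2 C.inv_inner m1 m2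
    Set.inter_subset_left p1 n
  have p2 : PairMap (Bor.map f) Set.univ (borSubset X C.nb) Set.univ (borSubset Y D.nb) :=
    pairMap_bor f fun x hx => lt_of_lt_of_eq hx (hf x).symm
  have i2 : p2.Iso n := PairMap.Iso.of_comp_right (hψ := p2) (hφ := C.pairMap_inner) (C.inner_iso n)
    (PairMap.Iso.comp (hψ := D.pairMap_inner) (hφ := p1) (D.inner_iso n) i1)
  have i3 : (p2.comp (relMap (Set.subset_univ _) C.bor_bd_subset)).Iso n :=
    PairMap.Iso.comp i2 (C.rel_iso n)
  exact PairMap.Iso.of_comp_left (hψ := relMap (Set.subset_univ _) D.bor_bd_subset) (hφ := h)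
    (D.rel_iso n) i3

end Collar

end Collar

/-! ### Disks -/

section Disk

variable {d : ℕ}

/-- The radial retraction to the unit disk. -/
def toDisk (v : EuclideanSpace ℝ (Fin d)) : Disk d :=
  ⟨(max 1 ‖v‖)⁻¹ • v, by
    have h : 0 < max 1 ‖v‖ := by positivity
    rw [mem_closedBall_zero_iff, norm_smul, norm_inv, Real.norm_of_nonneg h.le, ← div_eq_inv_mul,
      div_le_one h]
    exact le_max_right _ _⟩

lemma continuous_inv_max : Continuous fun v : EuclideanSpace ℝ (Fin d) => (max 1 ‖v‖)⁻¹ :=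
  Continuous.inv₀ (by fun_prop) fun v => by positivity

lemma continuous_toDisk : Continuous (toDisk : EuclideanSpace ℝ (Fin d) → Disk d) :=
  Continuous.subtype_mk (Continuous.smul continuous_inv_max continuous_id) _

lemma toDisk_coe (v : Disk d) : toDisk (v : EuclideanSpace ℝ (Fin d)) = v :=
  Subtype.ext (by
    change (max 1 ‖v.1‖)⁻¹ • v.1 = v.1
    rw [max_eq_left (mem_closedBall_zero_iff.1 v.2), inv_one, one_smul])

lemma toDisk_of_le {v : EuclideanSpace ℝ (Fin d)} (h : ‖v‖ ≤ 1) : (toDisk v).1 = v :=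
  congrArg Subtype.val (toDisk_coe ⟨v, mem_closedBall_zero_iff.2 h⟩)

lemma norm_toDisk (v : EuclideanSpace ℝ (Fin d)) : ‖(toDisk v).1‖ = min 1 ‖v‖ := by
  change ‖(max 1 ‖v‖)⁻¹ • v‖ = _
  have h : 0 < max 1 ‖v‖ := by positivity
  rw [norm_smul, norm_inv, Real.norm_of_nonneg h.le]
  rcases le_total 1 ‖v‖ with h1 | h1
  · rw [max_eq_right h1, min_eq_left h1, inv_mul_cancel₀ (by positivity)]
  · rw [max_eq_left h1, min_eq_right h1, inv_one, one_mul]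

/-- The cohomology of a disk relative to its boundary. -/
lemma sphereLike_disk (d : ℕ) : SphereLike d (Metric.closedBall (0 : EuclideanSpace ℝ (Fin d)) 1)
    (Metric.sphere 0 1) := by
  set E := EuclideanSpace ℝ (Fin d)
  have hs : Metric.sphere (0 : E) 1 ⊆ Metric.closedBall 0 1 ∩ {0}ᶜ := fun v hv =>
    ⟨Metric.sphere_subset_closedBall hv, fun h => by
      rw [Set.mem_singleton_iff.1 h] at hv
      simp at hv⟩
  have h1 : PairMap id (Metric.closedBall (0 : E) 1) (Metric.closedBall 0 1 ∩ {0}ᶜ) Set.univ {0}ᶜ :=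
    PairMap.id Set.inter_subset_left (Set.subset_univ _) Set.inter_subset_right
  have h2 : PairMap (fun v : E => (toDisk v).1) Set.univ {0}ᶜ (Metric.closedBall (0 : E) 1)
      (Metric.closedBall 0 1 ∩ {0}ᶜ) := by
    refine ⟨(continuous_subtype_val.comp continuous_toDisk).continuousOn, Set.subset_univ _,
      fun v _ => (toDisk v).2, fun v hv => ⟨(toDisk v).2, ?_⟩⟩
    rw [Set.mem_compl_singleton_iff, ← norm_pos_iff, norm_toDisk]
    exact lt_min one_pos (norm_pos_iff.2 hv)
  have i1 : ∀ n, h1.Iso n := fun n => by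
    refine PairMap.Iso.of_homotopy_inverse h1 h2 (PairHomotopic.of_eqOn (h2.comp h1) fun v hv =>
      toDisk_of_le (mem_closedBall_zero_iff.1 hv))
      ⟨fun q => ((1 - (q.2 : ℝ)) * (max 1 ‖q.1‖)⁻¹ + q.2) • q.1, ?_, fun _ _ => trivial, ?_, ?_, ?_⟩ n
    · have hc := continuous_inv_max (d := d)
      exact Continuous.continuousOn (Continuous.smul (Continuous.add (Continuous.mul (by fun_prop)
        (hc.comp continuous_fst)) (by fun_prop)) continuous_fst)
    · rintro ⟨v, s⟩ ⟨hv, -⟩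
      refine smul_ne_zero (ne_of_gt ?_) hv
      have h3 := s.2.1
      have h4 := s.2.2
      have h5 : 0 < (max 1 ‖v‖)⁻¹ := by positivity
      change 0 < (1 - (s : ℝ)) * (max 1 ‖v‖)⁻¹ + s
      rcases h3.eq_or_lt with h6 | h6
      · rw [← h6]
        linarith
      · nlinarith [mul_nonneg (sub_nonneg.2 h4) h5.le]
    · intro v _
      change ((1 - ((0 : unitInterval) : ℝ)) * (max 1 ‖v‖)⁻¹ + ((0 : unitInterval) : ℝ)) • v =
        (max 1 ‖v‖)⁻¹ • v
      simp
    · intro v _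
      simp
  have hv : ∀ m, Van m (Metric.closedBall (0 : E) 1 ∩ {0}ᶜ) (Metric.sphere 0 1) := fun m => by
    have key : ∀ (v : E) (s : unitInterval), ‖v‖ ≤ 1 → v ≠ 0 → 0 < 1 - (s : ℝ) + s * ‖v‖ ∧
        ‖v‖ ≤ 1 - (s : ℝ) + s * ‖v‖ := fun v s h hv => by
      have h3 := s.2.1
      have h4 := s.2.2
      have h5 := norm_pos_iff.2 hv
      have h6 : ‖v‖ ≤ 1 - (s : ℝ) + s * ‖v‖ := by nlinarith
      exact ⟨h5.trans_le h6, h6⟩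
    -- Radial push to the boundary: the divisor runs from `1` to `‖v‖` and never drops below `‖v‖`,
    -- so the disk is not left.
    refine van_of_deformation hs (fun q => (1 - (q.2 : ℝ) + q.2 * ‖q.1‖)⁻¹ • q.1) ?_ ?_ ?_ ?_ ?_ m
    · have hc : ContinuousOn (fun q : E × unitInterval => (1 - (q.2 : ℝ) + q.2 * ‖q.1‖)⁻¹)
          ((Metric.closedBall 0 1 ∩ {0}ᶜ) ×ˢ Set.univ) := by
        refine ContinuousOn.inv₀ (by fun_prop) ?_
        rintro ⟨v, s⟩ ⟨⟨hv, hv'⟩, -⟩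
        exact (key v s (mem_closedBall_zero_iff.1 hv) hv').1.ne'
      exact hc.smul continuousOn_fst
    · intro v _
      simp
    · rintro v ⟨hv, hv'⟩ s
      obtain ⟨h3, h4⟩ := key v s (mem_closedBall_zero_iff.1 hv) hv'
      refine ⟨?_, smul_ne_zero (inv_ne_zero h3.ne') hv'⟩
      rw [mem_closedBall_zero_iff, norm_smul, norm_inv, Real.norm_of_nonneg h3.le, ← div_eq_inv_mul]
      exact (div_le_one h3).2 h4
    · intro v hv s
      have h3 : ‖v‖ = 1 := mem_sphere_zero_iff_norm.1 hv
      simpa [h3] using h3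
    · rintro v ⟨-, hv'⟩
      rw [mem_sphere_zero_iff_norm, norm_smul]
      simp [norm_ne_zero_iff.2 (show v ≠ 0 from hv')]
  exact SphereLike.of_iso' (h := relMap Set.inter_subset_left hs)
    (fun n => rel_iso Set.inter_subset_left hs hv)
    (SphereLike.of_iso' (h := h1) i1 (sphereLike_finrank d E (by simp [E])))

end Disk

/-! ### Free cells -/

section FreeCell

variable (d : ℕ)

instance : ContinuousSMul Circle (FreeCell d) where
  continuous_smul := by
    have h : Continuous fun p : Circle × (Circle × Disk d) => (p.1 * p.2.1, p.2.2) := by fun_prop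
    exact h

instance : ContinuousSMul Circle (FreeCellBoundary d) where
  continuous_smul := by
    have h : Continuous fun p : Circle × (Circle × DiskBoundary d) => (p.1 * p.2.1, p.2.2) := by
      fun_prop
    exact h

lemma continuous_freeCell_fst : Continuous fun c : FreeCell d => c.1 :=
  continuous_fst (X := Circle) (Y := Disk d)

lemma continuous_freeCell_snd : Continuous fun c : FreeCell d => c.2 :=
  continuous_snd (X := Circle) (Y := Disk d)

/-- A point of a free cell. -/
def FreeCell.mk {d : ℕ} (z : Circle) (v : Disk d) : FreeCell d := (z, v)

lemma continuous_freeCell_mk {Z : Type} [TopologicalSpace Z] {f : Z → Circle} {g : Z → Disk d}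
    (hf : Continuous f) (hg : Continuous g) : Continuous fun z => FreeCell.mk (f z) (g z) := by
  have h : Continuous fun z => (f z, g z) := hf.prodMk hg
  exact h

lemma norm_push (v : Disk d) (s : unitInterval) :
    ‖(toDisk ((1 + (s : ℝ)) • v.1)).1‖ = min 1 ((1 + s) * ‖v.1‖) := by
  rw [norm_toDisk, norm_smul, Real.norm_of_nonneg (by have := s.2.1; linarith)]

/-- The radial collar of a free cell. -/
def FreeCell.collar : Collar (FreeCell d) where
  rho c := ‖c.2.1‖
  -- The radius is multiplied by `1 + s` and cut off at `1`. At the end it has doubled, which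
  -- explains the threshold `1 / 2` in the definition of a collar.
  push q := FreeCell.mk q.1.1 (toDisk ((1 + (q.2 : ℝ)) • q.1.2.1))
  continuous_rho := (continuous_subtype_val.comp (continuous_freeCell_snd d)).norm
  continuous_push := continuous_freeCell_mk d ((continuous_freeCell_fst d).comp continuous_fst)
    (continuous_toDisk.comp (Continuous.smul (continuous_const.add
      (continuous_subtype_val.comp continuous_snd)) (continuous_subtype_val.comp
        ((continuous_freeCell_snd d).comp continuous_fst))))
  rho_smul _ _ := rfl
  push_smul _ _ _ := rfl
  push_zero c := Prod.ext rfl (by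
    change toDisk ((1 + ((0 : unitInterval) : ℝ)) • c.2.1) = c.2
    simpa using toDisk_coe c.2)
  rho_push c s := by
    change ‖c.2.1‖ ≤ ‖(toDisk ((1 + (s : ℝ)) • c.2.1)).1‖ ∨ _
    rw [norm_push]
    left
    have h1 : ‖c.2.1‖ ≤ 1 := mem_closedBall_zero_iff.1 c.2.2
    have h2 := mul_nonneg s.2.1 (norm_nonneg c.2.1)
    exact le_min h1 (by linarith)
  rho_push_one c h := by
    change 1 ≤ ‖(toDisk ((1 + ((1 : unitInterval) : ℝ)) • c.2.1)).1‖
    rw [norm_push]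
    refine le_min le_rfl ?_
    change 1 / 2 < ‖c.2.1‖ at h
    rw [Set.Icc.coe_one]
    linarith

lemma FreeCell.push_of_norm {c : FreeCell d} (h : ‖c.2.1‖ = 1) (s : unitInterval) :
    (FreeCell.collar d).push (c, s) = c := by
  change FreeCell.mk c.1 _ = c
  refine Prod.ext (x := FreeCell.mk c.1 _) rfl (Subtype.ext ?_)
  change (max 1 ‖(1 + (s : ℝ)) • c.2.1‖)⁻¹ • (1 + (s : ℝ)) • c.2.1 = c.2.1
  have h1 : 0 < 1 + (s : ℝ) := by have := s.2.1; linarith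
  rw [norm_smul, h, mul_one, Real.norm_of_nonneg h1.le, max_eq_right (by have := s.2.1; linarith),
    smul_smul, inv_mul_cancel₀ h1.ne', one_smul]

lemma FreeCell.mem_bd {c : FreeCell d} : c ∈ (FreeCell.collar d).bd ↔ ‖c.2.1‖ = 1 :=
  ⟨fun h => le_antisymm (mem_closedBall_zero_iff.1 c.2.2) h, fun h => h.ge⟩

lemma pairMap_freeCell : PairMap (fun v : EuclideanSpace ℝ (Fin d) =>
      Bor.mk (ET.basis 0, FreeCell.mk 1 (toDisk v))) (Metric.closedBall 0 1) (Metric.sphere 0 1)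
      Set.univ (borSubset _ (FreeCell.collar d).bd) where
  cont := (Bor.continuous_mk.comp (continuous_const.prodMk (continuous_freeCell_mk d
    continuous_const continuous_toDisk))).continuousOn
  sub := Metric.sphere_subset_closedBall
  maps _ _ := trivial
  maps' v hv := ⟨_, FreeCell.mk 1 (toDisk v), (FreeCell.mem_bd d).2 (by
    change ‖(toDisk v).1‖ = 1
    rw [norm_toDisk, mem_sphere_zero_iff_norm.1 hv, min_self]), rfl⟩

/-- The equivariant cohomology of a free cell relative to its boundary is the cohomology of a disk
relative to its boundary. -/
lemma freeCell_iso (n : ℕ) : (pairMap_freeCell d).Iso n := by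
  have h1 : PairMap (fun c : FreeCell d => Bor.mk (ET.basis 0, c)) {c ∈ Set.univ | c.1 = 1}
      {c ∈ (FreeCell.collar d).bd | c.1 = 1} (borSubset _ Set.univ)
      (borSubset _ (FreeCell.collar d).bd) :=
    ⟨(Bor.continuous_mk.comp (by fun_prop)).continuousOn, fun c hc => ⟨trivial, hc.2⟩,
      fun c _ => ⟨_, c, trivial, rfl⟩, fun c hc => ⟨_, c, hc.1, rfl⟩⟩
  have i1 : h1.Iso n := free_iso inv_univ (FreeCell.collar d).inv_bd (Set.subset_univ _)
    (continuous_freeCell_fst d).continuousOn (fun _ _ _ => rfl) h1 n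
  have h2 : PairMap (fun v : EuclideanSpace ℝ (Fin d) => FreeCell.mk 1 (toDisk v))
      (Metric.closedBall 0 1) (Metric.sphere 0 1) {c ∈ Set.univ | c.1 = 1}
      {c ∈ (FreeCell.collar d).bd | c.1 = 1} := by
    refine ⟨(continuous_freeCell_mk d continuous_const continuous_toDisk).continuousOn,
      Metric.sphere_subset_closedBall, fun v _ => ⟨trivial, rfl⟩, fun v hv => ⟨?_, rfl⟩⟩
    refine (FreeCell.mem_bd d).2 ?_
    change ‖(toDisk v).1‖ = 1
    rw [norm_toDisk, mem_sphere_zero_iff_norm.1 hv, min_self]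
  have h3 : PairMap (fun c : FreeCell d => c.2.1) {c ∈ Set.univ | c.1 = 1}
      {c ∈ (FreeCell.collar d).bd | c.1 = 1} (Metric.closedBall 0 1) (Metric.sphere 0 1) := by
    refine ⟨(continuous_subtype_val.comp (continuous_freeCell_snd d)).continuousOn,
      fun c hc => ⟨trivial, hc.2⟩, fun c _ => c.2.2, fun c hc => ?_⟩
    exact mem_sphere_zero_iff_norm.2 ((FreeCell.mem_bd d).1 hc.1)
  have i2 : h2.Iso n := PairMap.Iso.of_inverse h2 h3
    (fun v hv => toDisk_of_le (mem_closedBall_zero_iff.1 hv))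
    (fun c hc => Prod.ext hc.2.symm (toDisk_coe c.2)) n
  have i3 := PairMap.Iso.comp (hψ := h1) (hφ := h2) i1 i2
  have e : borSubset (FreeCell d) Set.univ = Set.univ := Collar.borSubset_univ
  revert h1
  rw [e]
  exact fun _ _ i => i

lemma sphereLike_freeCell : SphereLike d Set.univ (borSubset _ (FreeCell.collar d).bd) :=
  SphereLike.of_iso (freeCell_iso d) (sphereLike_disk d)

lemma borSubset_empty {X : Type} [TopologicalSpace X] [MulAction Circle X] :
    borSubset X ∅ = ∅ := by
  rw [borSubset_eq, Set.preimage_empty, img, Set.image_empty]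

lemma van_freeCell {m : ℕ} (hm : m ≠ 0) : Van m (Set.univ : Set (Bor (FreeCell d))) ∅ := by
  have h1 : PairMap (fun c : FreeCell d => Bor.mk (ET.basis 0, c)) {c ∈ Set.univ | c.1 = 1}
      {c ∈ (∅ : Set (FreeCell d)) | c.1 = 1} (borSubset _ Set.univ) (borSubset _ ∅) :=
    ⟨(Bor.continuous_mk.comp (by fun_prop)).continuousOn, fun c hc => ⟨trivial, hc.2⟩,
      fun c _ => ⟨_, c, trivial, rfl⟩, fun c hc => ⟨_, c, hc.1, rfl⟩⟩
  have i1 : h1.Iso m := free_iso inv_univ inv_empty (Set.subset_univ _)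
    (continuous_freeCell_fst d).continuousOn (fun _ _ _ => rfl) h1 m
  have h2 : PairMap (fun _ : Unit => FreeCell.mk 1 (toDisk 0)) Set.univ ∅
      {c ∈ Set.univ | c.1 = 1} {c ∈ (∅ : Set (FreeCell d)) | c.1 = 1} :=
    ⟨continuousOn_const, Set.subset_univ _, fun _ _ => ⟨trivial, rfl⟩, Set.mapsTo_empty _ _⟩
  have h3 : PairMap (fun _ : FreeCell d => ()) {c ∈ Set.univ | c.1 = 1} {c ∈ (∅ : Set (FreeCell d)) | c.1 = 1}
      Set.univ ∅ :=
    ⟨continuousOn_const, fun c hc => hc.1.elim, fun _ _ => trivial, fun c hc => hc.1⟩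
  have i2 : h2.Iso m := by
    refine PairMap.Iso.of_homotopy_inverse h2 h3 (PairHomotopic.of_eqOn (h3.comp h2) fun _ _ => rfl)
      ⟨fun q => FreeCell.mk 1 (toDisk ((q.2 : ℝ) • q.1.2.1)), ?_, fun _ _ => ⟨trivial, rfl⟩,
        fun q hq => hq.1.1.elim, fun c _ => ?_, fun c hc => ?_⟩ m
    · exact (continuous_freeCell_mk d continuous_const (continuous_toDisk.comp (Continuous.smul
        (continuous_subtype_val.comp continuous_snd) (continuous_subtype_val.comp
          ((continuous_freeCell_snd d).comp continuous_fst))))).continuousOn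
    · simp
    · refine Prod.ext hc.2.symm ?_
      change toDisk (((1 : unitInterval) : ℝ) • c.2.1) = c.2
      simpa using toDisk_coe c.2
  have i3 := (PairMap.Iso.comp i1 i2).van (sphereLike_point.1 m hm)
  rwa [Collar.borSubset_univ, borSubset_empty] at i3

/-- The inclusion of the boundary of a free cell, as an equivariant map. -/
def FreeCellBoundary.toCell : TMap (FreeCellBoundary d) (FreeCell d) where
  map := ⟨FreeCellBoundary.incl, continuous_freeCell_mk d
    (continuous_fst (X := Circle) (Y := DiskBoundary d)) (Continuous.subtype_mk
      (continuous_subtype_val.comp (continuous_snd (X := Circle) (Y := DiskBoundary d))) _)⟩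
  equivariant _ _ := rfl

lemma pairMap_toCell : PairMap (Bor.map (FreeCellBoundary.toCell d)) Set.univ ∅
    (borSubset _ (FreeCell.collar d).bd) ∅ := by
  refine ⟨(Bor.map _).continuous.continuousOn, Set.subset_univ _, ?_, Set.mapsTo_empty _ _⟩
  intro x _
  obtain ⟨⟨e, c⟩, rfl⟩ := Bor.mk_surjective x
  exact ⟨e, c.incl, (FreeCell.mem_bd d).2 (mem_sphere_zero_iff_norm.1 c.2.2), rfl⟩

lemma toCell_iso [Nonempty (DiskBoundary d)] (n : ℕ) : (pairMap_toCell d).Iso n := by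
  classical
  let g : FreeCell d → FreeCellBoundary d := fun c =>
    (c.1, if h : ‖c.2.1‖ = 1 then ⟨c.2.1, mem_sphere_zero_iff_norm.2 h⟩ else Classical.arbitrary _)
  have hn : ∀ c ∈ (FreeCell.collar d).bd, ‖c.2.1‖ = 1 := fun c hc => (FreeCell.mem_bd d).1 hc
  have hg : ∀ c ∈ (FreeCell.collar d).bd, (g c).2.1 = c.2.1 := fun c hc => by
    simp only [g]
    rw [dif_pos (hn c hc)]
  have h : PairMap (Bor.map (FreeCellBoundary.toCell d)) (borSubset _ Set.univ) (borSubset _ ∅)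
      (borSubset _ (FreeCell.collar d).bd) (borSubset _ ∅) := by
    rw [Collar.borSubset_univ, borSubset_empty, borSubset_empty]
    exact pairMap_toCell d
  have i : h.Iso n := by
    refine bor_homeo_iso (FreeCellBoundary.toCell d) g (FreeCell.collar d).inv_bd ?_ ?_ ?_ inv_univ
      (fun _ _ => trivial) (Set.mapsTo_empty _ _) (Set.empty_subset _) h n
    · have h2 : ContinuousOn (fun c => (g c).2) (FreeCell.collar d).bd → ContinuousOn g _ :=
        fun h2 => ContinuousOn.prodMk (β := Circle) (γ := DiskBoundary d)
          (continuous_freeCell_fst d).continuousOn h2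
      refine h2 ?_
      rw [continuousOn_iff_continuous_restrict]
      have h1 : Continuous fun c : (FreeCell.collar d).bd => (g c.1).2.1 := by
        refine ((continuous_subtype_val.comp (continuous_freeCell_snd d)).comp
          continuous_subtype_val).congr fun c => (hg c.1 c.2).symm
      exact continuous_induced_rng.2 h1
    · intro c _
      exact Prod.ext rfl (Subtype.ext (hg c.incl ((FreeCell.mem_bd d).2 (mem_sphere_zero_iff_norm.1 c.2.2))))
    · intro c hc
      exact Prod.ext rfl (Subtype.ext (hg c hc))
  revert h
  rw [Collar.borSubset_univ, borSubset_empty, borSubset_empty]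
  exact fun _ i => i

end FreeCell


/-! ### Attaching a free cell -/

namespace Attach

variable {Y Z : Type} [TopologicalSpace Y] [MulAction Circle Y] [TopologicalSpace Z]
  [MulAction Circle Z] {d : ℕ} (φ : TMap (FreeCellBoundary d) Y)

/-- The inclusion of the space to which the cell is attached. -/
def incl : TMap Y (Attach φ) where
  map := ⟨fun y => Quot.mk _ (Sum.inl y), continuous_quot_mk.comp continuous_inl⟩
  equivariant _ _ := rfl

/-- The characteristic map of the cell. -/
def cell : TMap (FreeCell d) (Attach φ) where
  map := ⟨fun c => Quot.mk _ (Sum.inr c), continuous_quot_mk.comp continuous_inr⟩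
  equivariant _ _ := rfl

lemma cell_incl (c : FreeCellBoundary d) : (cell φ).map c.incl = (incl φ).map (φ.map c) :=
  (Quot.sound (AttachRel.glue c)).symm

variable {φ} in
lemma ind {P : Attach φ → Prop} (h1 : ∀ y, P ((incl φ).map y)) (h2 : ∀ c, P ((cell φ).map c))
    (x : Attach φ) : P x := by
  induction x using Quot.ind with
  | mk s =>
    cases s with
    | inl y => exact h1 y
    | inr c => exact h2 c

/-- Functions on the space with a cell attached. -/
def lift {W : Type} (f : Y → W) (g : FreeCell d → W) (h : ∀ c, f (φ.map c) = g c.incl) :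
    Attach φ → W :=
  Quot.lift (Sum.elim f g) (by rintro _ _ ⟨c⟩; exact h c)

lemma continuous_lift {f : Y → Z} {g : FreeCell d → Z} (hf : Continuous f) (hg : Continuous g)
    (h : ∀ c, f (φ.map c) = g c.incl) : Continuous (lift φ f g h) :=
  continuous_quot_lift _ (hf.sumElim hg)

/-- Equivariant maps on the space with a cell attached. -/
def desc (f : TMap Y Z) (g : TMap (FreeCell d) Z) (h : ∀ c, f.map (φ.map c) = g.map c.incl) :
    TMap (Attach φ) Z where
  map := ⟨lift φ f.map g.map h, continuous_lift φ f.map.continuous g.map.continuous h⟩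
  equivariant z x := by
    induction x using ind with
    | h1 y => exact f.equivariant z y
    | h2 c => exact g.equivariant z c

/-- A boundary point of a free cell as a point of the boundary. -/
def toBoundary {c : FreeCell d} (h : ‖c.2.1‖ = 1) : FreeCellBoundary d :=
  (c.1, ⟨c.2.1, mem_sphere_zero_iff_norm.2 h⟩)

lemma norm_incl (c : FreeCellBoundary d) : ‖c.incl.2.1‖ = 1 := mem_sphere_zero_iff_norm.1 c.2.2

lemma cell_of_norm {c : FreeCell d} (h : ‖c.2.1‖ = 1) :
    (cell φ).map c = (incl φ).map (φ.map (toBoundary h)) :=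
  cell_incl φ (toBoundary h)

open Classical in
/-- The normal form of a point. -/
def normalForm : Attach φ → Y ⊕ FreeCell d :=
  lift φ Sum.inl (fun c => if h : ‖c.2.1‖ = 1 then Sum.inl (φ.map (toBoundary h)) else Sum.inr c)
    fun c => by rw [dif_pos (norm_incl c)]; rfl

lemma normalForm_cell {c : FreeCell d} (h : ‖c.2.1‖ ≠ 1) :
    normalForm φ ((cell φ).map c) = Sum.inr c :=
  dif_neg h

lemma incl_injective : Function.Injective (incl φ).map := fun y y' h =>
  Sum.inl_injective (congrArg (normalForm φ) h)

/-- The inverse of the characteristic map on the open cell. -/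
def cellInv (x : Attach φ) : FreeCell d :=
  Sum.elim (fun _ => FreeCell.mk 1 (toDisk 0)) _root_.id (normalForm φ x)

lemma cellInv_cell {c : FreeCell d} (h : ‖c.2.1‖ ≠ 1) : cellInv φ ((cell φ).map c) = c := by
  rw [cellInv, normalForm_cell φ h]
  rfl

/-- The collar of the space to which the cell is attached. -/
def collar : Collar (Attach φ) where
  rho := lift φ (fun _ => 1) (fun c => ‖c.2.1‖) fun c => (norm_incl c).symm
  push q := lift φ (incl φ).map (fun c => (cell φ).map ((FreeCell.collar d).push (c, q.2)))
    (fun c => by rw [FreeCell.push_of_norm d (norm_incl c), cell_incl]) q.1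
  continuous_rho := continuous_quot_lift _
    (continuous_const.sumElim (FreeCell.collar d).continuous_rho)
  continuous_push := by
    have hq : Topology.IsQuotientMap (Quot.mk (AttachRel φ)) := isQuotientMap_quot_mk
    refine hq.continuous_lift_prod_left (Y := unitInterval) ?_
    have h1 : Continuous fun p : Y × unitInterval => (incl φ).map p.1 := by fun_prop
    have h2 : Continuous fun p : FreeCell d × unitInterval =>
        (cell φ).map ((FreeCell.collar d).push p) :=
      (cell φ).map.continuous.comp (FreeCell.collar d).continuous_push
    refine ((h1.sumElim h2).comp (Homeomorph.sumProdDistrib).continuous).congr ?_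
    rintro ⟨s, t⟩
    cases s <;> rfl
  rho_smul z x := by
    induction x using ind with
    | h1 y => rfl
    | h2 c => rfl
  push_smul z x s := by
    induction x using ind with
    | h1 y => rfl
    | h2 c => rfl
  push_zero x := by
    induction x using ind with
    | h1 y => rfl
    | h2 c => exact congrArg (cell φ).map ((FreeCell.collar d).push_zero c)
  rho_push x s := by
    induction x using ind with
    | h1 y => exact Or.inl le_rfl
    | h2 c => exact (FreeCell.collar d).rho_push c s
  rho_push_one x h := by
    induction x using ind with
    | h1 y => exact le_rfl
    | h2 c => exact (FreeCell.collar d).rho_push_one c h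

lemma bd_eq : (collar φ).bd = Set.range (incl φ).map := by
  ext x
  induction x using ind with
  | h1 y => exact iff_of_true (le_refl (1 : ℝ)) ⟨y, rfl⟩
  | h2 c =>
    constructor
    · intro h
      rw [cell_of_norm φ ((FreeCell.mem_bd d).1 h)]
      exact ⟨_, rfl⟩
    · rintro ⟨y, hy⟩
      change 1 ≤ (collar φ).rho _
      rw [← hy]
      exact le_rfl

/-- A quotient map may be restricted to an open subset of the target. Over the points with `rho < 1`
only the open cell lies, and there the inverse is the identity. -/
lemma continuousOn_cellInv : ContinuousOn (cellInv φ) (collar φ).inner := by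
  have hq : Topology.IsQuotientMap (Quot.mk (AttachRel φ)) := isQuotientMap_quot_mk
  refine (hq.continuousOn_isOpen_iff
    (isOpen_lt (collar φ).continuous_rho continuous_const)).2 ?_
  have h : Continuous (Sum.elim (fun _ : Y => FreeCell.mk (d := d) 1 (toDisk 0)) _root_.id) :=
    continuous_const.sumElim continuous_id
  refine h.continuousOn.congr ?_
  rintro (y | c) hs
  · exact (lt_irrefl (1 : ℝ) hs).elim
  · exact cellInv_cell φ (ne_of_lt hs)

lemma cell_cellInv {x : Attach φ} (h : x ∈ (collar φ).inner) : (cell φ).map (cellInv φ x) = x := by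
  induction x using ind with
  | h1 y => exact (lt_irrefl (1 : ℝ) h).elim
  | h2 c => rw [cellInv_cell φ (ne_of_lt h)]

lemma pairMap_cell [ContinuousSMul Circle Y] : PairMap (Bor.map (cell φ)) Set.univ (borSubset _ (FreeCell.collar d).bd)
    Set.univ (borSubset _ (collar φ).bd) :=
  pairMap_bor (cell φ) fun _ h => h

lemma cell_iso [ContinuousSMul Circle Y] (n : ℕ) : (pairMap_cell φ).Iso n :=
  Collar.relative_homeo_iso (FreeCell.collar d) (collar φ) (cell φ) (cellInv φ) (fun _ => rfl)
    (continuousOn_cellInv φ) (fun _ h => cellInv_cell φ (ne_of_lt h)) (fun _ h => cell_cellInv φ h)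
    (pairMap_cell φ) n

lemma sphereLike [ContinuousSMul Circle Y] :
    SphereLike d Set.univ (borSubset _ (collar φ).bd) :=
  SphereLike.of_iso (h := pairMap_cell φ) (cell_iso φ) (sphereLike_freeCell d)

lemma isClosedEmbedding_boundary (d : ℕ) :
    Topology.IsClosedEmbedding (FreeCellBoundary.toCell d).map := by
  haveI : CompactSpace (FreeCellBoundary d) :=
    inferInstanceAs (CompactSpace (Circle × DiskBoundary d))
  haveI : T2Space (FreeCell d) := inferInstanceAs (T2Space (Circle × Disk d))
  refine (FreeCellBoundary.toCell d).map.continuous.isClosedEmbedding fun c c' h => ?_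
  exact Prod.ext (congrArg (fun c : FreeCell d => c.1) h)
    (Subtype.ext (congrArg (fun c : FreeCell d => c.2.1) h))

/-- The preimage in the cell of the image of a closed set `C` is `φ⁻¹(C)`, placed in the boundary.
It is closed because the compact boundary is closed in the cell. -/
lemma isClosedEmbedding_incl : Topology.IsClosedEmbedding (incl φ).map := by
  refine .of_continuous_injective_isClosedMap (incl φ).map.continuous (incl_injective φ) fun C hC => ?_
  have hq : Topology.IsQuotientMap (Quot.mk (AttachRel φ)) := isQuotientMap_quot_mk
  refine hq.isClosed_preimage.1 (isClosed_sum_iff.2 ⟨?_, ?_⟩)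
  · convert hC using 1
    exact Set.preimage_image_eq C (incl_injective φ)
  · convert (isClosedEmbedding_boundary d).isClosedMap _ (hC.preimage φ.map.continuous) using 1
    ext c
    constructor
    · rintro ⟨y, hy, h⟩
      have hc : ‖c.2.1‖ = 1 := congrArg (collar φ).rho h.symm
      refine ⟨toBoundary hc, ?_, rfl⟩
      have h' := h.trans (cell_of_norm φ hc)
      rw [Set.mem_preimage, ← incl_injective φ h']
      exact hy
    · rintro ⟨b, hb, rfl⟩
      exact ⟨_, hb, (cell_incl φ b).symm⟩

/-- The inverse of the inclusion. -/
def inclInv [Nonempty Y] : Attach φ → Y := Function.invFun (incl φ).map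

lemma continuousOn_inclInv [Nonempty Y] : ContinuousOn (inclInv φ) (collar φ).bd := by
  rw [bd_eq, continuousOn_iff_continuous_restrict]
  let e := (isClosedEmbedding_incl φ).isEmbedding.toHomeomorph
  refine e.symm.continuous.congr fun x => ?_
  obtain ⟨y, rfl⟩ := e.surjective x
  rw [e.symm_apply_apply]
  exact (Function.leftInverse_invFun (incl_injective φ) y).symm

lemma inclInv_incl [Nonempty Y] (y : Y) : inclInv φ ((incl φ).map y) = y :=
  Function.leftInverse_invFun (incl_injective φ) y

lemma incl_inclInv [Nonempty Y] {x : Attach φ} (h : x ∈ (collar φ).bd) :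
    (incl φ).map (inclInv φ x) = x := by
  rw [bd_eq] at h
  obtain ⟨y, rfl⟩ := h
  rw [inclInv_incl]

lemma pairMap_incl (y : Y) : PairMap (Bor.map (incl φ)) Set.univ (borSubset Y {y})
    (borSubset _ (collar φ).bd) (borSubset _ {(incl φ).map y}) := by
  refine ⟨(Bor.map _).continuous.continuousOn, Set.subset_univ _, ?_, ?_⟩
  · intro x _
    obtain ⟨⟨e, y⟩, rfl⟩ := Bor.mk_surjective x
    exact ⟨e, (incl φ).map y, le_refl (1 : ℝ), rfl⟩
  · rintro _ ⟨e, x, rfl, rfl⟩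
    exact ⟨e, _, rfl, rfl⟩

lemma incl_iso [ContinuousSMul Circle Y] (y : Y) (n : ℕ) : (pairMap_incl φ y).Iso n := by
  haveI : Nonempty Y := ⟨y⟩
  have h : PairMap (Bor.map (incl φ)) (borSubset Y Set.univ) (borSubset Y {y})
      (borSubset _ (collar φ).bd) (borSubset _ {(incl φ).map y}) := by
    rw [Collar.borSubset_univ]
    exact pairMap_incl φ y
  have i : h.Iso n := bor_homeo_iso (incl φ) (inclInv φ) (collar φ).inv_bd
    (continuousOn_inclInv φ) (fun y _ => inclInv_incl φ y) (fun x hx => incl_inclInv φ hx)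
    inv_univ (fun _ _ => trivial) (by rintro _ rfl; exact inclInv_incl φ y)
    (by rintro _ rfl; exact le_refl (1 : ℝ)) h n
  revert h
  rw [Collar.borSubset_univ]
  exact fun _ i => i

lemma separated {X W : Type} [TopologicalSpace X] [TopologicalSpace W] [T2Space W] {O : Set X}
    (hO : IsOpen O) {f : X → W} (hf : ContinuousOn f O) {x y : X} (hx : x ∈ O) (hy : y ∈ O)
    (h : f x ≠ f y) : ∃ u v : Set X, IsOpen u ∧ IsOpen v ∧ x ∈ u ∧ y ∈ v ∧ Disjoint u v := by
  obtain ⟨u, v, hu, hv, hxu, hyv, hd⟩ := t2_separation h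
  exact ⟨_, _, hf.isOpen_inter_preimage hO hu, hf.isOpen_inter_preimage hO hv, ⟨hx, hxu⟩, ⟨hy, hyv⟩,
    (hd.preimage f).mono Set.inter_subset_right Set.inter_subset_right⟩

/-- Points with different values of `rho` are separated by `rho`. Two points of the open cell are
separated in the cell, and two points of `Y` are separated after the collar has been pushed onto
`Y`. -/
lemma t2Space [ContinuousSMul Circle Y] [T2Space Y] : T2Space (Attach φ) := by
  refine ⟨fun x y hxy => ?_⟩
  by_cases hr : (collar φ).rho x = (collar φ).rho y
  · rcases lt_or_ge ((collar φ).rho x) 1 with hx | hx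
    · haveI : T2Space (FreeCell d) := inferInstanceAs (T2Space (Circle × Disk d))
      have hy : y ∈ (collar φ).inner := lt_of_eq_of_lt hr.symm hx
      refine separated (isOpen_lt (collar φ).continuous_rho continuous_const)
        (continuousOn_cellInv φ) hx hy fun h => hxy ?_
      rw [← cell_cellInv φ hx, h, cell_cellInv φ hy]
    · have hy : y ∈ (collar φ).bd := hx.trans_eq hr
      obtain ⟨a, rfl⟩ := (bd_eq φ).le hx
      obtain ⟨b, rfl⟩ := (bd_eq φ).le hy
      haveI : Nonempty Y := ⟨a⟩
      have hO : IsOpen (collar φ).nb := isOpen_lt continuous_const (collar φ).continuous_rho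
      refine separated (f := fun x => inclInv φ ((collar φ).push (x, 1))) hO ?_
        ((collar φ).bd_subset_nb hx) ((collar φ).bd_subset_nb hy) fun h => hxy ?_
      · refine (continuousOn_inclInv φ).comp ((collar φ).continuous_push.comp
          (by fun_prop : Continuous fun x : Attach φ => (x, (1 : unitInterval)))).continuousOn ?_
        exact fun x hx => (collar φ).rho_push_one x hx
      · have h' : inclInv φ ((incl φ).map a) = inclInv φ ((incl φ).map b) := h
        rw [inclInv_incl, inclInv_incl] at h'
        rw [h']
  · exact separated isOpen_univ (collar φ).continuous_rho.continuousOn trivial trivial hr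

end Attach


/-! ### Reduced Borel cohomology -/

section Reduced

variable {X Y Z : Type} [TopologicalSpace X] [MulAction Circle X] [ContinuousSMul Circle X]
  [TopologicalSpace Y] [MulAction Circle Y] [ContinuousSMul Circle Y]
  [TopologicalSpace Z] [MulAction Circle Z] [ContinuousSMul Circle Z]

/-- Composition of equivariant maps. -/
def TMap.comp {X Y Z : Type} [TopologicalSpace X] [MulAction Circle X] [TopologicalSpace Y]
    [MulAction Circle Y] [TopologicalSpace Z] [MulAction Circle Z] (g : TMap Y Z) (f : TMap X Y) :
    TMap X Z where
  map := g.map.comp f.map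
  equivariant z x := (congrArg g.map (f.equivariant z x)).trans (g.equivariant z _)

/-- Borel cohomology in terms of cochains. -/
def borCohEquiv {X : Type} [TopologicalSpace X] [MulAction Circle X] (k : Type) [CommRing k] (n : ℕ)
    (S : Set X) : borelCohomology X k n S ≃ₗ[k] Coh k n (Set.univ : Set (Bor X)) (borSubset X S) :=
  cohEquiv k (borSubset X S) n

/-- The induced map in relative Borel cohomology in terms of cochains. -/
def borPull (k : Type) [CommRing k] (n : ℕ) (f : TMap X Y) {S : Set X} {S' : Set Y}
    (h : Set.MapsTo f.map S S') :
    Coh k n (Set.univ : Set (Bor Y)) (borSubset Y S') →ₗ[k] Coh k n Set.univ (borSubset X S) :=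
  (pairMap_bor f h).pull k n

variable {k : Type} [CommRing k]

lemma borCohEquiv_pullback (n : ℕ) (f : TMap X Y) {S : Set X} {S' : Set Y}
    (h : Set.MapsTo f.map S S') (y : borelCohomology Y k n S') :
    borCohEquiv k n S (borelPullback k n f S S' h y) = borPull k n f h (borCohEquiv k n S' y) :=
  cohEquiv_map k (X := Bor X) (Y := Bor Y) (borPairMap f S S' h) (pairMap_bor f h) n y

lemma borPull_of_comp_eq (n : ℕ) (g : TMap Y Z) (f : TMap X Y) (e : TMap X Z) {S : Set X}
    {S' : Set Y} {S'' : Set Z} (hf : Set.MapsTo f.map S S') (hg : Set.MapsTo g.map S' S'')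
    (h : Set.MapsTo e.map S S'') (he : ∀ x, g.map (f.map x) = e.map x) (y) :
    borPull k n f hf (borPull k n g hg y) = borPull k n e h y := by
  rw [borPull, borPull, borPull, ← PairMap.pull_comp]
  refine PairMap.pull_eq_of_eqOn _ _ (fun x _ => ?_) n y
  obtain ⟨p, rfl⟩ := Bor.mk_surjective x
  exact congrArg (fun x => Bor.mk (p.1, x)) (he p.2)

lemma coeff_borPull (n : ℕ) (f : TMap X Y) {S : Set X} {S' : Set Y} (h : Set.MapsTo f.map S S') (y) :
    coeff k n _ _ (borPull ℤ n f h y) = borPull k n f h (coeff k n _ _ y) := coeff_pull _ n y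

lemma mapsTo_pt {f : TMap X Y} {x : X} {y : Y} (h : f.map x = y) :
    Set.MapsTo f.map {x} {y} := by
  rintro _ rfl
  exact h

lemma pairMap_empty : PairMap id (Set.univ : Set (Bor X)) ∅ Set.univ (borSubset X ∅) :=
  PairMap.id (Set.empty_subset _) subset_rfl (Set.empty_subset _)

lemma empty_iso (n : ℕ) : (pairMap_empty (X := X)).Iso n :=
  PairMap.Iso.of_inverse pairMap_empty
    (PairMap.id (Set.subset_univ _) subset_rfl borSubset_empty.subset) (fun _ _ => rfl)
    (fun _ _ => rfl) n

/-- Two integral generators differ by a unit of `ℤ`, which stays invertible in every `k`. So a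
hypothesis over `ℤ` alone suffices once some generator for all coefficients is known. -/
lemma IsGen.of_int {W : Type} [TopologicalSpace W] {U A : Set W} {n : ℕ} {u₀ u : Coh ℤ n U A}
    (h₀ : IsGen u₀) (hu : ∀ y, ∃! c : ℤ, y = c • u) : IsGen u := by
  obtain ⟨s, hs, -⟩ := h₀.int u
  obtain ⟨t, ht, -⟩ := hu u₀
  have hts : t * s = 1 := by
    refine (h₀.int u₀).unique ?_ (one_smul ℤ u₀).symm
    rw [mul_smul, ← hs]
    exact ht
  intro k _ y
  have h1 : ∀ c : k, c • coeff k n U A u = (c * s) • coeff k n U A u₀ := fun c => by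
    rw [hs, coeff_smul, smul_smul]
  have hk : (t : k) * (s : k) = 1 := by exact_mod_cast congrArg (Int.cast : ℤ → k) hts
  obtain ⟨c, hc, hc'⟩ := h₀ k y
  refine ⟨c * t, ?_, fun c' h' => ?_⟩
  · dsimp only
    rw [h1, mul_assoc, hk, mul_one]
    exact hc
  · have h2 := hc' (c' * s) (h'.trans (h1 c'))
    rw [← h2, mul_assoc, mul_comm (s : k), hk, mul_one]

end Reduced

/-! ### Extension of cohomology classes over a free cell -/

namespace Attach

variable {Y : Type} [TopologicalSpace Y] [MulAction Circle Y] [ContinuousSMul Circle Y] {d : ℕ}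
  (φ : TMap (FreeCellBoundary d) Y) {y₀ : Y} {k : Type} [CommRing k] {n : ℕ}

lemma bor_pt_subset (y₀ : Y) : borSubset (Attach φ) {(incl φ).map y₀} ⊆ borSubset _ (collar φ).bd :=
  borSubset_mono (Set.singleton_subset_iff.2 (le_refl (1 : ℝ)))

lemma res_incl (y₀ : Y) (x : Coh k n Set.univ (borSubset (Attach φ) {(incl φ).map y₀})) :
    (pairMap_incl φ y₀).pull k n ((resMap (Set.subset_univ _) (bor_pt_subset φ y₀)).pull k n x) =
      borPull k n (incl φ) (mapsTo_pt rfl) x := by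
  rw [borPull, ← PairMap.pull_comp]

/-- Cohomology classes extend over a cell in other degrees. -/
lemma incl_surjective (y₀ : Y) (h : n + 1 ≠ d) :
    Function.Surjective (borPull k n (incl φ) (mapsTo_pt (rfl : _ = (incl φ).map y₀))) := fun y => by
  obtain ⟨y', rfl⟩ := (incl_iso φ y₀ n k).2 y
  obtain ⟨x, rfl⟩ := res_surjective (Set.subset_univ _) (bor_pt_subset φ y₀)
    ((sphereLike φ).1 _ h) y'
  exact ⟨x, (res_incl φ y₀ x).symm⟩

/-- A cohomology class extends over a cell if and only if it pulls back to zero. -/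
lemma exists_incl_iff (y₀ : Y) [Nonempty (DiskBoundary d)] (hn : n ≠ 0)
    (y : Coh k n Set.univ (borSubset Y {y₀})) :
    (∃ x, borPull k n (incl φ) (mapsTo_pt (rfl : _ = (incl φ).map y₀)) x = y) ↔
      borPull k n φ (Set.mapsTo_empty _ _) y = (0 : Coh k n Set.univ (borSubset _ ∅)) := by
  obtain ⟨y', rfl⟩ := (incl_iso φ y₀ n k).2 y
  have h1 : (∃ x, borPull k n (incl φ) (mapsTo_pt (rfl : _ = (incl φ).map y₀)) x =
      (pairMap_incl φ y₀).pull k n y') ↔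
      conn k n (Set.subset_univ _) (bor_pt_subset φ y₀) y' = 0 := by
    constructor
    · rintro ⟨x, hx⟩
      rw [← res_incl] at hx
      rw [← (incl_iso φ y₀ n k).1 hx, conn_res]
    · intro h
      obtain ⟨x, rfl⟩ := exact_res_conn _ _ y' h
      exact ⟨x, (res_incl φ y₀ x).symm⟩
  have h2 : PairMap (Bor.map (cell φ)) (borSubset _ (FreeCell.collar d).bd) ∅
      (borSubset _ (collar φ).bd) (borSubset (Attach φ) {(incl φ).map y₀}) :=
    ⟨(Bor.map _).continuous.continuousOn, Set.empty_subset _, by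
      rintro _ ⟨e, c, hc, rfl⟩
      exact ⟨e, (cell φ).map c, hc, rfl⟩, Set.mapsTo_empty _ _⟩
  -- The obstruction to extending is the connecting homomorphism, which is compared with that of the
  -- cell by the characteristic map. The latter is injective since the cell has no cohomology in
  -- degree `n ≠ 0`, so the obstruction vanishes exactly when the restriction to the boundary of the
  -- cell does.
  have h3 := conn_pull (k := k) (Set.subset_univ _) (Set.empty_subset _) (Set.subset_univ _)
    (bor_pt_subset φ y₀) (pairMap_cell φ) h2 n y'
  have h4 : (h2.comp (pairMap_toCell d)).pull k n y' = pairMap_empty.pull k n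
      (borPull k n φ (Set.mapsTo_empty _ _) ((pairMap_incl φ y₀).pull k n y')) := by
    rw [borPull, ← PairMap.pull_comp, ← PairMap.pull_comp]
    refine PairMap.pull_eq_of_eqOn _ _ (fun x _ => ?_) n y'
    obtain ⟨p, rfl⟩ := Bor.mk_surjective x
    exact congrArg (fun x => Bor.mk (p.1, x)) (cell_incl φ p.2)
  have inj1 : Function.Injective (conn k n (Set.subset_univ (borSubset _ (FreeCell.collar d).bd))
      (Set.empty_subset _)) := (injective_iff_map_eq_zero _).2 fun z hz => by
    obtain ⟨w, rfl⟩ := exact_res_conn _ _ z hz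
    rw [(van_freeCell d hn).eq_zero w, map_zero]
  rw [h1, ← map_eq_zero_iff _ (cell_iso φ (n + 1) k).1, ← h3, map_eq_zero_iff _ inj1,
    ← map_eq_zero_iff _ (toCell_iso d n k).1, ← PairMap.pull_comp, h4,
    map_eq_zero_iff _ (empty_iso n k).1]

end Attach


/-! ### Cohomology of a space that retracts after attaching a cell -/

namespace Attach

variable {Y : Type} [TopologicalSpace Y] [MulAction Circle Y] [ContinuousSMul Circle Y] {d : ℕ}
  (φ : TMap (FreeCellBoundary d) Y) {k : Type} [CommRing k] {n : ℕ}

/-- The reduced cohomology class defined by a relative class of the attached cell. -/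
def ofCell (k : Type) [CommRing k] (n : ℕ) (y₀ : Y) :
    Coh k n Set.univ (borSubset (Attach φ) (collar φ).bd) →ₗ[k]
      Coh k n Set.univ (borSubset (Attach φ) {(incl φ).map y₀}) :=
  (relMap (Set.subset_univ _) (bor_pt_subset φ y₀)).pull k n

lemma incl_ofCell (y₀ : Y) (u) :
    borPull k n (incl φ) (mapsTo_pt rfl) (ofCell φ k n y₀ u) = 0 := by
  have h := res_rel (Set.subset_univ _) (bor_pt_subset φ y₀) u
  rw [← res_incl, ofCell, h, map_zero]

/-- Cohomology of a space with a cell attached, in the presence of a retraction. -/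
lemma exists_unique_coord (r : TMap (Attach φ) Y) (hr : ∀ y, r.map ((incl φ).map y) = y) (y₀ : Y)
    (hv : Van n Set.univ (borSubset Y {y₀})) {γ : Coh ℤ (n + 1) Set.univ (borSubset Y {y₀})}
    (hγ : IsGen γ) {u : Coh ℤ (n + 1) Set.univ (borSubset (Attach φ) (collar φ).bd)} (hu : IsGen u)
    (y : Coh k (n + 1) Set.univ (borSubset (Attach φ) {(incl φ).map y₀})) :
    ∃! c : k × k, y = c.1 • coeff k _ _ _ (borPull ℤ _ r (mapsTo_pt (hr y₀)) γ) +
      c.2 • coeff k _ _ _ (ofCell φ ℤ _ y₀ u) := by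
  have hG : borSubset (Attach φ) (collar φ).bd ⊆ Set.univ := Set.subset_univ _
  have hK := bor_pt_subset φ y₀
  have h1 : ∀ z : Coh k (n + 1) Set.univ (borSubset Y {y₀}), borPull k _ (incl φ) (mapsTo_pt rfl)
      (borPull k _ r (mapsTo_pt (hr y₀)) z) = z := fun z => by
    rw [borPull, borPull, ← PairMap.pull_comp, PairMap.pull_eq_of_eqOn _
      (PairMap.id (Set.subset_univ _) subset_rfl subset_rfl) _, PairMap.pull_id]
    intro x _
    obtain ⟨p, rfl⟩ := Bor.mk_surjective x
    exact congrArg (fun x => Bor.mk (p.1, x)) (hr p.2)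
  have h2 : ∀ z : Coh k (n + 1) Set.univ (borSubset (Attach φ) (collar φ).bd),
      borPull k _ (incl φ) (mapsTo_pt rfl) (ofCell φ k _ y₀ z) = 0 := fun z => incl_ofCell φ y₀ z
  -- The kernel is the image of the reduced cohomology of `Y` one degree lower, which vanishes by
  -- `hv`.
  have h3 : Function.Injective (ofCell φ k (n + 1) y₀) := (injective_iff_map_eq_zero _).2 fun z hz => by
    obtain ⟨w, rfl⟩ := exact_conn_rel hG hK z hz
    rw [((incl_iso φ y₀ n).van hv).eq_zero w, map_zero]
  have h4 : coeff k _ _ _ (ofCell φ ℤ _ y₀ u) = ofCell φ k _ y₀ (coeff k _ _ _ u) :=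
    coeff_pull _ _ u
  rw [coeff_borPull, h4]
  -- The first coordinate is read off on `Y`. What remains after subtracting its retraction
  -- restricts to zero on `Y` and therefore comes from the cell.
  obtain ⟨c, hc, hc'⟩ := hγ k (borPull k _ (incl φ) (mapsTo_pt rfl) y)
  obtain ⟨z, hz⟩ := exact_rel_res hG hK (y - c • borPull k _ r (mapsTo_pt (hr y₀))
    (coeff k _ _ _ γ)) (by
      refine (incl_iso φ y₀ _ k).1 ?_
      rw [res_incl, map_zero, map_sub, map_smul, h1, sub_eq_zero]
      exact hc)
  obtain ⟨a, ha, ha'⟩ := hu k z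
  refine ⟨(c, a), ?_, ?_⟩
  · dsimp only
    rw [← map_smul, ← map_smul (ofCell φ k (n + 1) y₀), ← ha, map_smul]
    exact (sub_eq_iff_eq_add'.1 hz.symm)
  · rintro ⟨c', a'⟩ h
    dsimp only at h
    have hcc : c' = c := hc' c' (by
      dsimp only
      rw [h, map_add, map_smul, map_smul, h1, h2, smul_zero, add_zero])
    subst hcc
    refine Prod.ext rfl (ha' a' (h3 ?_))
    rw [map_smul]
    refine Eq.trans hz ?_
    rw [h, add_sub_cancel_left]

end Attach

/-! ### The space `A`, its retraction and its basis in degree `n` -/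

section SpaceA

variable (l h : ℕ)

/-- The retraction of `A` to the representation sphere. -/
def SpaceA.retract : TMap (SpaceA l h) (RepSphere l h) :=
  Attach.desc _ ⟨ContinuousMap.id _, fun _ _ => rfl⟩
    ⟨ContinuousMap.const _ (RepSphere.pt l h), fun z _ => ((RepSphere.base l h).2 z).symm⟩
    fun _ => rfl

/-- The inclusion of the representation sphere. -/
abbrev SpaceA.incl : TMap (RepSphere l h) (SpaceA l h) := Attach.incl _

lemma SpaceA.retract_incl (x : RepSphere l h) :
    (SpaceA.retract l h).map ((SpaceA.incl l h).map x) = x := rfl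

/-- The inclusion of the fixed points of `A`. -/
def SpaceA.fixed : TMap (RepSphere l 0) (SpaceA l h) := (SpaceA.incl l h).comp (RepSphere.incl l h)

lemma SpaceA.fixed_pt : (SpaceA.fixed l h).map (RepSphere.pt l 0) = (SpaceA.base l h).1 := rfl

/-- Reduced Borel cohomology of the representation sphere. -/
abbrev CohRep (k : Type) [CommRing k] (n : ℕ) : Type :=
  Coh k n Set.univ (borSubset (RepSphere l h) {RepSphere.pt l h})

/-- Reduced Borel cohomology of `A`. -/
abbrev CohA (k : Type) [CommRing k] (n : ℕ) : Type :=
  Coh k n Set.univ (borSubset (SpaceA l h) {(SpaceA.base l h).1})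

/-- Reduced Borel cohomology of the fixed point sphere. -/
abbrev CohFixed (k : Type) [CommRing k] (n : ℕ) : Type :=
  Coh k n Set.univ (borSubset (RepSphere l 0) {RepSphere.pt l 0})

lemma SpaceA.retract_pt : (SpaceA.retract l h).map (SpaceA.base l h).1 = RepSphere.pt l h := rfl

lemma SpaceA.incl_pt : (SpaceA.incl l h).map (RepSphere.pt l h) = (SpaceA.base l h).1 := rfl

variable (k : Type) [CommRing k] (n : ℕ)

/-- Restriction to the fixed points. -/
def CohA.restrict : CohA l h k n →ₗ[k] CohFixed l k n :=
  borPull k n (SpaceA.fixed l h) (mapsTo_pt (SpaceA.fixed_pt l h))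

/-- Restriction to the representation sphere. -/
def CohA.toRep : CohA l h k n →ₗ[k] CohRep l h k n :=
  borPull k n (SpaceA.incl l h) (mapsTo_pt (SpaceA.incl_pt l h))

/-- The map induced by the retraction to the representation sphere. -/
def CohRep.toA : CohRep l h k n →ₗ[k] CohA l h k n :=
  borPull k n (SpaceA.retract l h) (mapsTo_pt (SpaceA.retract_pt l h))

/-- Restriction to the fixed points. -/
def CohRep.restrict : CohRep l h k n →ₗ[k] CohFixed l k n := (pairMap_sphere_incl l h).pull k n

/-- The classes defined by the cell. -/
def CohA.ofCell : Coh k n Set.univ (borSubset (SpaceA l h) (Attach.collar _).bd) →ₗ[k] CohA l h k n :=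
  Attach.ofCell _ k n (RepSphere.pt l h)

variable {k n}

lemma CohA.restrict_toRep (y : CohA l h k n) :
    CohRep.restrict l h k n (CohA.toRep l h k n y) = CohA.restrict l h k n y :=
  borPull_of_comp_eq n (SpaceA.incl l h) (RepSphere.incl l h) (SpaceA.fixed l h)
    (mapsTo_pt (x := RepSphere.pt l 0) (y := RepSphere.pt l h) rfl) _ _ (fun _ => rfl) y

lemma CohRep.restrict_toA (y : CohRep l h k n) :
    CohA.restrict l h k n (CohRep.toA l h k n y) = CohRep.restrict l h k n y :=
  borPull_of_comp_eq n (SpaceA.retract l h) (SpaceA.fixed l h) (RepSphere.incl l h) _ _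
    (mapsTo_pt (x := RepSphere.pt l 0) (y := RepSphere.pt l h) rfl) (fun _ => rfl) y

lemma CohA.coeff_restrict (y : CohA l h ℤ n) : CohA.restrict l h k n (coeff k _ _ _ y) =
    coeff k _ _ _ (CohA.restrict l h ℤ n y) := (coeff_pull _ n y).symm

lemma CohA.toRep_ofCell (u) : CohA.toRep l h k n (CohA.ofCell l h k n u) = 0 :=
  Attach.incl_ofCell _ _ u

variable {l h}

/-- The map in cohomology induced by an attaching map. -/
abbrev AttachingMap.pull (φ : AttachingMap l h) (k : Type) [CommRing k] (n : ℕ) :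
    CohA l h k n →ₗ[k] Coh k n Set.univ (borSubset (FreeCellBoundary (l + 2 * h + 1)) ∅) :=
  borPull k n φ (Set.mapsTo_empty _ _)

instance (d : ℕ) : Nonempty (DiskBoundary (d + 1)) :=
  ((NormedSpace.sphere_nonempty (x := (0 : EuclideanSpace ℝ (Fin (d + 1))))).2
    zero_le_one).to_subtype

/-- The free cell has no cohomology in degrees `n` and `n + 1`, so the connecting homomorphism
identifies the cohomology of its boundary in degree `n` with that of the pair in degree `n + 1`. -/
lemma exists_gen_boundary {n : ℕ} (hn : n ≠ 0) :
    ∃ g : Coh ℤ n Set.univ (borSubset (FreeCellBoundary (n + 1)) ∅), IsGen g := by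
  obtain ⟨w, hw⟩ := (sphereLike_freeCell (n + 1)).2
  obtain ⟨u, hu⟩ := exists_gen_of_conn (Set.subset_univ _) (Set.empty_subset _) (van_freeCell _ hn)
    (van_freeCell _ n.succ_ne_zero) hw
  obtain ⟨g, hg⟩ := (empty_iso (X := FreeCellBoundary (n + 1)) n ℤ).2
    ((pairMap_toCell (n + 1)).pull ℤ n u)
  refine ⟨g, IsGen.of_pull (empty_iso n) ?_⟩
  rw [hg]
  exact IsGen.pull (toCell_iso (n + 1) n) hu

/-- A basis for all coefficient rings of the reduced cohomology of `A` in degree `n`. -/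
structure IsBasis (e f : CohA l h ℤ (l + 2 * h)) : Prop where
  coord : ∀ (k : Type) [CommRing k] (y : CohA l h k (l + 2 * h)),
    ∃! c : k × k, y = c.1 • coeff k _ _ _ e + c.2 • coeff k _ _ _ f
  restrict_f : CohA.restrict l h ℤ _ f = 0
  restrict_e : IsGen (CohA.restrict l h ℤ _ e)

/-- The first class is pulled back from `S^{l,h}` along the retraction, the second comes from the
cell. The degree has to be positive because the vanishing of the cohomology of `S^{l,h}` one degree
lower is used. -/
lemma isBasis_of_gen (hn : 1 ≤ l + 2 * h) {γ : CohRep l h ℤ (l + 2 * h)} (hγ : IsGen γ)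
    {u : Coh ℤ (l + 2 * h) Set.univ (borSubset (SpaceA l h) (Attach.collar _).bd)} (hu : IsGen u) :
    IsBasis (CohRep.toA l h ℤ _ γ) (CohA.ofCell l h ℤ _ u) where
  coord k _ y := by
    obtain ⟨m, hm⟩ : ∃ m, l + 2 * h = m + 1 := ⟨l + 2 * h - 1, by omega⟩
    have hv : Van m Set.univ (borSubset (RepSphere l h) {RepSphere.pt l h}) :=
      van_repSphere_pt l h (by omega)
    have key := @Attach.exists_unique_coord (RepSphere l h) _ _ _ _ (constBase l h (l + 2 * h)) k _ m
      (SpaceA.retract l h) (SpaceA.retract_incl l h) (RepSphere.pt l h) hv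
    rw [← hm] at key
    exact key hγ hu y
  restrict_f := by rw [← CohA.restrict_toRep, CohA.toRep_ofCell, map_zero]
  restrict_e := by
    rw [CohRep.restrict_toA]
    exact IsGen.pull (sphere_incl_iso l h le_rfl) hγ

lemma exists_gen_repSphere_pt (l h : ℕ) : ∃ γ : Coh ℤ (l + 2 * h) Set.univ
    (borSubset (RepSphere l h) {RepSphere.pt l h}), IsGen γ := by
  obtain ⟨u, hu⟩ := exists_gen_repSphere l h
  exact ⟨_, IsGen.pull (repSphere_rel_iso l h _) hu⟩

lemma exists_isBasis (hn : 1 ≤ l + 2 * h) : ∃ e f : CohA l h ℤ (l + 2 * h), IsBasis e f := by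
  obtain ⟨γ, hγ⟩ := exists_gen_repSphere_pt l h
  obtain ⟨u, hu⟩ := (Attach.sphereLike (constBase l h (l + 2 * h))).2
  exact ⟨_, _, isBasis_of_gen hn hγ hu⟩

end SpaceA

/-! ### The fixed points of the space with a second cell attached -/

section Restrict

variable {l h : ℕ} (φ : AttachingMap l h)

/-- The inclusion of the fixed points of the space `X`. -/
def AttachingMap.fixed : TMap (RepSphere l 0) (Attach φ) := (Attach.incl φ).comp (SpaceA.fixed l h)

lemma AttachingMap.fixed_pt : φ.fixed.map (RepSphere.pt l 0) = φ.base.1 := rfl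

/-- Reduced Borel cohomology of the space `X`. -/
abbrev AttachingMap.CohX (k : Type) [CommRing k] (n : ℕ) : Type :=
  Coh k n Set.univ (borSubset (Attach φ) {φ.base.1})

/-- Restriction to the fixed points. -/
def AttachingMap.restrict (k : Type) [CommRing k] (n : ℕ) : φ.CohX k n →ₗ[k] CohFixed l k n :=
  borPull k n φ.fixed (mapsTo_pt φ.fixed_pt)

/-- Restriction to `A`. -/
def AttachingMap.toA (k : Type) [CommRing k] (n : ℕ) : φ.CohX k n →ₗ[k] CohA l h k n :=
  borPull k n (Attach.incl φ) (mapsTo_pt rfl)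

variable {k : Type} [CommRing k]

lemma AttachingMap.restrict_toA (n : ℕ) (y) :
    CohA.restrict l h k n (φ.toA k n y) = φ.restrict k n y :=
  borPull_of_comp_eq n (Attach.incl φ) (SpaceA.fixed l h) φ.fixed _ _ _ (fun _ => rfl) y

lemma AttachingMap.exists_toA_iff {n : ℕ} (hn : n ≠ 0) (y : CohA l h k n) :
    (∃ x, φ.toA k n x = y) ↔ φ.pull k n y = 0 :=
  Attach.exists_incl_iff φ (SpaceA.base l h).1 hn y

lemma AttachingMap.toA_surjective {n : ℕ} (hn : n ≠ l + 2 * h) :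
    Function.Surjective (φ.toA k n) :=
  Attach.incl_surjective φ (SpaceA.base l h).1 (by omega)

/-- The fixed points are contained in `S^{l,h}`, whose reduced cohomology vanishes below the
dimension. -/
lemma AttachingMap.restrict_eq_zero {n : ℕ} (hn : n < l + 2 * h) (y) : φ.restrict k n y = 0 := by
  rw [← φ.restrict_toA, ← CohA.restrict_toRep,
    (van_repSphere_pt l h hn).eq_zero (CohA.toRep l h k n _), map_zero]

/-- A class on the fixed sphere extends to `S^{l,h}`, then to `A` by the retraction, and then over
the last cell, which obstructs in degree `l + 2h` only. -/
lemma AttachingMap.restrict_surjective {n : ℕ} (hn : l + 2 * h < n) :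
    Function.Surjective (φ.restrict k n) := fun z => by
  obtain ⟨w, rfl⟩ := (sphere_incl_iso l h hn.le k).2 z
  obtain ⟨x, hx⟩ := φ.toA_surjective hn.ne' (CohRep.toA l h k n w)
  refine ⟨x, ?_⟩
  rw [← φ.restrict_toA, hx, CohRep.restrict_toA]
  rfl

/-- The computation behind the theorem: the class with coordinates `(c, d)` pulls back to `(c a + d
b) g`, so it extends over the cell exactly when this coefficient vanishes, and only `c` is visible
on the fixed points. It is enough that `e` and `f` span over `k`. -/
lemma AttachingMap.exists_restrict_iff (hn : l + 2 * h ≠ 0) {e f : CohA l h ℤ (l + 2 * h)}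
    (hs : ∀ y : CohA l h k (l + 2 * h),
      ∃ c : k × k, y = c.1 • coeff k _ _ _ e + c.2 • coeff k _ _ _ f)
    (hf : CohA.restrict l h ℤ _ f = 0)
    {g : Coh ℤ (l + 2 * h) Set.univ (borSubset (FreeCellBoundary (l + 2 * h + 1)) ∅)} (hg : IsGen g)
    {a b : ℤ} (hae : φ.pull ℤ _ e = a • g) (hbf : φ.pull ℤ _ f = b • g)
    (z : CohFixed l k (l + 2 * h)) : (∃ x, φ.restrict k _ x = z) ↔
      ∃ c d : k, c * a + d * b = 0 ∧ z = c • coeff k _ _ _ (CohA.restrict l h ℤ _ e) := by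
  have hp : ∀ c d : k, φ.pull k _ (c • coeff k _ _ _ e + d • coeff k _ _ _ f) = 0 ↔
      c * a + d * b = 0 := fun c d => by
    have h1 : φ.pull k _ (c • coeff k _ _ _ e + d • coeff k _ _ _ f) =
        (c * a + d * b) • coeff k _ _ _ g := by
      rw [map_add, map_smul, map_smul, ← coeff_borPull, ← coeff_borPull, hae, hbf, coeff_smul,
        coeff_smul, smul_smul, smul_smul, add_smul]
    rw [h1]
    exact ⟨fun h0 => (hg k 0).unique h0.symm (zero_smul k _).symm, fun h0 => by rw [h0, zero_smul]⟩
  have hr : ∀ c d : k, CohA.restrict l h k _ (c • coeff k _ _ _ e + d • coeff k _ _ _ f) =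
      c • coeff k _ _ _ (CohA.restrict l h ℤ _ e) := fun c d => by
    rw [map_add, map_smul, map_smul, CohA.coeff_restrict, CohA.coeff_restrict, hf, map_zero,
      smul_zero, add_zero]
  constructor
  · rintro ⟨x, rfl⟩
    obtain ⟨⟨c, d⟩, hcd⟩ := hs (φ.toA k _ x)
    refine ⟨c, d, ?_, ?_⟩
    · rw [← hp, ← hcd]
      exact (φ.exists_toA_iff hn _).1 ⟨x, rfl⟩
    · rw [← hr c d, ← hcd, φ.restrict_toA]
  · rintro ⟨c, d, h0, rfl⟩
    obtain ⟨x, hx⟩ := (φ.exists_toA_iff hn _).2 ((hp c d).2 h0)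
    exact ⟨x, by rw [← φ.restrict_toA, hx, hr]⟩

end Restrict


/-! ### Fixed points -/

section FixedPoints

instance {X : Type} [TopologicalSpace X] [MulAction Circle X] [ContinuousSMul Circle X] :
    ContinuousSMul Circle (MulAction.fixedPoints Circle X) where
  continuous_smul := by
    have h : Continuous fun p : Circle × MulAction.fixedPoints Circle X => p.1 • p.2.1 := by fun_prop
    exact h.subtype_mk _

instance (l h : ℕ) : CompactSpace (RepSphere l h) := inferInstanceAs (CompactSpace (OnePoint _))

instance (l h : ℕ) : T2Space (RepSphere l h) := inferInstanceAs (T2Space (OnePoint (Rep l h)))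

lemma RepSphere.smul_eq_self {l : ℕ} (z : Circle) (x : RepSphere l 0) : z • x = x := by
  induction x using RepSphere.ind with
  | infty => exact (RepSphere.base l 0).2 z
  | coe v =>
    rw [← (RepSphere.coe l 0).equivariant]
    exact congrArg (RepSphere.coe l 0).map (Prod.ext rfl (Subsingleton.elim _ _))

/-- The image of `j` is the fixed point set, and the action is free elsewhere. -/
structure IsFixedSphere {X : Type} [TopologicalSpace X] [MulAction Circle X] {l : ℕ}
    (j : TMap (RepSphere l 0) X) : Prop where
  injective : Function.Injective j.map
  mem_or_free : ∀ x, x ∈ Set.range j.map ∨ ∀ z : Circle, z • x = x → z = 1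

variable {X : Type} [TopologicalSpace X] [MulAction Circle X] [ContinuousSMul Circle X] {l : ℕ}

instance : Nontrivial Circle :=
  ⟨1, -1, fun h => by
    have := congrArg (Subtype.val : Circle → ℂ) h
    norm_num [Complex.ext_iff] at this⟩

lemma IsFixedSphere.exists_eq {j : TMap (RepSphere l 0) X} (hj : IsFixedSphere j)
    (x : MulAction.fixedPoints Circle X) : ∃ s, j.map s = x.1 := by
  rcases hj.mem_or_free x.1 with h | h
  · exact h
  · obtain ⟨z, hz⟩ := exists_ne (1 : Circle)
    exact (hz (h z (x.2 z))).elim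

lemma TMap.mem_fixedPoints (j : TMap (RepSphere l 0) X) (s : RepSphere l 0) :
    j.map s ∈ MulAction.fixedPoints Circle X := fun z => by
  rw [← j.equivariant, RepSphere.smul_eq_self]

/-- An equivariant map of the fixed sphere as a map to the fixed point set. -/
def TMap.toFixed (j : TMap (RepSphere l 0) X) :
    TMap (RepSphere l 0) (MulAction.fixedPoints Circle X) where
  map := ⟨fun s => ⟨j.map s, j.mem_fixedPoints s⟩, j.map.continuous.subtype_mk _⟩
  equivariant z s := Subtype.ext (j.equivariant z s)

/-- The fixed point set is a sphere. -/
def IsFixedSphere.homeo [T2Space X] {j : TMap (RepSphere l 0) X} (hj : IsFixedSphere j) :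
    RepSphere l 0 ≃ₜ MulAction.fixedPoints Circle X :=
  j.toFixed.map.continuous.homeoOfEquivCompactToT2 (f := Equiv.ofBijective j.toFixed.map
    ⟨fun s s' h => hj.injective (congrArg Subtype.val h), fun x => by
      obtain ⟨s, hs⟩ := hj.exists_eq x
      exact ⟨s, Subtype.ext hs⟩⟩)

lemma IsFixedSphere.nonempty_homotopyEquiv [T2Space X] {j : TMap (RepSphere l 0) X}
    (hj : IsFixedSphere j) :
    Nonempty (ContinuousMap.HomotopyEquiv (MulAction.fixedPoints Circle X) (StdSphere l)) := by
  have e : RepSphere l 0 ≃ₜ StdSphere l := onePointEquivSphereOfFinrankEq (V := Rep l 0) (by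
    rw [Rep.finrank, Fintype.card_fin])
  exact ⟨(hj.homeo.symm.trans e).toHomotopyEquiv⟩

/-- The map `j` is a continuous bijection from a compact space onto the Hausdorff fixed point set.
Hence restriction to the fixed points may be replaced by pullback along `j`, whose source is a
standard sphere. -/
lemma IsFixedSphere.exists_equiv [T2Space X] {j : TMap (RepSphere l 0) X} (hj : IsFixedSphere j)
    (k : Type) [CommRing k] (x₀ : MulAction.fixedPoints Circle X)
    (h₀ : j.map (RepSphere.pt l 0) = x₀.1) (n : ℕ) :
    ∃ E : borelCohomology (MulAction.fixedPoints Circle X) k n {x₀} ≃ₗ[k] CohFixed l k n,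
      ∀ y, E (restrictFixed k X x₀ n y) = borPull k n j (mapsTo_pt h₀) (borCohEquiv k n _ y) := by
  have hθ : j.toFixed.map (RepSphere.pt l 0) = x₀ := Subtype.ext h₀
  let g : TMap (MulAction.fixedPoints Circle X) (RepSphere l 0) :=
    ⟨⟨hj.homeo.symm, hj.homeo.symm.continuous⟩, fun z x => by
      change hj.homeo.symm (z • x) = _
      rw [RepSphere.smul_eq_self]
      exact congrArg hj.homeo.symm (Subtype.ext (x.2 z))⟩
  have hg : g.map x₀ = RepSphere.pt l 0 := by
    rw [← hθ]
    exact hj.homeo.symm_apply_apply _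
  have hi : (pairMap_bor j.toFixed (mapsTo_pt hθ)).Iso n :=
    borMap_iso j.toFixed g (mapsTo_pt hθ) (mapsTo_pt hg) hj.homeo.symm_apply_apply
      hj.homeo.apply_symm_apply n
  refine ⟨(borCohEquiv k n _).trans (LinearEquiv.ofBijective _ (hi k)), fun y => ?_⟩
  have h1 := borCohEquiv_pullback (k := k) n (fixedInclusion X) (S := {x₀}) (S' := {x₀.1})
    (by rintro _ rfl; rfl) y
  change (pairMap_bor j.toFixed (mapsTo_pt hθ)).pull k n (borCohEquiv k n _ (borelPullback k n
    (fixedInclusion X) {x₀} {x₀.1} _ y)) = _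
  rw [h1]
  exact borPull_of_comp_eq n (fixedInclusion X) j.toFixed j (mapsTo_pt hθ) _ (mapsTo_pt h₀) (fun _ => rfl) _

lemma isFixedSphere_repSphere (l h : ℕ) : IsFixedSphere (RepSphere.incl l h) where
  injective x y hxy := by
    induction x using RepSphere.ind with
    | infty =>
      induction y using RepSphere.ind with
      | infty => rfl
      | coe w => exact (OnePoint.infty_ne_coe _ hxy).elim
    | coe v =>
      induction y using RepSphere.ind with
      | infty => exact (OnePoint.coe_ne_infty _ hxy).elim
      | coe w =>
        have h1 : (Rep.incl l h).map v = (Rep.incl l h).map w := OnePoint.coe_injective hxy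
        have h2 : v.1 = w.1 := congrArg (fun w : Rep l h => w.1) h1
        have h3 : v = w := Prod.ext h2 (Subsingleton.elim _ _)
        rw [h3]
  mem_or_free x := by
    induction x using RepSphere.ind with
    | infty => exact Or.inl ⟨RepSphere.pt l 0, rfl⟩
    | coe v =>
      by_cases hv : v.2 = 0
      · left
        refine ⟨(RepSphere.coe l 0).map (v.1, 0), ?_⟩
        exact congrArg (RepSphere.coe l h).map (Prod.ext (x := (v.1, 0)) rfl hv.symm)
      · right
        intro z hz
        rw [← (RepSphere.coe l h).equivariant] at hz
        have h1 : z • v = v := OnePoint.coe_injective hz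
        have h2 : (z : ℂ) • v.2 = v.2 := congrArg (fun w : Rep l h => w.2) h1
        have h3 : ((z : ℂ) - 1) • v.2 = 0 := by rw [sub_smul, h2, one_smul, sub_self]
        rcases smul_eq_zero.1 h3 with h4 | h4
        · exact Circle.ext (sub_eq_zero.1 h4)
        · exact (hv h4).elim

lemma IsFixedSphere.attach {Y : Type} [TopologicalSpace Y] [MulAction Circle Y] {d : ℕ}
    {j : TMap (RepSphere l 0) Y} (hj : IsFixedSphere j) (φ : TMap (FreeCellBoundary d) Y) :
    IsFixedSphere ((Attach.incl φ).comp j) where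
  injective := (Attach.incl_injective φ).comp hj.injective
  mem_or_free x := by
    have h1 : ∀ y, (Attach.incl φ).map y ∈ Set.range ((Attach.incl φ).comp j).map ∨
        ∀ z : Circle, z • (Attach.incl φ).map y = (Attach.incl φ).map y → z = 1 := fun y => by
      rcases hj.mem_or_free y with ⟨s, hs⟩ | h
      · exact Or.inl ⟨s, congrArg (Attach.incl φ).map hs⟩
      · refine Or.inr fun z hz => h z (Attach.incl_injective φ ?_)
        rw [(Attach.incl φ).equivariant, hz]
    induction x using Attach.ind with
    | h1 y => exact h1 y
    | h2 c =>
      by_cases hc : ‖c.2.1‖ = 1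
      · rw [Attach.cell_of_norm φ hc]
        exact h1 _
      · refine Or.inr fun z hz => ?_
        rw [← (Attach.cell φ).equivariant] at hz
        have h2 := congrArg (Attach.normalForm φ) hz
        rw [Attach.normalForm_cell φ hc, Attach.normalForm_cell φ (c := z • c) hc] at h2
        have h3 : z * c.1 = c.1 := congrArg (fun c : FreeCell d => c.1) (Sum.inr_injective h2)
        exact mul_eq_right.1 h3

end FixedPoints

/-! ### The h-invariants -/

section HInvariants

variable {l h : ℕ} (φ : AttachingMap l h)

lemma SpaceA.isFixedSphere (l h : ℕ) : IsFixedSphere (SpaceA.fixed l h) :=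
  (isFixedSphere_repSphere l h).attach _

lemma AttachingMap.isFixedSphere : IsFixedSphere φ.fixed := (SpaceA.isFixedSphere l h).attach φ

instance (l h : ℕ) : T2Space (SpaceA l h) := Attach.t2Space _

instance : T2Space (Attach φ) := Attach.t2Space _

lemma sInf_eq_of_first {P : ℕ → Prop} {m : ℕ} (hm : P m) (h : ∀ j < m, ¬ P j) :
    sInf {i : ℕ∞ | ∃ j : ℕ, P j ∧ i = j} = m := by
  refine le_antisymm (sInf_le ⟨m, hm, rfl⟩) (le_sInf ?_)
  rintro _ ⟨j, hj, rfl⟩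
  exact Nat.cast_le.2 (not_lt.1 fun hjm => h j hjm hj)

variable (k : Type) [CommRing k]

lemma AttachingMap.surjective_iff (n : ℕ) :
    Function.Surjective (restrictFixed k (Attach φ) φ.base n) ↔
      Function.Surjective (φ.restrict k n) := by
  obtain ⟨E, hE⟩ := φ.isFixedSphere.exists_equiv k φ.base φ.fixed_pt n
  have h1 : ⇑E ∘ ⇑(restrictFixed k (Attach φ) φ.base n) =
      ⇑(φ.restrict k n) ∘ ⇑(borCohEquiv k n {φ.base.1}) := funext hE
  have h2 := E.toEquiv.comp_surjective (restrictFixed k (Attach φ) φ.base n)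
  have h3 := (borCohEquiv k n {φ.base.1}).toEquiv.surjective_comp (φ.restrict k n)
  change Function.Surjective (⇑E ∘ _) ↔ _ at h2
  rw [← h2, h1]
  exact h3

lemma AttachingMap.ne_zero_iff (n : ℕ) :
    restrictFixed k (Attach φ) φ.base n ≠ 0 ↔ ∃ x, φ.restrict k n x ≠ 0 := by
  obtain ⟨E, hE⟩ := φ.isFixedSphere.exists_equiv k φ.base φ.fixed_pt n
  rw [Ne, LinearMap.ext_iff, not_forall]
  constructor
  · rintro ⟨y, hy⟩
    refine ⟨borCohEquiv k n _ y, fun h0 => hy ?_⟩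
    exact E.injective ((hE y).trans (h0.trans (map_zero E).symm))
  · rintro ⟨x, hx⟩
    refine ⟨(borCohEquiv k n _).symm x, fun h0 => hx ?_⟩
    have h1 := hE ((borCohEquiv k n _).symm x)
    rw [h0, LinearEquiv.apply_symm_apply] at h1
    exact h1.symm.trans (map_zero E)

variable [Nontrivial k]

lemma exists_ne_zero_fixed (l j : ℕ) : ∃ y : CohFixed l k (l + 2 * j), y ≠ 0 := by
  obtain ⟨u, hu⟩ := exists_gen_sphere_fixed l j
  refine ⟨coeff k _ _ _ u, fun h0 => one_ne_zero (α := k) ?_⟩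
  exact (hu k 0).unique (by rw [h0, smul_zero]) (zero_smul k _).symm

variable {k}

lemma AttachingMap.not_surjective {j : ℕ} (hj : j < h) :
    ¬ Function.Surjective (φ.restrict k (l + 2 * j)) := fun hs => by
  obtain ⟨y, hy⟩ := exists_ne_zero_fixed k l j
  obtain ⟨x, rfl⟩ := hs y
  exact hy (φ.restrict_eq_zero (by omega) x)

-- Degrees below `l + 2h` do not count, since restriction is zero there and its target is not;
-- degrees above always count. In degree `l + 2h` it suffices to hit the generator, which forces `c
-- = 1`.
open Classical in
lemma AttachingMap.hStrong_eq (hn : l + 2 * h ≠ 0) {e f : CohA l h ℤ (l + 2 * h)}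
    (hs : ∀ y : CohA l h k (l + 2 * h),
      ∃ c : k × k, y = c.1 • coeff k _ _ _ e + c.2 • coeff k _ _ _ f)
    (he : IsGen (CohA.restrict l h ℤ _ e)) (hf : CohA.restrict l h ℤ _ f = 0)
    {g : Coh ℤ (l + 2 * h) Set.univ (borSubset (FreeCellBoundary (l + 2 * h + 1)) ∅)} (hg : IsGen g)
    {a b : ℤ} (hae : φ.pull ℤ _ e = a • g) (hbf : φ.pull ℤ _ f = b • g) :
    hStrong k (Attach φ) φ.base l =
      if ∃ d : k, a + d * b = 0 then (h : ℕ∞) else (h : ℕ∞) + 1 := by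
  have hiff : Function.Surjective (φ.restrict k (l + 2 * h)) ↔ ∃ d : k, a + d * b = 0 := by
    constructor
    · intro H
      obtain ⟨c, d, h0, h1⟩ := (φ.exists_restrict_iff hn hs hf hg hae hbf
        (coeff k _ _ _ (CohA.restrict l h ℤ _ e))).1 (H _)
      have hc : c = 1 := (he k _).unique h1 (one_smul k _).symm
      rw [hc, one_mul] at h0
      exact ⟨d, h0⟩
    · rintro ⟨d, hd⟩ z
      obtain ⟨c, hc, -⟩ := he k z
      refine (φ.exists_restrict_iff hn hs hf hg hae hbf z).2 ⟨c, c * d, ?_, hc⟩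
      rw [mul_assoc, ← mul_add, hd, mul_zero]
  unfold hStrong
  simp only [φ.surjective_iff]
  split_ifs with hd
  · exact sInf_eq_of_first (hiff.2 hd) fun j hj => φ.not_surjective hj
  · refine (sInf_eq_of_first (m := h + 1) (φ.restrict_surjective (by omega)) fun j hj => ?_).trans
      (by push_cast; rfl)
    rcases (Nat.lt_succ_iff.1 hj).lt_or_eq with hj | rfl
    · exact φ.not_surjective hj
    · exact fun H => hd (hiff.1 H)

-- The pattern is that of the strong invariant, but in degree `l + 2h` any class with `c ≠ 0` will
-- do, because `c` times the generator is then nonzero.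
open Classical in
lemma AttachingMap.hWeak_eq (hn : l + 2 * h ≠ 0) {e f : CohA l h ℤ (l + 2 * h)}
    (hs : ∀ y : CohA l h k (l + 2 * h),
      ∃ c : k × k, y = c.1 • coeff k _ _ _ e + c.2 • coeff k _ _ _ f)
    (he : IsGen (CohA.restrict l h ℤ _ e)) (hf : CohA.restrict l h ℤ _ f = 0)
    {g : Coh ℤ (l + 2 * h) Set.univ (borSubset (FreeCellBoundary (l + 2 * h + 1)) ∅)} (hg : IsGen g)
    {a b : ℤ} (hae : φ.pull ℤ _ e = a • g) (hbf : φ.pull ℤ _ f = b • g) :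
    hWeak k (Attach φ) φ.base l =
      if ∃ c d : k, c ≠ 0 ∧ c * a + d * b = 0 then (h : ℕ∞) else (h : ℕ∞) + 1 := by
  have hiff : (∃ x, φ.restrict k (l + 2 * h) x ≠ 0) ↔ ∃ c d : k, c ≠ 0 ∧ c * a + d * b = 0 := by
    constructor
    · rintro ⟨x, hx⟩
      obtain ⟨c, d, h0, h1⟩ := (φ.exists_restrict_iff hn hs hf hg hae hbf _).1 ⟨x, rfl⟩
      refine ⟨c, d, ?_, h0⟩
      rintro rfl
      exact hx (h1.trans (zero_smul k _))
    · rintro ⟨c, d, hc, h0⟩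
      obtain ⟨x, hx⟩ := (φ.exists_restrict_iff hn hs hf hg hae hbf _).2 ⟨c, d, h0, rfl⟩
      refine ⟨x, fun hx0 => hc ((he k 0).unique ?_ (zero_smul k _).symm)⟩
      rw [← hx, hx0]
  unfold hWeak
  simp only [φ.ne_zero_iff]
  have hlt : ∀ j < h, ¬ ∃ x, φ.restrict k (l + 2 * j) x ≠ 0 := fun j hj ⟨x, hx⟩ =>
    hx (φ.restrict_eq_zero (by omega) x)
  split_ifs with hd
  · exact sInf_eq_of_first (hiff.2 hd) hlt
  · refine (sInf_eq_of_first (m := h + 1) ?_ fun j hj => ?_).trans (by push_cast; rfl)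
    · obtain ⟨y, hy⟩ := exists_ne_zero_fixed k l (h + 1)
      obtain ⟨x, rfl⟩ := φ.restrict_surjective (by omega) y
      exact ⟨x, hy⟩
    · rcases (Nat.lt_succ_iff.1 hj).lt_or_eq with hj | rfl
      · exact hlt j hj
      · exact fun H => hd (hiff.1 H)

end HInvariants


/-! ### Maps to one-point compactifications -/

section Ratio

open Filter Topology

variable {Z W : Type} [TopologicalSpace Z] [NormedAddCommGroup W] [ProperSpace W] [NormedSpace ℝ W]

open Classical in
/-- The quotient of a vector by a number, with value infinity if the number is zero. -/
def ratio (t : ℝ) (v : W) : OnePoint W := if t = 0 then OnePoint.infty else ((t⁻¹ • v : W) : OnePoint W)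

lemma ratio_zero (v : W) : ratio 0 v = OnePoint.infty := if_pos rfl

lemma ratio_of_ne {t : ℝ} (h : t ≠ 0) (v : W) : ratio t v = ((t⁻¹ • v : W) : OnePoint W) := if_neg h

lemma invNorm_ratio {t : ℝ} (ht : 0 ≤ t) (v : W) : invNorm (ratio t v) = t / (t + ‖v‖) := by
  rcases ht.eq_or_lt with rfl | h
  · rw [ratio_zero, invNorm_infty, zero_div]
  · have h1 : 0 < t + ‖v‖ := by positivity
    rw [ratio_of_ne h.ne', invNorm_coe, norm_smul, norm_inv, Real.norm_of_nonneg ht]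
    field_simp

/-- At zeros of the denominator it is enough to bound `invNorm` by a continuous function that
vanishes there. The square is bounded because at the pole of a stereographic projection the
numerator tends to zero as well, and the natural estimate is one for squares. -/
lemma continuous_ratio_of_le {t b : Z → ℝ} {v : Z → W} (ht : Continuous t) (hv : Continuous v)
    (hb : Continuous b) (h0 : ∀ z, t z = 0 → b z = 0)
    (hle : ∀ z, invNorm (ratio (t z) (v z)) ^ 2 ≤ b z) : Continuous fun z => ratio (t z) (v z) := by
  refine continuous_iff_continuousAt.2 fun z => ?_
  by_cases hz : t z = 0
  · have h1 : ratio (t z) (v z) = OnePoint.infty := by rw [hz, ratio_zero]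
    rw [ContinuousAt, h1]
    refine tendsto_infty_of_invNorm ?_
    have h2 : Tendsto b (𝓝 z) (𝓝 0) := by
      rw [← h0 z hz]
      exact hb.continuousAt
    have h3 : Tendsto (fun z => invNorm (ratio (t z) (v z)) ^ 2) (𝓝 z) (𝓝 0) :=
      squeeze_zero (fun _ => sq_nonneg _) hle h2
    have h4 := h3.sqrt
    rw [Real.sqrt_zero] at h4
    refine (tendsto_zero_iff_abs_tendsto_zero _).2 (h4.congr fun z => ?_)
    exact Real.sqrt_sq_eq_abs _
  · have h1 : ContinuousAt (fun z => (t z)⁻¹ • v z) z := (ht.continuousAt.inv₀ hz).smul hv.continuousAt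
    refine ((OnePoint.continuous_coe (X := W)).continuousAt.comp h1).congr ?_
    filter_upwards [ht.continuousAt.eventually_ne hz] with y hy
    exact (ratio_of_ne hy _).symm

lemma continuous_ratio {t : Z → ℝ} {v : Z → W} (ht : Continuous t) (hv : Continuous v)
    (ht0 : ∀ z, 0 ≤ t z) (h : ∀ z, t z = 0 → v z ≠ 0) : Continuous fun z => ratio (t z) (v z) := by
  have h1 : ∀ z, 0 < t z + ‖v z‖ := fun z => by
    rcases (ht0 z).eq_or_lt with h0 | h0
    · rw [← h0, zero_add]
      exact norm_pos_iff.2 (h z h0.symm)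
    · positivity
  refine continuous_ratio_of_le ht hv (b := fun z => (t z / (t z + ‖v z‖)) ^ 2) ?_ (fun z hz => ?_)
    fun z => ?_
  · exact (ht.div (ht.add hv.norm) fun z => (h1 z).ne').pow 2
  · simp [hz]
  · rw [invNorm_ratio (ht0 z)]

end Ratio

section Disks

variable {d : ℕ}

/-- The map from the disk to the one-point compactification that collapses the boundary. -/
def collapse (v : Disk d) : OnePoint (EuclideanSpace ℝ (Fin d)) := ratio (1 - ‖v.1‖) v.1

lemma Disk.norm_le (v : Disk d) : ‖v.1‖ ≤ 1 := mem_closedBall_zero_iff.1 v.2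

lemma continuous_collapse : Continuous (collapse (d := d)) :=
  continuous_ratio (by fun_prop) (by fun_prop) (fun v => sub_nonneg.2 v.norm_le) fun v h h0 => by
    rw [h0, norm_zero, sub_zero] at h
    exact one_ne_zero h

lemma collapse_of_norm {v : Disk d} (h : ‖v.1‖ = 1) : collapse v = OnePoint.infty := by
  rw [collapse, h, sub_self, ratio_zero]

lemma collapse_of_lt {v : Disk d} (h : ‖v.1‖ < 1) :
    collapse v = (((1 - ‖v.1‖)⁻¹ • v.1 : EuclideanSpace ℝ (Fin d)) : OnePoint _) :=
  ratio_of_ne (sub_pos.2 h).ne' _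

/-- The homeomorphism from Euclidean space to the open disk. -/
def shrink (v : EuclideanSpace ℝ (Fin d)) : Disk d := toDisk ((1 + ‖v‖)⁻¹ • v)

lemma norm_shrink (v : EuclideanSpace ℝ (Fin d)) : ‖(1 + ‖v‖)⁻¹ • v‖ = ‖v‖ / (1 + ‖v‖) := by
  rw [norm_smul, norm_inv, Real.norm_of_nonneg (one_add_norm_pos v).le, inv_mul_eq_div]

lemma norm_shrink_lt (v : EuclideanSpace ℝ (Fin d)) : ‖(1 + ‖v‖)⁻¹ • v‖ < 1 := by
  rw [norm_shrink, div_lt_one (one_add_norm_pos v)]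
  linarith

lemma shrink_coe (v : EuclideanSpace ℝ (Fin d)) : (shrink v).1 = (1 + ‖v‖)⁻¹ • v :=
  toDisk_of_le (norm_shrink_lt v).le

lemma collapse_shrink (v : EuclideanSpace ℝ (Fin d)) : collapse (shrink v) = v := by
  have h1 := one_add_norm_pos v
  have h2 : ‖(shrink v).1‖ < 1 := by
    rw [shrink_coe]
    exact norm_shrink_lt v
  rw [collapse_of_lt h2, shrink_coe, norm_shrink, smul_smul]
  have h3 : (1 - ‖v‖ / (1 + ‖v‖))⁻¹ * (1 + ‖v‖)⁻¹ = 1 := by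
    field_simp
    simp
  rw [h3, one_smul]

lemma shrink_of_lt {v : Disk d} (h : ‖v.1‖ < 1) : shrink ((1 - ‖v.1‖)⁻¹ • v.1) = v := by
  refine Subtype.ext ?_
  have h1 : 0 < 1 - ‖v.1‖ := sub_pos.2 h
  rw [shrink_coe, norm_smul, norm_inv, Real.norm_of_nonneg h1.le, smul_smul]
  have h3 : (1 + (1 - ‖v.1‖)⁻¹ * ‖v.1‖)⁻¹ * (1 - ‖v.1‖)⁻¹ = 1 := by
    have h2 : (1 + (1 - ‖v.1‖)⁻¹ * ‖v.1‖) = (1 - ‖v.1‖)⁻¹ := by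
      field_simp
      ring
    rw [h2, inv_inv, mul_inv_cancel₀ h1.ne']
  rw [h3, one_smul]

lemma collapse_injOn {v w : Disk d} (hv : ‖v.1‖ < 1) (hw : ‖w.1‖ < 1) (h : collapse v = collapse w) :
    v = w := by
  rw [collapse_of_lt hv, collapse_of_lt hw, OnePoint.coe_eq_coe] at h
  rw [← shrink_of_lt hv, h, shrink_of_lt hw]

end Disks

/-! ### Finite equivariant cell complexes -/

section Complexes

variable {X Y : Type} [TopologicalSpace X] [MulAction Circle X] [TopologicalSpace Y]
  [MulAction Circle Y]

/-- The space is a finite equivariant CW complex with cells of dimension at most `D`, and `x₀` is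
a vertex. -/
def HasFiniteCells (X : Type) [TopologicalSpace X] [MulAction Circle X] (x₀ : X) (D : ℕ) : Prop :=
  ∃ (J : Type) (_ : Finite J) (d : J → ℕ) (H : J → Subgroup Circle)
    (Φ : ∀ j, C((Circle ⧸ H j) × Disk (d j), X)),
    (∀ j, IsClosed (H j : Set Circle)) ∧
    (∀ (j : J) (z : Circle) (q : Circle ⧸ H j) (v : Disk (d j)),
      Φ j (z • q, v) = z • Φ j (q, v)) ∧
    (∀ x : X, ∃! c : Σ j, (Circle ⧸ H j) × Disk (d j),
      ‖(c.2.2 : EuclideanSpace ℝ (Fin (d c.1)))‖ < 1 ∧ Φ c.1 c.2 = x) ∧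
    (∀ (j : J) (q : Circle ⧸ H j) (v : Disk (d j)),
      ‖(v : EuclideanSpace ℝ (Fin (d j)))‖ = 1 →
        ∃ i, d i < d j ∧ ∃ c : (Circle ⧸ H i) × Disk (d i), Φ i c = Φ j (q, v)) ∧
    (∀ j, d j ≤ D) ∧ ∃ j c, d j = 0 ∧ Φ j c = x₀

lemma HasFiniteCells.isFiniteTComplex [T2Space X] {x₀ : X} {D : ℕ} (h : HasFiniteCells X x₀ D) :
    IsFiniteTComplex X := by
  obtain ⟨J, hJ, d, H, Φ, h1, h2, h3, h4, -, -⟩ := h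
  exact ⟨‹_›, J, hJ, d, H, Φ, h1, h2, h3, h4⟩

/-- The characteristic map of a free cell in terms of cosets of the trivial subgroup. -/
def freeCellMap {d : ℕ} (c : TMap (FreeCell d) X) : C((Circle ⧸ (⊥ : Subgroup Circle)) × Disk d, X) where
  toFun p := c.map (FreeCell.mk (QuotientGroup.quotientBot p.1) p.2)
  continuous_toFun := by
    have h1 : Continuous (QuotientGroup.quotientBot : Circle ⧸ (⊥ : Subgroup Circle) ≃* Circle) :=
      continuous_quot_lift _ continuous_id
    exact c.map.continuous.comp (continuous_freeCell_mk d (h1.comp continuous_fst) continuous_snd)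

lemma freeCellMap_smul {d : ℕ} (c : TMap (FreeCell d) X) (z : Circle)
    (q : Circle ⧸ (⊥ : Subgroup Circle)) (v : Disk d) :
    freeCellMap c (z • q, v) = z • freeCellMap c (q, v) := by
  induction q using QuotientGroup.induction_on with
  | H w => exact c.equivariant z (FreeCell.mk w v)

/-- A space obtained by attaching a free cell. -/
lemma HasFiniteCells.attach {y₀ : Y} {D D' d : ℕ} (hY : HasFiniteCells Y y₀ D) (f : TMap Y X)
    (c : TMap (FreeCell d) X) (hf : Function.Injective f.map)
    (hc : ∀ a b : FreeCell d, ‖a.2.1‖ < 1 → ‖b.2.1‖ < 1 → c.map a = c.map b → a = b)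
    (hfc : ∀ y (a : FreeCell d), ‖a.2.1‖ < 1 → f.map y ≠ c.map a)
    (hs : ∀ x, (∃ y, f.map y = x) ∨ ∃ a : FreeCell d, ‖a.2.1‖ < 1 ∧ c.map a = x)
    (hb : ∀ a : FreeCell d, ‖a.2.1‖ = 1 →
      (D < d ∧ ∃ y, f.map y = c.map a) ∨ (0 < d ∧ f.map y₀ = c.map a))
    (hD : D ≤ D') (hd : d ≤ D') : HasFiniteCells X (f.map y₀) D' := by
  obtain ⟨J, hJ, e, H, Φ, h1, h2, h3, h4, h5, j₀, c₀, h6, h7⟩ := hY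
  refine ⟨Option J, inferInstance, fun o => o.elim d e, fun o => o.elim ⊥ H, fun o => match o with
    | none => freeCellMap c
    | some j => f.map.comp (Φ j), ?_, ?_, ?_, ?_, ?_, ?_⟩
  · rintro (_ | j)
    · exact isClosed_singleton (x := (1 : Circle))
    · exact h1 j
  · rintro (_ | j) z q v
    · exact freeCellMap_smul c z q v
    · exact (congrArg f.map (h2 j z q v)).trans (f.equivariant z _)
  · intro x
    rcases hs x with ⟨y, rfl⟩ | ⟨a, ha, rfl⟩
    · obtain ⟨⟨j, q, v⟩, ⟨hv, hy⟩, hu⟩ := h3 y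
      refine ⟨⟨some j, q, v⟩, ⟨hv, congrArg f.map hy⟩, ?_⟩
      rintro ⟨_ | i, p, w⟩ ⟨hw, hx⟩
      · exact (hfc y (FreeCell.mk (QuotientGroup.quotientBot p) w) hw hx.symm).elim
      · have h8 : (⟨i, p, w⟩ : Σ j, (Circle ⧸ H j) × Disk (e j)) = ⟨j, q, v⟩ :=
          hu ⟨i, p, w⟩ ⟨hw, hf hx⟩
        cases h8
        rfl
    · refine ⟨⟨none, QuotientGroup.quotientBot.symm a.1, a.2⟩, ⟨ha, ?_⟩, ?_⟩
      · change c.map (FreeCell.mk (QuotientGroup.quotientBot (QuotientGroup.quotientBot.symm a.1))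
          a.2) = _
        rw [MulEquiv.apply_symm_apply]
        rfl
      · rintro ⟨_ | i, p, w⟩ ⟨hw, hx⟩
        · have h8 : FreeCell.mk (QuotientGroup.quotientBot p) w = a :=
            hc (FreeCell.mk (QuotientGroup.quotientBot p) w) a hw ha hx
          subst h8
          have h9 : QuotientGroup.quotientBot.symm (QuotientGroup.quotientBot p) = p :=
            MulEquiv.symm_apply_apply _ _
          exact congrArg (fun p : Circle ⧸ (⊥ : Subgroup Circle) =>
            (⟨none, p, w⟩ : Σ o : Option J, (Circle ⧸ (Option.elim o ⊥ H : Subgroup Circle)) ×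
              Disk (o.elim d e))) h9.symm
        · exact (hfc (Φ i (p, w)) a ha hx).elim
  · rintro (_ | j) q v hv
    · rcases hb (FreeCell.mk (QuotientGroup.quotientBot q) v) hv with ⟨hDd, y, hy⟩ | ⟨h0, hy⟩
      · obtain ⟨⟨j, p, w⟩, ⟨-, hw⟩, -⟩ := h3 y
        exact ⟨some j, (h5 j).trans_lt hDd, (p, w), (congrArg f.map hw).trans hy⟩
      · exact ⟨some j₀, h6.trans_lt h0, c₀, (congrArg f.map h7).trans hy⟩
    · obtain ⟨i, hi, p, hp⟩ := h4 j q v hv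
      exact ⟨some i, hi, p, congrArg f.map hp⟩
  · rintro (_ | j)
    · exact hd
    · exact (h5 j).trans hD
  · exact ⟨some j₀, c₀, h6, congrArg f.map h7⟩

/-- The second alternative in `hb` is needed for `A`: the dimension of its cell does not exceed the
bound for the cells of `S^{l,h}`, but the boundary goes to the vertex at infinity. -/
lemma HasFiniteCells.attach_cell {y₀ : Y} {D D' d : ℕ} (hY : HasFiniteCells Y y₀ D)
    (φ : TMap (FreeCellBoundary d) Y) (hb : D < d ∨ 0 < d ∧ ∀ c, φ.map c = y₀) (hD : D ≤ D')
    (hd : d ≤ D') : HasFiniteCells (Attach φ) ((Attach.incl φ).map y₀) D' := by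
  refine hY.attach (Attach.incl φ) (Attach.cell φ) (Attach.incl_injective φ) (fun a b ha hb h => ?_)
    (fun y a ha h => ?_) (fun x => ?_) (fun a ha => ?_) hD hd
  · rw [← Attach.cellInv_cell φ ha.ne, h, Attach.cellInv_cell φ hb.ne]
  · exact ha.ne (congrArg (Attach.collar φ).rho h).symm
  · induction x using Attach.ind with
    | h1 y => exact Or.inl ⟨y, rfl⟩
    | h2 c =>
      rcases (Disk.norm_le c.2).lt_or_eq with h | h
      · exact Or.inr ⟨c, h, rfl⟩
      · exact Or.inl ⟨_, (Attach.cell_of_norm φ h).symm⟩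
  · rw [Attach.cell_of_norm φ ha]
    rcases hb with h | ⟨h, h'⟩
    · exact Or.inl ⟨h, _, rfl⟩
    · exact Or.inr ⟨h, by rw [h']⟩

end Complexes


/-! ### The cells of representation spheres -/

section Stereographic

variable {m : ℕ}

/-- All but the last coordinate. -/
def initCoord (u : EuclideanSpace ℝ (Fin (m + 1))) : EuclideanSpace ℝ (Fin m) :=
  WithLp.toLp 2 fun i => u i.castSucc

lemma continuous_initCoord : Continuous (initCoord (m := m)) := by
  unfold initCoord
  fun_prop

lemma norm_sq_coord (u : EuclideanSpace ℝ (Fin (m + 1))) :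
    ‖u‖ ^ 2 = ‖initCoord u‖ ^ 2 + u (Fin.last m) ^ 2 := by
  rw [EuclideanSpace.real_norm_sq_eq, EuclideanSpace.real_norm_sq_eq, Fin.sum_univ_castSucc]
  rfl

lemma ext_coord {u w : EuclideanSpace ℝ (Fin (m + 1))} (h : initCoord u = initCoord w)
    (h' : u (Fin.last m) = w (Fin.last m)) : u = w := by
  refine PiLp.ext fun i => ?_
  refine Fin.lastCases h' (fun i => ?_) i
  exact congrFun (congrArg WithLp.ofLp h) i

lemma exists_coord (p : EuclideanSpace ℝ (Fin m)) (r : ℝ) :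
    ∃ u : EuclideanSpace ℝ (Fin (m + 1)), initCoord u = p ∧ u (Fin.last m) = r :=
  ⟨WithLp.toLp 2 (Fin.snoc (α := fun _ => ℝ) p r),
    PiLp.ext fun i => Fin.snoc_castSucc (α := fun _ => ℝ) (n := m) _ _ _,
    Fin.snoc_last (α := fun _ => ℝ) (n := m) _ _⟩

/-- The height of the point of the upper hemisphere above a point of the disk. -/
def height (u : Disk (m + 1)) : ℝ := √(1 - ‖u.1‖ ^ 2)

lemma height_sq (u : Disk (m + 1)) : height u ^ 2 = 1 - ‖u.1‖ ^ 2 :=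
  Real.sq_sqrt (by
    have := u.norm_le
    have := norm_nonneg u.1
    nlinarith)

lemma last_le (u : Disk (m + 1)) : u.1 (Fin.last m) ≤ 1 := by
  have h1 := norm_sq_coord u.1
  have h2 := u.norm_le
  nlinarith [sq_nonneg ‖initCoord u.1‖, norm_nonneg u.1]

/-- Stereographic projection of the upper hemisphere to the one-point compactification of the upper
half space. -/
def stereo (u : Disk (m + 1)) : OnePoint (EuclideanSpace ℝ (Fin m) × ℝ) :=
  ratio (1 - u.1 (Fin.last m)) (initCoord u.1, height u)

lemma continuous_last : Continuous fun u : Disk (m + 1) => u.1 (Fin.last m) := by fun_prop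

/-- Only the pole `r = 1` of the last coordinate is at issue. The squares of the two components of
the numerator add up to `1 - r²`, so its maximum norm `N` satisfies `2 N² ≥ 1 - r²`, and `((1 - r) /
(1 - r + N))² ≤ 2 (1 - r) / (3 - r)` follows. -/
lemma continuous_stereo : Continuous (stereo (m := m)) := by
  have hl := continuous_last (m := m)
  have h3 : ∀ u : Disk (m + 1), 3 - u.1 (Fin.last m) ≠ 0 := fun u => by linarith [last_le u]
  refine continuous_ratio_of_le (t := fun u : Disk (m + 1) => 1 - u.1 (Fin.last m))
    (v := fun u => (initCoord u.1, height u))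
    (b := fun u => 2 * (1 - u.1 (Fin.last m)) / (3 - u.1 (Fin.last m))) (by fun_prop)
    ((continuous_initCoord.comp continuous_subtype_val).prodMk (by unfold height; fun_prop))
    (Continuous.div (by fun_prop) (by fun_prop) h3) (fun u h => by rw [h]; simp) fun u => ?_
  have h1 := last_le u
  have ht : 0 ≤ 1 - u.1 (Fin.last m) := sub_nonneg.2 h1
  rw [invNorm_ratio ht]
  have h2 := norm_sq_coord u.1
  have h4 := height_sq u
  set r := u.1 (Fin.last m)
  have h5 : ‖initCoord u.1‖ ≤ ‖(initCoord u.1, height u)‖ := norm_fst_le (initCoord u.1, height u)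
  have h6 : |height u| ≤ ‖(initCoord u.1, height u)‖ := norm_snd_le (initCoord u.1, height u)
  set N := ‖(initCoord u.1, height u)‖
  have h7 : 1 - r ^ 2 ≤ 2 * N ^ 2 := by
    have h8 := pow_le_pow_left₀ (norm_nonneg _) h5 2
    have h9 := pow_le_pow_left₀ (abs_nonneg _) h6 2
    rw [sq_abs] at h9
    linarith
  have hN : 0 ≤ N := norm_nonneg _
  rcases ht.eq_or_lt with h0 | h0
  · rw [← h0]
    simp
  · rw [div_pow, div_le_div_iff₀ (by positivity) (by linarith)]
    have h8 : (1 - r) * (3 - r) ≤ 2 * (1 - r + N) ^ 2 := by nlinarith [mul_nonneg ht hN]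
    nlinarith

/-- The two equations recover the coordinates of `u` from its image `(p, s)`; injectivity on the
open disk is deduced from them. -/
lemma stereo_of_lt {u : Disk (m + 1)} (h : ‖u.1‖ < 1) : ∃ p s, 0 < s ∧ stereo u =
    ((p, s) : EuclideanSpace ℝ (Fin m) × ℝ) ∧ initCoord u.1 = (1 - u.1 (Fin.last m)) • p ∧
    u.1 (Fin.last m) * (‖p‖ ^ 2 + s ^ 2 + 1) = ‖p‖ ^ 2 + s ^ 2 - 1 := by
  have h1 := norm_sq_coord u.1
  have h2 := height_sq u
  have h4 : ‖u.1‖ ^ 2 < 1 := by nlinarith [norm_nonneg u.1]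
  set r := u.1 (Fin.last m) with hr
  have h3 : 0 < 1 - r := by nlinarith [sq_nonneg ‖initCoord u.1‖]
  have h5 : 0 < height u := Real.sqrt_pos.2 (by linarith)
  refine ⟨(1 - r)⁻¹ • initCoord u.1, (1 - r)⁻¹ * height u, by positivity, ratio_of_ne h3.ne' _, ?_, ?_⟩
  · rw [smul_smul, mul_inv_cancel₀ h3.ne', one_smul]
  · rw [norm_smul, norm_inv, Real.norm_of_nonneg h3.le]
    have h6 : ‖initCoord u.1‖ ^ 2 = 1 - height u ^ 2 - r ^ 2 := by linarith
    rw [mul_pow, mul_pow, h6]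
    field_simp
    ring

lemma stereo_of_norm {u : Disk (m + 1)} (h : ‖u.1‖ = 1) :
    stereo u = OnePoint.infty ∨ ∃ p, stereo u = ((p, 0) : EuclideanSpace ℝ (Fin m) × ℝ) := by
  have h0 : height u = 0 := by rw [height, h]; simp
  by_cases h1 : 1 - u.1 (Fin.last m) = 0
  · left
    rw [stereo, h1, ratio_zero]
  · right
    refine ⟨(1 - u.1 (Fin.last m))⁻¹ • initCoord u.1, ?_⟩
    rw [stereo, ratio_of_ne h1, h0]
    simp [Prod.smul_mk]

lemma stereo_injOn {u w : Disk (m + 1)} (hu : ‖u.1‖ < 1) (hw : ‖w.1‖ < 1) (h : stereo u = stereo w) :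
    u = w := by
  obtain ⟨p, s, -, h1, h2, h3⟩ := stereo_of_lt hu
  obtain ⟨p', s', -, h1', h2', h3'⟩ := stereo_of_lt hw
  rw [h1, h1', OnePoint.coe_eq_coe, Prod.mk.injEq] at h
  obtain ⟨rfl, rfl⟩ := h
  have h4 : u.1 (Fin.last m) = w.1 (Fin.last m) := by
    rw [← h3'] at h3
    exact mul_right_cancel₀ (by positivity) h3
  exact Subtype.ext (ext_coord (by rw [h2, h2', h4]) h4)

lemma exists_stereo (p : EuclideanSpace ℝ (Fin m)) {s : ℝ} (hs : 0 < s) :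
    ∃ u : Disk (m + 1), ‖u.1‖ < 1 ∧ stereo u = ((p, s) : EuclideanSpace ℝ (Fin m) × ℝ) := by
  set N := ‖p‖ ^ 2 + s ^ 2 with hN
  have hN0 : 0 < N + 1 := by positivity
  -- Inverse stereographic projection of `(p, s)`; the remaining coordinate of the point on the
  -- hemisphere is its height `2s / (N + 1)`.
  obtain ⟨u, hu, hr⟩ := exists_coord ((2 / (N + 1)) • p) ((N - 1) / (N + 1))
  have h1 : 1 - ‖u‖ ^ 2 = (2 / (N + 1) * s) ^ 2 := by
    rw [norm_sq_coord, hu, hr, norm_smul, Real.norm_of_nonneg (by positivity)]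
    have : ‖p‖ ^ 2 = N - s ^ 2 := by rw [hN]; ring
    rw [mul_pow, this]
    field_simp
    ring
  have h2 : ‖u‖ < 1 := by
    have : 0 < (2 / (N + 1) * s) ^ 2 := by positivity
    nlinarith [norm_nonneg u]
  refine ⟨⟨u, mem_closedBall_zero_iff.2 h2.le⟩, h2, ?_⟩
  have h3 : height ⟨u, mem_closedBall_zero_iff.2 h2.le⟩ = 2 / (N + 1) * s := by
    rw [height]
    change √(1 - ‖u‖ ^ 2) = _
    rw [h1, Real.sqrt_sq (by positivity)]
  have h4 : 1 - (N - 1) / (N + 1) = 2 / (N + 1) := by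
    field_simp
    ring
  rw [stereo, h3]
  change ratio (1 - u (Fin.last m)) (initCoord u, _) = _
  rw [hu, hr, h4, ratio_of_ne (by positivity), Prod.smul_mk, smul_smul, smul_eq_mul, ← mul_assoc,
    inv_mul_cancel₀ (by positivity), one_smul, one_mul]

end Stereographic

section RepSphere

lemma continuous_onePoint_map {V W : Type} [TopologicalSpace V] [TopologicalSpace W] [T2Space V]
    [T2Space W] {f : V → W} {g : W → V} (hf : Continuous f) (hg : Continuous g)
    (h : Function.LeftInverse g f) : Continuous (OnePoint.map f) := by
  refine OnePoint.continuous_map hf ?_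
  rw [Filter.coclosedCompact_eq_cocompact, Filter.coclosedCompact_eq_cocompact]
  exact (h.isClosedEmbedding hg hf).tendsto_cocompact

/-- The one-point compactification of `ℝ^l` is the fixed sphere. -/
def RepSphere.homeo (l : ℕ) : OnePoint (EuclideanSpace ℝ (Fin l)) ≃ₜ RepSphere l 0 :=
  haveI : Unique (EuclideanSpace ℂ (Fin 0)) := Unique.mk' _
  (Homeomorph.prodUnique (EuclideanSpace ℝ (Fin l)) (EuclideanSpace ℂ (Fin 0))).symm.onePointCongr

/-- Two cells with isotropy group the whole circle: the point at infinity and `ℝ^l`. For `l = 0` the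
second is a point too, and its empty boundary imposes no condition. -/
lemma hasFiniteCells_zero (l : ℕ) : HasFiniteCells (RepSphere l 0) (RepSphere.pt l 0) l := by
  have hz : ∀ n : ℕ, ‖(0 : EuclideanSpace ℝ (Fin n))‖ < 1 := fun n => by simp
  let c0 : Disk 0 := ⟨0, mem_closedBall_zero_iff.2 (hz 0).le⟩
  have hc : ∀ w : Disk 0, w = c0 := fun w => Subtype.ext (Subsingleton.elim _ _)
  have hpos : ∀ v : Disk l, ‖v.1‖ = 1 → 0 < l := fun v hv => by
    rcases Nat.eq_zero_or_pos l with rfl | h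
    · rw [Subsingleton.elim v.1 0, norm_zero] at hv
      exact (zero_ne_one hv).elim
    · exact h
  let Ψ : Disk l → RepSphere l 0 := fun v => RepSphere.homeo l (collapse v)
  have hΨ : Continuous Ψ := (RepSphere.homeo l).continuous.comp continuous_collapse
  refine ⟨Bool, inferInstance, fun b => bif b then l else 0, fun _ => ⊤, fun b => match b with
    | false => ContinuousMap.const _ (RepSphere.pt l 0)
    | true => ⟨fun p => Ψ p.2, hΨ.comp continuous_snd⟩, fun _ => isClosed_univ, ?_, ?_, ?_, ?_,
      false, ((1 : Circle), c0), rfl, rfl⟩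
  · rintro (_ | _) z q v
    · exact (RepSphere.smul_eq_self z _).symm
    · exact (RepSphere.smul_eq_self z _).symm
  · intro x
    haveI : Subsingleton (Circle ⧸ (⊤ : Subgroup Circle)) := QuotientGroup.subsingleton_quotient_top
    obtain ⟨y, rfl⟩ := (RepSphere.homeo l).surjective x
    induction y using OnePoint.rec with
    | infty =>
      refine ⟨⟨false, (1 : Circle), c0⟩, ⟨hz 0, rfl⟩, ?_⟩
      rintro ⟨_ | _, p, w⟩ ⟨hw, hx⟩
      · have h1 : p = ((1 : Circle) : Circle ⧸ (⊤ : Subgroup Circle)) := Subsingleton.elim _ _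
        have h2 : (w : Disk 0) = c0 := hc w
        rw [h1]
        exact congrArg (fun w : Disk 0 => (⟨false, (1 : Circle), w⟩ : Σ b : Bool,
          (Circle ⧸ (⊤ : Subgroup Circle)) × Disk (bif b then l else 0))) h2
      · have hx' : collapse (d := l) w = OnePoint.infty := (RepSphere.homeo l).injective hx
        rw [collapse_of_lt (d := l) hw] at hx'
        exact (OnePoint.coe_ne_infty _ hx').elim
    | coe v =>
      have hv : ‖(shrink v).1‖ < 1 := by
        rw [shrink_coe]
        exact norm_shrink_lt v
      refine ⟨⟨true, (1 : Circle), shrink v⟩, ⟨hv,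
        congrArg (RepSphere.homeo l) (collapse_shrink v)⟩, ?_⟩
      rintro ⟨_ | _, p, w⟩ ⟨hw, hx⟩
      · exact (OnePoint.infty_ne_coe v ((RepSphere.homeo l).injective hx)).elim
      · have h1 : p = ((1 : Circle) : Circle ⧸ (⊤ : Subgroup Circle)) := Subsingleton.elim _ _
        have h2 : (w : Disk l) = shrink v := collapse_injOn hw hv (by
          rw [collapse_shrink]
          exact (RepSphere.homeo l).injective hx)
        rw [h1]
        exact congrArg (fun w : Disk l => (⟨true, (1 : Circle), w⟩ : Σ b : Bool,
          (Circle ⧸ (⊤ : Subgroup Circle)) × Disk (bif b then l else 0))) h2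
  · rintro (_ | _) q v hv
    · have h1 : ‖c0.1‖ = 1 := hc v ▸ hv
      exact ((hz 0).ne h1).elim
    · exact ⟨false, hpos v hv, ((1 : Circle), c0),
        (congrArg (RepSphere.homeo l) (collapse_of_norm (d := l) hv)).symm⟩
  · rintro (_ | _)
    · exact Nat.zero_le l
    · exact le_refl l

variable (l h : ℕ)

/-- The inclusion of representation spheres. -/
def RepSphere.up : TMap (RepSphere l h) (RepSphere l (h + 1)) where
  map := ⟨OnePoint.map fun v : Rep l h => (Rep.join l h).map (v, 0),
    continuous_onePoint_map (g := fun v => ((Rep.split l h).map v).1)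
      ((Rep.join l h).map.continuous.comp (by fun_prop))
      (continuous_fst.comp (Rep.split l h).map.continuous) fun v =>
        congrArg Prod.fst (Rep.split_join l h (v, 0))⟩
  equivariant z x := by
    induction x using RepSphere.ind with
    | infty => rfl
    | coe v =>
      have h1 := (Rep.join l h).equivariant z (v, 0)
      rw [Prod.smul_mk, smul_zero] at h1
      exact congrArg OnePoint.some h1

/-- Linear coordinates on a representation. -/
def Rep.coord : EuclideanSpace ℝ (Fin (l + 2 * h)) ≃L[ℝ] Rep l h :=
  ContinuousLinearEquiv.ofFinrankEq (by rw [Rep.finrank, finrank_euclideanSpace_fin])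

/-- The half space of points whose last coordinate is a nonnegative real number. -/
def Rep.half (q : EuclideanSpace ℝ (Fin (l + 2 * h)) × ℝ) : Rep l (h + 1) :=
  (Rep.join l h).map (Rep.coord l h q.1, (q.2 : ℂ))

lemma continuous_onePoint_half : Continuous (OnePoint.map (Rep.half l h)) :=
  continuous_onePoint_map (g := fun v => ((Rep.coord l h).symm ((Rep.split l h).map v).1,
      ((Rep.split l h).map v).2.re))
    ((Rep.join l h).map.continuous.comp (by fun_prop))
    (((Rep.coord l h).symm.continuous.comp (continuous_fst.comp (Rep.split l h).map.continuous)).prodMk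
      (Complex.continuous_re.comp (continuous_snd.comp (Rep.split l h).map.continuous))) fun q => by
    simp only [Rep.half, Rep.split_join, ContinuousLinearEquiv.symm_apply_apply, Complex.ofReal_re]

/-- A hemisphere in the representation sphere. -/
def RepSphere.hemi (u : Disk (l + 2 * h + 1)) : RepSphere l (h + 1) :=
  OnePoint.map (Rep.half l h) (stereo u)

variable {l h} in
lemma RepSphere.hemi_coe {u : Disk (l + 2 * h + 1)} {q : EuclideanSpace ℝ (Fin (l + 2 * h)) × ℝ}
    (hu : stereo u = q) : RepSphere.hemi l h u = (RepSphere.coe l (h + 1)).map (Rep.half l h q) := by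
  rw [RepSphere.hemi, hu]
  rfl

variable {l h} in
lemma RepSphere.hemi_infty {u : Disk (l + 2 * h + 1)} (hu : stereo u = OnePoint.infty) :
    RepSphere.hemi l h u = RepSphere.pt l (h + 1) := by
  rw [RepSphere.hemi, hu]
  rfl

/-- The characteristic map of the top cell of the representation sphere. -/
def RepSphere.cell : TMap (FreeCell (l + 2 * h + 1)) (RepSphere l (h + 1)) where
  map := ⟨fun c => c.1 • RepSphere.hemi l h c.2, (continuous_freeCell_fst _).smul
    (((continuous_onePoint_half l h).comp continuous_stereo).comp (continuous_freeCell_snd _))⟩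
  equivariant z c := mul_smul z c.1 _

/-- A point outside of the smaller sphere has nonzero last coordinate, whose direction and absolute
value make it a unique translate of a point in an open half space of dimension `l + 2h + 1`. Thus a
single free cell is attached, with a closed hemisphere as slice. -/
lemma hasFiniteCells_succ
    (hY : HasFiniteCells (RepSphere l h) (RepSphere.pt l h) (l + 2 * h)) :
    HasFiniteCells (RepSphere l (h + 1)) (RepSphere.pt l (h + 1)) (l + 2 * (h + 1)) := by
  have key : ∀ a : FreeCell (l + 2 * h + 1), ‖a.2.1‖ < 1 → ∃ p s, 0 < s ∧
      stereo a.2 = ((p, s) : EuclideanSpace ℝ (Fin (l + 2 * h)) × ℝ) ∧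
      (RepSphere.cell l h).map a = (RepSphere.coe l (h + 1)).map (a.1 • Rep.half l h (p, s)) :=
    fun a ha => by
      obtain ⟨p, s, hs, h1, -⟩ := stereo_of_lt ha
      refine ⟨p, s, hs, h1, ?_⟩
      rw [(RepSphere.coe l (h + 1)).equivariant]
      change a.1 • RepSphere.hemi l h a.2 = _
      rw [RepSphere.hemi_coe h1]
  have hsplit : ∀ (z : Circle) p s, (Rep.split l h).map (z • Rep.half l h (p, s)) =
      (z • Rep.coord l h p, (z : ℂ) * s) := fun z p s => by
    rw [(Rep.split l h).equivariant, Rep.half, Rep.split_join]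
    rfl
  refine hY.attach (RepSphere.up l h) (RepSphere.cell l h) (fun x y hxy => ?_) (fun a b ha hb hab => ?_)
    (fun y a ha hya => ?_) (fun x => ?_) (fun a ha => Or.inl ⟨by omega, ?_⟩) (by omega) (by omega)
  · refine Option.map_injective (fun v w hvw => ?_) hxy
    have h1 := congrArg (Rep.split l h).map hvw
    rw [Rep.split_join, Rep.split_join] at h1
    exact congrArg Prod.fst h1
  · obtain ⟨p, s, hs, h1, h2⟩ := key a ha
    obtain ⟨p', s', hs', h1', h2'⟩ := key b hb
    rw [h2, h2'] at hab
    have h3 := congrArg (Rep.split l h).map (OnePoint.coe_injective hab)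
    rw [hsplit, hsplit, Prod.mk.injEq] at h3
    obtain ⟨h3, h4⟩ := h3
    have h5 : s = s' := by
      have e : ∀ (z : Circle) {s : ℝ}, 0 < s → ‖(z : ℂ) * s‖ = s := fun z s hs => by
        rw [norm_mul, Circle.norm_coe, one_mul, Complex.norm_real, Real.norm_of_nonneg hs.le]
      exact (e a.1 hs).symm.trans ((congrArg norm h4).trans (e b.1 hs'))
    have h6 : a.1 = b.1 := by
      rw [← h5] at h4
      exact Circle.ext (mul_right_cancel₀ (Complex.ofReal_ne_zero.2 hs.ne') h4)
    rw [h6] at h3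
    have h7 : p = p' := (Rep.coord l h).injective (MulAction.injective b.1 h3)
    refine Prod.ext h6 (stereo_injOn ha hb ?_)
    rw [h1, h1', h5, h7]
  · obtain ⟨p, s, hs, -, h2⟩ := key a ha
    rw [h2] at hya
    induction y using RepSphere.ind with
    | infty => exact OnePoint.infty_ne_coe _ hya
    | coe v =>
      have h3 := congrArg (Rep.split l h).map (OnePoint.coe_injective hya)
      rw [hsplit, Rep.split_join] at h3
      have h4 : (0 : ℂ) = a.1 * s := congrArg Prod.snd h3
      exact mul_ne_zero (Circle.coe_ne_zero a.1) (Complex.ofReal_ne_zero.2 hs.ne') h4.symm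
  · induction x using RepSphere.ind with
    | infty => exact Or.inl ⟨RepSphere.pt l h, rfl⟩
    | coe w =>
      obtain ⟨⟨v, c⟩, rfl⟩ : ∃ v, (Rep.join l h).map v = w := ⟨_, Rep.join_split l h w⟩
      by_cases hc : c = 0
      · left
        refine ⟨(RepSphere.coe l h).map v, ?_⟩
        rw [hc]
        rfl
      · right
        set z := Circle.exp c.arg
        have hz : (z : ℂ) * ‖c‖ = c := by
          rw [mul_comm, Circle.coe_exp]
          exact Complex.norm_mul_exp_arg_mul_I c
        obtain ⟨u, hu, hu'⟩ := exists_stereo ((Rep.coord l h).symm (z⁻¹ • v)) (norm_pos_iff.2 hc)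
        refine ⟨FreeCell.mk z u, hu, ?_⟩
        obtain ⟨p, s, -, h1, h2⟩ := key (FreeCell.mk z u) hu
        have h3 : stereo u = ((p, s) : EuclideanSpace ℝ (Fin (l + 2 * h)) × ℝ) := h1
        rw [hu', OnePoint.coe_eq_coe, Prod.mk.injEq] at h3
        obtain ⟨rfl, rfl⟩ := h3
        rw [h2]
        refine congrArg (RepSphere.coe l (h + 1)).map ?_
        rw [← Rep.join_split l h (_ • _), hsplit]
        change (Rep.join l h).map (z • _, (z : ℂ) * _) = _
        rw [hz, ContinuousLinearEquiv.apply_symm_apply, smul_inv_smul]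
  · rcases stereo_of_norm ha with h1 | ⟨p, h1⟩
    · refine ⟨RepSphere.pt l h, ?_⟩
      change _ = a.1 • RepSphere.hemi l h a.2
      rw [RepSphere.hemi_infty h1]
      exact ((RepSphere.base l (h + 1)).2 a.1).symm
    · refine ⟨(RepSphere.coe l h).map (a.1 • Rep.coord l h p), ?_⟩
      rw [(RepSphere.coe l h).equivariant, (RepSphere.up l h).equivariant]
      change _ = a.1 • RepSphere.hemi l h a.2
      rw [RepSphere.hemi_coe h1, Rep.half, Complex.ofReal_zero]
      rfl

lemma hasFiniteCells_repSphere :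
    HasFiniteCells (RepSphere l h) (RepSphere.pt l h) (l + 2 * h) := by
  induction h with
  | zero => exact hasFiniteCells_zero l
  | succ h ih => exact hasFiniteCells_succ l h ih

end RepSphere

/-- All cells of `A` have dimension at most `l + 2h`, and the last cell has dimension `l + 2h + 1`.
So every attaching map is admissible and no cellular approximation is needed. -/
lemma isTypeSWF {l h : ℕ} (hn : 0 < l + 2 * h) (φ : AttachingMap l h) : IsTypeSWF (Attach φ) l where
  finite := by
    refine ⟨Attach φ, inferInstance, inferInstance, inferInstance, ?_, ?_⟩
    · have h1 := (hasFiniteCells_repSphere l h).attach_cell (constBase l h (l + 2 * h))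
        (Or.inr ⟨hn, fun _ => rfl⟩) le_rfl le_rfl
      exact (h1.attach_cell φ (Or.inl (Nat.lt_succ_self _)) (Nat.le_succ _) le_rfl).isFiniteTComplex
    · let f : TMap (Attach φ) (Attach φ) := ⟨ContinuousMap.id _, fun _ _ => rfl⟩
      have hf : ContinuousMap.HomotopicWith (f.map.comp f.map) (ContinuousMap.id (Attach φ))
          IsEquivariant := ContinuousMap.HomotopicWith.refl _ f.equivariant
      exact ⟨f, f, hf, hf⟩
  free x hx := by
    rcases φ.isFixedSphere.mem_or_free x with ⟨s, rfl⟩ | h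
    · exact (hx (φ.fixed.mem_fixedPoints s)).elim
    · exact h
  fixed := φ.isFixedSphere.nonempty_homotopyEquiv


/-! ### Degrees of maps of spheres -/

section Pull

variable {X Y Z : Type} [TopologicalSpace X] [TopologicalSpace Y] [TopologicalSpace Z] {k : Type}
  [CommRing k] {n : ℕ}

lemma pairMap_of (f : C(X, Y)) {A : Set X} {B : Set Y} (h : Set.MapsTo f A B) :
    PairMap f Set.univ A Set.univ B :=
  ⟨f.continuous.continuousOn, Set.subset_univ _, fun _ _ => trivial, h⟩

/-- The map from the cohomology of a pair to the cohomology of a space that is induced by a map. -/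
def absPull (k : Type) [CommRing k] (n : ℕ) (f : C(X, Y)) (B : Set Y) :
    Coh k n Set.univ B →ₗ[k] Coh k n (Set.univ : Set X) ∅ :=
  (pairMap_of f (Set.mapsTo_empty _ B)).pull k n

lemma absPull_comp (f : C(X, Y)) (g : C(Y, Z)) (B : Set Z) (y : Coh k n Set.univ B) :
    absPull k n (g.comp f) B y = absPull k n f ∅ (absPull k n g B y) := by
  rw [absPull, absPull, absPull, ← PairMap.pull_comp]

lemma absPull_const (c : Y) (B : Set Y) (hn : n ≠ 0) (y : Coh k n Set.univ B) :
    absPull k n (ContinuousMap.const X c) B y = 0 := by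
  have h1 : ContinuousMap.const X c =
      (ContinuousMap.const Unit c).comp (ContinuousMap.const X ()) := rfl
  rw [h1, absPull_comp, (sphereLike_point.1 n hn).eq_zero (absPull k n (ContinuousMap.const Unit c) B y),
    map_zero]

lemma absPull_id (y : Coh k n (Set.univ : Set X) ∅) : absPull k n (ContinuousMap.id X) ∅ y = y :=
  PairMap.pull_id _ n y

end Pull

section Sphere

variable {E : Type} [NormedAddCommGroup E] [InnerProductSpace ℝ E] {Z T : Type}
  [TopologicalSpace Z] [TopologicalSpace T] {k : Type} [CommRing k] {n : ℕ}

local notation "⟪" x ", " y "⟫" => inner ℝ x y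

/-- Normalization of a map to the complement of the origin. -/
def toSphere (F : Z → E) (hF : Continuous F) (h0 : ∀ z, F z ≠ 0) : C(Z, Metric.sphere (0 : E) 1) :=
  have h : ∀ z, ‖F z‖⁻¹ • F z ∈ Metric.sphere (0 : E) 1 := fun z => by
    rw [mem_sphere_zero_iff_norm, norm_smul, norm_inv, norm_norm,
      inv_mul_cancel₀ (norm_ne_zero_iff.2 (h0 z))]
  ⟨fun z => ⟨‖F z‖⁻¹ • F z, h z⟩,
    ((hF.norm.inv₀ fun z => norm_ne_zero_iff.2 (h0 z)).smul hF).subtype_mk h⟩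

lemma toSphere_coe (F : Z → E) (hF : Continuous F) (h0 : ∀ z, F z ≠ 0) (z : Z) :
    (toSphere F hF h0 z : E) = ‖F z‖⁻¹ • F z := rfl

lemma sphere_norm (v : Metric.sphere (0 : E) 1) : ‖(v : E)‖ = 1 := mem_sphere_zero_iff_norm.1 v.2

/-- Maps to a sphere that are nowhere antipodal induce the same map in cohomology. -/
lemma absPull_eq_of_ne (f g : C(Z, Metric.sphere (0 : E) 1)) (h : ∀ z, (f z : E) ≠ -(g z : E))
    (y : Coh k n Set.univ ∅) : absPull k n f ∅ y = absPull k n g ∅ y := by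
  have h0 : ∀ q : Z × unitInterval, (1 - (q.2 : ℝ)) • (f q.1 : E) + (q.2 : ℝ) • (g q.1 : E) ≠ 0 := by
    rintro ⟨z, s⟩ hz
    have hs := s.2
    dsimp only at hz
    have h1 : (1 - (s : ℝ)) • (f z : E) = -((s : ℝ) • (g z : E)) := eq_neg_of_add_eq_zero_left hz
    have h2 := congrArg norm h1
    rw [norm_neg, norm_smul, norm_smul, sphere_norm, sphere_norm, mul_one, mul_one,
      Real.norm_of_nonneg (sub_nonneg.2 hs.2), Real.norm_of_nonneg hs.1] at h2
    have h3 : (s : ℝ) ≠ 0 := fun h3 => by linarith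
    rw [h2, ← smul_neg] at h1
    exact h z (smul_right_injective E h3 h1)
  let H := toSphere (fun q : Z × unitInterval => (1 - (q.2 : ℝ)) • (f q.1 : E) +
    (q.2 : ℝ) • (g q.1 : E)) (by fun_prop) h0
  have hp : PairHomotopic f g Set.univ ∅ Set.univ ∅ := by
    refine ⟨H, H.continuous.continuousOn, fun _ _ => trivial, ?_, ?_, ?_⟩
    · rintro q ⟨h, -⟩
      exact h.elim
    · intro z _
      refine Subtype.ext ?_
      rw [toSphere_coe]
      simp [sphere_norm]
    · intro z _
      refine Subtype.ext ?_
      rw [toSphere_coe]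
      simp [sphere_norm]
  exact hp.pull_eq _ _ n y

variable (u : Metric.sphere (0 : E) 1)

lemma inner_self_sphere : ⟪(u : E), (u : E)⟫ = 1 := by
  rw [real_inner_self_eq_norm_sq, sphere_norm, one_pow]

/-- A map of the sphere of degree one that is constant on a neighbourhood of a hemisphere. -/
def pinch : C(Metric.sphere (0 : E) 1, Metric.sphere (0 : E) 1) :=
  -- For `t = ⟪v, u⟫ ≤ 1/3` the part orthogonal to `u` is cut off and the coefficient of `u` is
  -- negative, so the value is `-u`. The coefficient of `u` vanishes only at `t = 2/3`, where the
  -- orthogonal part does not.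
  toSphere (fun v => (3 * ⟪(v : E), (u : E)⟫ - 2) • (u : E) +
    max 0 (⟪(v : E), (u : E)⟫ - 1 / 3) • ((v : E) - ⟪(v : E), (u : E)⟫ • (u : E))) (by fun_prop)
    fun v h => by
      set t := ⟪(v : E), (u : E)⟫ with ht
      have h1 := congrArg (fun x => ⟪x, (u : E)⟫) h
      simp only [inner_add_left, inner_smul_left, inner_sub_left, inner_zero_left, ← ht,
        inner_self_sphere, map_mul, map_sub, RCLike.conj_to_real, mul_one, sub_self, mul_zero,
        add_zero] at h1
      have h2 : t = 2 / 3 := by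
        linarith
      rw [h2] at h
      norm_num at h
      have h3 : (v : E) = (2 / 3 : ℝ) • (u : E) := sub_eq_zero.1 h
      have h4 := congrArg norm h3
      rw [norm_smul, sphere_norm, sphere_norm] at h4
      norm_num at h4

lemma pinch_of_le {v : Metric.sphere (0 : E) 1} (h : ⟪(v : E), (u : E)⟫ ≤ 1 / 3) :
    (pinch u v : E) = -(u : E) := by
  rw [pinch, toSphere_coe, max_eq_left (by linarith), zero_smul, add_zero, norm_smul, sphere_norm,
    mul_one, smul_smul, Real.norm_of_nonpos (by linarith), inv_neg, neg_mul,
    inv_mul_cancel₀ (by linarith), neg_one_smul]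

/-- The part orthogonal to `u` is multiplied by a nonnegative number, so an antipodal value would
force it to vanish. This leaves only `v = u` beyond the pinched region, and `u` is fixed. Hence
pinching induces the identity in cohomology. -/
lemma pinch_ne (v : Metric.sphere (0 : E) 1) : (pinch u v : E) ≠ -(v : E) := by
  intro h
  rcases le_or_gt ⟪(v : E), (u : E)⟫ (1 / 3) with ht | ht
  · rw [pinch_of_le u ht, neg_inj] at h
    rw [← h, inner_self_sphere] at ht
    norm_num at ht
  · rw [pinch, toSphere_coe] at h
    set t := ⟪(v : E), (u : E)⟫ with htd
    set c := ‖(3 * t - 2) • (u : E) + max 0 (t - 1 / 3) • ((v : E) - t • (u : E))‖⁻¹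
    have hc : 0 ≤ c := by positivity
    rw [max_eq_right (by linarith)] at h
    have h1 : (1 + c * (t - 1 / 3)) • ((v : E) - t • (u : E)) = -(t + c * (3 * t - 2)) • (u : E) := by
      have : (v : E) = -(c • ((3 * t - 2) • (u : E) + (t - 1 / 3) • ((v : E) - t • (u : E)))) := by
        rw [h, neg_neg]
      refine sub_eq_zero.1 (Eq.trans ?_ (sub_eq_zero.2 this))
      module
    have h2 := congrArg (fun x => ⟪x, (u : E)⟫) h1
    simp only [inner_smul_left, inner_sub_left, ← htd, inner_self_sphere, mul_one, sub_self,
      mul_zero, RCLike.conj_to_real] at h2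
    rw [← h2, zero_smul] at h1
    have h3 : (v : E) - t • (u : E) = 0 := (smul_eq_zero.1 h1).resolve_left (by nlinarith)
    have h4 : t = 1 := by
      have h5 := congrArg norm (sub_eq_zero.1 h3)
      rw [norm_smul, sphere_norm, sphere_norm, mul_one, Real.norm_of_nonneg (by linarith)] at h5
      exact h5.symm
    rw [h4] at h2
    linarith

/-- Reflection in a hyperplane. -/
def reflect : C(Metric.sphere (0 : E) 1, Metric.sphere (0 : E) 1) :=
  have h : ∀ v : Metric.sphere (0 : E) 1, (v : E) - (2 * ⟪(v : E), (u : E)⟫) • (u : E) ∈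
      Metric.sphere (0 : E) 1 := fun v => by
    rw [mem_sphere_zero_iff_norm, ← sq_eq_sq₀ (norm_nonneg _) zero_le_one, norm_sub_sq_real,
      norm_smul, inner_smul_right, sphere_norm, sphere_norm, mul_one, Real.norm_eq_abs, sq_abs]
    ring
  ⟨fun v => ⟨_, h v⟩, Continuous.subtype_mk (by fun_prop) h⟩

lemma reflect_coe (v : Metric.sphere (0 : E) 1) :
    (reflect u v : E) = v - (2 * ⟪(v : E), (u : E)⟫) • (u : E) := rfl

lemma inner_reflect (v : Metric.sphere (0 : E) 1) :
    ⟪(reflect u v : E), (u : E)⟫ = -⟪(v : E), (u : E)⟫ := by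
  rw [reflect_coe, inner_sub_left, real_inner_smul_left, inner_self_sphere]
  ring

/-- The retraction of the sphere to a hemisphere. -/
def fold : C(Metric.sphere (0 : E) 1, Metric.sphere (0 : E) 1) :=
  have h : ∀ v : Metric.sphere (0 : E) 1, (v : E) + (|⟪(v : E), (u : E)⟫| - ⟪(v : E), (u : E)⟫) •
      (u : E) ∈ Metric.sphere (0 : E) 1 := fun v => by
    rw [mem_sphere_zero_iff_norm, ← sq_eq_sq₀ (norm_nonneg _) zero_le_one, norm_add_sq_real,
      norm_smul, inner_smul_right, sphere_norm, sphere_norm, mul_one, Real.norm_eq_abs, sq_abs]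
    have := sq_abs ⟪(v : E), (u : E)⟫
    linear_combination this
  ⟨fun v => ⟨_, h v⟩, Continuous.subtype_mk (by fun_prop) h⟩

lemma fold_coe (v : Metric.sphere (0 : E) 1) :
    (fold u v : E) = v + (|⟪(v : E), (u : E)⟫| - ⟪(v : E), (u : E)⟫) • (u : E) := rfl

lemma fold_ne (v : Metric.sphere (0 : E) 1) : (fold u v : E) ≠ -(u : E) := fun h => by
  have h1 := congrArg (fun x => ⟪x, (u : E)⟫) h
  simp only [fold_coe, inner_add_left, real_inner_smul_left, inner_self_sphere,
    inner_neg_left] at h1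
  linarith [abs_nonneg ⟪(v : E), (u : E)⟫]

open Classical in
/-- The map that is given by one map on a hemisphere and by another map on the other. -/
def glue {u : Metric.sphere (0 : E) 1} {y₀ : T} (ψ₁ ψ₂ : C(Metric.sphere (0 : E) 1, T))
    (h₁ : ψ₁ (-u) = y₀) (h₂ : ψ₂ (-u) = y₀) : C(Metric.sphere (0 : E) 1, T) where
  toFun v := if 0 ≤ ⟪(v : E), (u : E)⟫ then ψ₁ (pinch u v) else ψ₂ (pinch u (reflect u v))
  continuous_toFun := by
    refine Continuous.if_le (by fun_prop) (by fun_prop) continuous_const (by fun_prop) fun v hv => ?_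
    rw [show pinch u v = -u from Subtype.ext (pinch_of_le u (by linarith)),
      show pinch u (reflect u v) = -u from Subtype.ext (pinch_of_le u (by
        rw [inner_reflect]
        linarith)), h₁, h₂]

variable {u}

/-- In the band `|⟪v, u⟫| ≤ 1/3` both pieces are constant. The description of each half is therefore
valid beyond the equator, and the two halves extend to overlapping open sets as `pull_eq_add`
requires. -/
lemma glue_of_ge {y₀ : T} {ψ₁ ψ₂ : C(Metric.sphere (0 : E) 1, T)} (h₁ : ψ₁ (-u) = y₀)
    (h₂ : ψ₂ (-u) = y₀) {v : Metric.sphere (0 : E) 1} (hv : -(1 / 3) ≤ ⟪(v : E), (u : E)⟫) :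
    glue ψ₁ ψ₂ h₁ h₂ v = ψ₁ (pinch u v) ∧ ψ₂ (pinch u (reflect u v)) = y₀ := by
  have h3 : ψ₂ (pinch u (reflect u v)) = y₀ := by
    rw [show pinch u (reflect u v) = -u from Subtype.ext (pinch_of_le u (by
        rw [inner_reflect]
        linarith)), h₂]
  refine ⟨?_, h3⟩
  by_cases h : 0 ≤ ⟪(v : E), (u : E)⟫
  · exact if_pos h
  · refine (if_neg h).trans ?_
    rw [h3, show pinch u v = -u from Subtype.ext (pinch_of_le u (by linarith)), h₁]

lemma glue_of_le {y₀ : T} {ψ₁ ψ₂ : C(Metric.sphere (0 : E) 1, T)} (h₁ : ψ₁ (-u) = y₀)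
    (h₂ : ψ₂ (-u) = y₀) {v : Metric.sphere (0 : E) 1} (hv : ⟪(v : E), (u : E)⟫ ≤ 1 / 3) :
    glue ψ₁ ψ₂ h₁ h₂ v = ψ₂ (pinch u (reflect u v)) ∧ ψ₁ (pinch u v) = y₀ := by
  have h3 : ψ₁ (pinch u v) = y₀ := by
    rw [show pinch u v = -u from Subtype.ext (pinch_of_le u hv), h₁]
  refine ⟨?_, h3⟩
  by_cases h : 0 ≤ ⟪(v : E), (u : E)⟫
  · refine (if_pos h).trans ?_
    rw [h3, show pinch u (reflect u v) = -u from Subtype.ext (pinch_of_le u (by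
        rw [inner_reflect]
        linarith)), h₂]
  · exact if_neg h

lemma absPull_pinch (y : Coh k n (Set.univ : Set (Metric.sphere (0 : E) 1)) ∅) :
    absPull k n (pinch u) ∅ y = y := by
  rw [absPull_eq_of_ne (pinch u) (ContinuousMap.id _) (pinch_ne u), absPull_id]

lemma absPull_glue {y₀ : T} {ψ₁ ψ₂ : C(Metric.sphere (0 : E) 1, T)} (h₁ : ψ₁ (-u) = y₀)
    (h₂ : ψ₂ (-u) = y₀) (y : Coh k n Set.univ {y₀}) :
    absPull k n (glue ψ₁ ψ₂ h₁ h₂) {y₀} y =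
      absPull k n ψ₁ {y₀} y + absPull k n (reflect u) ∅ (absPull k n ψ₂ {y₀} y) := by
  have ht : Continuous fun v : Metric.sphere (0 : E) 1 => ⟪(v : E), (u : E)⟫ := by fun_prop
  have h3 : absPull k n (glue ψ₁ ψ₂ h₁ h₂) {y₀} y = absPull k n (ψ₁.comp (pinch u)) {y₀} y +
      absPull k n (ψ₂.comp ((pinch u).comp (reflect u))) {y₀} y := by
    refine pull_eq_add (O₁ := {v : Metric.sphere (0 : E) 1 | -(1 / 3) < ⟪(v : E), (u : E)⟫})
      (O₂ := {v : Metric.sphere (0 : E) 1 | ⟪(v : E), (u : E)⟫ < 1 / 3})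
      (isOpen_lt continuous_const ht) (isOpen_lt ht continuous_const)
      (Set.eq_univ_of_forall fun v => ?_) (fun v hv => (glue_of_ge h₁ h₂ (le_of_lt hv)).1)
      (fun v hv => (glue_of_ge h₁ h₂ (le_of_lt hv)).2) (fun v hv => (glue_of_le h₁ h₂ (le_of_lt hv)).1)
      (fun v hv => (glue_of_le h₁ h₂ (le_of_lt hv)).2) _ _ _ n y
    rcases lt_or_ge ⟪(v : E), (u : E)⟫ (1 / 3) with h | h
    · exact Or.inr h
    · exact Or.inl (show -(1 / 3) < ⟪(v : E), (u : E)⟫ by linarith)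
  rw [h3, absPull_comp, absPull_comp, absPull_comp, absPull_pinch, absPull_pinch]

/-- Reflections change the sign of cohomology classes. -/
lemma absPull_reflect (u : Metric.sphere (0 : E) 1) (hn : n ≠ 0)
    (y : Coh k n (Set.univ : Set (Metric.sphere (0 : E) 1)) ∅) :
    absPull k n (reflect u) ∅ y = -y := by
  have hv : Van n ({-u} : Set (Metric.sphere (0 : E) 1)) ∅ := by
    have h1 : PairMap (fun _ : Unit => -u) Set.univ ∅ {-u} ∅ :=
      ⟨continuousOn_const, Set.subset_univ _, fun _ _ => rfl, Set.mapsTo_empty _ _⟩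
    have h2 : PairMap (fun _ : Metric.sphere (0 : E) 1 => ()) {-u} ∅ Set.univ ∅ :=
      ⟨continuousOn_const, Set.empty_subset _, fun _ _ => trivial, Set.mapsTo_empty _ _⟩
    exact (PairMap.Iso.of_inverse h1 h2 (fun _ _ => rfl) (fun _ h => h.symm) n).van
      (sphereLike_point.1 n hn)
  -- The formula for glued maps concerns classes relative to a point, so the class is lifted.
  obtain ⟨w, rfl⟩ := rel_surjective (Set.subset_univ _) (Set.empty_subset _) hv y
  have e : ContinuousMap.id _ (-u) = -u := rfl
  have h1 := absPull_glue (k := k) (n := n) e e w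
  -- Gluing the identity with itself gives a map that folds the sphere onto a hemisphere before
  -- pinching. The fold misses `-u` and so induces zero; the sum of a class and its reflection is
  -- therefore zero.
  have h2 : glue (ContinuousMap.id _) (ContinuousMap.id _) e e = (pinch u).comp (fold u) := by
    ext1 v
    rcases le_total 0 ⟪(v : E), (u : E)⟫ with h | h
    · refine (glue_of_ge e e (by linarith)).1.trans (congrArg (pinch u) (Subtype.ext ?_))
      rw [fold_coe, abs_of_nonneg h, sub_self, zero_smul, add_zero]
    · refine (glue_of_le e e (by linarith)).1.trans (congrArg (pinch u) (Subtype.ext ?_))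
      rw [fold_coe, reflect_coe, abs_of_nonpos h, sub_eq_add_neg, ← neg_smul]
      congr 2
      ring
  have h3 : ∀ f : C(Metric.sphere (0 : E) 1, Metric.sphere (0 : E) 1), absPull k n f {-u} w =
      absPull k n f ∅ (absPull k n (ContinuousMap.id _) {-u} w) := fun f => by
    rw [← absPull_comp, ContinuousMap.id_comp]
  rw [h2, h3 ((pinch u).comp (fold u)), absPull_comp, absPull_pinch,
    absPull_eq_of_ne (fold u) (ContinuousMap.const _ u) (fold_ne u), absPull_const u ∅ hn] at h1
  exact eq_neg_of_add_eq_zero_right h1.symm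

/-- Rotation by a right angle in the plane spanned by two orthonormal vectors. -/
def quarter (u w : Metric.sphere (0 : E) 1) (h : ⟪(u : E), (w : E)⟫ = 0) :
    C(Metric.sphere (0 : E) 1, Metric.sphere (0 : E) 1) :=
  have h : ∀ v : Metric.sphere (0 : E) 1, (v : E) +
      ((⟪(v : E), (w : E)⟫ - ⟪(v : E), (u : E)⟫) • (u : E) +
        (-⟪(v : E), (u : E)⟫ - ⟪(v : E), (w : E)⟫) • (w : E)) ∈ Metric.sphere (0 : E) 1 := fun v => by
    rw [mem_sphere_zero_iff_norm, ← sq_eq_sq₀ (norm_nonneg _) zero_le_one, norm_add_sq_real,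
      norm_add_sq_real, norm_smul, norm_smul, inner_add_right, inner_smul_right, inner_smul_right,
      inner_smul_right, real_inner_smul_left, h, sphere_norm, sphere_norm, sphere_norm, mul_one,
      mul_one, Real.norm_eq_abs, Real.norm_eq_abs, sq_abs, sq_abs]
    ring
  ⟨fun v => ⟨_, h v⟩, Continuous.subtype_mk (by fun_prop) h⟩

lemma quarter_coe {u w : Metric.sphere (0 : E) 1} (h : ⟪(u : E), (w : E)⟫ = 0)
    (v : Metric.sphere (0 : E) 1) : (quarter u w h v : E) = v +
      ((⟪(v : E), (w : E)⟫ - ⟪(v : E), (u : E)⟫) • (u : E) +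
      (-⟪(v : E), (u : E)⟫ - ⟪(v : E), (w : E)⟫) • (w : E)) := rfl

lemma quarter_ne {u w : Metric.sphere (0 : E) 1} (h : ⟪(u : E), (w : E)⟫ = 0)
    (v : Metric.sphere (0 : E) 1) : (quarter u w h v : E) ≠ -(v : E) := fun hv => by
  have h' : ⟪(w : E), (u : E)⟫ = 0 := by rw [real_inner_comm, h]
  have h1 := congrArg (fun x => ⟪x, (u : E)⟫) hv
  have h2 := congrArg (fun x => ⟪x, (w : E)⟫) hv
  simp only [quarter_coe, inner_add_left, real_inner_smul_left, inner_self_sphere, inner_neg_left,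
    h, h', mul_zero, mul_one, add_zero, zero_add] at h1 h2
  have h3 : ⟪(v : E), (u : E)⟫ = 0 := by linarith
  have h4 : ⟪(v : E), (w : E)⟫ = 0 := by linarith
  rw [quarter_coe, h3, h4] at hv
  simp only [neg_zero, sub_zero, zero_smul, add_zero] at hv
  have h5 : (v : E) = 0 := by
    have h6 := add_eq_zero_iff_eq_neg.2 hv
    rw [← two_smul ℝ] at h6
    exact (smul_eq_zero.1 h6).resolve_left two_ne_zero
  have h6 := sphere_norm v
  rw [h5, norm_zero] at h6
  exact zero_ne_one h6

lemma absPull_quarter {u w : Metric.sphere (0 : E) 1} (h : ⟪(u : E), (w : E)⟫ = 0)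
    (y : Coh k n (Set.univ : Set (Metric.sphere (0 : E) 1)) ∅) :
    absPull k n (quarter u w h) ∅ y = y := by
  rw [absPull_eq_of_ne (quarter u w h) (ContinuousMap.id _) (quarter_ne h), absPull_id]

/-- The pairs of degrees of maps from the sphere form a group. -/
def degreeGroup {u w : Metric.sphere (0 : E) 1} (h : ⟪(u : E), (w : E)⟫ = 0) (hn : n ≠ 0) {y₀ : T}
    (e f : Coh ℤ n Set.univ {y₀}) (g : Coh ℤ n (Set.univ : Set (Metric.sphere (0 : E) 1)) ∅) :
    AddSubgroup (ℤ × ℤ) where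
  carrier := {c | ∃ ψ : C(Metric.sphere (0 : E) 1, T), ψ (-u) = y₀ ∧
    absPull ℤ n ψ {y₀} e = c.1 • g ∧ absPull ℤ n ψ {y₀} f = c.2 • g}
  zero_mem' := ⟨ContinuousMap.const _ y₀, rfl, by rw [absPull_const y₀ _ hn]; exact (zero_smul ℤ g).symm,
    by rw [absPull_const y₀ _ hn]; exact (zero_smul ℤ g).symm⟩
  neg_mem' := by
    rintro ⟨a, b⟩ ⟨ψ, h0, ha, hb⟩
    refine ⟨ψ.comp (reflect w), ?_, ?_, ?_⟩
    · have : reflect w (-u) = -u := Subtype.ext (by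
        rw [reflect_coe]
        change -(u : E) - (2 * ⟪-(u : E), (w : E)⟫) • (w : E) = -(u : E)
        rw [inner_neg_left, h, neg_zero, mul_zero, zero_smul, sub_zero])
      exact (congrArg ψ this).trans h0
    · rw [absPull_comp, absPull_reflect w hn, ha]
      exact (neg_smul a g).symm
    · rw [absPull_comp, absPull_reflect w hn, hb]
      exact (neg_smul b g).symm
  add_mem' := by
    rintro ⟨a, b⟩ ⟨a', b'⟩ ⟨ψ, h0, ha, hb⟩ ⟨ψ', h0', ha', hb'⟩
    -- The second half of a glued map carries a reflection and thus a sign. Another reflection, in a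
    -- direction orthogonal to `u` so that `-u` stays fixed, cancels it.
    have e1 : (ψ'.comp (reflect w)) (-u) = y₀ := by
      have : reflect w (-u) = -u := Subtype.ext (by
        rw [reflect_coe]
        change -(u : E) - (2 * ⟪-(u : E), (w : E)⟫) • (w : E) = -(u : E)
        rw [inner_neg_left, h, neg_zero, mul_zero, zero_smul, sub_zero])
      exact (congrArg ψ' this).trans h0'
    have h' : ⟪(w : E), (u : E)⟫ = 0 := by rw [real_inner_comm, h]
    -- The glued map is known to take the value `y₀` on the equator, in particular at `w`, but not
    -- at `-u`. A quarter turn, which induces the identity, carries `-u` to `w` and restores the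
    -- base point.
    refine ⟨(glue ψ (ψ'.comp (reflect w)) h0 e1).comp (quarter u w h), ?_, ?_, ?_⟩
    · have h2 : quarter u w h (-u) = w := Subtype.ext (by
        rw [quarter_coe]
        change -(u : E) + ((⟪-(u : E), (w : E)⟫ - ⟪-(u : E), (u : E)⟫) • (u : E) +
          (-⟪-(u : E), (u : E)⟫ - ⟪-(u : E), (w : E)⟫) • (w : E)) = w
        rw [inner_neg_left, inner_neg_left, h, inner_self_sphere]
        simp)
      have h3 := glue_of_ge h0 e1 (v := w) (by rw [h']; norm_num)
      have h4 := glue_of_le h0 e1 (v := w) (by rw [h']; norm_num)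
      exact (congrArg _ h2).trans (h4.1.trans h3.2)
    · rw [absPull_comp, absPull_quarter, absPull_glue, absPull_comp, absPull_reflect _ hn,
        absPull_reflect _ hn, neg_neg, ha, ha']
      exact (add_smul a a' g).symm
    · rw [absPull_comp, absPull_quarter, absPull_glue, absPull_comp, absPull_reflect _ hn,
        absPull_reflect _ hn, neg_neg, hb, hb']
      exact (add_smul b b' g).symm

end Sphere


/-! ### Realization of degrees -/

section Fibre

variable {X Y Z : Type} [TopologicalSpace X] [MulAction Circle X] [ContinuousSMul Circle X]
  [TopologicalSpace Y] [MulAction Circle Y] [ContinuousSMul Circle Y] [TopologicalSpace Z]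
  {k : Type} [CommRing k] {n : ℕ}

/-- Restriction of Borel cohomology to the fibre. -/
def fibrePull (k : Type) [CommRing k] (n : ℕ) (S : Set X) :
    Coh k n (Set.univ : Set (Bor X)) (borSubset X S) →ₗ[k] Coh k n Set.univ S :=
  (pairMap_fibre S).pull k n

lemma fibrePull_borPull (f : TMap X Y) {S : Set X} {S' : Set Y} (h : Set.MapsTo f.map S S') (y) :
    fibrePull k n S (borPull k n f h y) = (pairMap_of f.map h).pull k n (fibrePull k n S' y) := by
  rw [fibrePull, fibrePull, borPull, ← PairMap.pull_comp, ← PairMap.pull_comp]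
  rfl

lemma absPull_pull (f : C(X, Y)) {S : Set X} {S' : Set Y} (h : Set.MapsTo f S S') (ψ : C(Z, X)) (y) :
    absPull k n ψ S ((pairMap_of f h).pull k n y) = absPull k n (f.comp ψ) S' y := by
  rw [absPull, absPull, ← PairMap.pull_comp]

/-- The equivariant map defined by a map from the sphere. -/
def orbitMap {d : ℕ} (ψ : C(DiskBoundary d, X)) : TMap (FreeCellBoundary d) X where
  map := ⟨fun c => c.1 • ψ c.2, (continuous_fst (X := Circle) (Y := DiskBoundary d)).smul
    (ψ.continuous.comp (continuous_snd (X := Circle) (Y := DiskBoundary d)))⟩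
  equivariant z c := mul_smul z c.1 _

/-- The inclusion of the sphere in the boundary of a free cell. -/
def boundarySlice (d : ℕ) : C(DiskBoundary d, FreeCellBoundary d) :=
  ⟨fun v => ((1 : Circle), v), continuous_const.prodMk continuous_id⟩

/-- Restriction from the boundary of a free cell to a sphere. -/
def slicePull (k : Type) [CommRing k] (n d : ℕ) :
    Coh k n Set.univ (borSubset (FreeCellBoundary d) ∅) →ₗ[k]
      Coh k n (Set.univ : Set (DiskBoundary d)) ∅ :=
  absPull k n (boundarySlice d) ∅ ∘ₗ fibrePull k n ∅

/-- The map defined on the free space `𝕋 × S` restricts to `ψ` on the slice. Together with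
`slicePull_bijective` this reduces equivariant degrees to ordinary ones. -/
lemma slicePull_orbitMap {d : ℕ} (ψ : C(DiskBoundary d, X)) (S : Set X) (y) :
    slicePull k n d (borPull k n (orbitMap ψ) (Set.mapsTo_empty _ S) y) =
      absPull k n ψ S (fibrePull k n S y) := by
  have h1 : (orbitMap ψ).map.comp (boundarySlice d) = ψ :=
    ContinuousMap.ext fun v => one_smul Circle (ψ v)
  rw [slicePull, LinearMap.comp_apply, fibrePull_borPull,
    absPull_pull (orbitMap ψ).map (Set.mapsTo_empty _ S), h1]

lemma continuous_boundary_fst (d : ℕ) : Continuous fun c : FreeCellBoundary d => c.1 :=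
  continuous_fst (X := Circle) (Y := DiskBoundary d)

lemma continuous_boundary_snd (d : ℕ) : Continuous fun c : FreeCellBoundary d => c.2 :=
  continuous_snd (X := Circle) (Y := DiskBoundary d)

lemma slicePull_bijective (n d : ℕ) : Function.Bijective (slicePull k n d) := by
  have h1 : PairMap (fun c : FreeCellBoundary d => Bor.mk (ET.basis 0, c)) ({c ∈ (Set.univ : Set (FreeCellBoundary d)) | c.1 = 1})
      {c ∈ (∅ : Set (FreeCellBoundary d)) | c.1 = 1} (borSubset (FreeCellBoundary d) Set.univ)
      (borSubset (FreeCellBoundary d) ∅) :=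
    ⟨((pairMap_fibre (Set.univ : Set (FreeCellBoundary d))).cont).mono (Set.subset_univ _),
      fun c hc => ⟨trivial, hc.2⟩, fun c _ => ⟨_, c, trivial, rfl⟩, fun c hc => ⟨_, c, hc.1, rfl⟩⟩
  have i1 : h1.Iso n := free_iso (X := FreeCellBoundary d) (θ := fun c => c.1) inv_univ inv_empty (Set.subset_univ _)
    (continuous_boundary_fst d).continuousOn (fun _ _ _ => rfl) h1 n
  have h2 : PairMap (boundarySlice d) Set.univ ∅ ({c ∈ (Set.univ : Set (FreeCellBoundary d)) | c.1 = 1})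
      {c ∈ (∅ : Set (FreeCellBoundary d)) | c.1 = 1} :=
    ⟨(boundarySlice d).continuous.continuousOn, Set.subset_univ _, fun _ _ => ⟨trivial, rfl⟩,
      Set.mapsTo_empty _ _⟩
  have h3 : PairMap (fun c : FreeCellBoundary d => c.2) ({c ∈ (Set.univ : Set (FreeCellBoundary d)) | c.1 = 1})
      {c ∈ (∅ : Set (FreeCellBoundary d)) | c.1 = 1} Set.univ ∅ :=
    ⟨(continuous_boundary_snd d).continuousOn, fun c hc => hc.1.elim,
      fun _ _ => trivial, fun c hc => hc.1⟩
  have i2 : h2.Iso n := PairMap.Iso.of_inverse h2 h3 (fun _ _ => rfl)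
    (fun c hc => Prod.ext hc.2.symm rfl) n
  have i3 := PairMap.Iso.comp (hψ := h1) (hφ := h2) i1 i2
  have h4 : slicePull k n d = ((pairMap_fibre ∅).comp (pairMap_of (boundarySlice d)
      (Set.mapsTo_empty _ _))).pull k n :=
    LinearMap.ext fun y => (PairMap.pull_comp (pairMap_fibre ∅) (pairMap_of (boundarySlice d)
      (Set.mapsTo_empty _ _)) n y).symm
  rw [h4]
  revert h1
  rw [Collar.borSubset_univ]
  exact fun _ _ i => i k

end Fibre

/-! ### The two spheres in `A` and the degrees they realize -/

section Generators

/-- A class that some homomorphism takes to a generator cannot be a proper multiple: its coefficient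
divides `1`. This makes it possible to recognize generators up to sign without knowing that the
homomorphism is bijective. -/
lemma exists_unit_smul {W V : Type} [TopologicalSpace W] [TopologicalSpace V] {n : ℕ} {U A : Set W}
    {U' A' : Set V} {γ x : Coh ℤ n U A} {θ : Coh ℤ n U' A'} (hγ : IsGen γ) (hθ : IsGen θ)
    (L : Coh ℤ n U A →ₗ[ℤ] Coh ℤ n U' A') (hL : L x = θ) : ∃ c : ℤˣ, x = (c : ℤ) • γ := by
  obtain ⟨c, hc, -⟩ := hγ.int x
  obtain ⟨m, hm, -⟩ := hθ.int (L γ)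
  have h1 : c * m = 1 := by
    refine (hθ.int θ).unique ?_ (one_smul ℤ θ).symm
    rw [mul_smul, ← hm, ← map_smul, ← hc, hL]
  exact ⟨⟨c, m, h1, by rw [mul_comm, h1]⟩, hc⟩

variable (l h : ℕ)

lemma repSphere_fibre_iso {n : ℕ} (hn : n ≤ l + 2 * h) :
    (pairMap_fibre {RepSphere.pt l h}).Iso n := by
  have h1 : PairMap (RepSphere.coe l h).map Set.univ {0}ᶜ Set.univ {RepSphere.origin l h}ᶜ :=
    pairMap_onePoint (W := Rep l h)
  have h2 : PairMap (fun x : RepSphere l h => x) Set.univ {RepSphere.pt l h} Set.univ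
      {RepSphere.origin l h}ᶜ := relMap (Set.subset_univ _) (pt_subset l h)
  have h3 : PairMap (fun x : RepSphere l h => Bor.mk (ET.basis 0, x)) Set.univ
      {RepSphere.origin l h}ᶜ Set.univ (borSubset _ {RepSphere.origin l h}ᶜ) := pairMap_fibre _
  have h4 := relMap (Set.subset_univ _) (borPt_subset l h)
  have i1 : h1.Iso n := onePoint_coe_iso (W := Rep l h) n
  have i2 : h2.Iso n := onePoint_rel_iso (W := Rep l h) n
  have i0 : (pairMap_fibre ({0}ᶜ : Set (Rep l h))).Iso n :=
    thom_iso (Rep l h) (by rwa [Rep.finrank])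
  have i3 : ((pairMap_coe l h).comp (pairMap_fibre ({0}ᶜ : Set (Rep l h)))).Iso n :=
    (coe_iso l h n).comp i0
  have i4 : (h3.comp h1).Iso n := PairMap.Iso.congr (fun _ _ => rfl) i3
  have i7 : h3.Iso n := PairMap.Iso.of_comp_right i1 i4
  have i5 : (h3.comp h2).Iso n := i7.comp i2
  have i6 : (h4.comp (pairMap_fibre {RepSphere.pt l h})).Iso n :=
    PairMap.Iso.congr (fun _ _ => rfl) i5
  exact PairMap.Iso.of_comp_left (repSphere_rel_iso l h n) i6

/-- The representation sphere is a sphere. -/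
def RepSphere.toSphere : RepSphere l h ≃ₜ DiskBoundary (l + 2 * h + 1) :=
  onePointEquivSphereOfFinrankEq (V := Rep l h) (by rw [Rep.finrank, Fintype.card_fin])

lemma van_point {X : Type} [TopologicalSpace X] (x : X) {n : ℕ} (hn : n ≠ 0) : Van n {x} ∅ := by
  have h1 : PairMap (fun _ : Unit => x) Set.univ ∅ {x} ∅ :=
    ⟨continuousOn_const, Set.subset_univ _, fun _ _ => rfl, Set.mapsTo_empty _ _⟩
  have h2 : PairMap (fun _ : X => ()) {x} ∅ Set.univ ∅ :=
    ⟨continuousOn_const, Set.empty_subset _, fun _ _ => trivial, Set.mapsTo_empty _ _⟩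
  exact (PairMap.Iso.of_inverse h1 h2 (fun _ _ => rfl) (fun _ h => h.symm) n).van
    (sphereLike_point.1 n hn)

/-- The base point is dropped by the exact sequence of the pair, for which a point must have no
cohomology in degrees `n - 1` and `n`. This is where `n ≥ 2` enters. -/
lemma toSphere_symm_iso {n : ℕ} (hn : 2 ≤ n) :
    (pairMap_of ⟨(RepSphere.toSphere l h).symm, (RepSphere.toSphere l h).symm.continuous⟩
      (Set.mapsTo_empty _ {RepSphere.pt l h})).Iso n := by
  set β := RepSphere.toSphere l h
  let f : C(DiskBoundary (l + 2 * h + 1), RepSphere l h) := ⟨β.symm, β.symm.continuous⟩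
  let g : C(RepSphere l h, DiskBoundary (l + 2 * h + 1)) := ⟨β, β.continuous⟩
  have hf : Set.MapsTo f {β (RepSphere.pt l h)} {RepSphere.pt l h} := by
    rintro _ rfl
    exact β.symm_apply_apply _
  have hg : Set.MapsTo g {RepSphere.pt l h} {β (RepSphere.pt l h)} := by
    rintro _ rfl
    rfl
  have i1 : (pairMap_of f hf).Iso n := PairMap.Iso.of_inverse _ (pairMap_of g hg)
    (fun x _ => β.apply_symm_apply x) (fun x _ => β.symm_apply_apply x) n
  obtain ⟨m, rfl⟩ : ∃ m, n = m + 1 := ⟨n - 1, by omega⟩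
  have i2 : (relMap (Set.subset_univ {β (RepSphere.pt l h)}) (Set.empty_subset _)).Iso (m + 1) :=
    rel_iso_succ (Set.subset_univ _) (Set.empty_subset _) (van_point _ (by omega))
      (van_point _ m.succ_ne_zero)
  exact PairMap.Iso.comp (hψ := pairMap_of f hf) i1 i2

variable {l h}

lemma exists_orthogonal {d : ℕ} (hd : 2 ≤ d) (u : DiskBoundary d) :
    ∃ w : DiskBoundary d, inner ℝ (u : EuclideanSpace ℝ (Fin d)) (w : EuclideanSpace ℝ (Fin d)) = 0 := by
  have hu : (u : EuclideanSpace ℝ (Fin d)) ≠ 0 := fun h0 => by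
    have := sphere_norm u
    rw [h0, norm_zero] at this
    exact zero_ne_one this
  have hf : Fact (Module.finrank ℝ (EuclideanSpace ℝ (Fin d)) = (d - 1) + 1) :=
    ⟨by rw [finrank_euclideanSpace_fin]; omega⟩
  have h1 := Submodule.finrank_orthogonal_span_singleton (𝕜 := ℝ) (n := d - 1) hu
  have h2 : (Submodule.span ℝ {(u : EuclideanSpace ℝ (Fin d))})ᗮ ≠ ⊥ := fun h2 => by
    rw [h2, finrank_bot] at h1
    omega
  obtain ⟨w, hw, hw0⟩ := Submodule.exists_mem_ne_zero_of_ne_bot h2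
  refine ⟨⟨‖w‖⁻¹ • w, ?_⟩, ?_⟩
  · rw [mem_sphere_zero_iff_norm, norm_smul, norm_inv, norm_norm,
      inv_mul_cancel₀ (norm_ne_zero_iff.2 hw0)]
  · rw [inner_smul_right, Submodule.mem_orthogonal_singleton_iff_inner_right.1 hw, mul_zero]

lemma collapse_surjective {d : ℕ} (hd : 0 < d) : Function.Surjective (collapse (d := d)) := fun x => by
  induction x using OnePoint.rec with
  | infty =>
    let v : EuclideanSpace ℝ (Fin d) := EuclideanSpace.single ⟨0, hd⟩ 1
    have hv : ‖v‖ = 1 := by simp [v]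
    exact ⟨⟨v, mem_closedBall_zero_iff.2 hv.le⟩, collapse_of_norm hv⟩
  | coe v => exact ⟨_, collapse_shrink v⟩

/-- The map from the sphere to `A` that is given by the cell. -/
def SpaceA.cellMap (hn : 0 < l + 2 * h) :
    C(OnePoint (EuclideanSpace ℝ (Fin (l + 2 * h))), SpaceA l h) where
  toFun x := x.elim (SpaceA.base l h).1 fun v =>
    (Attach.cell (constBase l h (l + 2 * h))).map (FreeCell.mk 1 (shrink v))
  continuous_toFun := by
    have hq : Topology.IsQuotientMap (collapse (d := l + 2 * h)) :=
      continuous_collapse.isClosedMap.isQuotientMap continuous_collapse (collapse_surjective hn)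
    refine hq.continuous_iff.2 ?_
    have h1 : Continuous fun v : Disk (l + 2 * h) =>
        (Attach.cell (constBase l h (l + 2 * h))).map (FreeCell.mk 1 v) :=
      (Attach.cell _).map.continuous.comp (continuous_freeCell_mk _ continuous_const continuous_id)
    refine h1.congr fun v => ?_
    rcases v.norm_le.lt_or_eq with hv | hv
    · rw [Function.comp_apply, collapse_of_lt hv]
      change _ = (Attach.cell (constBase l h (l + 2 * h))).map (FreeCell.mk 1 (shrink _))
      rw [shrink_of_lt hv]
    · rw [Function.comp_apply, collapse_of_norm hv]
      exact Attach.cell_of_norm _ (c := FreeCell.mk 1 v) hv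

lemma SpaceA.cellMap_collapse (hn : 0 < l + 2 * h) (v : Disk (l + 2 * h)) :
    SpaceA.cellMap hn (collapse v) =
      (Attach.cell (constBase l h (l + 2 * h))).map (FreeCell.mk 1 v) := by
  rcases v.norm_le.lt_or_eq with hv | hv
  · rw [collapse_of_lt hv]
    change (Attach.cell (constBase l h (l + 2 * h))).map (FreeCell.mk 1 (shrink _)) = _
    rw [shrink_of_lt hv]
  · rw [collapse_of_norm hv]
    exact (Attach.cell_of_norm _ (c := FreeCell.mk 1 v) hv).symm

lemma SpaceA.retract_cellMap (hn : 0 < l + 2 * h) (x) :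
    (SpaceA.retract l h).map (SpaceA.cellMap hn x) = RepSphere.pt l h := by
  induction x using OnePoint.rec with
  | infty => rfl
  | coe v => rfl

/-- Linear coordinates on the representation sphere. -/
def RepSphere.coord (l h : ℕ) :
    OnePoint (EuclideanSpace ℝ (Fin (l + 2 * h))) ≃ₜ RepSphere l h :=
  (Rep.coord l h).toHomeomorph.onePointCongr

/-- The inclusion of the sphere that is given by the cell of `A`. -/
def SpaceA.wedgeMap (hn : 0 < l + 2 * h) : C(RepSphere l h, SpaceA l h) :=
  (SpaceA.cellMap hn).comp ⟨(RepSphere.coord l h).symm, (RepSphere.coord l h).symm.continuous⟩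

lemma SpaceA.mapsTo_wedgeMap (hn : 0 < l + 2 * h) :
    Set.MapsTo (SpaceA.wedgeMap hn) {RepSphere.pt l h} {(SpaceA.base l h).1} := by
  rintro _ rfl
  rfl

/-- The retraction collapses the second sphere of the wedge to the base point, so classes pulled
back along it have degree zero there. -/
lemma SpaceA.absPull_wedgeMap {Z : Type} [TopologicalSpace Z] (hn : 0 < l + 2 * h)
    (β : C(Z, RepSphere l h)) (γ : CohRep l h ℤ (l + 2 * h)) :
    absPull ℤ (l + 2 * h) ((SpaceA.wedgeMap hn).comp β) {(SpaceA.base l h).1}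
      (fibrePull ℤ (l + 2 * h) _ (CohRep.toA l h ℤ (l + 2 * h) γ)) = 0 := by
  have h4 : (SpaceA.retract l h).map.comp ((SpaceA.wedgeMap hn).comp β) =
      ContinuousMap.const _ (RepSphere.pt l h) :=
    ContinuousMap.ext fun v => SpaceA.retract_cellMap hn _
  have h5 : fibrePull ℤ (l + 2 * h) _ (CohRep.toA l h ℤ (l + 2 * h) γ) =
      (pairMap_of (SpaceA.retract l h).map (mapsTo_pt (SpaceA.retract_pt l h))).pull ℤ (l + 2 * h)
        (fibrePull ℤ (l + 2 * h) _ γ) :=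
    fibrePull_borPull (SpaceA.retract l h) (mapsTo_pt (SpaceA.retract_pt l h)) γ
  rw [h5, absPull_pull (SpaceA.retract l h).map (mapsTo_pt (SpaceA.retract_pt l h)), h4,
    absPull_const _ _ hn.ne']

/-- The characteristic map of the sphere. -/
def RepSphere.diskMap (l h : ℕ) (v : EuclideanSpace ℝ (Fin (l + 2 * h))) : RepSphere l h :=
  RepSphere.coord l h (collapse (toDisk v))

lemma pairMap_diskMap (l h : ℕ) : PairMap (RepSphere.diskMap l h) (Metric.closedBall 0 1)
    (Metric.sphere 0 1) Set.univ {RepSphere.pt l h} := by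
  refine ⟨((RepSphere.coord l h).continuous.comp
    (continuous_collapse.comp continuous_toDisk)).continuousOn,
    Metric.sphere_subset_closedBall, fun _ _ => trivial, fun v hv => ?_⟩
  have h1 : ‖(toDisk v).1‖ = 1 := by
    rw [norm_toDisk, mem_sphere_zero_iff_norm.1 hv, min_self]
  exact congrArg (RepSphere.coord l h) (collapse_of_norm h1)

lemma SpaceA.wedgeMap_diskMap (hn : 0 < l + 2 * h) (v) :
    SpaceA.wedgeMap hn (RepSphere.diskMap l h v) =
      (Attach.cell (constBase l h (l + 2 * h))).map (FreeCell.mk 1 (toDisk v)) :=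
  Eq.trans (congrArg (SpaceA.cellMap hn) ((RepSphere.coord l h).symm_apply_apply _))
    (SpaceA.cellMap_collapse hn (toDisk v))

lemma SpaceA.pull_wedgeMap (hn : 0 < l + 2 * h) (x : Coh ℤ (l + 2 * h) Set.univ
      (borSubset (SpaceA l h) (Attach.collar (constBase l h (l + 2 * h))).bd)) :
    (pairMap_diskMap l h).pull ℤ (l + 2 * h) ((pairMap_of _ (SpaceA.mapsTo_wedgeMap hn)).pull ℤ
      (l + 2 * h) (fibrePull ℤ (l + 2 * h) _ (CohA.ofCell l h ℤ (l + 2 * h) x))) =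
    (pairMap_freeCell (l + 2 * h)).pull ℤ (l + 2 * h)
      ((Attach.pairMap_cell (constBase l h (l + 2 * h))).pull ℤ (l + 2 * h) x) := by
  have h1 := relMap (Set.subset_univ _) (Attach.bor_pt_subset
    (constBase l h (l + 2 * h)) (RepSphere.pt l h))
  have h2 : PairMap (fun x : SpaceA l h => Bor.mk (ET.basis 0, x)) Set.univ {(SpaceA.base l h).1}
      Set.univ (borSubset (SpaceA l h) {(SpaceA.base l h).1}) := pairMap_fibre _
  have h3 := pairMap_of _ (SpaceA.mapsTo_wedgeMap hn)
  have h4 := pairMap_diskMap l h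
  have h5 := Attach.pairMap_cell (constBase l h (l + 2 * h))
  have h6 := pairMap_freeCell (l + 2 * h)
  have e1 := (congrArg (h4.pull ℤ (l + 2 * h)) ((congrArg (h3.pull ℤ (l + 2 * h))
    (PairMap.pull_comp h1 h2 (l + 2 * h) x).symm).trans
    (PairMap.pull_comp (h1.comp h2) h3 (l + 2 * h) x).symm)).trans
    (PairMap.pull_comp ((h1.comp h2).comp h3) h4 (l + 2 * h) x).symm
  have e2 := PairMap.pull_comp (k := ℤ) h5 h6 (l + 2 * h) x
  refine e1.trans (Eq.trans ?_ e2)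
  exact PairMap.pull_eq_of_eqOn _ _ (fun v _ => congrArg (fun y => Bor.mk (ET.basis 0, y))
      (SpaceA.wedgeMap_diskMap hn v)) (l + 2 * h) x

/-- The class of the cell and its restriction to the second sphere pull back to the same class of
the disk relative to its boundary, and this class is a generator. The sign need not be determined.
-/
lemma SpaceA.exists_unit_wedgeMap (hn : 0 < l + 2 * h)
    {γ : Coh ℤ (l + 2 * h) Set.univ {RepSphere.pt l h}} (hγ : IsGen γ) {x : Coh ℤ (l + 2 * h) Set.univ
      (borSubset (SpaceA l h) (Attach.collar (constBase l h (l + 2 * h))).bd)} (hx : IsGen x) :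
    ∃ c : ℤˣ, (pairMap_of _ (SpaceA.mapsTo_wedgeMap hn)).pull ℤ (l + 2 * h)
      (fibrePull ℤ (l + 2 * h) _ (CohA.ofCell l h ℤ (l + 2 * h) x)) = (c : ℤ) • γ :=
  exists_unit_smul hγ (IsGen.pull (freeCell_iso (l + 2 * h) (l + 2 * h))
    (IsGen.pull (Attach.cell_iso (constBase l h (l + 2 * h)) (l + 2 * h)) hx))
    ((pairMap_diskMap l h).pull ℤ (l + 2 * h)) (SpaceA.pull_wedgeMap hn x)

/-- Every pair of degrees is realized by a map from the sphere, for a suitable basis. -/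
lemma exists_degrees (hn : 2 ≤ l + 2 * h) : ∃ e f : CohA l h ℤ (l + 2 * h), IsBasis e f ∧
    ∀ g : Coh ℤ (l + 2 * h) Set.univ (borSubset (FreeCellBoundary (l + 2 * h + 1)) ∅), IsGen g →
      ∀ a b : ℤ, ∃ φ : AttachingMap l h, φ.pull ℤ _ e = a • g ∧ φ.pull ℤ _ f = b • g := by
  obtain ⟨γ, hγ⟩ := exists_gen_repSphere_pt l h
  obtain ⟨x, hx⟩ := (Attach.sphereLike (constBase l h (l + 2 * h))).2
  have hn0 : 0 < l + 2 * h := by omega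
  refine ⟨_, _, isBasis_of_gen hn0 hγ hx, fun g hg => ?_⟩
  let pt : SpaceA l h := (SpaceA.base l h).1
  let β := RepSphere.toSphere l h
  let β' : C(DiskBoundary ((l + 2 * h) + 1), RepSphere l h) := ⟨β.symm, β.symm.continuous⟩
  -- Based maps are normalized at `-u`, so `u` is chosen opposite to the point that corresponds to
  -- infinity.
  let u : DiskBoundary ((l + 2 * h) + 1) := -β (RepSphere.pt l h)
  have hu : β' (-u) = RepSphere.pt l h := by
    change β.symm (- -β (RepSphere.pt l h)) = _
    rw [neg_neg, β.symm_apply_apply]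
  obtain ⟨w, huw⟩ := exists_orthogonal (by omega) u
  have hγ' : IsGen (fibrePull ℤ (l + 2 * h) _ γ) := IsGen.pull (repSphere_fibre_iso l h le_rfl) hγ
  have hγ'' : IsGen (absPull ℤ (l + 2 * h) β' {RepSphere.pt l h} (fibrePull ℤ (l + 2 * h) _ γ)) :=
    IsGen.pull (toSphere_symm_iso l h hn) hγ'
  let e := CohRep.toA l h ℤ (l + 2 * h) γ
  let f := CohA.ofCell l h ℤ (l + 2 * h) x
  let G := degreeGroup (n := l + 2 * h) huw hn0.ne' (fibrePull ℤ (l + 2 * h) {pt} e) (fibrePull ℤ (l + 2 * h) {pt} f)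
    (slicePull ℤ (l + 2 * h) ((l + 2 * h) + 1) g)
  suffices hG : ∀ c, c ∈ G by
    intro a b
    obtain ⟨ψ, -, h1, h2⟩ := hG (a, b)
    refine ⟨orbitMap ψ, (slicePull_bijective (l + 2 * h) ((l + 2 * h) + 1)).1 ?_, (slicePull_bijective (l + 2 * h) ((l + 2 * h) + 1)).1 ?_⟩
    · rw [map_smul]
      exact (slicePull_orbitMap ψ {pt} e).trans h1
    · rw [map_smul]
      exact (slicePull_orbitMap ψ {pt} f).trans h2
  have hgu : ∀ c : ℤˣ, ∀ y, y = (c : ℤ) • fibrePull ℤ (l + 2 * h) _ γ → ∃ c' : ℤˣ,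
      absPull ℤ (l + 2 * h) β' {RepSphere.pt l h} y = (c' : ℤ) • slicePull ℤ (l + 2 * h) ((l + 2 * h) + 1) g := by
    intro c y hy
    obtain ⟨y', hy'⟩ := (slicePull_bijective (l + 2 * h) ((l + 2 * h) + 1)).2
      (absPull ℤ (l + 2 * h) β' {RepSphere.pt l h} (fibrePull ℤ (l + 2 * h) _ γ))
    obtain ⟨c', hc'⟩ := exists_unit_smul hg hγ'' (slicePull ℤ (l + 2 * h) ((l + 2 * h) + 1)) hy'
    refine ⟨c * c', ?_⟩
    rw [hy, map_smul, ← hy', hc', map_smul, smul_smul, Units.val_mul]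
  -- Realized by the inclusion of `S^{l,h}`: composed with the retraction it is the identity, and
  -- the class of the cell restricts to zero.
  have mem1 : ∃ c : ℤˣ, ((c : ℤ), (0 : ℤ)) ∈ G := by
    obtain ⟨c, hc⟩ := hgu 1 (fibrePull ℤ (l + 2 * h) _ γ) (one_smul ℤ _).symm
    refine ⟨c, (SpaceA.incl l h).map.comp β', congrArg (SpaceA.incl l h).map hu, ?_, ?_⟩
    · rw [← hc, ← absPull_pull (SpaceA.incl l h).map (mapsTo_pt (SpaceA.incl_pt l h)),
        ← fibrePull_borPull]
      swap
      · exact mapsTo_pt (SpaceA.incl_pt l h)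
      refine congrArg (fun y => absPull ℤ (l + 2 * h) β' _ (fibrePull ℤ (l + 2 * h) _ y)) ?_
      have h1 := borPull_of_comp_eq (k := ℤ) (l + 2 * h) (SpaceA.retract l h) (SpaceA.incl l h)
        ⟨ContinuousMap.id _, fun _ _ => rfl⟩ (mapsTo_pt (SpaceA.incl_pt l h))
        (mapsTo_pt (SpaceA.retract_pt l h)) (fun _ hx => hx) (SpaceA.retract_incl l h) γ
      refine h1.trans ((PairMap.pull_eq_of_eqOn _ (PairMap.id (Set.subset_univ _) subset_rfl
        subset_rfl) ?_ (l + 2 * h) γ).trans (PairMap.pull_id _ (l + 2 * h) γ))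
      intro x _
      obtain ⟨p, rfl⟩ := Bor.mk_surjective x
      rfl
    · rw [← absPull_pull (SpaceA.incl l h).map (mapsTo_pt (SpaceA.incl_pt l h)),
        ← fibrePull_borPull]
      swap
      · exact mapsTo_pt (SpaceA.incl_pt l h)
      have h1 : borPull ℤ (l + 2 * h) (SpaceA.incl l h) (mapsTo_pt (SpaceA.incl_pt l h)) f = 0 :=
        CohA.toRep_ofCell l h x
      rw [h1, map_zero, map_zero]
      exact (zero_smul ℤ _).symm
  -- Realized by the sphere that the slice of the cell forms in `A`.
  have mem2 : ∃ c : ℤˣ, ((0 : ℤ), (c : ℤ)) ∈ G := by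
    obtain ⟨c, hc⟩ := SpaceA.exists_unit_wedgeMap hn0 hγ' hx
    obtain ⟨c', hc'⟩ := hgu c _ hc
    refine ⟨c', (SpaceA.wedgeMap hn0).comp β', congrArg (SpaceA.wedgeMap hn0) hu, ?_, ?_⟩
    · exact (SpaceA.absPull_wedgeMap hn0 β' γ).trans (zero_smul ℤ _).symm
    · exact (absPull_pull (SpaceA.wedgeMap hn0) (SpaceA.mapsTo_wedgeMap hn0) β' _).symm.trans hc'
  obtain ⟨c, hc⟩ := mem1
  obtain ⟨c', hc'⟩ := mem2
  rintro ⟨a, b⟩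
  have h1 := G.add_mem (G.zsmul_mem hc (a * (c⁻¹ : ℤˣ))) (G.zsmul_mem hc' (b * (c'⁻¹ : ℤˣ)))
  convert h1 using 1
  refine Prod.ext ?_ ?_
  · simp [mul_assoc]
  · simp [mul_assoc]

end Generators


/-! ### Generators and prime fields -/

lemma forall_exists_unique_congr {M N ι : Type} [AddCommGroup M] [AddCommGroup N] (E : M ≃+ N)
    {u : ι → M} {v : ι → N} (h : ∀ c, E (u c) = v c) :
    (∀ y, ∃! c, y = u c) ↔ ∀ y, ∃! c, y = v c := by
  rw [E.surjective.forall]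
  refine forall_congr' fun y => existsUnique_congr fun c => ?_
  rw [← h, E.injective.eq_iff]

variable {l h : ℕ}

/-- The hypotheses of the theorem speak of integral cohomology only. For the two infinite cyclic
groups they are upgraded to all coefficient rings by comparison with generators already constructed.
-/
lemma isGenerators_iff (hn : l + 2 * h ≠ 0)
    (eA fA : borelCohomology (SpaceA l h) ℤ (l + 2 * h) {(SpaceA.base l h).1})
    (g : borelCohomology (FreeCellBoundary (l + 2 * h + 1)) ℤ (l + 2 * h) ∅) :
    IsGenerators l h eA fA g ↔
      (∀ y : CohA l h ℤ (l + 2 * h), ∃! c : ℤ × ℤ,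
        y = c.1 • borCohEquiv ℤ _ _ eA + c.2 • borCohEquiv ℤ _ _ fA) ∧
      CohA.restrict l h ℤ _ (borCohEquiv ℤ _ _ fA) = 0 ∧
      IsGen (CohA.restrict l h ℤ _ (borCohEquiv ℤ _ _ eA)) ∧ IsGen (borCohEquiv ℤ _ _ g) := by
  obtain ⟨E, hE⟩ := (SpaceA.isFixedSphere l h).exists_equiv ℤ (SpaceA.base l h) (SpaceA.fixed_pt l h)
    (l + 2 * h)
  have h1 := forall_exists_unique_congr (borCohEquiv ℤ (l + 2 * h) {(SpaceA.base l h).1}).toAddEquiv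
    (u := fun c : ℤ × ℤ => c.1 • eA + c.2 • fA)
    (v := fun c => c.1 • borCohEquiv ℤ _ _ eA + c.2 • borCohEquiv ℤ _ _ fA) fun c =>
      (map_add (borCohEquiv ℤ (l + 2 * h) {(SpaceA.base l h).1}) _ _).trans
        (congrArg₂ (· + ·) (map_zsmul (borCohEquiv ℤ (l + 2 * h) {(SpaceA.base l h).1}) _ _)
          (map_zsmul (borCohEquiv ℤ (l + 2 * h) {(SpaceA.base l h).1}) _ _))
  have h2 : restrictFixed ℤ (SpaceA l h) (SpaceA.base l h) (l + 2 * h) fA = 0 ↔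
      CohA.restrict l h ℤ _ (borCohEquiv ℤ _ _ fA) = 0 := by
    rw [← E.map_eq_zero_iff, hE]
    rfl
  have h3 := forall_exists_unique_congr E.toAddEquiv
    (u := fun c : ℤ => c • restrictFixed ℤ (SpaceA l h) (SpaceA.base l h) (l + 2 * h) eA)
    (v := fun c => c • CohA.restrict l h ℤ _ (borCohEquiv ℤ _ _ eA)) fun c =>
      (map_zsmul E _ _).trans (congrArg (c • ·) (hE eA))
  have h4 := forall_exists_unique_congr (borCohEquiv ℤ (l + 2 * h) ∅).toAddEquiv
    (u := fun c : ℤ => c • g) (v := fun c => c • borCohEquiv ℤ _ _ g) fun c =>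
      map_zsmul (borCohEquiv ℤ (l + 2 * h) ∅) _ _
  constructor
  · rintro ⟨b1, b2, b3, b4⟩
    obtain ⟨u, hu⟩ := exists_gen_sphere_fixed l h
    refine ⟨h1.1 b1, h2.1 b2, hu.of_int (h3.1 b3), ?_⟩
    obtain ⟨w, hw⟩ := exists_gen_boundary hn
    exact hw.of_int (h4.1 b4)
  · rintro ⟨b1, b2, b3, b4⟩
    exact ⟨h1.2 b1, h2.2 b2, h3.2 b3.int, h4.2 b4.int⟩

lemma exists_isGenerators (hn : 1 ≤ l + 2 * h) : ∃ eA fA g, IsGenerators l h eA fA g := by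
  obtain ⟨e, f, hb⟩ := exists_isBasis hn
  obtain ⟨g, hg⟩ := exists_gen_boundary (n := l + 2 * h) (by omega)
  refine ⟨(borCohEquiv ℤ _ _).symm e, (borCohEquiv ℤ _ _).symm f, (borCohEquiv ℤ _ _).symm g,
    (isGenerators_iff (by omega) _ _ _).2 ?_⟩
  rw [LinearEquiv.apply_symm_apply, LinearEquiv.apply_symm_apply, LinearEquiv.apply_symm_apply]
  refine ⟨fun y => ?_, hb.restrict_f, hb.restrict_e, hg⟩
  have h1 := hb.coord ℤ y
  rwa [coeff_int, coeff_int] at h1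

lemma AttachingMap.pullback_eq_iff (φ : AttachingMap l h) (y) (a : ℤ) (g) :
    φ.pullback y = a • g ↔ φ.pull ℤ _ (borCohEquiv ℤ _ _ y) = a • borCohEquiv ℤ _ _ g := by
  rw [← (borCohEquiv ℤ (l + 2 * h) ∅).injective.eq_iff, map_zsmul]
  exact Eq.congr_left (borCohEquiv_pullback (l + 2 * h) φ (Set.mapsTo_empty _ _) y)

/-- An integral basis is a basis for all coefficient rings. -/
lemma IsBasis.exists_coord {e₀ f₀ e f : CohA l h ℤ (l + 2 * h)} (hb : IsBasis e₀ f₀)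
    (he : ∀ y : CohA l h ℤ (l + 2 * h), ∃! c : ℤ × ℤ, y = c.1 • e + c.2 • f) (k : Type) [CommRing k]
    (y : CohA l h k (l + 2 * h)) : ∃ c : k × k, y = c.1 • coeff k _ _ _ e + c.2 • coeff k _ _ _ f := by
  obtain ⟨⟨p, q⟩, h1, -⟩ := he e₀
  obtain ⟨⟨r, s⟩, h2, -⟩ := he f₀
  obtain ⟨c, hc, -⟩ := hb.coord k y
  refine ⟨(c.1 * p + c.2 * r, c.1 * q + c.2 * s), ?_⟩
  rw [hc, h1, h2, map_add, map_add, coeff_smul, coeff_smul, coeff_smul, coeff_smul]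
  module

/-- The given basis and the one for which degrees were realized are related by mutually inverse
integral matrices. Degrees `(p a + q b, r a + s b)` with respect to the latter become `(a, b)` with
respect to the former. -/
lemma exists_hasDegrees (hn : 2 ≤ l + 2 * h) {eA fA g} (hg : IsGenerators l h eA fA g) (a b : ℤ) :
    ∃ φ : AttachingMap l h, HasDegrees φ eA fA g a b := by
  obtain ⟨e₀, f₀, hb, hd⟩ := exists_degrees hn
  obtain ⟨b1, -, -, b4⟩ := (isGenerators_iff (by omega) _ _ _).1 hg
  set e := borCohEquiv ℤ _ _ eA
  set f := borCohEquiv ℤ _ _ fA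
  have hb1 := hb.coord ℤ
  simp only [coeff_int] at hb1
  obtain ⟨⟨p, q⟩, h1, -⟩ := b1 e₀
  obtain ⟨⟨r, s⟩, h2, -⟩ := b1 f₀
  obtain ⟨⟨x, y⟩, h3, -⟩ := hb1 e
  obtain ⟨⟨u, v⟩, h4, -⟩ := hb1 f
  dsimp only at h1 h2 h3 h4
  have h5 : (x * p + y * r, x * q + y * s) = ((1, 0) : ℤ × ℤ) :=
    (b1 e).unique (by
      dsimp only
      conv_lhs => rw [h3, h1, h2]
      module) (by module)
  have h6 : (u * p + v * r, u * q + v * s) = ((0, 1) : ℤ × ℤ) :=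
    (b1 f).unique (by
      dsimp only
      conv_lhs => rw [h4, h1, h2]
      module) (by module)
  obtain ⟨φ, d1, d2⟩ := hd _ b4 (p * a + q * b) (r * a + s * b)
  rw [Prod.mk.injEq] at h5 h6
  refine ⟨φ, (φ.pullback_eq_iff _ _ _).2 ?_, (φ.pullback_eq_iff _ _ _).2 ?_⟩
  · change φ.pull ℤ _ e = _
    rw [h3, map_add, map_smul, map_smul, d1, d2, smul_smul, smul_smul, ← add_smul]
    congr 1
    linear_combination a * h5.1 + b * h5.2
  · change φ.pull ℤ _ f = _
    rw [h4, map_add, map_smul, map_smul, d1, d2, smul_smul, smul_smul, ← add_smul]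
    congr 1
    linear_combination a * h6.1 + b * h6.2

/-! ### Evaluation of the invariants over prime fields and over the integers -/

section Invariants

open Classical in
lemma HasDegrees.hStrong_eq (hn : 2 ≤ l + 2 * h) {eA fA g} (hg : IsGenerators l h eA fA g) {a b : ℤ}
    {φ : AttachingMap l h} (hφ : HasDegrees φ eA fA g a b) (k : Type) [CommRing k] [Nontrivial k] :
    hStrong k (Attach φ) φ.base l =
      if ∃ d : k, a + d * b = 0 then (h : ℕ∞) else (h : ℕ∞) + 1 := by
  obtain ⟨e₀, f₀, hb⟩ := exists_isBasis (l := l) (h := h) (by omega)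
  obtain ⟨b1, b2, b3, b4⟩ := (isGenerators_iff (by omega) _ _ _).1 hg
  exact φ.hStrong_eq (by omega) (hb.exists_coord b1 k) b3 b2 b4 ((φ.pullback_eq_iff _ _ _).1 hφ.1)
    ((φ.pullback_eq_iff _ _ _).1 hφ.2)

open Classical in
lemma HasDegrees.hWeak_eq (hn : 2 ≤ l + 2 * h) {eA fA g} (hg : IsGenerators l h eA fA g) {a b : ℤ}
    {φ : AttachingMap l h} (hφ : HasDegrees φ eA fA g a b) (k : Type) [CommRing k] [Nontrivial k] :
    hWeak k (Attach φ) φ.base l =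
      if ∃ c d : k, c ≠ 0 ∧ c * a + d * b = 0 then (h : ℕ∞) else (h : ℕ∞) + 1 := by
  obtain ⟨e₀, f₀, hb⟩ := exists_isBasis (l := l) (h := h) (by omega)
  obtain ⟨b1, b2, b3, b4⟩ := (isGenerators_iff (by omega) _ _ _).1 hg
  exact φ.hWeak_eq (by omega) (hb.exists_coord b1 k) b3 b2 b4 ((φ.pullback_eq_iff _ _ _).1 hφ.1)
    ((φ.pullback_eq_iff _ _ _).1 hφ.2)

lemma PrimeField.isField {p : ℕ} (hp : p.Prime ∨ p = 0) : IsField (PrimeField p) := by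
  cases p with
  | zero => exact Field.toIsField ℚ
  | succ n =>
    have : Fact (n + 1).Prime := ⟨hp.resolve_right n.succ_ne_zero⟩
    exact Field.toIsField (ZMod (n + 1))

lemma PrimeField.intCast_eq_zero (p : ℕ) (m : ℤ) : (m : PrimeField p) = 0 ↔ (p : ℤ) ∣ m := by
  cases p with
  | zero =>
    rw [Nat.cast_zero, zero_dvd_iff]
    exact Int.cast_eq_zero (α := ℚ)
  | succ n => exact ZMod.intCast_zmod_eq_zero_iff_dvd m (n + 1)

lemma exists_add_mul_eq_zero_iff {k : Type} [CommRing k] (hk : IsField k) (a b : k) :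
    (∃ d, a + d * b = 0) ↔ ¬(b = 0 ∧ a ≠ 0) := by
  by_cases hb : b = 0
  · simp [hb]
  · obtain ⟨b', hb'⟩ := hk.mul_inv_cancel hb
    exact iff_of_true ⟨-a * b', by linear_combination -a * hb'⟩ fun h => hb h.1

/-- Over a field a solution with `c ≠ 0` can be scaled to one with `c = 1`; this is why the weak and
the strong invariant agree there. -/
lemma exists_mul_add_mul_eq_zero_iff {k : Type} [CommRing k] (hk : IsField k) (a b : k) :
    (∃ c d, c ≠ 0 ∧ c * a + d * b = 0) ↔ ¬(b = 0 ∧ a ≠ 0) := by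
  rw [← exists_add_mul_eq_zero_iff hk]
  constructor
  · rintro ⟨c, d, hc, h⟩
    obtain ⟨c', hc'⟩ := hk.mul_inv_cancel hc
    exact ⟨c' * d, by linear_combination c' * h - a * hc'⟩
  · rintro ⟨d, h⟩
    have := hk.nontrivial
    exact ⟨1, d, one_ne_zero, by rw [one_mul, h]⟩

variable {eA fA : borelCohomology (SpaceA l h) ℤ (l + 2 * h) {(SpaceA.base l h).1}}
  {g : borelCohomology (FreeCellBoundary (l + 2 * h + 1)) ℤ (l + 2 * h) ∅} {a b : ℤ}
  {φ : AttachingMap l h}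

lemma HasDegrees.hStrong_primeField (hn : 2 ≤ l + 2 * h) (hg : IsGenerators l h eA fA g)
    (hφ : HasDegrees φ eA fA g a b) {p : ℕ} (hp : p.Prime ∨ p = 0) :
    hStrong (PrimeField p) (Attach φ) φ.base l =
      if (p : ℤ) ∣ b ∧ ¬ (p : ℤ) ∣ a then (h : ℕ∞) + 1 else (h : ℕ∞) := by
  have hk := PrimeField.isField hp
  have := hk.nontrivial
  classical
  rw [hφ.hStrong_eq hn hg, ← ite_not]
  refine if_congr ?_ rfl rfl
  rw [exists_add_mul_eq_zero_iff hk, not_not, Ne, PrimeField.intCast_eq_zero,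
    PrimeField.intCast_eq_zero]

lemma HasDegrees.hWeak_primeField (hn : 2 ≤ l + 2 * h) (hg : IsGenerators l h eA fA g)
    (hφ : HasDegrees φ eA fA g a b) {p : ℕ} (hp : p.Prime ∨ p = 0) :
    hWeak (PrimeField p) (Attach φ) φ.base l =
      if (p : ℤ) ∣ b ∧ ¬ (p : ℤ) ∣ a then (h : ℕ∞) + 1 else (h : ℕ∞) := by
  have hk := PrimeField.isField hp
  have := hk.nontrivial
  classical
  rw [hφ.hWeak_eq hn hg, ← ite_not]
  refine if_congr ?_ rfl rfl
  rw [exists_mul_add_mul_eq_zero_iff hk, not_not, Ne, PrimeField.intCast_eq_zero,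
    PrimeField.intCast_eq_zero]

lemma HasDegrees.hStrong_int (hn : 2 ≤ l + 2 * h) (hg : IsGenerators l h eA fA g)
    (hφ : HasDegrees φ eA fA g a b) (hab : ¬ b ∣ a) :
    hStrong ℤ (Attach φ) φ.base l = (h : ℕ∞) + 1 := by
  classical
  rw [hφ.hStrong_eq hn hg, if_neg]
  rintro ⟨d, hd⟩
  -- Over the integers surjectivity in degree `l + 2h` would mean that `b` divides `a`.
  exact hab ⟨-d, by linear_combination hd⟩

lemma HasDegrees.hWeak_int (hn : 2 ≤ l + 2 * h) (hg : IsGenerators l h eA fA g)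
    (hφ : HasDegrees φ eA fA g a b) (hb : b ≠ 0) : hWeak ℤ (Attach φ) φ.base l = h := by
  classical
  rw [hφ.hWeak_eq hn hg, if_pos]
  -- The class with coordinates `(b, -a)` always extends over the cell; it restricts to `b` times a
  -- generator.
  exact ⟨b, -a, hb, by push_cast; ring⟩

end Invariants

end SWF

end

theorem theoremT (l h : ℕ) (hn : 2 ≤ l + 2 * h) :
    (∃ eA fA g, IsGenerators l h eA fA g) ∧
    ∀ eA fA g, IsGenerators l h eA fA g →
      (∀ a b : ℤ, ∃ φ : AttachingMap l h, HasDegrees φ eA fA g a b) ∧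
      (∀ (a b : ℤ) (φ : AttachingMap l h), HasDegrees φ eA fA g a b →
        IsTypeSWF (Attach φ) l ∧
        ∀ p : ℕ, p.Prime ∨ p = 0 →
          hStrong (PrimeField p) (Attach φ) φ.base l =
            (if (p : ℤ) ∣ b ∧ ¬ (p : ℤ) ∣ a then (h : ℕ∞) + 1 else (h : ℕ∞)) ∧
          hWeak (PrimeField p) (Attach φ) φ.base l =
            (if (p : ℤ) ∣ b ∧ ¬ (p : ℤ) ∣ a then (h : ℕ∞) + 1 else (h : ℕ∞))) ∧
      (∀ a b : ℕ, a.Prime → b.Prime → a ≠ b →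
        ∀ φ : AttachingMap l h, HasDegrees φ eA fA g a b →
          (∀ p : ℕ, p.Prime ∨ p = 0 → p ≠ b →
            hStrong (PrimeField p) (Attach φ) φ.base l = h ∧
            hStrong (PrimeField p) (Attach φ) φ.base l ≠
              hStrong (PrimeField b) (Attach φ) φ.base l) ∧
          hWeak ℤ (Attach φ) φ.base l = hStrong (PrimeField 0) (Attach φ) φ.base l ∧
          hStrong (PrimeField 0) (Attach φ) φ.base l = h ∧
          hStrong (PrimeField b) (Attach φ) φ.base l = (h : ℕ∞) + 1 ∧
          hStrong ℤ (Attach φ) φ.base l = hStrong (PrimeField b) (Attach φ) φ.base l ∧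
          hWeak ℤ (Attach φ) φ.base l < hStrong ℤ (Attach φ) φ.base l) := by
  refine ⟨exists_isGenerators (by omega), fun eA fA g hg => ⟨exists_hasDegrees hn hg,
    fun a b φ hφ => ⟨isTypeSWF (by omega) φ, fun p hp =>
      ⟨hφ.hStrong_primeField hn hg hp, hφ.hWeak_primeField hn hg hp⟩⟩, ?_⟩⟩
  intro a b ha hb hab φ hφ
  have hba : ¬ (b : ℤ) ∣ a := fun hd =>
    hab ((Nat.prime_dvd_prime_iff_eq hb ha).1 (Int.natCast_dvd_natCast.1 hd)).symm
  have hb0 : (b : ℤ) ≠ 0 := Nat.cast_ne_zero.2 hb.ne_zero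
  have h1 : ∀ p : ℕ, p.Prime ∨ p = 0 → p ≠ b → hStrong (PrimeField p) (Attach φ) φ.base l = h := by
    intro p hp hpb
    rw [hφ.hStrong_primeField hn hg hp, if_neg]
    rintro ⟨hd, -⟩
    rcases hp with hp | rfl
    · exact hpb ((Nat.prime_dvd_prime_iff_eq hp hb).1 (Int.natCast_dvd_natCast.1 hd))
    · exact hb0 (zero_dvd_iff.1 (by rwa [Nat.cast_zero] at hd))
  have h2 : hStrong (PrimeField b) (Attach φ) φ.base l = (h : ℕ∞) + 1 := by
    rw [hφ.hStrong_primeField hn hg (Or.inl hb), if_pos ⟨dvd_rfl, hba⟩]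
  have h3 : (h : ℕ∞) < (h : ℕ∞) + 1 := by exact_mod_cast h.lt_succ_self
  have h4 := h1 0 (Or.inr rfl) hb.ne_zero.symm
  have h5 := hφ.hWeak_int hn hg hb0
  have h6 := hφ.hStrong_int hn hg hba
  refine ⟨fun p hp hpb => ⟨h1 p hp hpb, ?_⟩, h5.trans h4.symm, h4, h2, h6.trans h2.symm, ?_⟩
  · rw [h1 p hp hpb, h2]
    exact h3.ne
  · rw [h5, h6]
    exact h3
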